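/- **Setting.** Let $(\Omega_0,\mathcal F_0,P_0)$ be a probability space that is also a topological space whose open sets are measurable, $\Omega=\Omega_0^{\mathbb Z}$ with the product topology, $\mathbb P=P_0^{\mathbb Z}$, and let $\sigma$ be the left shift. Let $M$ be a measurable space and $f_\omega=f_{\omega_0}:M\to M$ a jointly measurable family; put $f_\omega^n=f_{\sigma^{n-1}\omega}\circ\cdots\circ f_\omega$. For every $\omega$ let $\{\Lambda_{\omega,i}\}_i$ be a countable measurable partition of a set $\Delta_{\omega,0}\subset M$, depending measurably on $\omega$, and let $R_{\omega,i}\ge 1$ (measurable in $\omega$) be minimal with $f_\omega^{R_{\omega,i}}\Lambda_{\omega,i}\subset\Delta_{\sigma^{R_{\omega,i}}\omega,0}$, where $f_\omega^{R_{\omega,i}}:\Lambda_{\omega,i}\to\Delta_{\sigma^{R_{\omega,i}}\omega,0}$ is a bijection, measurable in both directions. Put $R_\omega=R_{\omega,i}$ on $\Lambda_{\omega,i}$, and assume that $R_\omega$ is a stopping time: if $x\in\Delta_{\omega,0}$, $R_\omega(x)=n$ and $\omega'_j=\omega_j$ for $0\le j<n$, then $x\in\Delta_{\omega',0}$ and $R_{\omega'}(x)=n$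 (this forces $\Delta_{\omega,0}$ to be the same set $\Delta_0$ for all $\omega$). The tower is $\Delta_\omega=\{(x,\ell):\ell\ge0,\ x\in\Delta_{\sigma^{-\ell}\omega,0},\ R_{\sigma^{-\ell}\omega}(x)\ge\ell+1\}$, with atoms $\Lambda_{\sigma^{-\ell}\omega,i}\times\{\ell\}$ ($R_{\sigma^{-\ell}\omega,i}>\ell$) and map $F_\omega:\Delta_\omega\to\Delta_{\sigma\omega}$, $F_\omega(x,\ell)=(x,\ell+1)$ if $R_{\sigma^{-\ell}\omega}(x)>\ell+1$ and $F_\omega(x,\ell)=(f^{\ell+1}_{\sigma^{-\ell}\omega}x,0)$ otherwise; $F_\omega^n=F_{\sigma^{n-1}\omega}\circ\cdots\circ F_\omega$. The separation time $s_\omega(z,z')$ is the first $n$ such that $F_\omega^kz,F_\omega^kz'$ are not in a common atom of $\Delta_{\sigma^k\omega}$ for some $k<n$ ($\infty$ if there is none); assume $s_\omega(z,z')=\infty$ only for $z=z'$. Fix $\beta\in(0,1)$ and put $d_\omega=\beta^{s_\omega}$. Let $m_\omega$ be probability measures on $\Delta_{\omega,0}$, measurable in $\omega$, for which the return maps $f_\omega^{R_{\omega}}$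 have a positive Jacobian $J_\omega$, i.e. $m_{\sigma^{R_{\omega,i}}\omega}(f_\omega^{R_{\omega,i}}A)=\int_AJ_\omega\,dm_\omega$ for measurable $A\subset\Lambda_{\omega,i}$, and assume that there is $A_1>0$ with $$\left|\frac{J_\omega(x)}{J_\omega(y)}-1\right|\le A_1\,d_{\sigma^{R_{\omega,i}}\omega}\big((f_\omega^{R_{\omega,i}}x,0),(f_\omega^{R_{\omega,i}}y,0)\big)\qquad(x,y\in\Lambda_{\omega,i})$$ for all $\omega,i$. Assume that there are constants $c_1,c_2>0$ with $m_\omega(R_\omega\ge n)\le c_1e^{-c_2n}$ for all $n\ge1$ and $\mathbb P$-a.e. $\omega$. Write $m_\omega$ also for the measure on $\Delta_\omega$ that on level $\ell$ is the restriction of $m_{\sigma^{-\ell}\omega}$ to $\{R_{\sigma^{-\ell}\omega}\ge\ell+1\}$. Fix $\varepsilon_0\in(0,c_2)$, let $v(x,\ell)=e^{\varepsilon_0\ell}$, $\bar m_\omega=m_\omega/m_\omega(\Delta_\omega)$ and $\tilde m_\omega=v\,m_\omega$. Let $JF_\omega(x,\ell)=1$ if $R_{\sigma^{-\ell}\omega}(x)>\ell+1$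 and $JF_\omega(x,\ell)=J_{\sigma^{-\ell}\omega}(x)$ otherwise. Let $\varphi_\omega:\Delta_\omega\to\mathbb R$ be jointly measurable and, for constants $C_1,C_2$ and $\mathbb P$-a.e. $\omega$, satisfy $|\varphi_\omega|\le C_1$ and $|\varphi_\omega(z)-\varphi_\omega(z')|\le C_2d_\omega(z,z')$. Let $S_n^\omega\varphi=\sum_{j<n}\varphi_{\sigma^j\omega}\circ F_\omega^j$. Let $\mu_\omega$ be an equivariant family of absolutely continuous probability measures: $\mu_\omega$ is measurable in $\omega$ and, for $\mathbb P$-a.e. $\omega$, $\mu_\omega\ll m_\omega$ and $(F_\omega)_*\mu_\omega=\mu_{\sigma\omega}$. Let $\mathcal H_\omega$ be the Banach space of functions $g:\Delta_\omega\to\mathbb C$ with finite norm $\|g\|=\sup|g|+\sup_\ell\sup_{z\ne z'}|g(z)-g(z')|/d_\omega(z,z')$, where $z,z'$ run over the $\ell$-th level. Put $P_\omega^{\zeta}g(z)=\sum_{F_\omega y=z}\frac{e^{\zeta\varphi_\omega(y)}}{JF_\omega(y)}g(y)$ and $\mathcal L_\omega^\zeta g=P_\omega^\zeta(gv)/v$,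 and for functions on the base put $\mathcal P_{\omega,n}g(x)=\sum_{y:\,R_\omega(y)=n,\,f_\omega^ny=x}g(y)/J_\omega(y)$. **Assumptions at a fixed point.** There is a point $a_0\in\Omega_0$ all of whose neighbourhoods have positive $P_0$-measure such that, with $a=a_0^{\mathbb Z}$: 1. (continuity at $a$) (a) for every $i$ and all $\omega$ in some neighbourhood of $a$, the set $\Lambda_{a,i}$ is contained in a single atom $\Lambda_{\omega,j}$; (b) for every $n$ and every function $g$ on $\Delta_0$ that is bounded and Lipschitz with respect to $d_a$, $\mathcal P_{\omega,n}g\to\mathcal P_{a,n}g$ uniformly on $\Delta_0$ as $\omega\to a$; (c) $\sup_{\Delta_\omega\cap\Delta_a}|\varphi_\omega-\varphi_a|\to0$ as $\omega\to a$; 2. (spectral condition) $\mathcal L_a^{it}$ is a bounded operator on $\mathcal H_a$ with spectral radius $<1$ for every $t\in I$, where either (aperiodic case) $I=\mathbb R\setminus\{0\}$, or (lattice case) $I=[-\pi/h,\pi/h]\setminus\{0\}$ for some $h>0$. **Conclusion.** For $\mathbb P$-a.e. $\omega$ and every compact set $J\subset I$, each of the sequences $$\sqrt n\,\sup_{t\in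 J}\big|\kappa_\omega(e^{itS_n^\omega\varphi})\big|,\qquad \kappa_\omega\in\{\mu_\omega,\ \bar m_\omega,\ \tilde m_\omega\},$$ decays exponentially fast: it is at most $Ce^{-cn}$ for all $n\ge 0$, with some $C$ and $c>0$ (which may depend on $\omega$, $J$ and $\kappa$). -/

import Mathlib

open MeasureTheory ProbabilityTheory Filter Topology Set

/-- The two-sided shift on `Ω₀^ℤ`, to the power `k`: `(σ^k ω)_j = ω_{j+k}`. -/
def seqShift {Ω₀ : Type*} (k : ℤ) (ω : ℤ → Ω₀) : ℤ → Ω₀ := fun j => ω (j + k)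

/-- The data of a random tower over the full shift `Ω₀^ℤ`: the maps `f_{ω_0} : M → M`, the atoms
`Λ_{ω,i}` of the partition of the random base `Δ_{ω,0}` (a finite partition is allowed: the
remaining `Λ_{ω,i}` are then empty), the return times `R_{ω,i}`, the reference measures `m_ω` on
`Δ_{ω,0}`, and the Jacobian `J_ω = J f_ω^{R_ω}` on `Δ_{ω,0}` of the return map. -/
structure RandomTower (Ω₀ M : Type*) [MeasurableSpace Ω₀] [MeasurableSpace M] where
  f : Ω₀ → M → M
  Λ : (ℤ → Ω₀) → ℕ → Set M
  R : (ℤ → Ω₀) → ℕ → ℕ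
  m : Kernel (ℤ → Ω₀) M
  J : (ℤ → Ω₀) → M → ℝ

namespace RandomTower

section

variable {Ω₀ M : Type*} [MeasurableSpace Ω₀] [MeasurableSpace M] (T : RandomTower Ω₀ M)

/-- `f_ω^n = f_{ω_{n-1}} ∘ ⋯ ∘ f_{ω_1} ∘ f_{ω_0}`. -/
def orbit (ω : ℤ → Ω₀) : ℕ → M → M
  | 0 => id
  | n + 1 => fun x => T.f (ω n) (orbit ω n x)

/-- The random base `Δ_{ω,0}`. -/
def base (ω : ℤ → Ω₀) : Set M := ⋃ i, T.Λ ω i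

/-- The return time function `R_ω`, equal to `R_{ω,i}` on `Λ_{ω,i}` (only used on `Δ_{ω,0}`). -/
noncomputable def ret (ω : ℤ → Ω₀) (x : M) : ℕ := sInf {n | ∃ i, x ∈ T.Λ ω i ∧ T.R ω i = n}

/-- The tower `Δ_ω`, whose `ℓ`-th level is the set of `(x, ℓ)` with `x ∈ Δ_{σ^{-ℓ}ω,0}` and
`R_{σ^{-ℓ}ω}(x) ≥ ℓ + 1`. -/
def tower (ω : ℤ → Ω₀) : Set (M × ℕ) :=
  {z | z.1 ∈ T.base (seqShift (-(z.2 : ℤ)) ω) ∧ z.2 + 1 ≤ T.ret (seqShift (-(z.2 : ℤ)) ω) z.1}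

/-- The tower map `F_ω : Δ_ω → Δ_{σω}`. -/
noncomputable def F (ω : ℤ → Ω₀) (z : M × ℕ) : M × ℕ :=
  if z.2 + 1 < T.ret (seqShift (-(z.2 : ℤ)) ω) z.1 then (z.1, z.2 + 1)
  else (T.orbit (seqShift (-(z.2 : ℤ)) ω) (z.2 + 1) z.1, 0)

/-- `F_ω^n = F_{σ^{n-1}ω} ∘ ⋯ ∘ F_{σω} ∘ F_ω`. -/
noncomputable def Fiter (ω : ℤ → Ω₀) : ℕ → M × ℕ → M × ℕ
  | 0 => id
  | n + 1 => fun z => T.F (seqShift (n : ℤ) ω) (Fiter ω n z)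

/-- `z` and `z'` lie in the same atom `Λ_{σ^{-ℓ}ω,i} × {ℓ}` of the partition of `Δ_ω`. -/
def SameAtom (ω : ℤ → Ω₀) (z z' : M × ℕ) : Prop :=
  z.2 = z'.2 ∧
    ∃ i, z.1 ∈ T.Λ (seqShift (-(z.2 : ℤ)) ω) i ∧ z'.1 ∈ T.Λ (seqShift (-(z.2 : ℤ)) ω) i

/-- `z` and `z'` lie in the same cylinder of order `n`, an element of
`⋁_{k<n} (F_ω^k)^{-1} 𝒬_{σ^k ω}` where `𝒬_ω` is the partition of `Δ_ω` into atoms. -/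
def SameCylinder (ω : ℤ → Ω₀) (n : ℕ) (z z' : M × ℕ) : Prop :=
  ∀ k < n, T.SameAtom (seqShift (k : ℤ) ω) (T.Fiter ω k z) (T.Fiter ω k z')

/-- The separation time `s_ω(z, z')`: the first `n` such that `z` and `z'` are not in the same
cylinder of order `n` (`⊤` if there is none). -/
noncomputable def sepTime (ω : ℤ → Ω₀) (z z' : M × ℕ) : ℕ∞ :=
  sInf ((fun n : ℕ => (n : ℕ∞)) '' {n : ℕ | ¬ T.SameCylinder ω n z z'})

/-- `d_ω(z, z') = β^{s_ω(z, z')}`, with `β^∞ = 0`. -/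
noncomputable def sepDist (β : ℝ) (ω : ℤ → Ω₀) (z z' : M × ℕ) : ℝ :=
  open Classical in if T.sepTime ω z z' = ⊤ then 0 else β ^ (T.sepTime ω z z').toNat

/-- The measure `m_ω` on the tower `Δ_ω`: on the `ℓ`-th level it is the restriction of
`m_{σ^{-ℓ}ω}` to `{R_{σ^{-ℓ}ω} ≥ ℓ + 1}`. -/
noncomputable def towerMeasure (ω : ℤ → Ω₀) : Measure (M × ℕ) :=
  Measure.sum fun ℓ : ℕ =>
    ((T.m (seqShift (-(ℓ : ℤ)) ω)).restrict
      {x | x ∈ T.base (seqShift (-(ℓ : ℤ)) ω) ∧ ℓ + 1 ≤ T.ret (seqShift (-(ℓ : ℤ)) ω) x}).map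
      fun x => (x, ℓ)

/-- The normalized measure `m̄_ω = m_ω / m_ω(Δ_ω)`. -/
noncomputable def normMeasure (ω : ℤ → Ω₀) : Measure (M × ℕ) :=
  (T.towerMeasure ω univ)⁻¹ • T.towerMeasure ω

/-- The weighted measure `m̃_ω = v m_ω` with `v(x, ℓ) = e^{ε₀ ℓ}`. -/
noncomputable def weightedMeasure (ε₀ : ℝ) (ω : ℤ → Ω₀) : Measure (M × ℕ) :=
  (T.towerMeasure ω).withDensity fun z => ENNReal.ofReal (Real.exp (ε₀ * z.2))

/-- The Jacobian `JF_ω` of the tower map: `1` when the point moves up, and the Jacobian of the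
return map at the base point when it returns to the base. -/
noncomputable def JF (ω : ℤ → Ω₀) (z : M × ℕ) : ℝ :=
  if z.2 + 1 < T.ret (seqShift (-(z.2 : ℤ)) ω) z.1 then 1
  else T.J (seqShift (-(z.2 : ℤ)) ω) z.1

/-- The defining properties of a random Young tower with independent identically distributed maps
and return times that are stopping times. -/
structure IsYoungTower (β : ℝ) : Prop where
  measurable_f : Measurable (Function.uncurry T.f)
  measurable_Λ : ∀ i, MeasurableSet {p : (ℤ → Ω₀) × M | p.2 ∈ T.Λ p.1 i}
  measurable_R : ∀ i, Measurable fun ω => T.R ω i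
  disjoint : ∀ ω, Pairwise fun i j => Disjoint (T.Λ ω i) (T.Λ ω j)
  -- `R_{ω,i}` is the minimal positive integer for which the atom is mapped into the base
  R_pos : ∀ ω i, 0 < T.R ω i
  R_minimal : ∀ ω i, (T.Λ ω i).Nonempty → ∀ k, 0 < k → k < T.R ω i →
    ¬ MapsTo (T.orbit ω k) (T.Λ ω i) (T.base (seqShift (k : ℤ) ω))
  -- full returns
  bijOn : ∀ ω i, (T.Λ ω i).Nonempty →
    BijOn (T.orbit ω (T.R ω i)) (T.Λ ω i) (T.base (seqShift (T.R ω i : ℤ) ω))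
  measurable_image : ∀ ω i, ∀ A ⊆ T.Λ ω i, MeasurableSet A →
    MeasurableSet (T.orbit ω (T.R ω i) '' A)
  -- the reference measures are probability measures carried by the base
  m_prob : ∀ ω, IsProbabilityMeasure (T.m ω)
  m_base : ∀ ω, T.m ω (T.base ω)ᶜ = 0
  -- `J_ω` is the (positive) Jacobian of the return map
  J_pos : ∀ ω, ∀ x ∈ T.base ω, 0 < T.J ω x
  jacobian : ∀ ω i, ∀ A ⊆ T.Λ ω i, MeasurableSet A →
    T.m (seqShift (T.R ω i : ℤ) ω) (T.orbit ω (T.R ω i) '' A)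
      = ∫⁻ x in A, ENNReal.ofReal (T.J ω x) ∂(T.m ω)
  distortion : ∃ A₁ : ℝ, 0 < A₁ ∧ ∀ ω i, ∀ x ∈ T.Λ ω i, ∀ y ∈ T.Λ ω i,
    |T.J ω x / T.J ω y - 1| ≤ A₁ * T.sepDist β (seqShift (T.R ω i : ℤ) ω)
      (T.orbit ω (T.R ω i) x, 0) (T.orbit ω (T.R ω i) y, 0)
  -- the cylinders separate points
  separating : ∀ ω, ∀ z ∈ T.tower ω, ∀ z' ∈ T.tower ω, T.sepTime ω z z' = ⊤ → z = z'
  -- `R_ω` is a stopping time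
  stopping : ∀ ω, ∀ x ∈ T.base ω, ∀ ω' : ℤ → Ω₀,
    (∀ j : ℤ, 0 ≤ j → j < T.ret ω x → ω' j = ω j) →
      x ∈ T.base ω' ∧ T.ret ω' x = T.ret ω x

/-- Uniform exponential tails: `m_ω(R_ω ≥ n) ≤ c₁ e^{-c₂ n}` for almost every `ω`. -/
def ExpTails (P : Measure (ℤ → Ω₀)) (c₁ c₂ : ℝ) : Prop :=
  ∀ᵐ ω ∂P, ∀ n : ℕ, 1 ≤ n →
    T.m ω {x | x ∈ T.base ω ∧ n ≤ T.ret ω x} ≤ ENNReal.ofReal (c₁ * Real.exp (-c₂ * n))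

/-- Measurable observables `φ_ω : Δ_ω → ℝ` that are uniformly bounded and uniformly Lipschitz with
respect to `d_ω`, for almost every `ω`. -/
structure IsObservable (P : Measure (ℤ → Ω₀)) (β : ℝ) (φ : (ℤ → Ω₀) → M × ℕ → ℝ) : Prop where
  measurable : Measurable (Function.uncurry φ)
  bounded : ∃ C₁ : ℝ, ∀ᵐ ω ∂P, ∀ z ∈ T.tower ω, |φ ω z| ≤ C₁
  lipschitz : ∃ C₂ : ℝ, ∀ᵐ ω ∂P, ∀ z ∈ T.tower ω, ∀ z' ∈ T.tower ω,
    |φ ω z - φ ω z'| ≤ C₂ * T.sepDist β ω z z'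

/-- The random Birkhoff sums `S_n^ω φ = ∑_{j<n} φ_{σ^j ω} ∘ F_ω^j`. -/
noncomputable def birkhoff (φ : (ℤ → Ω₀) → M × ℕ → ℝ) (ω : ℤ → Ω₀) (n : ℕ) (z : M × ℕ) : ℝ :=
  ∑ j ∈ Finset.range n, φ (seqShift (j : ℤ) ω) (T.Fiter ω j z)

/-- A (measurable) equivariant family of absolutely continuous probability measures:
`μ_ω ≪ m_ω` and `(F_ω)_* μ_ω = μ_{σω}` for almost every `ω`. -/
structure IsEquivariant (P : Measure (ℤ → Ω₀)) (μ : Kernel (ℤ → Ω₀) (M × ℕ)) : Prop where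
  prob : ∀ᵐ ω ∂P, IsProbabilityMeasure (μ ω)
  absolutelyContinuous : ∀ᵐ ω ∂P, μ ω ≪ T.towerMeasure ω
  equivariant : ∀ᵐ ω ∂P, (μ ω).map (T.F ω) = μ (seqShift 1 ω)

/-- The transfer operator `P_ω^ζ g(z) = ∑_{F_ω y = z} e^{ζ φ_ω(y)} g(y) / JF_ω(y)` applied to a
function on `Δ_ω`. -/
noncomputable def transferP (φ : (ℤ → Ω₀) → M × ℕ → ℝ) (ω : ℤ → Ω₀) (ζ : ℂ)
    (g : T.tower ω → ℂ) (z : M × ℕ) : ℂ :=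
  ∑' y : {y : T.tower ω // T.F ω y = z},
    ((T.JF ω y.1 : ℂ))⁻¹ * Complex.exp (ζ * (φ ω y.1 : ℂ)) * g y.1

/-- The weighted operator `ℒ_ω^ζ g = P_ω^ζ(g v) / v` with `v(x, ℓ) = e^{ε₀ ℓ}`. -/
noncomputable def transferL (ε₀ : ℝ) (φ : (ℤ → Ω₀) → M × ℕ → ℝ) (ω : ℤ → Ω₀) (ζ : ℂ)
    (g : T.tower ω → ℂ) (z : M × ℕ) : ℂ :=
  T.transferP φ ω ζ (fun y => g y * (Real.exp (ε₀ * y.1.2) : ℂ)) z / (Real.exp (ε₀ * z.2) : ℂ)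

/-- The pairs of distinct points of the same level of `Δ_ω`. -/
abbrev LevelPair (ω : ℤ → Ω₀) : Type _ :=
  {p : T.tower ω × T.tower ω // p.1.1.2 = p.2.1.2 ∧ p.1 ≠ p.2}

/-- The difference quotient of `g` at a pair of points. -/
noncomputable def quot (β : ℝ) (ω : ℤ → Ω₀) (g : T.tower ω → ℂ) (p : T.LevelPair ω) : ℝ :=
  ‖g p.1.1 - g p.1.2‖ / T.sepDist β ω p.1.1 p.1.2

theorem sepDist_nonneg {β : ℝ} (hβ : 0 ≤ β) (ω : ℤ → Ω₀) (z z' : M × ℕ) :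
    0 ≤ T.sepDist β ω z z' := by
  unfold sepDist
  split_ifs
  · exact le_rfl
  · positivity

theorem quot_nonneg {β : ℝ} (hβ : 0 ≤ β) (ω : ℤ → Ω₀) (g : T.tower ω → ℂ) (p : T.LevelPair ω) :
    0 ≤ T.quot β ω g p :=
  div_nonneg (norm_nonneg _) (T.sepDist_nonneg hβ _ _ _)

theorem quot_add_le {β : ℝ} (hβ : 0 ≤ β) (ω : ℤ → Ω₀) (g g' : T.tower ω → ℂ)
    (p : T.LevelPair ω) : T.quot β ω (g + g') p ≤ T.quot β ω g p + T.quot β ω g' p := by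
  unfold quot
  rw [← add_div]
  refine div_le_div_of_nonneg_right ?_ (T.sepDist_nonneg hβ _ _ _)
  simp only [Pi.add_apply]
  rw [add_sub_add_comm]
  exact norm_add_le _ _

theorem quot_smul (β : ℝ) (ω : ℤ → Ω₀) (c : ℂ) (g : T.tower ω → ℂ) (p : T.LevelPair ω) :
    T.quot β ω (c • g) p = ‖c‖ * T.quot β ω g p := by
  unfold quot
  simp only [Pi.smul_apply, smul_eq_mul]
  rw [← mul_sub, norm_mul, mul_div_assoc]

/-- The functions on `Δ_ω` that are bounded and, on each level, Lipschitz for `d_ω` with a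
constant independent of the level. The exponent base is a nonnegative real number `β`. -/
noncomputable def lipSubmodule (β : NNReal) (ω : ℤ → Ω₀) : Submodule ℂ (T.tower ω → ℂ) where
  carrier := {g | BddAbove (range fun z => ‖g z‖) ∧ BddAbove (range (T.quot β ω g))}
  zero_mem' := by
    refine ⟨⟨0, ?_⟩, ⟨0, ?_⟩⟩
    · rintro _ ⟨z, rfl⟩; simp
    · rintro _ ⟨p, rfl⟩; simp [quot]
  add_mem' := by
    rintro g g' ⟨⟨A, hA⟩, ⟨B, hB⟩⟩ ⟨⟨A', hA'⟩, ⟨B', hB'⟩⟩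
    refine ⟨⟨A + A', ?_⟩, ⟨B + B', ?_⟩⟩
    · rintro _ ⟨z, rfl⟩
      exact (norm_add_le _ _).trans (add_le_add (hA ⟨z, rfl⟩) (hA' ⟨z, rfl⟩))
    · rintro _ ⟨p, rfl⟩
      exact (T.quot_add_le β.2 ω g g' p).trans (add_le_add (hB ⟨p, rfl⟩) (hB' ⟨p, rfl⟩))
  smul_mem' := by
    rintro c g ⟨⟨A, hA⟩, ⟨B, hB⟩⟩
    refine ⟨⟨‖c‖ * A, ?_⟩, ⟨‖c‖ * B, ?_⟩⟩
    · rintro _ ⟨z, rfl⟩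
      simp only [Pi.smul_apply, norm_smul]
      exact mul_le_mul_of_nonneg_left (hA ⟨z, rfl⟩) (norm_nonneg _)
    · rintro _ ⟨p, rfl⟩
      rw [T.quot_smul]
      exact mul_le_mul_of_nonneg_left (hB ⟨p, rfl⟩) (norm_nonneg _)

/-- The space `ℋ_ω` of the functions `g` on `Δ_ω` with
`‖g‖ = sup |g| + sup_ℓ sup_{z ≠ z' in level ℓ} |g(z) - g(z')| / d_ω(z, z') < ∞`. -/
def LipSpace (β : NNReal) (ω : ℤ → Ω₀) : Type _ := T.lipSubmodule β ω

noncomputable instance (β : NNReal) (ω : ℤ → Ω₀) : AddCommGroup (T.LipSpace β ω) :=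
  inferInstanceAs (AddCommGroup (T.lipSubmodule β ω))

noncomputable instance (β : NNReal) (ω : ℤ → Ω₀) : Module ℂ (T.LipSpace β ω) :=
  inferInstanceAs (Module ℂ (T.lipSubmodule β ω))

/-- The function on `Δ_ω` underlying an element of `ℋ_ω`. -/
def LipSpace.toFun {T : RandomTower Ω₀ M} {β : NNReal} {ω : ℤ → Ω₀} (g : T.LipSpace β ω) :
    T.tower ω → ℂ := g.1

noncomputable instance (β : NNReal) (ω : ℤ → Ω₀) : Norm (T.LipSpace β ω) where
  norm g := (⨆ z, ‖g.toFun z‖) + ⨆ p, T.quot β ω g.toFun p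

theorem lipSpace_core (β : NNReal) (ω : ℤ → Ω₀) : NormedSpace.Core ℂ (T.LipSpace β ω) where
  norm_nonneg g :=
    add_nonneg (Real.iSup_nonneg fun _ => norm_nonneg _)
      (Real.iSup_nonneg fun p => T.quot_nonneg β.2 ω g.toFun p)
  norm_smul c g := by
    change (⨆ z, ‖(c • g.toFun) z‖) + (⨆ p, T.quot β ω (c • g.toFun) p)
      = ‖c‖ * ((⨆ z, ‖g.toFun z‖) + ⨆ p, T.quot β ω g.toFun p)
    rw [mul_add, Real.mul_iSup_of_nonneg (norm_nonneg c), Real.mul_iSup_of_nonneg (norm_nonneg c)]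
    simp only [T.quot_smul, Pi.smul_apply, norm_smul]
  norm_triangle g g' := by
    change (⨆ z, ‖(g.toFun + g'.toFun) z‖) + (⨆ p, T.quot β ω (g.toFun + g'.toFun) p)
      ≤ ((⨆ z, ‖g.toFun z‖) + ⨆ p, T.quot β ω g.toFun p)
        + ((⨆ z, ‖g'.toFun z‖) + ⨆ p, T.quot β ω g'.toFun p)
    have h1 : (⨆ z, ‖(g.toFun + g'.toFun) z‖) ≤ (⨆ z, ‖g.toFun z‖) + ⨆ z, ‖g'.toFun z‖ := by
      refine Real.iSup_le (fun z => ?_) (add_nonneg (Real.iSup_nonneg fun _ => norm_nonneg _)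
        (Real.iSup_nonneg fun _ => norm_nonneg _))
      exact (norm_add_le _ _).trans (add_le_add (le_ciSup g.2.1 z) (le_ciSup g'.2.1 z))
    have h2 : (⨆ p, T.quot β ω (g.toFun + g'.toFun) p)
        ≤ (⨆ p, T.quot β ω g.toFun p) + ⨆ p, T.quot β ω g'.toFun p := by
      refine Real.iSup_le (fun p => ?_)
        (add_nonneg (Real.iSup_nonneg fun p => T.quot_nonneg β.2 ω g.toFun p)
        (Real.iSup_nonneg fun p => T.quot_nonneg β.2 ω g'.toFun p))
      exact (T.quot_add_le β.2 ω _ _ p).trans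
        (add_le_add (le_ciSup g.2.2 p) (le_ciSup g'.2.2 p))
    linarith
  norm_eq_zero_iff g := by
    constructor
    · intro h
      have hs : (⨆ z, ‖g.toFun z‖) = 0 := by
        have h1 : 0 ≤ ⨆ z, ‖g.toFun z‖ := Real.iSup_nonneg fun _ => norm_nonneg _
        have h2 : 0 ≤ ⨆ p, T.quot β ω g.toFun p :=
          Real.iSup_nonneg fun p => T.quot_nonneg β.2 ω g.toFun p
        have h3 : (⨆ z, ‖g.toFun z‖) + (⨆ p, T.quot β ω g.toFun p) = 0 := h
        linarith
      refine Subtype.ext (funext fun z => ?_)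
      have h4 : ‖g.toFun z‖ ≤ 0 := hs ▸ le_ciSup g.2.1 z
      exact norm_le_zero_iff.1 h4
    · rintro rfl
      change (⨆ z : T.tower ω, ‖(0 : ℂ)‖) + (⨆ p, T.quot β ω 0 p) = 0
      simp [quot]

noncomputable instance (β : NNReal) (ω : ℤ → Ω₀) : NormedAddCommGroup (T.LipSpace β ω) :=
  NormedAddCommGroup.ofCore (T.lipSpace_core β ω)

noncomputable instance (β : NNReal) (ω : ℤ → Ω₀) : NormedSpace ℂ (T.LipSpace β ω) :=
  NormedSpace.ofCore (T.lipSpace_core β ω)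

/-- For a sequence `a` with `σ a = a`: the operator `ℒ_a^{it}` is a bounded operator on the Banach
space `ℋ_a`, and its spectral radius is less than `1`. -/
def TwistedContracts (β : NNReal) (ε₀ : ℝ) (φ : (ℤ → Ω₀) → M × ℕ → ℝ) (a : ℤ → Ω₀)
    (t : ℝ) : Prop :=
  ∃ L : T.LipSpace β a →L[ℂ] T.LipSpace β a,
    (∀ g z, (L g).toFun z = T.transferL ε₀ φ a (Complex.I * t) g.toFun z) ∧
    spectralRadius ℂ L < 1

/-- The operator `𝒫_{ω,n} g(x) = ∑ g(y) / J f_ω^n(y)` on functions on the base, the sum being over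
the `y ∈ Δ_{ω,0}` with `R_ω(y) = n` and `f_ω^n y = x`. -/
noncomputable def baseOp (ω : ℤ → Ω₀) (n : ℕ) (g : M → ℂ) (x : M) : ℂ :=
  ∑' y : {y : M // y ∈ T.base ω ∧ T.ret ω y = n ∧ T.orbit ω n y = x}, g y / (T.J ω y : ℂ)

/-- Bounded Lipschitz functions on the base `Δ_{ω,0}`, with respect to `d_ω`. -/
def LipOnBase (β : ℝ) (ω : ℤ → Ω₀) (g : M → ℂ) : Prop :=
  ∃ K : ℝ, ∀ x ∈ T.base ω, ‖g x‖ ≤ K ∧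
    ∀ y ∈ T.base ω, ‖g x - g y‖ ≤ K * T.sepDist β ω (x, 0) (y, 0)

/-- Continuity at the sequence `a` of the data of the tower and of the observable.
The stopping time property and the full returns force `Δ_{ω,0}` to be the same set for all `ω`, so
that the `𝒫_{ω,n}` act on functions on one set. -/
structure ContinuousAtSeq [TopologicalSpace Ω₀] (β : ℝ) (φ : (ℤ → Ω₀) → M × ℕ → ℝ)
    (a : ℤ → Ω₀) : Prop where
  -- an atom of the base of `Δ_a` is not cut by the partition of `Δ_{ω,0}` when `ω` is close to `a`
  atoms : ∀ i, ∀ᶠ ω in 𝓝 a, ∃ j, T.Λ a i ⊆ T.Λ ω j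
  operators : ∀ n g, T.LipOnBase β a g →
    TendstoUniformlyOn (fun ω => T.baseOp ω n g) (T.baseOp a n g) (𝓝 a) (T.base a)
  observable : ∀ ε > 0, ∀ᶠ ω in 𝓝 a, ∀ z ∈ T.tower ω ∩ T.tower a, |φ ω z - φ a z| < ε

/-- `√n sup_{t ∈ J} |κ(e^{it S_n^ω φ})|` decays to `0` exponentially fast as `n → ∞`. -/
def CharDecays (φ : (ℤ → Ω₀) → M × ℕ → ℝ) (ω : ℤ → Ω₀) (κ : Measure (M × ℕ))
    (J : Set ℝ) : Prop :=
  ∃ C c : ℝ, 0 < c ∧ ∀ n : ℕ,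
    √(n : ℝ) * (⨆ t : J, ‖∫ z, Complex.exp (Complex.I * (t : ℝ) * (T.birkhoff φ ω n z : ℂ)) ∂κ‖)
      ≤ C * Real.exp (-c * n)

end

end RandomTower

/-! A characteristic function `κ(e^{itS_n})` is the integral of the `n`-th twisted transfer operator
`Pn` applied to the density of `κ`. It therefore suffices that these operators decay exponentially
along almost every orbit, locally uniformly in `t`.

Uniform bounds. Put `K = A₁/(1-β)`. The transfer operators preserve the integral and the cone of
functions with `h z ≤ h z' e^{K d(z,z')}`. As the base has mass one, the iterates of the weight `v`
are bounded on the base; as `v` gains a factor `e^{ε₀}` per level, they are bounded by a constant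
times `v` everywhere (`Setup.wn_le`). A Lasota–Yorke inequality relative to these iterates
(`Setup.domLip_Pn`) bounds all twisted iterates, uniformly in `ω` and `n` (`Setup.bd_Pn`).

Contraction near `a`. The operators for different `ω` act on different towers and are only known to
converge weakly as `ω → a`, so compactness takes the place of perturbation theory
(`eventually_tame_Pn`). If contraction failed for `ω` arbitrarily near `a`, the offending functions,
uniformly bounded by `v` and uniformly Lipschitz, would have a pointwise limit on `Δ_a`. The twisted
operators pass to the limit (`tendsto_Pn`), and the spectral condition makes the limit small. A
priori the original functions are then small only on a cylinder around each point, for `ω` in a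
neighbourhood depending on that point. After `k` more steps cylinders of order `k` have become the
whole base, so the bound is uniform there, and the weight takes care of the high levels. Lipschitz
dependence on the parameter and one more use of Lasota–Yorke give contraction in `N` steps for all
parameters near `t` (`exists_contractsAt`).

Independence. A neighbourhood of `a` contains an event of positive probability that restricts
finitely many coordinates. On disjoint blocks of coordinates these events are independent, and each
one that occurs gains a factor `1/2`; the product of the factors decays exponentially almost surely
(`exists_rate_blockFactor`, `bd_Pn_blocks`). Countably many parameters cover `I`, hence the
full-measure set serves all compact `J` (`ae_decaysAt`).

Measures. The densities of `m̄_ω` and `m̃_ω` are constants and multiples of `v`, which are regular.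
No regularity of the density of `μ_ω` is available, but `μ_ω` is the image of `μ_{σ^{-n}ω}`. By
Poincaré recurrence of the backward shift, for infinitely many `n` the latter is `ε`-close on
cylinders to one function from a countable family (`Setup.ae_frequently_codeClose`). Transported `n`
steps, that function satisfies bounds that do not depend on which function it was (`Setup.bd_trn`),
so the estimate holds up to `ε` with a constant independent of `ε` (`Setup.norm_integral_exp_le`).
-/

set_option linter.unusedSectionVars false

/-! ### Shifts, the common base, cylinders and the separation distance. -/

@[simp] theorem seqShift_zero {Ω₀ : Type*} (ω : ℤ → Ω₀) : seqShift 0 ω = ω := by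
  funext j; simp [seqShift]

@[simp] theorem seqShift_seqShift {Ω₀ : Type*} (k j : ℤ) (ω : ℤ → Ω₀) :
    seqShift k (seqShift j ω) = seqShift (k + j) ω := by
  funext i; simp [seqShift, add_assoc]

theorem seqShift_const {Ω₀ : Type*} (k : ℤ) (a₀ : Ω₀) :
    seqShift k (fun _ => a₀) = fun _ => a₀ := rfl

theorem seqShift_congr {Ω₀ : Type*} {k j : ℤ} (h : k = j) (ω : ℤ → Ω₀) :
    seqShift k ω = seqShift j ω := by rw [h]

theorem seqShift_neg_succ {Ω₀ : Type*} (ℓ : ℕ) (ω : ℤ → Ω₀) :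
    seqShift (-((ℓ + 1 : ℕ) : ℤ) + 1) ω = seqShift (-(ℓ : ℤ)) ω :=
  seqShift_congr (by push_cast; ring) ω

namespace RandomTower

section

variable {Ω₀ M : Type*} [MeasurableSpace Ω₀] [MeasurableSpace M] {T : RandomTower Ω₀ M} {β : ℝ}

theorem mem_base {ω : ℤ → Ω₀} {x : M} : x ∈ T.base ω ↔ ∃ i, x ∈ T.Λ ω i := mem_iUnion

theorem mem_tower {ω : ℤ → Ω₀} {x : M} {ℓ : ℕ} : (x, ℓ) ∈ T.tower ω ↔
    x ∈ T.base (seqShift (-(ℓ : ℤ)) ω) ∧ ℓ + 1 ≤ T.ret (seqShift (-(ℓ : ℤ)) ω) x := Iff.rfl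

theorem orbit_congr {ω ω' : ℤ → Ω₀} (n : ℕ) (h : ∀ j : ℤ, 0 ≤ j → j < n → ω' j = ω j) :
    T.orbit ω' n = T.orbit ω n := by
  induction n with
  | zero => rfl
  | succ n ih =>
    funext x
    have h1 := ih fun j hj hjn => h j hj (by push_cast; omega)
    simp only [orbit]
    rw [h1, h n (by positivity) (by push_cast; omega)]

theorem IsYoungTower.atom_unique (hT : T.IsYoungTower β) {ω : ℤ → Ω₀} {x : M} {i j : ℕ}
    (hi : x ∈ T.Λ ω i) (hj : x ∈ T.Λ ω j) : i = j := by
  by_contra h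
  exact Set.disjoint_left.1 (hT.disjoint ω h) hi hj

theorem IsYoungTower.ret_eq (hT : T.IsYoungTower β) {ω : ℤ → Ω₀} {x : M} {i : ℕ}
    (hi : x ∈ T.Λ ω i) : T.ret ω x = T.R ω i := by
  have : {n | ∃ j, x ∈ T.Λ ω j ∧ T.R ω j = n} = {T.R ω i} := by
    ext n
    constructor
    · rintro ⟨j, hj, rfl⟩
      rw [hT.atom_unique hi hj]; rfl
    · rintro rfl
      exact ⟨i, hi, rfl⟩
  rw [ret, this, csInf_singleton]

theorem IsYoungTower.ret_pos (hT : T.IsYoungTower β) {ω : ℤ → Ω₀} {x : M}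
    (hx : x ∈ T.base ω) : 0 < T.ret ω x := by
  obtain ⟨i, hi⟩ := mem_base.1 hx
  rw [hT.ret_eq hi]
  exact hT.R_pos ω i

theorem IsYoungTower.base_nonempty (hT : T.IsYoungTower β) (ω : ℤ → Ω₀) :
    (T.base ω).Nonempty := by
  by_contra h
  have := hT.m_prob ω
  have h1 := hT.m_base ω
  rw [not_nonempty_iff_eq_empty.1 h, compl_empty, measure_univ] at h1
  exact one_ne_zero h1

theorem IsYoungTower.orbit_mem_base (hT : T.IsYoungTower β) {ω : ℤ → Ω₀} {x : M}
    (hx : x ∈ T.base ω) : T.orbit ω (T.ret ω x) x ∈ T.base (seqShift (T.ret ω x : ℤ) ω) := by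
  obtain ⟨i, hi⟩ := mem_base.1 hx
  rw [hT.ret_eq hi]
  exact (hT.bijOn ω i ⟨x, hi⟩).mapsTo hi

/-- By the full return, every point of the base at `σ^n ω` is the image of some `y` in the atom of
`x₀`. The stopping time property keeps `y` in the base at `ω'` with the same return time, and its
orbit up to time `n` reads only coordinates shared by `ω` and `ω'`. -/
theorem IsYoungTower.base_shift_subset (hT : T.IsYoungTower β) {ω ω' : ℤ → Ω₀} {x₀ : M}
    (hx₀ : x₀ ∈ T.base ω) (h : ∀ j : ℤ, 0 ≤ j → j < T.ret ω x₀ → ω' j = ω j) :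
    T.base (seqShift (T.ret ω x₀ : ℤ) ω) ⊆ T.base (seqShift (T.ret ω x₀ : ℤ) ω') := by
  intro x hx
  obtain ⟨i, hi⟩ := mem_base.1 hx₀
  rw [hT.ret_eq hi] at hx h ⊢
  obtain ⟨y, hy, rfl⟩ := (hT.bijOn ω i ⟨x₀, hi⟩).surjOn hx
  have hyr := hT.ret_eq hy
  obtain ⟨h1, h2⟩ := hT.stopping ω y (mem_base.2 ⟨i, hy⟩) ω' (by rwa [hyr])
  have h3 := hT.orbit_mem_base h1
  rwa [h2, hyr, orbit_congr _ h] at h3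

/-- The base of the tower does not depend on `ω`. -/
theorem IsYoungTower.base_eq (hT : T.IsYoungTower β) (ω₁ ω₂ : ℤ → Ω₀) :
    T.base ω₁ = T.base ω₂ := by
  suffices H : ∀ ω₁ ω₂ : ℤ → Ω₀, T.base ω₁ ⊆ T.base ω₂ from
    Subset.antisymm (H _ _) (H _ _)
  clear ω₁ ω₂
  intro ω₁ ω₂
  obtain ⟨x₀, hx₀⟩ := hT.base_nonempty ω₁
  let n : ℕ := T.ret ω₁ x₀
  -- `A ω` follows `ω₁` up to time `n` and then plays `ω` from its coordinate `0`. Two such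
  -- sequences agree before time `n`, so the return of `x₀` compares the bases at `σ^n (A ω₁)` and
  -- `σ^n (A ω₂)`, whose nonnegative coordinates are those of `ω₁` and `ω₂`.
  let A (ω : ℤ → Ω₀) : ℤ → Ω₀ := fun j => if j < n then ω₁ j else ω (j - n)
  have hA : ∀ ω, x₀ ∈ T.base (A ω) ∧ T.ret (A ω) x₀ = n := fun ω =>
    hT.stopping ω₁ x₀ hx₀ (A ω) fun j _ hj => if_pos hj
  -- The base depends on the nonnegative coordinates only.
  have hsub : ∀ ω ω' : ℤ → Ω₀, (∀ j, 0 ≤ j → ω' j = ω j) → T.base ω ⊆ T.base ω' :=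
    fun ω ω' h x hx => (hT.stopping ω x hx ω' fun j hj _ => h j hj).1
  have hs : ∀ ω (j : ℤ), 0 ≤ j → seqShift (n : ℤ) (A ω) j = ω j := by
    intro ω j hj
    simp only [seqShift, A]
    rw [if_neg (by omega)]
    congr 1
    ring
  have h1 := hsub ω₁ (seqShift (n : ℤ) (A ω₁)) (hs ω₁)
  have h2 : T.base (seqShift (n : ℤ) (A ω₁)) ⊆ T.base (seqShift (n : ℤ) (A ω₂)) := by
    have := hT.base_shift_subset (ω := A ω₁) (ω' := A ω₂) (hA ω₁).1
    rw [(hA ω₁).2] at this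
    refine this fun j _ hj => ?_
    simp only [A]
    rw [if_pos hj, if_pos hj]
  have h3 := hsub (seqShift (n : ℤ) (A ω₂)) ω₂ fun j hj => (hs ω₂ j hj).symm
  exact (h1.trans h2).trans h3

theorem F_of_lt {ω : ℤ → Ω₀} {x : M} {ℓ : ℕ}
    (h : ℓ + 1 < T.ret (seqShift (-(ℓ : ℤ)) ω) x) : T.F ω (x, ℓ) = (x, ℓ + 1) := if_pos h

theorem F_of_eq {ω : ℤ → Ω₀} {x : M} {ℓ : ℕ} (h : T.ret (seqShift (-(ℓ : ℤ)) ω) x = ℓ + 1) :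
    T.F ω (x, ℓ) = (T.orbit (seqShift (-(ℓ : ℤ)) ω) (ℓ + 1) x, 0) :=
  if_neg (by rw [h]; exact lt_irrefl _)

theorem JF_of_lt {ω : ℤ → Ω₀} {x : M} {ℓ : ℕ}
    (h : ℓ + 1 < T.ret (seqShift (-(ℓ : ℤ)) ω) x) : T.JF ω (x, ℓ) = 1 := if_pos h

theorem JF_of_eq {ω : ℤ → Ω₀} {x : M} {ℓ : ℕ} (h : T.ret (seqShift (-(ℓ : ℤ)) ω) x = ℓ + 1) :
    T.JF ω (x, ℓ) = T.J (seqShift (-(ℓ : ℤ)) ω) x :=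
  if_neg (by rw [h]; exact lt_irrefl _)

theorem IsYoungTower.JF_pos (hT : T.IsYoungTower β) {ω : ℤ → Ω₀} {z : M × ℕ}
    (hz : z ∈ T.tower ω) : 0 < T.JF ω z := by
  unfold JF
  split_ifs
  · exact one_pos
  · exact hT.J_pos _ _ hz.1

theorem IsYoungTower.mem_tower_zero (hT : T.IsYoungTower β) {ω : ℤ → Ω₀} {x : M} :
    (x, 0) ∈ T.tower ω ↔ x ∈ T.base ω := by
  rw [mem_tower]
  simp only [Nat.cast_zero, neg_zero, seqShift_zero, zero_add]
  exact ⟨fun h => h.1, fun h => ⟨h, hT.ret_pos h⟩⟩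

theorem IsYoungTower.mapsTo_F (hT : T.IsYoungTower β) {ω : ℤ → Ω₀} {z : M × ℕ}
    (hz : z ∈ T.tower ω) : T.F ω z ∈ T.tower (seqShift 1 ω) := by
  obtain ⟨x, ℓ⟩ := z
  rcases hz.2.lt_or_eq with h | h
  · rw [F_of_lt h, mem_tower, seqShift_seqShift, seqShift_neg_succ]
    exact ⟨hz.1, h⟩
  · rw [F_of_eq h.symm, hT.mem_tower_zero]
    have := hT.orbit_mem_base hz.1
    dsimp only at h this
    rw [← h] at this
    rwa [hT.base_eq (seqShift 1 ω) _]

theorem IsYoungTower.mapsTo_Fiter (hT : T.IsYoungTower β) {ω : ℤ → Ω₀} {z : M × ℕ}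
    (hz : z ∈ T.tower ω) (n : ℕ) : T.Fiter ω n z ∈ T.tower (seqShift (n : ℤ) ω) := by
  induction n with
  | zero => simpa [Fiter] using hz
  | succ n ih =>
    have := hT.mapsTo_F ih
    rw [seqShift_seqShift, add_comm] at this
    exact_mod_cast this

theorem Fiter_succ' (ω : ℤ → Ω₀) (n : ℕ) (z : M × ℕ) :
    T.Fiter ω (n + 1) z = T.Fiter (seqShift 1 ω) n (T.F ω z) := by
  induction n with
  | zero => simp [Fiter]
  | succ n ih =>
    change T.F _ (T.Fiter ω (n + 1) z) = T.F _ _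
    rw [ih, seqShift_seqShift]
    norm_cast

theorem SameAtom.level {ω : ℤ → Ω₀} {z z' : M × ℕ} (h : T.SameAtom ω z z') : z.2 = z'.2 := h.1

theorem SameAtom.symm {ω : ℤ → Ω₀} {z z' : M × ℕ} (h : T.SameAtom ω z z') :
    T.SameAtom ω z' z := by
  obtain ⟨x, ℓ⟩ := z
  obtain ⟨x', ℓ'⟩ := z'
  obtain ⟨h1, i, h2, h3⟩ := h
  dsimp only at h1 h2 h3
  subst h1
  exact ⟨rfl, i, h3, h2⟩

theorem IsYoungTower.sameAtom_trans (hT : T.IsYoungTower β) {ω : ℤ → Ω₀} {z z' z'' : M × ℕ}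
    (h : T.SameAtom ω z z') (h' : T.SameAtom ω z' z'') : T.SameAtom ω z z'' := by
  obtain ⟨x, ℓ⟩ := z
  obtain ⟨x', ℓ'⟩ := z'
  obtain ⟨x'', ℓ''⟩ := z''
  obtain ⟨h1, i, h2, h3⟩ := h
  obtain ⟨h1', j, h2', h3'⟩ := h'
  dsimp only at h1 h2 h3 h1' h2' h3'
  subst h1 h1'
  obtain rfl := hT.atom_unique h3 h2'
  exact ⟨rfl, i, h2, h3'⟩

theorem sameAtom_refl {ω : ℤ → Ω₀} {z : M × ℕ} (hz : z ∈ T.tower ω) : T.SameAtom ω z z := by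
  obtain ⟨i, hi⟩ := mem_base.1 hz.1
  exact ⟨rfl, i, hi, hi⟩

theorem IsYoungTower.sameAtom_ret (hT : T.IsYoungTower β) {ω : ℤ → Ω₀} {x x' : M} {ℓ : ℕ}
    (h : T.SameAtom ω (x, ℓ) (x', ℓ)) :
    T.ret (seqShift (-(ℓ : ℤ)) ω) x = T.ret (seqShift (-(ℓ : ℤ)) ω) x' := by
  obtain ⟨_, i, h1, h2⟩ := h
  rw [hT.ret_eq h1, hT.ret_eq h2]

theorem sameCylinder_zero (ω : ℤ → Ω₀) (z z' : M × ℕ) : T.SameCylinder ω 0 z z' :=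
  fun _ h => absurd h (Nat.not_lt_zero _)

theorem sameCylinder_succ {ω : ℤ → Ω₀} {n : ℕ} {z z' : M × ℕ} :
    T.SameCylinder ω (n + 1) z z' ↔
      T.SameAtom ω z z' ∧ T.SameCylinder (seqShift 1 ω) n (T.F ω z) (T.F ω z') := by
  constructor
  · intro h
    refine ⟨by simpa [Fiter] using h 0 (Nat.succ_pos _), fun k hk => ?_⟩
    have := h (k + 1) (Nat.succ_lt_succ hk)
    rw [Fiter_succ', Fiter_succ'] at this
    rw [seqShift_seqShift]
    exact_mod_cast this
  · rintro ⟨h0, h⟩ k hk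
    cases k with
    | zero => simpa [Fiter] using h0
    | succ k =>
      have := h k (Nat.lt_of_succ_lt_succ hk)
      rw [seqShift_seqShift] at this
      rw [Fiter_succ', Fiter_succ']
      exact_mod_cast this

theorem SameCylinder.mono {ω : ℤ → Ω₀} {n m : ℕ} {z z' : M × ℕ}
    (h : T.SameCylinder ω n z z') (hm : m ≤ n) : T.SameCylinder ω m z z' :=
  fun k hk => h k (hk.trans_le hm)

theorem SameCylinder.symm {ω : ℤ → Ω₀} {n : ℕ} {z z' : M × ℕ}
    (h : T.SameCylinder ω n z z') : T.SameCylinder ω n z' z := fun k hk => (h k hk).symm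

theorem IsYoungTower.sameCylinder_trans (hT : T.IsYoungTower β) {ω : ℤ → Ω₀} {n : ℕ}
    {z z' z'' : M × ℕ} (h : T.SameCylinder ω n z z') (h' : T.SameCylinder ω n z' z'') :
    T.SameCylinder ω n z z'' := fun k hk => hT.sameAtom_trans (h k hk) (h' k hk)

theorem IsYoungTower.sameCylinder_refl (hT : T.IsYoungTower β) {ω : ℤ → Ω₀} {z : M × ℕ}
    (hz : z ∈ T.tower ω) (n : ℕ) : T.SameCylinder ω n z z :=
  fun k _ => sameAtom_refl (hT.mapsTo_Fiter hz k)

/-- Points of a common level whose preimages can be matched: both in the base, or in a common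
atom. -/
def Comparable (T : RandomTower Ω₀ M) (ω : ℤ → Ω₀) (z z' : M × ℕ) : Prop :=
  z.2 = 0 ∧ z'.2 = 0 ∨ T.SameAtom ω z z'

theorem Comparable.symm {ω : ℤ → Ω₀} {z z' : M × ℕ} (h : T.Comparable ω z z') :
    T.Comparable ω z' z := h.imp And.symm SameAtom.symm

theorem sepDist_eq_of_forall {ω : ℤ → Ω₀} {z z' : M × ℕ} (h : ∀ n, T.SameCylinder ω n z z') :
    T.sepDist β ω z z' = 0 := by
  have : T.sepTime ω z z' = ⊤ := by
    rw [sepTime]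
    have : {n : ℕ | ¬ T.SameCylinder ω n z z'} = ∅ := by
      ext n; simp [h n]
    rw [this, image_empty, sInf_empty]
  rw [sepDist, if_pos this]

theorem sepTime_eq {ω : ℤ → Ω₀} {z z' : M × ℕ} {n : ℕ} (h : T.SameCylinder ω n z z')
    (h' : ¬ T.SameCylinder ω (n + 1) z z') : T.sepTime ω z z' = ((n + 1 : ℕ) : ℕ∞) := by
  rw [sepTime]
  apply le_antisymm
  · exact sInf_le ⟨n + 1, h', rfl⟩
  · apply le_sInf
    rintro _ ⟨m, hm, rfl⟩
    by_contra hlt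
    simp only [not_le] at hlt
    exact hm (h.mono (Nat.lt_succ_iff.1 (by exact_mod_cast hlt)))

theorem sepDist_eq {ω : ℤ → Ω₀} {z z' : M × ℕ} {n : ℕ} (h : T.SameCylinder ω n z z')
    (h' : ¬ T.SameCylinder ω (n + 1) z z') : T.sepDist β ω z z' = β ^ (n + 1) := by
  rw [sepDist, sepTime_eq h h', if_neg (ENat.natCast_ne_top _), ENat.toNat_natCast]

theorem sameCylinder_cases (T : RandomTower Ω₀ M) (ω : ℤ → Ω₀) (z z' : M × ℕ) :
    (∀ n, T.SameCylinder ω n z z') ∨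
      ∃ n, T.SameCylinder ω n z z' ∧ ¬ T.SameCylinder ω (n + 1) z z' := by
  by_cases h : ∀ n, T.SameCylinder ω n z z'
  · exact Or.inl h
  · right
    push Not at h
    classical
    have hpos : Nat.find h ≠ 0 := fun h0 =>
      Nat.find_spec h (h0 ▸ sameCylinder_zero ω z z')
    obtain ⟨n, hn⟩ := Nat.exists_eq_succ_of_ne_zero hpos
    refine ⟨n, ?_, fun hc => Nat.find_spec h (hn.symm ▸ hc)⟩
    by_contra hc
    exact Nat.find_min h (hn ▸ Nat.lt_succ_self n) hc

theorem sepDist_le_of_sameCylinder (hβ₀ : 0 < β) (hβ₁ : β < 1) {ω : ℤ → Ω₀} {z z' : M × ℕ}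
    {n : ℕ} (h : T.SameCylinder ω n z z') : T.sepDist β ω z z' ≤ β ^ (n + 1) := by
  rcases T.sameCylinder_cases ω z z' with h0 | ⟨m, hm, hm'⟩
  · rw [sepDist_eq_of_forall h0]; positivity
  · rw [sepDist_eq hm hm']
    refine pow_le_pow_of_le_one hβ₀.le hβ₁.le (Nat.succ_le_succ ?_)
    by_contra hc
    exact hm' (h.mono (by omega))

theorem le_sepDist_of_not_sameCylinder (hβ₀ : 0 < β) (hβ₁ : β < 1) {ω : ℤ → Ω₀}
    {z z' : M × ℕ} {n : ℕ} (h : ¬ T.SameCylinder ω n z z') : β ^ n ≤ T.sepDist β ω z z' := by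
  rcases T.sameCylinder_cases ω z z' with h0 | ⟨m, hm, hm'⟩
  · exact absurd (h0 n) h
  · rw [sepDist_eq hm hm']
    refine pow_le_pow_of_le_one hβ₀.le hβ₁.le ?_
    by_contra hc
    exact h (hm.mono (by omega))

/-- Cylinders of order `0` impose no condition, so separation times are at least `1`. -/
theorem sepDist_le (hβ₀ : 0 < β) (hβ₁ : β < 1) (ω : ℤ → Ω₀) (z z' : M × ℕ) :
    T.sepDist β ω z z' ≤ β := by
  simpa using sepDist_le_of_sameCylinder hβ₀ hβ₁ (sameCylinder_zero (T := T) ω z z')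

theorem sepDist_comm (ω : ℤ → Ω₀) (z z' : M × ℕ) :
    T.sepDist β ω z z' = T.sepDist β ω z' z := by
  have : ∀ n, T.SameCylinder ω n z z' ↔ T.SameCylinder ω n z' z :=
    fun n => ⟨SameCylinder.symm, SameCylinder.symm⟩
  have h2 : T.sepTime ω z z' = T.sepTime ω z' z := by simp only [sepTime, this]
  rw [sepDist, sepDist, h2]

/-- The tower map expands the distance of points of a common atom by the factor `β⁻¹`. -/
theorem SameAtom.sepDist_eq {ω : ℤ → Ω₀} {z z' : M × ℕ} (h : T.SameAtom ω z z') :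
    T.sepDist β ω z z' = β * T.sepDist β (seqShift 1 ω) (T.F ω z) (T.F ω z') := by
  rcases T.sameCylinder_cases (seqShift 1 ω) (T.F ω z) (T.F ω z') with h0 | ⟨n, hn, hn'⟩
  · rw [sepDist_eq_of_forall h0, mul_zero, sepDist_eq_of_forall]
    intro n
    exact SameCylinder.mono (sameCylinder_succ.2 ⟨h, h0 n⟩) (Nat.le_succ n)
  · rw [RandomTower.sepDist_eq hn hn', RandomTower.sepDist_eq (n := n + 1)
      (sameCylinder_succ.2 ⟨h, hn⟩) (fun hc => hn' (sameCylinder_succ.1 hc).2), pow_succ' β (n + 1)]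

end

end RandomTower

/-! ### Preimages under the tower map, and the transfer operator. -/

namespace RandomTower

section

variable {Ω₀ M : Type*} [MeasurableSpace Ω₀] [MeasurableSpace M] {T : RandomTower Ω₀ M} {β : ℝ}
  {E : Type*} [NormedAddCommGroup E] [NormedSpace ℝ E]

/-- The preimages of `z` under `F_ω : Δ_ω → Δ_{σω}`. -/
def fib (T : RandomTower Ω₀ M) (ω : ℤ → Ω₀) (z : M × ℕ) : Set (M × ℕ) :=
  {y | y ∈ T.tower ω ∧ T.F ω y = z}

theorem mem_fib {ω : ℤ → Ω₀} {z y : M × ℕ} :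
    y ∈ T.fib ω z ↔ y ∈ T.tower ω ∧ T.F ω y = z := Iff.rfl

theorem fib_succ {ω : ℤ → Ω₀} {x : M} {ℓ : ℕ} (hz : (x, ℓ + 1) ∈ T.tower (seqShift 1 ω)) :
    T.fib ω (x, ℓ + 1) = {(x, ℓ)} := by
  rw [mem_tower, seqShift_seqShift, seqShift_neg_succ] at hz
  ext ⟨y, k⟩
  rw [mem_singleton_iff, mem_fib]
  constructor
  · rintro ⟨-, h⟩
    unfold F at h
    split_ifs at h <;> simp_all
  · intro h
    obtain ⟨rfl, rfl⟩ := Prod.mk.inj h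
    exact ⟨mem_tower.2 ⟨hz.1, Nat.le_of_succ_le hz.2⟩, F_of_lt hz.2⟩

theorem ret_of_mem_fib_succ {ω : ℤ → Ω₀} {x : M} {ℓ : ℕ}
    (hz : (x, ℓ + 1) ∈ T.tower (seqShift 1 ω)) : ℓ + 1 < T.ret (seqShift (-(ℓ : ℤ)) ω) x := by
  rw [mem_tower, seqShift_seqShift, seqShift_neg_succ] at hz
  exact hz.2

theorem mem_fib_zero {ω : ℤ → Ω₀} {x y : M} {ℓ : ℕ} :
    (y, ℓ) ∈ T.fib ω (x, 0) ↔ y ∈ T.base (seqShift (-(ℓ : ℤ)) ω) ∧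
      T.ret (seqShift (-(ℓ : ℤ)) ω) y = ℓ + 1 ∧
      T.orbit (seqShift (-(ℓ : ℤ)) ω) (ℓ + 1) y = x := by
  rw [mem_fib, mem_tower]
  constructor
  · rintro ⟨⟨h1, h2⟩, h3⟩
    rcases h2.lt_or_eq with h | h
    · rw [F_of_lt h] at h3
      simp at h3
    · rw [F_of_eq h.symm] at h3
      exact ⟨h1, h.symm, (Prod.mk.inj h3).1⟩
  · rintro ⟨h1, h2, h3⟩
    exact ⟨⟨h1, h2.ge⟩, by rw [F_of_eq h2, h3]⟩

/-- Over the base this is the full return: each atom with the right return time is mapped onto the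
whole base, so it contains a preimage of `z'` as soon as it contains one of `z`. Over a positive
level the only preimage is the point just below, and the atom of a point does not change while it
climbs. -/
theorem IsYoungTower.exists_fib (hT : T.IsYoungTower β) {ω : ℤ → Ω₀} {z z' y : M × ℕ}
    (hz : z ∈ T.tower (seqShift 1 ω)) (hz' : z' ∈ T.tower (seqShift 1 ω))
    (h : T.Comparable (seqShift 1 ω) z z') (hy : y ∈ T.fib ω z) :
    ∃ y' ∈ T.fib ω z', T.SameAtom ω y y' := by
  obtain ⟨x, k⟩ := z
  obtain ⟨x', k'⟩ := z'
  cases k with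
  | zero =>
    obtain rfl : k' = 0 := by
      rcases h with h | h
      · exact h.2
      · exact h.1.symm
    obtain ⟨y, ℓ⟩ := y
    rw [mem_fib_zero] at hy
    obtain ⟨h1, h2, h3⟩ := hy
    obtain ⟨i, hi⟩ := mem_base.1 h1
    have hR := (hT.ret_eq hi).symm.trans h2
    have hb := hT.bijOn _ i ⟨y, hi⟩
    rw [hT.base_eq _ (seqShift 1 ω), hR] at hb
    obtain ⟨y', hy', hyx⟩ := hb.surjOn (hT.mem_tower_zero.1 hz')
    refine ⟨(y', ℓ), ?_, rfl, i, hi, hy'⟩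
    rw [mem_fib_zero]
    exact ⟨mem_base.2 ⟨i, hy'⟩, by rw [hT.ret_eq hy', hR], hyx⟩
  | succ ℓ =>
    rcases h with h | h
    · simp at h
    · obtain rfl : ℓ + 1 = k' := h.1
      rw [fib_succ hz] at hy
      rw [mem_singleton_iff] at hy
      subst hy
      refine ⟨(x', ℓ), by rw [fib_succ hz']; rfl, rfl, ?_⟩
      obtain ⟨i, hi⟩ := h.2
      dsimp only at hi
      rw [seqShift_seqShift, seqShift_neg_succ] at hi
      exact ⟨i, hi⟩

theorem IsYoungTower.fib_unique (hT : T.IsYoungTower β) {ω : ℤ → Ω₀} {z y y' : M × ℕ}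
    (hz : z ∈ T.tower (seqShift 1 ω)) (hy : y ∈ T.fib ω z) (hy' : y' ∈ T.fib ω z)
    (h : T.SameAtom ω y y') : y = y' := by
  obtain ⟨x, k⟩ := z
  cases k with
  | zero =>
    obtain ⟨y, ℓ⟩ := y
    obtain ⟨y', ℓ'⟩ := y'
    obtain rfl : ℓ = ℓ' := h.1
    rw [mem_fib_zero] at hy hy'
    obtain ⟨-, i, hi, hi'⟩ := h
    have hb := hT.bijOn _ i ⟨y, hi⟩
    rw [← hT.ret_eq hi, hy.2.1] at hb
    have e : y = y' := hb.injOn hi hi' (hy.2.2.trans hy'.2.2.symm)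
    rw [e]
  | succ ℓ =>
    rw [fib_succ hz, mem_singleton_iff] at hy hy'
    rw [hy, hy']

/-- The matching of the preimages of two comparable points. -/
noncomputable def IsYoungTower.fibEquiv (hT : T.IsYoungTower β) {ω : ℤ → Ω₀} {z z' : M × ℕ}
    (hz : z ∈ T.tower (seqShift 1 ω)) (hz' : z' ∈ T.tower (seqShift 1 ω))
    (h : T.Comparable (seqShift 1 ω) z z') : T.fib ω z ≃ T.fib ω z' :=
  Equiv.ofBijective
    (fun y => ⟨(hT.exists_fib hz hz' h y.2).choose, (hT.exists_fib hz hz' h y.2).choose_spec.1⟩)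
    (by
      constructor
      · intro y₁ y₂ h12
        have h1 := (hT.exists_fib hz hz' h y₁.2).choose_spec.2
        have h2 := (hT.exists_fib hz hz' h y₂.2).choose_spec.2
        rw [← Subtype.mk.inj h12] at h2
        exact Subtype.ext (hT.fib_unique hz y₁.2 y₂.2 (hT.sameAtom_trans h1 h2.symm))
      · intro y'
        obtain ⟨y, hy, hyy⟩ := hT.exists_fib hz' hz h.symm y'.2
        refine ⟨⟨y, hy⟩, Subtype.ext ?_⟩
        have h1 := (hT.exists_fib hz hz' h hy).choose_spec
        exact hT.fib_unique hz' h1.1 y'.2 (hT.sameAtom_trans h1.2.symm hyy.symm))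

theorem IsYoungTower.fibEquiv_sameAtom (hT : T.IsYoungTower β) {ω : ℤ → Ω₀} {z z' : M × ℕ}
    (hz : z ∈ T.tower (seqShift 1 ω)) (hz' : z' ∈ T.tower (seqShift 1 ω))
    (h : T.Comparable (seqShift 1 ω) z z') (y : T.fib ω z) :
    T.SameAtom ω y (hT.fibEquiv hz hz' h y) :=
  (hT.exists_fib hz hz' h y.2).choose_spec.2

theorem sepDist_fib {ω : ℤ → Ω₀} {z z' y y' : M × ℕ} (hy : y ∈ T.fib ω z)
    (hy' : y' ∈ T.fib ω z') (h : T.SameAtom ω y y') :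
    T.sepDist β ω y y' = β * T.sepDist β (seqShift 1 ω) z z' := by
  rw [h.sepDist_eq, hy.2, hy'.2]

/-- `A₁` is a distortion constant of the return maps. -/
def DistortionConst (T : RandomTower Ω₀ M) (β A₁ : ℝ) : Prop :=
  0 < A₁ ∧ ∀ ω i, ∀ x ∈ T.Λ ω i, ∀ y ∈ T.Λ ω i,
    |T.J ω x / T.J ω y - 1| ≤ A₁ * T.sepDist β (seqShift (T.R ω i : ℤ) ω)
      (T.orbit ω (T.R ω i) x, 0) (T.orbit ω (T.R ω i) y, 0)

/-- While the points climb both Jacobians are `1`; at a return this is the distortion hypothesis,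
since the distance there is taken at the images `z`, `z'`. -/
theorem IsYoungTower.abs_JF_div_sub_one_le (hT : T.IsYoungTower β) (hβ₀ : 0 < β) {A₁ : ℝ}
    (hA : T.DistortionConst β A₁) {ω : ℤ → Ω₀} {z z' y y' : M × ℕ} (hy : y ∈ T.fib ω z)
    (hy' : y' ∈ T.fib ω z') (h : T.SameAtom ω y y') :
    |T.JF ω y / T.JF ω y' - 1| ≤ A₁ * T.sepDist β (seqShift 1 ω) z z' := by
  obtain ⟨y, ℓ⟩ := y
  obtain ⟨y', ℓ'⟩ := y'
  obtain rfl : ℓ = ℓ' := h.1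
  have hr := hT.sameAtom_ret h
  have h1 := hy.1.2
  dsimp only at h1
  rcases h1.lt_or_eq with h1 | h1
  · rw [JF_of_lt h1, JF_of_lt (hr ▸ h1)]
    simp only [div_one, sub_self, abs_zero]
    exact mul_nonneg hA.1.le (T.sepDist_nonneg hβ₀.le _ _ _)
  · have h2 := hy.2
    have h3 := hy'.2
    rw [F_of_eq h1.symm] at h2
    rw [F_of_eq (h1.trans hr).symm] at h3
    obtain ⟨-, i, hi, hi'⟩ := h
    rw [JF_of_eq h1.symm, JF_of_eq (h1.trans hr).symm]
    have := hA.2 _ i _ hi _ hi'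
    rw [← hT.ret_eq hi] at this
    dsimp only at this
    rw [← h1, seqShift_seqShift, h2, h3] at this
    rwa [seqShift_congr (show ((ℓ + 1 : ℕ) : ℤ) + -(ℓ : ℤ) = 1 by push_cast; ring)] at this

/-- The transfer operator of `F_ω`, applied to a function with values in a normed space. -/
noncomputable def tr (T : RandomTower Ω₀ M) (ω : ℤ → Ω₀) (g : M × ℕ → E) (z : M × ℕ) : E :=
  ∑' y : T.fib ω z, (T.JF ω y)⁻¹ • g y

theorem tr_succ {ω : ℤ → Ω₀} (g : M × ℕ → E) {x : M} {ℓ : ℕ}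
    (hz : (x, ℓ + 1) ∈ T.tower (seqShift 1 ω)) : T.tr ω g (x, ℓ + 1) = g (x, ℓ) := by
  have : Unique (T.fib ω (x, ℓ + 1)) := by
    rw [fib_succ hz]; exact Set.uniqueSingleton _
  have hd : ((default : T.fib ω (x, ℓ + 1)) : M × ℕ) = (x, ℓ) :=
    (Set.ext_iff.1 (fib_succ hz) _).1 (default : T.fib ω (x, ℓ + 1)).2
  rw [tr, tsum_eq_single default (fun b hb => absurd (Subsingleton.elim _ _) hb), hd,
    JF_of_lt (ret_of_mem_fib_succ hz), inv_one, one_smul]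

theorem tr_congr {ω : ℤ → Ω₀} {g g' : M × ℕ → E} {z : M × ℕ}
    (h : ∀ y ∈ T.fib ω z, g y = g' y) : T.tr ω g z = T.tr ω g' z :=
  tsum_congr fun y => by rw [h y y.2]

/-- The sums over preimages in the base on which the return time is `n`. -/
noncomputable def bR (T : RandomTower Ω₀ M) (ω : ℤ → Ω₀) (n : ℕ) (g : M → E) (x : M) : E :=
  ∑' y : {y : M // y ∈ T.base ω ∧ T.ret ω y = n ∧ T.orbit ω n y = x}, (T.J ω y)⁻¹ • g y

/-- The preimages of a point of the base, by level. -/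
def fibZeroEquiv (T : RandomTower Ω₀ M) (ω : ℤ → Ω₀) (x : M) :
    (Σ ℓ : ℕ, {y : M // y ∈ T.base (seqShift (-(ℓ : ℤ)) ω) ∧
      T.ret (seqShift (-(ℓ : ℤ)) ω) y = ℓ + 1 ∧
      T.orbit (seqShift (-(ℓ : ℤ)) ω) (ℓ + 1) y = x}) ≃ T.fib ω (x, 0) where
  toFun p := ⟨(p.2, p.1), mem_fib_zero.2 p.2.2⟩
  invFun q := ⟨q.1.2, q.1.1, mem_fib_zero.1 q.2⟩
  left_inv _ := rfl
  right_inv _ := rfl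

end

end RandomTower

/-! ### Sums of reciprocal Jacobians by return time, and convergence of the transfer operators. -/

namespace RandomTower

section

variable {Ω₀ M : Type*} [MeasurableSpace Ω₀] [MeasurableSpace M] {T : RandomTower Ω₀ M} {β : ℝ}
  {E : Type*} [NormedAddCommGroup E] [NormedSpace ℝ E]

theorem IsYoungTower.measurableSet_Λ (hT : T.IsYoungTower β) (ω : ℤ → Ω₀) (i : ℕ) :
    MeasurableSet (T.Λ ω i) := measurable_prodMk_left (hT.measurable_Λ i)

theorem IsYoungTower.measurableSet_base (hT : T.IsYoungTower β) (ω : ℤ → Ω₀) :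
    MeasurableSet (T.base ω) := MeasurableSet.iUnion fun i => hT.measurableSet_Λ ω i

theorem IsYoungTower.m_base_eq_one (hT : T.IsYoungTower β) (ω ω' : ℤ → Ω₀) :
    T.m ω (T.base ω') = 1 := by
  have := hT.m_prob ω
  rw [hT.base_eq ω' ω]
  have h := prob_compl_eq_zero_iff (μ := T.m ω) (hT.measurableSet_base ω)
  exact h.1 (hT.m_base ω)

theorem DistortionConst.div_le {A₁ : ℝ} (hA : T.DistortionConst β A₁) (hβ₀ : 0 < β)
    (hβ₁ : β < 1) {ω : ℤ → Ω₀} {i : ℕ} {x y : M} (hx : x ∈ T.Λ ω i) (hy : y ∈ T.Λ ω i) :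
    T.J ω x / T.J ω y ≤ 1 + A₁ := by
  have h1 := (abs_le.1 (hA.2 ω i x hx y hy)).2
  have h2 := mul_le_mul_of_nonneg_left (sepDist_le (T := T) hβ₀ hβ₁ (seqShift (T.R ω i : ℤ) ω)
    (T.orbit ω (T.R ω i) x, 0) (T.orbit ω (T.R ω i) y, 0)) hA.1.le
  nlinarith [hA.1]

/-- The reciprocal of the Jacobian is bounded by the measure of the atom. -/
theorem IsYoungTower.inv_J_le (hT : T.IsYoungTower β) (hβ₀ : 0 < β) (hβ₁ : β < 1) {A₁ : ℝ}
    (hA : T.DistortionConst β A₁) {ω : ℤ → Ω₀} {i : ℕ} {x : M} (hx : x ∈ T.Λ ω i) :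
    (T.J ω x)⁻¹ ≤ (1 + A₁) * (T.m ω (T.Λ ω i)).toReal := by
  have := hT.m_prob ω
  have hJ : 0 < T.J ω x := hT.J_pos ω x (mem_base.2 ⟨i, hx⟩)
  have h1 := hT.jacobian ω i _ Subset.rfl (hT.measurableSet_Λ ω i)
  rw [(hT.bijOn ω i ⟨x, hx⟩).image_eq, hT.m_base_eq_one] at h1
  -- The image of the atom is the base, of mass `1`, and on the atom `J` is at most `(1 + A₁) J x`.
  have h2 : (1 : ENNReal) ≤ ENNReal.ofReal ((1 + A₁) * T.J ω x) * T.m ω (T.Λ ω i) := by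
    rw [h1, ← setLIntegral_const]
    refine setLIntegral_mono' (hT.measurableSet_Λ ω i) fun y hy => ENNReal.ofReal_le_ofReal ?_
    exact (div_le_iff₀ hJ).1 (hA.div_le hβ₀ hβ₁ hy hx)
  have h3 := ENNReal.toReal_mono (ENNReal.mul_ne_top ENNReal.ofReal_ne_top (measure_ne_top _ _)) h2
  rw [ENNReal.toReal_mul, ENNReal.toReal_ofReal (by have := hA.1; positivity)] at h3
  rw [inv_le_iff_one_le_mul₀ hJ]
  simpa [mul_right_comm] using h3

theorem IsYoungTower.summable_m (hT : T.IsYoungTower β) (ω : ℤ → Ω₀) :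
    Summable fun i => (T.m ω (T.Λ ω i)).toReal := by
  have := hT.m_prob ω
  refine ENNReal.summable_toReal ?_
  rw [← measure_iUnion (hT.disjoint ω) (hT.measurableSet_Λ ω)]
  exact measure_ne_top _ _

/-- The points of the base that return at time `n` to the point `x`. -/
abbrev Ret (T : RandomTower Ω₀ M) (ω : ℤ → Ω₀) (n : ℕ) (x : M) : Type _ :=
  {y : M // y ∈ T.base ω ∧ T.ret ω y = n ∧ T.orbit ω n y = x}

/-- Each atom contains at most one preimage of `x`. Sums over preimages are thereby dominated by
sums of the masses of atoms. -/
theorem IsYoungTower.exists_atom_injective (hT : T.IsYoungTower β) (ω : ℤ → Ω₀) (n : ℕ) (x : M) :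
    ∃ ι : T.Ret ω n x → ℕ, Function.Injective ι ∧ ∀ y, y.1 ∈ T.Λ ω (ι y) := by
  choose ι hι using fun y : T.Ret ω n x => mem_base.1 y.2.1
  refine ⟨ι, fun y y' h => Subtype.ext ?_, hι⟩
  have hy := hι y
  have hy' := hι y'
  rw [← h] at hy'
  have hb := hT.bijOn ω _ ⟨_, hy⟩
  rw [← hT.ret_eq hy, y.2.2.1] at hb
  exact hb.injOn hy hy' (y.2.2.2.trans y'.2.2.2.symm)

theorem IsYoungTower.summable_inv_J (hT : T.IsYoungTower β) (hβ₀ : 0 < β) (hβ₁ : β < 1) {A₁ : ℝ}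
    (hA : T.DistortionConst β A₁) (ω : ℤ → Ω₀) (n : ℕ) (x : M) :
    Summable fun y : T.Ret ω n x => (T.J ω y)⁻¹ := by
  obtain ⟨ι, hι, hmem⟩ := hT.exists_atom_injective ω n x
  refine Summable.of_nonneg_of_le (fun y => (inv_pos.2 (hT.J_pos ω y y.2.1)).le)
    (fun y => hT.inv_J_le hβ₀ hβ₁ hA (hmem y)) ?_
  exact ((hT.summable_m ω).comp_injective hι).mul_left _

/-- The sum of `1 / J` over the preimages lying in atoms with an index in `S`. -/
theorem IsYoungTower.bR_le_of_index (hT : T.IsYoungTower β) (hβ₀ : 0 < β) (hβ₁ : β < 1) {A₁ : ℝ}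
    (hA : T.DistortionConst β A₁) (ω : ℤ → Ω₀) (n : ℕ) (x : M) (S : Set ℕ) (g : M → ℝ)
    (hg : ∀ y, ∀ i ∉ S, y ∈ T.Λ ω i → T.R ω i = n → g y = 0) (hg1 : ∀ y, g y ≤ 1) :
    T.bR ω n g x ≤ (1 + A₁) * ∑' i : S, (T.m ω (T.Λ ω i)).toReal := by
  have hA' : 0 ≤ 1 + A₁ := by have := hA.1; positivity
  obtain ⟨ι, hι, hmem⟩ := hT.exists_atom_injective ω n x
  have hsum := (hT.summable_m ω).indicator S
  rw [tsum_subtype S fun i => (T.m ω (T.Λ ω i)).toReal, ← tsum_mul_left]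
  have hle : ∀ y : T.Ret ω n x, (T.J ω y)⁻¹ • g y ≤
      (1 + A₁) * S.indicator (fun i => (T.m ω (T.Λ ω i)).toReal) (ι y) := by
    intro y
    have hJ := inv_pos.2 (hT.J_pos ω y y.2.1)
    by_cases hS : ι y ∈ S
    · rw [indicator_of_mem hS]
      refine le_trans ?_ (hT.inv_J_le hβ₀ hβ₁ hA (hmem y))
      exact mul_le_of_le_one_right hJ.le (hg1 y)
    · rw [indicator_of_notMem hS, hg y _ hS (hmem y) (by rw [← hT.ret_eq (hmem y), y.2.2.1])]
      simp
  -- `g` is bounded from above only, so the series need not converge; in that case its value is `0`.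
  by_cases hs : Summable fun y : T.Ret ω n x => (T.J ω y)⁻¹ • g y
  · exact hs.tsum_le_tsum_of_inj ι hι
      (fun c _ => mul_nonneg hA' (indicator_nonneg (fun _ _ => ENNReal.toReal_nonneg) _)) hle
      (hsum.mul_left _)
  · rw [bR, tsum_eq_zero_of_not_summable hs]
    exact tsum_nonneg fun c =>
      mul_nonneg hA' (indicator_nonneg (fun _ _ => ENNReal.toReal_nonneg) _)

theorem IsYoungTower.bR_one_le (hT : T.IsYoungTower β) (hβ₀ : 0 < β) (hβ₁ : β < 1) {A₁ : ℝ}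
    (hA : T.DistortionConst β A₁) (ω : ℤ → Ω₀) (n : ℕ) (x : M) :
    T.bR ω n (fun _ => (1 : ℝ)) x
      ≤ (1 + A₁) * (T.m ω {x | x ∈ T.base ω ∧ n ≤ T.ret ω x}).toReal := by
  have := hT.m_prob ω
  have hA' : 0 ≤ 1 + A₁ := by have := hA.1; positivity
  refine (hT.bR_le_of_index hβ₀ hβ₁ hA ω n x {i | T.R ω i = n} _ ?_ fun _ => le_rfl).trans ?_
  · intro y i hi _ h
    exact absurd h hi
  · refine mul_le_mul_of_nonneg_left ?_ hA'
    rw [← ENNReal.tsum_toReal_eq fun _ => measure_ne_top _ _,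
      ← measure_iUnion (fun i j hij => hT.disjoint ω fun h => hij (Subtype.ext h))
        fun i => hT.measurableSet_Λ ω i]
    refine ENNReal.toReal_mono (measure_ne_top _ _) (measure_mono ?_)
    intro y hy
    obtain ⟨i, hi⟩ := mem_iUnion.1 hy
    exact ⟨mem_base.2 ⟨i, hi⟩, by rw [hT.ret_eq hi]; exact i.2.ge⟩

/-- Uniform exponential bounds for the sums of `1 / J` over the preimages with a given return
time, along the orbit of `ω`. -/
def TowerTail (T : RandomTower Ω₀ M) (D c₂ : ℝ) (ω : ℤ → Ω₀) : Prop :=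
  ∀ k : ℤ, ∀ n : ℕ, 1 ≤ n → ∀ x ∈ T.base ω,
    T.bR (seqShift k ω) n (fun _ => (1 : ℝ)) x ≤ D * Real.exp (-c₂ * n)

theorem IsYoungTower.towerTail (hT : T.IsYoungTower β) (hβ₀ : 0 < β) (hβ₁ : β < 1) {A₁ : ℝ}
    (hA : T.DistortionConst β A₁) {ω : ℤ → Ω₀} {c₁ c₂ : ℝ} (hc₁ : 0 ≤ c₁)
    (h : ∀ k : ℤ, ∀ n : ℕ, 1 ≤ n → T.m (seqShift k ω) {x | x ∈ T.base (seqShift k ω) ∧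
      n ≤ T.ret (seqShift k ω) x} ≤ ENNReal.ofReal (c₁ * Real.exp (-c₂ * n))) :
    T.TowerTail ((1 + A₁) * c₁) c₂ ω := by
  intro k n hn x _
  refine (hT.bR_one_le hβ₀ hβ₁ hA _ n x).trans ?_
  rw [mul_assoc]
  refine mul_le_mul_of_nonneg_left ?_ (by have := hA.1; positivity)
  have := ENNReal.toReal_mono ENNReal.ofReal_ne_top (h k n hn)
  rwa [ENNReal.toReal_ofReal (by positivity)] at this

theorem TowerTail.shift (hT : T.IsYoungTower β) {D c₂ : ℝ} {ω : ℤ → Ω₀} (h : T.TowerTail D c₂ ω)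
    (k : ℤ) : T.TowerTail D c₂ (seqShift k ω) := by
  intro j n hn x hx
  rw [seqShift_seqShift]
  exact h _ n hn x (by rwa [hT.base_eq ω (seqShift k ω)])

/-- The weight `v(x, ℓ) = e^{ε₀ ℓ}`. -/
noncomputable def wv (ε₀ : ℝ) (z : M × ℕ) : ℝ := Real.exp (ε₀ * z.2)

theorem wv_pos (ε₀ : ℝ) (z : M × ℕ) : 0 < wv ε₀ z := Real.exp_pos _

theorem one_le_wv {ε₀ : ℝ} (hε : 0 ≤ ε₀) (z : M × ℕ) : 1 ≤ wv ε₀ z :=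
  Real.one_le_exp (by positivity)

theorem wv_zero (ε₀ : ℝ) (x : M) : wv ε₀ (x, 0) = 1 := by simp [wv]

theorem wv_succ (ε₀ : ℝ) (x x' : M) (ℓ : ℕ) :
    wv ε₀ (x, ℓ + 1) = Real.exp ε₀ * wv ε₀ (x', ℓ) := by
  rw [wv, wv, ← Real.exp_add]; push_cast; ring_nf

/-- The functions bounded by `A v` on the tower. -/
def Tame (T : RandomTower Ω₀ M) (ε₀ : ℝ) (ω : ℤ → Ω₀) (A : ℝ) (g : M × ℕ → E) : Prop :=
  ∀ z ∈ T.tower ω, ‖g z‖ ≤ A * wv ε₀ z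

theorem Tame.mono {ε₀ : ℝ} {ω : ℤ → Ω₀} {A A' : ℝ} {g : M × ℕ → E} (h : T.Tame ε₀ ω A g)
    (hA : A ≤ A') : T.Tame ε₀ ω A' g :=
  fun z hz => (h z hz).trans (mul_le_mul_of_nonneg_right hA (wv_pos _ _).le)

theorem tame_wv (ε₀ : ℝ) (ω : ℤ → Ω₀) : T.Tame ε₀ ω 1 (wv ε₀) := fun z _ => by
  rw [Real.norm_of_nonneg (wv_pos _ _).le, one_mul]

/-- The tails of the return times beat the growth of the weight because `ε₀ < c₂`. -/
theorem summable_exp_levels {ε₀ c₂ : ℝ} (h : ε₀ < c₂) (D : ℝ) :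
    Summable fun ℓ : ℕ => Real.exp (ε₀ * ℓ) * (D * Real.exp (-c₂ * (ℓ + 1 : ℕ))) := by
  have : (fun ℓ : ℕ => Real.exp (ε₀ * ℓ) * (D * Real.exp (-c₂ * (ℓ + 1 : ℕ))))
      = fun ℓ : ℕ => (D * Real.exp (-c₂)) * Real.exp (ε₀ - c₂) ^ ℓ := by
    funext ℓ
    rw [← Real.exp_nat_mul, mul_left_comm, ← Real.exp_add, mul_assoc, ← Real.exp_add]
    push_cast; ring_nf
  rw [this]
  exact (summable_geometric_of_lt_one (Real.exp_pos _).le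
    (by rw [← Real.exp_zero]; exact Real.exp_lt_exp.2 (by linarith))).mul_left _

/-- The uniform bound of the transfer operators on the weight, at points of the base. -/
noncomputable def levelSum (ε₀ c₂ D : ℝ) : ℝ :=
  ∑' ℓ : ℕ, Real.exp (ε₀ * ℓ) * (D * Real.exp (-c₂ * (ℓ + 1 : ℕ)))

section sums

variable (hT : T.IsYoungTower β) (hβ₀ : 0 < β) (hβ₁ : β < 1) {A₁ : ℝ}
  (hA : T.DistortionConst β A₁) {ε₀ c₂ D : ℝ} (hε : ε₀ < c₂)

include hT hβ₀ hβ₁ hA hε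

theorem summable_fib_zero_wv {ω : ℤ → Ω₀} (hD : T.TowerTail D c₂ ω) {x : M}
    (hx : x ∈ T.base ω) : Summable fun y : T.fib ω (x, 0) => (T.JF ω y)⁻¹ * wv ε₀ y.1 := by
  rw [← (T.fibZeroEquiv ω x).summable_iff]
  have hterm : ∀ p, ((fun y : T.fib ω (x, 0) => (T.JF ω y)⁻¹ * wv ε₀ y.1) ∘
      T.fibZeroEquiv ω x) p = Real.exp (ε₀ * p.1) * (T.J (seqShift (-(p.1 : ℤ)) ω) p.2)⁻¹ := by
    rintro ⟨ℓ, y⟩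
    change (T.JF ω (y.1, ℓ))⁻¹ * wv ε₀ (y.1, ℓ) = _
    rw [JF_of_eq y.2.2.1, mul_comm, wv]
  have hpos : ∀ (ℓ : ℕ) (y : T.Ret (seqShift (-(ℓ : ℤ)) ω) (ℓ + 1) x),
      0 ≤ Real.exp (ε₀ * ℓ) * (T.J (seqShift (-(ℓ : ℤ)) ω) y)⁻¹ := fun ℓ y =>
    mul_nonneg (Real.exp_pos _).le (inv_nonneg.2 (hT.J_pos _ _ y.2.1).le)
  have h1 : ∀ ℓ : ℕ, Summable fun y : T.Ret (seqShift (-(ℓ : ℤ)) ω) (ℓ + 1) x =>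
      Real.exp (ε₀ * ℓ) * (T.J (seqShift (-(ℓ : ℤ)) ω) y)⁻¹ := fun ℓ =>
    (hT.summable_inv_J hβ₀ hβ₁ hA (seqShift (-(ℓ : ℤ)) ω) (ℓ + 1) x).mul_left
      (Real.exp (ε₀ * ℓ))
  have h2 : ∀ ℓ : ℕ, ∑' y : T.Ret (seqShift (-(ℓ : ℤ)) ω) (ℓ + 1) x,
      Real.exp (ε₀ * ℓ) * (T.J (seqShift (-(ℓ : ℤ)) ω) y)⁻¹
      ≤ Real.exp (ε₀ * ℓ) * (D * Real.exp (-c₂ * (ℓ + 1 : ℕ))) := by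
    intro ℓ
    rw [tsum_mul_left]
    refine mul_le_mul_of_nonneg_left ?_ (Real.exp_pos _).le
    have := hD (-(ℓ : ℤ)) (ℓ + 1) (by omega) x hx
    simpa [bR] using this
  have h3 : Summable fun ℓ : ℕ => ∑' y : T.Ret (seqShift (-(ℓ : ℤ)) ω) (ℓ + 1) x,
      Real.exp (ε₀ * ℓ) * (T.J (seqShift (-(ℓ : ℤ)) ω) y)⁻¹ :=
    Summable.of_nonneg_of_le (fun ℓ => tsum_nonneg fun y => hpos ℓ y) h2
      (summable_exp_levels hε D)
  have key : Summable fun p : Σ ℓ : ℕ, T.Ret (seqShift (-(ℓ : ℤ)) ω) (ℓ + 1) x =>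
      Real.exp (ε₀ * p.1) * (T.J (seqShift (-(p.1 : ℤ)) ω) p.2)⁻¹ :=
    (summable_sigma_of_nonneg (β := fun ℓ : ℕ => T.Ret (seqShift (-(ℓ : ℤ)) ω) (ℓ + 1) x)
      fun p => hpos p.1 p.2).2 ⟨h1, h3⟩
  exact key.congr fun p => (hterm p).symm

theorem summable_fib_wv {ω : ℤ → Ω₀} (hD : T.TowerTail D c₂ ω) {z : M × ℕ}
    (hz : z ∈ T.tower (seqShift 1 ω)) :
    Summable fun y : T.fib ω z => (T.JF ω y)⁻¹ * wv ε₀ y.1 := by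
  obtain ⟨x, k⟩ := z
  cases k with
  | zero =>
    exact summable_fib_zero_wv hT hβ₀ hβ₁ hA hε hD
      (hT.base_eq _ ω ▸ hT.mem_tower_zero.1 hz)
  | succ ℓ =>
    have : Finite (T.fib ω (x, ℓ + 1)) := by
      rw [fib_succ hz]; infer_instance
    have := Fintype.ofFinite (T.fib ω (x, ℓ + 1))
    exact (hasSum_fintype _).summable

theorem Tame.summable_norm {ω : ℤ → Ω₀} (hD : T.TowerTail D c₂ ω) {z : M × ℕ}
    (hz : z ∈ T.tower (seqShift 1 ω)) {A : ℝ} {g : M × ℕ → E} (hg : T.Tame ε₀ ω A g) :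
    Summable fun y : T.fib ω z => ‖(T.JF ω y)⁻¹ • g y‖ := by
  refine Summable.of_nonneg_of_le (fun _ => norm_nonneg _) (fun y => ?_)
    ((summable_fib_wv hT hβ₀ hβ₁ hA hε hD hz).mul_left A)
  have hJ := (inv_pos.2 (hT.JF_pos y.2.1)).le
  rw [norm_smul, Real.norm_of_nonneg hJ, mul_left_comm]
  exact mul_le_mul_of_nonneg_left (hg y y.2.1) hJ

theorem Tame.summable [CompleteSpace E] {ω : ℤ → Ω₀} (hD : T.TowerTail D c₂ ω) {z : M × ℕ}
    (hz : z ∈ T.tower (seqShift 1 ω)) {A : ℝ} {g : M × ℕ → E} (hg : T.Tame ε₀ ω A g) :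
    Summable fun y : T.fib ω z => (T.JF ω y)⁻¹ • g y :=
  (hg.summable_norm hT hβ₀ hβ₁ hA hε hD hz).of_norm

/-- The transfer operator at a point of the base, as a sum over the levels. -/
theorem Tame.tr_zero [CompleteSpace E] {ω : ℤ → Ω₀} (hD : T.TowerTail D c₂ ω) {x : M}
    (hx : x ∈ T.base ω) {A : ℝ} {g : M × ℕ → E} (hg : T.Tame ε₀ ω A g) :
    T.tr ω g (x, 0)
      = ∑' ℓ : ℕ, T.bR (seqShift (-(ℓ : ℤ)) ω) (ℓ + 1) (fun y => g (y, ℓ)) x := by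
  have hs := hg.summable hT hβ₀ hβ₁ hA hε hD
    (hT.mem_tower_zero.2 (hT.base_eq ω (seqShift 1 ω) ▸ hx))
  rw [tr, ← (T.fibZeroEquiv ω x).tsum_eq]
  rw [← (T.fibZeroEquiv ω x).summable_iff] at hs
  refine (hs.tsum_sigma).trans (tsum_congr fun ℓ => tsum_congr fun y => ?_)
  change (T.JF ω (y.1, ℓ))⁻¹ • g (y.1, ℓ) = _
  rw [JF_of_eq y.2.2.1]

theorem norm_tr_le [CompleteSpace E] {ω : ℤ → Ω₀} (hD : T.TowerTail D c₂ ω) {z : M × ℕ}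
    (hz : z ∈ T.tower (seqShift 1 ω)) {A A' : ℝ} {g : M × ℕ → E} {h : M × ℕ → ℝ}
    (hg : T.Tame ε₀ ω A g) (hh : T.Tame ε₀ ω A' h) (hle : ∀ y ∈ T.fib ω z, ‖g y‖ ≤ h y) :
    ‖T.tr ω g z‖ ≤ T.tr ω h z := by
  refine (norm_tsum_le_tsum_norm (hg.summable_norm hT hβ₀ hβ₁ hA hε hD hz)).trans ?_
  refine Summable.tsum_le_tsum (fun y => ?_) (hg.summable_norm hT hβ₀ hβ₁ hA hε hD hz)
    (hh.summable hT hβ₀ hβ₁ hA hε hD hz)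
  have hJ := (inv_pos.2 (hT.JF_pos y.2.1)).le
  rw [norm_smul, Real.norm_of_nonneg hJ]
  exact mul_le_mul_of_nonneg_left (hle y y.2) hJ

theorem tr_wv_zero_le {ω : ℤ → Ω₀} (hD : T.TowerTail D c₂ ω) {x : M} (hx : x ∈ T.base ω) :
    T.tr ω (wv ε₀) (x, 0) ≤ levelSum ε₀ c₂ D := by
  have h1 : ∀ ℓ : ℕ, T.bR (seqShift (-(ℓ : ℤ)) ω) (ℓ + 1) (fun y => wv ε₀ (y, ℓ)) x
      = Real.exp (ε₀ * ℓ) * T.bR (seqShift (-(ℓ : ℤ)) ω) (ℓ + 1) (fun _ => (1 : ℝ)) x := by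
    intro ℓ
    rw [bR, bR, ← tsum_mul_left]
    exact tsum_congr fun y => by simp [wv, mul_comm]
  rw [(tame_wv ε₀ ω).tr_zero hT hβ₀ hβ₁ hA hε hD hx, levelSum]
  have h2 : ∀ ℓ : ℕ, Real.exp (ε₀ * ℓ) * T.bR (seqShift (-(ℓ : ℤ)) ω) (ℓ + 1)
      (fun _ => (1 : ℝ)) x ≤ Real.exp (ε₀ * ℓ) * (D * Real.exp (-c₂ * (ℓ + 1 : ℕ))) :=
    fun ℓ => mul_le_mul_of_nonneg_left (hD _ _ (by omega) x hx) (Real.exp_pos _).le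
  refine (tsum_congr h1).trans_le (Summable.tsum_le_tsum h2 ?_ (summable_exp_levels hε D))
  refine Summable.of_nonneg_of_le (fun ℓ => mul_nonneg (Real.exp_pos _).le
    (tsum_nonneg fun y => ?_)) h2 (summable_exp_levels hε D)
  exact smul_nonneg (inv_nonneg.2 (hT.J_pos _ _ y.2.1).le) zero_le_one

end sums

end

end RandomTower

/-! ### The cone of regular densities and the Lasota–Yorke inequality for one step. -/

namespace RandomTower

section

variable {Ω₀ M : Type*} [MeasurableSpace Ω₀] [MeasurableSpace M] {T : RandomTower Ω₀ M} {β : ℝ}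

/-- The functions `h` with `h z ≤ h z' e^{K d(z, z')}` for comparable points of a common cylinder
of order `j`. -/
def Cone (T : RandomTower Ω₀ M) (β K : ℝ) (j : ℕ) (ω : ℤ → Ω₀) (h : M × ℕ → ℝ) : Prop :=
  ∀ z ∈ T.tower ω, ∀ z' ∈ T.tower ω, T.Comparable ω z z' → T.SameCylinder ω j z z' →
    h z ≤ h z' * Real.exp (K * T.sepDist β ω z z')

theorem Cone.mono {K : ℝ} {j k : ℕ} (hjk : j ≤ k) {ω : ℤ → Ω₀} {h : M × ℕ → ℝ}
    (hh : T.Cone β K j ω h) : T.Cone β K k ω h :=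
  fun z hz z' hz' hc hs => hh z hz z' hz' hc (hs.mono hjk)

/-- The functions `g` with `|g z - g z'| ≤ B h(z) d(z, z')` on each atom. -/
def DomLip (T : RandomTower Ω₀ M) (β : ℝ) (ω : ℤ → Ω₀) (h : M × ℕ → ℝ) (B : ℝ)
    (g : M × ℕ → ℂ) : Prop :=
  ∀ z ∈ T.tower ω, ∀ z' ∈ T.tower ω, T.SameAtom ω z z' →
    ‖g z - g z'‖ ≤ B * h z * T.sepDist β ω z z'

/-- The twisted transfer operator. -/
noncomputable def tw (T : RandomTower Ω₀ M) (φ : (ℤ → Ω₀) → M × ℕ → ℝ) (t : ℝ) (ω : ℤ → Ω₀)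
    (g : M × ℕ → ℂ) : M × ℕ → ℂ :=
  T.tr ω fun y => Complex.exp (Complex.I * t * (φ ω y : ℂ)) * g y

theorem norm_exp_twist (t s : ℝ) : ‖Complex.exp (Complex.I * t * (s : ℂ))‖ = 1 := by
  rw [Complex.norm_exp]
  simp

theorem norm_exp_twist_sub_le (t s s' : ℝ) :
    ‖Complex.exp (Complex.I * t * (s : ℂ)) - Complex.exp (Complex.I * t * (s' : ℂ))‖
      ≤ |t| * |s - s'| := by
  have h1 : Complex.exp (Complex.I * t * (s : ℂ)) - Complex.exp (Complex.I * t * (s' : ℂ))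
      = Complex.exp (Complex.I * t * (s' : ℂ))
        * (Complex.exp (Complex.I * ((t * (s - s') : ℝ) : ℂ)) - 1) := by
    rw [mul_sub, ← Complex.exp_add, mul_one]
    congr 2
    push_cast; ring
  rw [h1, norm_mul, norm_exp_twist, one_mul, ← abs_mul]
  exact Real.norm_exp_I_mul_ofReal_sub_one_le

section onestep

variable (hT : T.IsYoungTower β) (hβ₀ : 0 < β) (hβ₁ : β < 1) {A₁ : ℝ}
  (hA : T.DistortionConst β A₁) {ε₀ c₂ D : ℝ} (hε : ε₀ < c₂)

include hT hβ₀ hA in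
theorem inv_JF_le {ω : ℤ → Ω₀} {z z' y y' : M × ℕ} (hy : y ∈ T.fib ω z)
    (hy' : y' ∈ T.fib ω z') (h : T.SameAtom ω y y') :
    (T.JF ω y)⁻¹ ≤ (T.JF ω y')⁻¹ * Real.exp (A₁ * T.sepDist β (seqShift 1 ω) z z') := by
  have h1 := hT.abs_JF_div_sub_one_le hβ₀ hA hy' hy h.symm
  rw [sepDist_comm] at h1
  have hp := hT.JF_pos hy.1
  have hp' := hT.JF_pos hy'.1
  have h2 : T.JF ω y' / T.JF ω y ≤ Real.exp (A₁ * T.sepDist β (seqShift 1 ω) z z') := by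
    have := Real.add_one_le_exp (A₁ * T.sepDist β (seqShift 1 ω) z z')
    have := (abs_le.1 h1).2
    linarith
  rw [div_eq_mul_inv] at h2
  calc (T.JF ω y)⁻¹ = (T.JF ω y')⁻¹ * (T.JF ω y' * (T.JF ω y)⁻¹) := by
        field_simp
    _ ≤ _ := mul_le_mul_of_nonneg_left h2 (inv_pos.2 hp').le

include hT hβ₀ hβ₁ hA hε

/-- Matched preimages are closer by the factor `β`, and the distortion adds `A₁ d`; the constant `K
= A₁/(1-β)` solves `A₁ + β K = K`. The order drops by one because preimages in a common atom, with
images in a common cylinder of order `j`, lie in a common cylinder of order `j + 1`. -/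
theorem Cone.tr {ω : ℤ → Ω₀} (hD : T.TowerTail D c₂ ω) {j : ℕ} {h : M × ℕ → ℝ} {A : ℝ}
    (ht : T.Tame ε₀ ω A h) (hpos : ∀ y ∈ T.tower ω, 0 ≤ h y)
    (hh : T.Cone β (A₁ / (1 - β)) (j + 1) ω h) :
    T.Cone β (A₁ / (1 - β)) j (seqShift 1 ω) (T.tr ω h) := by
  intro z hz z' hz' hc hs
  set d := T.sepDist β (seqShift 1 ω) z z' with hd
  have hs' := ht.summable hT hβ₀ hβ₁ hA hε hD hz'
  unfold RandomTower.tr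
  rw [← (hT.fibEquiv hz hz' hc).tsum_eq, ← tsum_mul_right]
  rw [← (hT.fibEquiv hz hz' hc).summable_iff] at hs'
  refine Summable.tsum_le_tsum (fun y => ?_) (ht.summable hT hβ₀ hβ₁ hA hε hD hz)
    (hs'.mul_right _)
  have hsa := hT.fibEquiv_sameAtom hz hz' hc y
  set y' := hT.fibEquiv hz hz' hc y
  have h1 := inv_JF_le hT hβ₀ hA y.2 y'.2 hsa
  have h2 := hh y y.2.1 y' y'.2.1 (Or.inr hsa)
    (sameCylinder_succ.2 ⟨hsa, by rw [y.2.2, y'.2.2]; exact hs⟩)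
  rw [sepDist_fib y.2 y'.2 hsa] at h2
  rw [← hd] at h1 h2
  simp only [smul_eq_mul]
  have hJ := (inv_pos.2 (hT.JF_pos y.2.1)).le
  have hJ' := (inv_pos.2 (hT.JF_pos y'.2.1)).le
  have hh0 := hpos y' y'.2.1
  calc (T.JF ω y)⁻¹ * h y
      ≤ ((T.JF ω y')⁻¹ * Real.exp (A₁ * d)) * (h y' * Real.exp (A₁ / (1 - β) * (β * d))) :=
        mul_le_mul h1 h2 (hpos y y.2.1) (by positivity)
    _ = (T.JF ω y')⁻¹ * h y' * Real.exp (A₁ * d + A₁ / (1 - β) * (β * d)) := by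
        rw [Real.exp_add]; ring
    _ = (T.JF ω y')⁻¹ * h y' * Real.exp (A₁ / (1 - β) * d) := by
        congr 2
        have : 1 - β ≠ 0 := by linarith
        field_simp
        ring

theorem norm_tw_le {ω : ℤ → Ω₀} (hD : T.TowerTail D c₂ ω) {z : M × ℕ}
    (hz : z ∈ T.tower (seqShift 1 ω)) {A A' : ℝ} {g : M × ℕ → ℂ} {h : M × ℕ → ℝ}
    (φ : (ℤ → Ω₀) → M × ℕ → ℝ) (t : ℝ)
    (hg : T.Tame ε₀ ω A g) (hh : T.Tame ε₀ ω A' h) (hle : ∀ y ∈ T.fib ω z, ‖g y‖ ≤ h y) :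
    ‖T.tw φ t ω g z‖ ≤ T.tr ω h z := by
  refine norm_tr_le hT hβ₀ hβ₁ hA hε hD hz (A := A) (fun y hy => ?_) hh fun y hy => ?_
  · rw [norm_mul, norm_exp_twist, one_mul]; exact hg y hy
  · rw [norm_mul, norm_exp_twist, one_mul]; exact hle y hy

/-- The Lasota--Yorke inequality for one step. -/
theorem DomLip.tw {ω : ℤ → Ω₀} (hD : T.TowerTail D c₂ ω) {φ : (ℤ → Ω₀) → M × ℕ → ℝ} {C₂ : ℝ}
    (hC₂ : 0 ≤ C₂) (hφ : ∀ z ∈ T.tower ω, ∀ z' ∈ T.tower ω,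
      |φ ω z - φ ω z'| ≤ C₂ * T.sepDist β ω z z') (t : ℝ)
    {h : M × ℕ → ℝ} {A' : ℝ} (ht : T.Tame ε₀ ω A' h) (hpos : ∀ y ∈ T.tower ω, 0 ≤ h y)
    (hh : T.Cone β (A₁ / (1 - β)) 1 ω h) {g : M × ℕ → ℂ} {A B : ℝ} (hA0 : 0 ≤ A)
    (hgA : ∀ y ∈ T.tower ω, ‖g y‖ ≤ A * h y) (hgB : T.DomLip β ω h B g)
    {z z' : M × ℕ} (hz : z ∈ T.tower (seqShift 1 ω)) (hz' : z' ∈ T.tower (seqShift 1 ω))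
    (hc : T.Comparable (seqShift 1 ω) z z') :
    ‖T.tw φ t ω g z - T.tw φ t ω g z'‖
      ≤ (β * B + A * (|t| * C₂ + Real.exp (A₁ / (1 - β)) * A₁)) * T.tr ω h z
        * T.sepDist β (seqShift 1 ω) z z' := by
  set d := T.sepDist β (seqShift 1 ω) z z' with hd
  set K := A₁ / (1 - β) with hK
  have hK0 : 0 ≤ K := div_nonneg hA.1.le (by linarith)
  have hd0 : 0 ≤ d := T.sepDist_nonneg hβ₀.le _ _ _
  have hdβ : d ≤ β := sepDist_le hβ₀ hβ₁ _ _ _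
  let G : M × ℕ → ℂ := fun y => Complex.exp (Complex.I * t * (φ ω y : ℂ)) * g y
  have hG : ∀ y, ‖G y‖ = ‖g y‖ := fun y => by
    simp only [G]; rw [norm_mul, norm_exp_twist, one_mul]
  have hGt : T.Tame ε₀ ω (A * A') G := fun y hy => by
    rw [hG]
    refine (hgA y hy).trans ?_
    have := ht y hy
    rw [Real.norm_of_nonneg (hpos y hy)] at this
    rw [mul_assoc]
    exact mul_le_mul_of_nonneg_left this hA0
  have hs := hGt.summable hT hβ₀ hβ₁ hA hε hD hz
  have hs' := hGt.summable hT hβ₀ hβ₁ hA hε hD hz'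
  have hsh := (ht.summable hT hβ₀ hβ₁ hA hε hD hz)
  rw [← (hT.fibEquiv hz hz' hc).summable_iff] at hs'
  have key : T.tw φ t ω g z - T.tw φ t ω g z' = ∑' y : T.fib ω z, ((T.JF ω y)⁻¹ • G y -
      (T.JF ω (hT.fibEquiv hz hz' hc y))⁻¹ • G (hT.fibEquiv hz hz' hc y)) := by
    unfold RandomTower.tw RandomTower.tr
    rw [← (hT.fibEquiv hz hz' hc).tsum_eq (fun y : T.fib ω z' => (T.JF ω y)⁻¹ •
      (Complex.exp (Complex.I * t * (φ ω y : ℂ)) * g y))]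
    exact (hs.tsum_sub hs').symm
  have hsum := (hsh.mul_left ((β * B + A * (|t| * C₂ + Real.exp K * A₁)) * d)).hasSum
  rw [key]
  refine (tsum_of_norm_bounded hsum fun y => ?_).trans (le_of_eq ?_)
  · have hsa := hT.fibEquiv_sameAtom hz hz' hc y
    set y' := hT.fibEquiv hz hz' hc y
    have hJ := hT.JF_pos y.2.1
    have hJ' := hT.JF_pos y'.2.1
    have hdy : T.sepDist β ω y y' = β * d := sepDist_fib y.2 y'.2 hsa
    have hy0 := hpos y y.2.1
    have e1 : ‖Complex.exp (Complex.I * t * (φ ω y : ℂ)) -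
        Complex.exp (Complex.I * t * (φ ω y' : ℂ))‖ ≤ |t| * (C₂ * d) := by
      refine (norm_exp_twist_sub_le _ _ _).trans (mul_le_mul_of_nonneg_left ?_ (abs_nonneg t))
      refine (hφ y y.2.1 y' y'.2.1).trans (mul_le_mul_of_nonneg_left ?_ hC₂)
      rw [hdy]
      exact mul_le_of_le_one_left hd0 hβ₁.le
    have e2 : ‖g y - g y'‖ ≤ B * h y * (β * d) := by
      have := hgB y y.2.1 y' y'.2.1 hsa
      rwa [hdy] at this
    have e3 : |1 - T.JF ω y / T.JF ω y'| ≤ A₁ * d := by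
      rw [abs_sub_comm]
      exact hT.abs_JF_div_sub_one_le hβ₀ hA y.2 y'.2 hsa
    -- The bound at `y'` is rewritten in terms of `h y`: the cone of order `1` compares the two
    -- points of the atom.
    have e4 : ‖g y'‖ ≤ A * (h y * Real.exp K) := by
      refine (hgA y' y'.2.1).trans (mul_le_mul_of_nonneg_left ?_ hA0)
      refine (hh y' y'.2.1 y y.2.1 (Or.inr hsa.symm) (sameCylinder_succ.2
        ⟨hsa.symm, sameCylinder_zero _ _ _⟩)).trans (mul_le_mul_of_nonneg_left ?_ hy0)
      refine Real.exp_le_exp.2 (mul_le_of_le_one_right hK0 ?_)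
      exact (sepDist_le hβ₀ hβ₁ _ _ _).trans hβ₁.le
    -- The difference of two matched terms splits into the variation of the phase, of `g`, and of
    -- the Jacobian. Only the variation of `g` involves `B`, with the factor `β`.
    have e5 : (T.JF ω y)⁻¹ • G y - (T.JF ω y')⁻¹ • G y' = (T.JF ω y)⁻¹ •
        ((Complex.exp (Complex.I * t * (φ ω y : ℂ)) -
          Complex.exp (Complex.I * t * (φ ω y' : ℂ))) * g y
        + Complex.exp (Complex.I * t * (φ ω y' : ℂ)) * (g y - g y')
        + (1 - T.JF ω y / T.JF ω y') • G y') := by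
      have hJc : (T.JF ω y : ℂ) ≠ 0 := by exact_mod_cast hJ.ne'
      have hJc' : (T.JF ω y' : ℂ) ≠ 0 := by exact_mod_cast hJ'.ne'
      simp only [G, Complex.real_smul]
      push_cast
      field_simp
      ring
    rw [e5, norm_smul, Real.norm_of_nonneg (inv_pos.2 hJ).le, smul_eq_mul, mul_left_comm]
    refine mul_le_mul_of_nonneg_left ?_ (inv_pos.2 hJ).le
    have f1 : ‖(Complex.exp (Complex.I * t * (φ ω y : ℂ)) -
          Complex.exp (Complex.I * t * (φ ω y' : ℂ))) * g y‖ ≤ |t| * (C₂ * d) * (A * h y) := by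
      rw [norm_mul]
      exact mul_le_mul e1 (hgA y y.2.1) (norm_nonneg _) (by positivity)
    have f2 : ‖Complex.exp (Complex.I * t * (φ ω y' : ℂ)) * (g y - g y')‖
        ≤ B * h y * (β * d) := by
      rw [norm_mul, norm_exp_twist, one_mul]; exact e2
    have f3 : ‖(1 - T.JF ω y / T.JF ω y') • G y'‖ ≤ A₁ * d * (A * (h y * Real.exp K)) := by
      rw [norm_smul, hG]
      exact mul_le_mul e3 e4 (norm_nonneg _) (mul_nonneg hA.1.le hd0)
    refine (norm_add₃_le.trans (add_le_add (add_le_add f1 f2) f3)).trans (le_of_eq ?_)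
    ring
  · rw [tsum_mul_left]
    unfold RandomTower.tr
    ring

end onestep

end

end RandomTower

/-! ### Measurability on the tower by means of the codes of cylinders. -/

@[fun_prop]
theorem measurable_seqShift {Ω₀ : Type*} [MeasurableSpace Ω₀] (k : ℤ) :
    Measurable (seqShift k : (ℤ → Ω₀) → ℤ → Ω₀) :=
  measurable_pi_lambda _ fun j => measurable_pi_apply (j + k)

namespace RandomTower

section

variable {Ω₀ M : Type*} [MeasurableSpace Ω₀] [MeasurableSpace M] {T : RandomTower Ω₀ M} {β : ℝ}

theorem IsYoungTower.measurable_orbit (hT : T.IsYoungTower β) (n : ℕ) :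
    Measurable fun p : (ℤ → Ω₀) × M => T.orbit p.1 n p.2 := by
  induction n with
  | zero => exact measurable_snd
  | succ n ih =>
    exact hT.measurable_f.comp
      (((measurable_pi_apply (n : ℤ)).comp measurable_fst).prodMk ih)

theorem IsYoungTower.measurableSet_base' (hT : T.IsYoungTower β) :
    MeasurableSet {p : (ℤ → Ω₀) × M | p.2 ∈ T.base p.1} := by
  have : {p : (ℤ → Ω₀) × M | p.2 ∈ T.base p.1} = ⋃ i, {p | p.2 ∈ T.Λ p.1 i} := by
    ext p; simp [base]
  rw [this]
  exact MeasurableSet.iUnion hT.measurable_Λ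

theorem IsYoungTower.measurable_ret (hT : T.IsYoungTower β) :
    Measurable fun p : (ℤ → Ω₀) × M => T.ret p.1 p.2 := by
  have hpos : ∀ n : ℕ, n ≠ 0 → {p : (ℤ → Ω₀) × M | T.ret p.1 p.2 = n}
      = ⋃ i, {p | p.2 ∈ T.Λ p.1 i} ∩ {p | T.R p.1 i = n} := by
    intro n hn
    ext p
    simp only [mem_ofPred_eq, mem_iUnion, mem_inter_iff]
    constructor
    · intro h
      by_cases hp : ∃ i, p.2 ∈ T.Λ p.1 i
      · obtain ⟨i, hi⟩ := hp
        exact ⟨i, hi, by rw [← hT.ret_eq hi, h]⟩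
      · exfalso
        apply hn
        rw [← h, ret]
        have : {n | ∃ i, p.2 ∈ T.Λ p.1 i ∧ T.R p.1 i = n} = ∅ := by
          ext m; simp only [mem_ofPred_eq, mem_empty_iff_false, iff_false]
          rintro ⟨i, hi, -⟩
          exact hp ⟨i, hi⟩
        rw [this, Nat.sInf_empty]
    · rintro ⟨i, hi, h⟩
      rw [hT.ret_eq hi, h]
  have hm : ∀ n : ℕ, n ≠ 0 → MeasurableSet {p : (ℤ → Ω₀) × M | T.ret p.1 p.2 = n} := by
    intro n hn
    rw [hpos n hn]
    refine MeasurableSet.iUnion fun i => (hT.measurable_Λ i).inter ?_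
    exact ((hT.measurable_R i).comp measurable_fst) (measurableSet_singleton n)
  refine measurable_to_countable' fun n => ?_
  -- `0` is the value of `ret` off the base, where the infimum is over the empty set; its level set
  -- is the complement of the other ones.
  by_cases hn : n = 0
  · subst hn
    have : (fun p : (ℤ → Ω₀) × M => T.ret p.1 p.2) ⁻¹' {0}
        = (⋃ n : {n : ℕ // n ≠ 0}, {p | T.ret p.1 p.2 = n})ᶜ := by
      ext p
      simp only [mem_preimage, mem_singleton_iff, mem_compl_iff, mem_iUnion, mem_ofPred_eq,
        Subtype.exists, exists_prop, not_exists, not_and]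
      exact ⟨fun h n hn hc => hn (hc.symm.trans h), fun h => by_contra fun hc => h _ hc rfl⟩
    rw [this]
    exact (MeasurableSet.iUnion fun n : {n : ℕ // n ≠ 0} => hm n n.2).compl
  · exact hm n hn

theorem measurable_of_levels {Ω X Y : Type*} [MeasurableSpace Ω] [MeasurableSpace X]
    [MeasurableSpace Y] {f : Ω × (X × ℕ) → Y} (h : ∀ ℓ : ℕ, Measurable fun p : Ω × X =>
      f (p.1, p.2, ℓ)) : Measurable f := by
  have h1 : Measurable fun q : (Ω × X) × ℕ => f (q.1.1, q.1.2, q.2) :=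
    measurable_from_prod_countable_left h
  exact h1.comp (f := fun p : Ω × (X × ℕ) => ((p.1, p.2.1), p.2.2)) (by fun_prop)

theorem measurableSet_of_levels {Ω X : Type*} [MeasurableSpace Ω] [MeasurableSpace X]
    {s : Set (Ω × (X × ℕ))} (h : ∀ ℓ : ℕ, MeasurableSet {p : Ω × X | (p.1, p.2, ℓ) ∈ s}) :
    MeasurableSet s :=
  measurableSet_setOfPred.2 (measurable_of_levels (f := fun p => p ∈ s)
    fun ℓ => measurableSet_setOfPred.1 (h ℓ))

theorem measurable_shift_level (k : ℤ) :
    Measurable fun p : (ℤ → Ω₀) × M => (seqShift k p.1, p.2) := by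
  fun_prop

theorem IsYoungTower.measurableSet_level (hT : T.IsYoungTower β) (ℓ : ℕ) :
    MeasurableSet {p : (ℤ → Ω₀) × M | (p.2, ℓ) ∈ T.tower p.1} := by
  have h := measurable_shift_level (Ω₀ := Ω₀) (M := M) (-(ℓ : ℤ))
  exact (h hT.measurableSet_base').inter
    ((hT.measurable_ret.comp h) (measurableSet_Ici (a := ℓ + 1)))

theorem IsYoungTower.measurableSet_tower' (hT : T.IsYoungTower β) :
    MeasurableSet {p : (ℤ → Ω₀) × (M × ℕ) | p.2 ∈ T.tower p.1} :=
  measurableSet_of_levels fun ℓ => hT.measurableSet_level ℓ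

theorem IsYoungTower.measurableSet_tower (hT : T.IsYoungTower β) (ω : ℤ → Ω₀) :
    MeasurableSet (T.tower ω) := measurable_prodMk_left hT.measurableSet_tower'

theorem IsYoungTower.measurable_F (hT : T.IsYoungTower β) :
    Measurable fun p : (ℤ → Ω₀) × (M × ℕ) => T.F p.1 p.2 := by
  refine measurable_of_levels fun ℓ => ?_
  have h := measurable_shift_level (Ω₀ := Ω₀) (M := M) (-(ℓ : ℤ))
  refine Measurable.ite ?_ (by fun_prop) ?_
  · exact (hT.measurable_ret.comp h) (measurableSet_Ioi (a := ℓ + 1))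
  · exact ((hT.measurable_orbit (ℓ + 1)).comp h).prodMk measurable_const

theorem IsYoungTower.measurable_Fiter (hT : T.IsYoungTower β) (n : ℕ) :
    Measurable fun p : (ℤ → Ω₀) × (M × ℕ) => T.Fiter p.1 n p.2 := by
  induction n with
  | zero => exact measurable_snd
  | succ n ih =>
    exact hT.measurable_F.comp (((measurable_seqShift (n : ℤ)).comp measurable_fst).prodMk ih)

/-- The index of the atom of a point of the tower. -/
noncomputable def idx (T : RandomTower Ω₀ M) (ω : ℤ → Ω₀) (z : M × ℕ) : ℕ :=
  sInf {i | z.1 ∈ T.Λ (seqShift (-(z.2 : ℤ)) ω) i}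

theorem IsYoungTower.idx_eq (hT : T.IsYoungTower β) {ω : ℤ → Ω₀} {z : M × ℕ} {i : ℕ}
    (hi : z.1 ∈ T.Λ (seqShift (-(z.2 : ℤ)) ω) i) : T.idx ω z = i := by
  have : {j | z.1 ∈ T.Λ (seqShift (-(z.2 : ℤ)) ω) j} = {i} := by
    ext j
    exact ⟨fun hj => hT.atom_unique hj hi, fun h => h ▸ hi⟩
  rw [idx, this, csInf_singleton]

theorem IsYoungTower.measurable_idx (hT : T.IsYoungTower β) :
    Measurable fun p : (ℤ → Ω₀) × (M × ℕ) => T.idx p.1 p.2 := by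
  have hΛ : ∀ i, MeasurableSet {p : (ℤ → Ω₀) × (M × ℕ) |
      p.2.1 ∈ T.Λ (seqShift (-(p.2.2 : ℤ)) p.1) i} := fun i =>
    measurableSet_of_levels fun ℓ =>
      measurable_shift_level (Ω₀ := Ω₀) (M := M) (-(ℓ : ℤ)) (hT.measurable_Λ i)
  have hm : ∀ n : ℕ, n ≠ 0 → (fun p : (ℤ → Ω₀) × (M × ℕ) => T.idx p.1 p.2) ⁻¹' {n}
      = {p | p.2.1 ∈ T.Λ (seqShift (-(p.2.2 : ℤ)) p.1) n} := by
    intro n hn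
    ext p
    constructor
    · intro h
      have h' : T.idx p.1 p.2 = n := h
      have hne : {i | p.2.1 ∈ T.Λ (seqShift (-(p.2.2 : ℤ)) p.1) i}.Nonempty := by
        by_contra hc
        rw [not_nonempty_iff_eq_empty] at hc
        rw [idx, hc, Nat.sInf_empty] at h'
        exact hn h'.symm
      have h2 : p.2.1 ∈ T.Λ (seqShift (-(p.2.2 : ℤ)) p.1) (T.idx p.1 p.2) := Nat.sInf_mem hne
      rwa [h'] at h2
    · intro h
      exact hT.idx_eq h
  refine measurable_to_countable' fun n => ?_
  by_cases hn : n = 0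
  · subst hn
    have : (fun p : (ℤ → Ω₀) × (M × ℕ) => T.idx p.1 p.2) ⁻¹' {0}
        = (⋃ n : {n : ℕ // n ≠ 0}, (fun p : (ℤ → Ω₀) × (M × ℕ) => T.idx p.1 p.2) ⁻¹' {n.1})ᶜ := by
      ext p
      simp only [mem_preimage, mem_singleton_iff, mem_compl_iff, mem_iUnion,
        Subtype.exists, exists_prop, not_exists, not_and]
      exact ⟨fun h n hn hc => hn (hc.symm.trans h), fun h => by_contra fun hc => h _ hc rfl⟩
    rw [this]
    refine (MeasurableSet.iUnion fun n : {n : ℕ // n ≠ 0} => ?_).compl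
    rw [hm n n.2]
    exact hΛ n
  · rw [hm n hn]
    exact hΛ n

theorem IsYoungTower.sameAtom_iff (hT : T.IsYoungTower β) {ω : ℤ → Ω₀} {z z' : M × ℕ}
    (hz : z ∈ T.tower ω) (hz' : z' ∈ T.tower ω) :
    T.SameAtom ω z z' ↔ (z.2, T.idx ω z) = (z'.2, T.idx ω z') := by
  obtain ⟨x, ℓ⟩ := z
  obtain ⟨x', ℓ'⟩ := z'
  constructor
  · rintro ⟨h, i, hi, hi'⟩
    dsimp only at h
    subst h
    rw [hT.idx_eq hi, hT.idx_eq (z := (x', ℓ)) hi']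
  · intro h
    obtain ⟨h, h'⟩ := Prod.mk.inj h
    dsimp only at h
    subst h
    obtain ⟨i, hi⟩ := mem_base.1 hz.1
    obtain ⟨j, hj⟩ := mem_base.1 hz'.1
    rw [hT.idx_eq hi, hT.idx_eq hj] at h'
    subst h'
    exact ⟨rfl, i, hi, hj⟩

/-- The codes of the cylinders of order `n`. -/
noncomputable def code (T : RandomTower Ω₀ M) (n : ℕ) (ω : ℤ → Ω₀) (z : M × ℕ) :
    Fin n → ℕ × ℕ :=
  fun k => ((T.Fiter ω k z).2, T.idx (seqShift (k : ℤ) ω) (T.Fiter ω k z))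

theorem IsYoungTower.measurable_code (hT : T.IsYoungTower β) (n : ℕ) :
    Measurable fun p : (ℤ → Ω₀) × (M × ℕ) => T.code n p.1 p.2 := by
  refine measurable_pi_lambda _ fun k => ?_
  have h := hT.measurable_Fiter (k : ℕ)
  exact (measurable_snd.comp h).prodMk (hT.measurable_idx.comp
    (((measurable_seqShift ((k : ℕ) : ℤ)).comp measurable_fst).prodMk h))

theorem IsYoungTower.sameCylinder_iff (hT : T.IsYoungTower β) {ω : ℤ → Ω₀} {z z' : M × ℕ}
    (hz : z ∈ T.tower ω) (hz' : z' ∈ T.tower ω) (n : ℕ) :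
    T.SameCylinder ω n z z' ↔ T.code n ω z = T.code n ω z' := by
  constructor
  · intro h
    funext k
    exact (hT.sameAtom_iff (hT.mapsTo_Fiter hz k) (hT.mapsTo_Fiter hz' k)).1 (h k k.2)
  · intro h k hk
    exact (hT.sameAtom_iff (hT.mapsTo_Fiter hz k) (hT.mapsTo_Fiter hz' k)).2 (congrFun h ⟨k, hk⟩)

/-- Functions that are approximated by their values on cylinders are pointwise limits of functions
of the codes. -/
theorem IsYoungTower.exists_code_tendsto (hT : T.IsYoungTower β) (hβ₀ : 0 < β) (hβ₁ : β < 1)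
    (ω : ℤ → Ω₀) {E : Type*} [NormedAddCommGroup E] {u : M × ℕ → E}
    (h : ∀ z ∈ T.tower ω, ∃ B, ∀ j, ∀ z' ∈ T.tower ω, T.SameCylinder ω (j + 1) z z' →
      ‖u z - u z'‖ ≤ B * β ^ j) :
    ∃ r : ∀ n : ℕ, (Fin n → ℕ × ℕ) → E, (∀ n c, r n c = 0 ∨ ∃ z ∈ T.tower ω, r n c = u z) ∧
      ∀ z ∈ T.tower ω, Tendsto (fun n => r n (T.code n ω z)) atTop (𝓝 (u z)) := by
  classical
  refine ⟨fun n c => if hc : ∃ z' ∈ T.tower ω, T.code n ω z' = c then u hc.choose else 0,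
    fun n c => ?_, fun z hz => ?_⟩
  · dsimp only
    split_ifs with hc
    · exact Or.inr ⟨_, hc.choose_spec.1, rfl⟩
    · exact Or.inl rfl
  obtain ⟨B, hB⟩ := h z hz
  rw [← tendsto_add_atTop_iff_nat 1, tendsto_iff_norm_sub_tendsto_zero]
  have hlim : Tendsto (fun n : ℕ => B * β ^ n) atTop (𝓝 0) := by
    simpa using (tendsto_pow_atTop_nhds_zero_of_lt_one hβ₀.le hβ₁).const_mul B
  refine squeeze_zero (fun _ => norm_nonneg _) (fun n => ?_) hlim
  have hc : ∃ z' ∈ T.tower ω, T.code (n + 1) ω z' = T.code (n + 1) ω z := ⟨z, hz, rfl⟩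
  dsimp only
  rw [dif_pos hc, norm_sub_rev]
  exact hB n _ hc.choose_spec.1
    ((hT.sameCylinder_iff hz hc.choose_spec.1 (n + 1)).2 hc.choose_spec.2.symm)

/-- Functions that are locally Lipschitz on the tower are measurable. -/
theorem IsYoungTower.measurable_of_lipschitz (hT : T.IsYoungTower β) (hβ₀ : 0 < β) (hβ₁ : β < 1)
    (ω : ℤ → Ω₀) {E : Type*} [NormedAddCommGroup E] [MeasurableSpace E] [BorelSpace E]
    {u : M × ℕ → E}
    (h : ∀ z ∈ T.tower ω, ∃ B, 0 ≤ B ∧ ∀ z' ∈ T.tower ω, T.SameAtom ω z z' →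
      ‖u z - u z'‖ ≤ B * T.sepDist β ω z z') : Measurable ((T.tower ω).indicator u) := by
  obtain ⟨r, -, hr⟩ := hT.exists_code_tendsto hβ₀ hβ₁ ω (u := u) fun z hz => by
    obtain ⟨B, hB0, hB⟩ := h z hz
    refine ⟨B, fun j z' hz' hs => (hB z' hz' (sameCylinder_succ.1 hs).1).trans ?_⟩
    refine mul_le_mul_of_nonneg_left ((sepDist_le_of_sameCylinder hβ₀ hβ₁ hs).trans ?_) hB0
    exact pow_le_pow_of_le_one hβ₀.le hβ₁.le (by omega)
  refine measurable_of_tendsto_metrizable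
    (f := fun n => (T.tower ω).indicator fun z => r n (T.code n ω z)) (fun n => ?_) ?_
  · refine Measurable.indicator ?_ (hT.measurableSet_tower ω)
    exact (Measurable.of_discrete (f := r n)).comp
      ((hT.measurable_code n).comp measurable_prodMk_left)
  · rw [tendsto_pi_nhds]
    intro z
    by_cases hz : z ∈ T.tower ω
    · simp only [indicator_of_mem hz]
      exact hr z hz
    · simp only [indicator_of_notMem hz]
      exact tendsto_const_nhds

/-- Measurability of the Jacobian is not part of the data: it comes from the distortion bound, which
makes `JF` Lipschitz on each atom. -/
theorem IsYoungTower.measurable_JF (hT : T.IsYoungTower β) (hβ₀ : 0 < β) (hβ₁ : β < 1) {A₁ : ℝ}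
    (hA : T.DistortionConst β A₁) (ω : ℤ → Ω₀) :
    Measurable ((T.tower ω).indicator (T.JF ω)) := by
  refine hT.measurable_of_lipschitz hβ₀ hβ₁ ω fun z hz => ?_
  have hJ := hT.JF_pos hz
  refine ⟨T.JF ω z * (A₁ * β⁻¹), by have := hA.1; positivity, fun z' hz' h => ?_⟩
  have h1 := hT.abs_JF_div_sub_one_le hβ₀ hA (z := T.F ω z') (z' := T.F ω z) ⟨hz', rfl⟩
    ⟨hz, rfl⟩ h.symm
  have h2 := h.symm.sepDist_eq (β := β)
  rw [sepDist_comm] at h2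
  rw [h2, norm_sub_rev, Real.norm_eq_abs]
  have h3 : T.JF ω z' - T.JF ω z = T.JF ω z * (T.JF ω z' / T.JF ω z - 1) := by
    field_simp
  rw [h3, abs_mul, abs_of_pos hJ, mul_assoc]
  refine mul_le_mul_of_nonneg_left (h1.trans (le_of_eq ?_)) hJ.le
  field_simp

end

end RandomTower

/-! ### The transfer operator preserves the integral of functions with values in `[0, ∞]`. -/

namespace RandomTower

section

variable {Ω₀ M : Type*} [MeasurableSpace Ω₀] [MeasurableSpace M] {T : RandomTower Ω₀ M} {β : ℝ}

theorem lintegral_towerMeasure (T : RandomTower Ω₀ M) (ω : ℤ → Ω₀)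
    {g : M × ℕ → ENNReal} (hg : Measurable g) :
    ∫⁻ z, g z ∂(T.towerMeasure ω) = ∑' ℓ : ℕ, ∫⁻ x in {x | (x, ℓ) ∈ T.tower ω}, g (x, ℓ)
      ∂(T.m (seqShift (-(ℓ : ℤ)) ω)) := by
  rw [towerMeasure, lintegral_sum_measure]
  refine tsum_congr fun ℓ => ?_
  rw [lintegral_map hg (by fun_prop)]
  rfl

theorem IsYoungTower.measurableSet_level_fixed (hT : T.IsYoungTower β) (ω : ℤ → Ω₀) (ℓ : ℕ) :
    MeasurableSet {x | (x, ℓ) ∈ T.tower ω} :=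
  measurable_prodMk_left (hT.measurableSet_level ℓ)

theorem IsYoungTower.ae_mem_tower (hT : T.IsYoungTower β) (ω : ℤ → Ω₀) :
    ∀ᵐ z ∂(T.towerMeasure ω), z ∈ T.tower ω := by
  refine (Measure.ae_sum_iff' (p := fun z => z ∈ T.tower ω) (hT.measurableSet_tower ω)).2
    fun ℓ => ?_
  refine (ae_map_iff (p := fun z => z ∈ T.tower ω) (by fun_prop)
    (hT.measurableSet_tower ω)).2 ?_
  exact ae_restrict_mem (hT.measurableSet_level_fixed ω ℓ)

/-- On the top level of the column over an atom the Jacobian of the tower map is `J`, so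
measurability is inherited from `JF`. -/
theorem IsYoungTower.measurable_J (hT : T.IsYoungTower β) (hβ₀ : 0 < β) (hβ₁ : β < 1) {A₁ : ℝ}
    (hA : T.DistortionConst β A₁) (ω : ℤ → Ω₀) (i : ℕ) :
    Measurable ((T.Λ ω i).indicator (T.J ω)) := by
  rcases (T.Λ ω i).eq_empty_or_nonempty with h0 | ⟨x₀, hx₀⟩
  · rw [h0, indicator_empty]; exact measurable_const
  obtain ⟨n, hn⟩ := Nat.exists_eq_succ_of_ne_zero (hT.R_pos ω i).ne'
  have h1 := (hT.measurable_JF hβ₀ hβ₁ hA (seqShift (n : ℤ) ω)).comp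
    (measurable_prodMk_right (y := n) : Measurable fun x : M => (x, n))
  have h2 : (T.Λ ω i).indicator (T.J ω) = (T.Λ ω i).indicator
      (((T.tower (seqShift (n : ℤ) ω)).indicator (T.JF (seqShift (n : ℤ) ω))) ∘
        fun x => (x, n)) := by
    refine indicator_congr fun x hx => ?_
    have hr : T.ret ω x = n + 1 := by rw [hT.ret_eq hx, hn]
    have hs : seqShift (-(n : ℤ)) (seqShift (n : ℤ) ω) = ω := by simp
    have hm : (x, n) ∈ T.tower (seqShift (n : ℤ) ω) := by
      rw [mem_tower, hs]
      exact ⟨mem_base.2 ⟨i, hx⟩, hr.ge⟩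
    simp only [Function.comp]
    rw [indicator_of_mem hm, JF_of_eq (by rw [hs, hr]), hs]
  rw [h2]
  exact h1.indicator (hT.measurableSet_Λ ω i)

/-- The sums over the preimages in the base, for functions with values in `[0, ∞]`. -/
noncomputable def bE (T : RandomTower Ω₀ M) (ω : ℤ → Ω₀) (n : ℕ) (g : M → ENNReal) (x : M) :
    ENNReal :=
  ∑' y : T.Ret ω n x, ENNReal.ofReal (T.J ω y)⁻¹ * g y

/-- On the base the sum has at most one term, at the inverse branch of the return map of the atom,
and the Jacobian identity is the change of variables for this branch. The function `H` is a
measurable substitute for the sum, equal to it on the base, which carries the measure. -/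
theorem IsYoungTower.lintegral_bE_atom (hT : T.IsYoungTower β) (hβ₀ : 0 < β) (hβ₁ : β < 1)
    {A₁ : ℝ} (hA : T.DistortionConst β A₁) (ω : ℤ → Ω₀) (n i : ℕ) {h : M → ENNReal}
    (hh : Measurable h) : ∃ H : M → ENNReal, Measurable H ∧
      (∀ x ∈ T.base ω, T.bE ω n ((T.Λ ω i).indicator h) x = H x) ∧
      ∫⁻ x, H x ∂(T.m (seqShift (n : ℤ) ω)) = ∫⁻ x in T.Λ ω i ∩ {x | T.ret ω x = n}, h x
        ∂(T.m ω) := by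
  classical
  by_cases hc : T.R ω i = n ∧ (T.Λ ω i).Nonempty
  swap
  · have he : T.Λ ω i ∩ {x | T.ret ω x = n} = ∅ := by
      ext x
      simp only [mem_inter_iff, mem_ofPred_eq, mem_empty_iff_false, iff_false]
      rintro ⟨hx, hr⟩
      exact hc ⟨by rw [← hT.ret_eq hx, hr], x, hx⟩
    refine ⟨0, measurable_const, fun x _ => ?_, by simp [he]⟩
    rw [bE, Pi.zero_apply, ENNReal.tsum_eq_zero]
    intro y
    rw [indicator_of_notMem, mul_zero]
    intro hy
    exact (he ▸ (⟨hy, y.2.2.1⟩ : y.1 ∈ T.Λ ω i ∩ {x | T.ret ω x = n}) : y.1 ∈ (∅ : Set M))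
  obtain ⟨hR, x₀, hx₀⟩ := hc
  have hinter : T.Λ ω i ∩ {x | T.ret ω x = n} = T.Λ ω i := by
    refine inter_eq_left.2 fun x hx => ?_
    rw [mem_ofPred_eq, hT.ret_eq hx, hR]
  have hb := hT.bijOn ω i ⟨x₀, hx₀⟩
  have hΛ := hT.measurableSet_Λ ω i
  have hbase := hT.measurableSet_base ω
  have : Nonempty M := ⟨x₀⟩
  rw [hR, hT.base_eq (seqShift (n : ℤ) ω) ω] at hb
  have himg := fun A hAs hAm => hT.measurable_image ω i A hAs hAm
  have hjac := fun A hAs hAm => hT.jacobian ω i A hAs hAm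
  rw [hR] at himg hjac
  let inv : M → M := Function.invFunOn (T.orbit ω n) (T.Λ ω i)
  have hinv : ∀ x ∈ T.base ω, inv x ∈ T.Λ ω i ∧ T.orbit ω n (inv x) = x := fun x hx =>
    Function.invFunOn_pos (hb.surjOn hx)
  have hinv' : ∀ y ∈ T.Λ ω i, inv (T.orbit ω n y) = y := fun y hy =>
    hb.injOn (hinv _ (hb.mapsTo hy)).1 hy (hinv _ (hb.mapsTo hy)).2
  -- The inverse branch, extended by a constant off the base. The preimage of `A` under it is
  -- essentially the image of `A ∩ Λ`, so `measurable_image` gives its measurability.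
  let k : M → M := (T.base ω).piecewise inv fun _ => x₀
  have hk : Measurable k := by
    intro A hAm
    have : k ⁻¹' A = T.orbit ω n '' (A ∩ T.Λ ω i) ∪ ((T.base ω)ᶜ ∩ {_x | x₀ ∈ A}) := by
      ext x
      by_cases hx : x ∈ T.base ω
      · simp only [k, mem_preimage, piecewise_eq_of_mem _ _ _ hx, mem_union, mem_inter_iff,
          mem_compl_iff, hx, not_true_eq_false, false_and, or_false, mem_image]
        constructor
        · intro h
          exact ⟨inv x, ⟨h, (hinv x hx).1⟩, (hinv x hx).2⟩
        · rintro ⟨y, ⟨hyA, hyΛ⟩, rfl⟩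
          rwa [hinv' y hyΛ]
      · simp only [k, mem_preimage, piecewise_eq_of_notMem _ _ _ hx, mem_union, mem_inter_iff,
          mem_compl_iff, hx, not_false_eq_true, true_and, mem_image, mem_ofPred_eq]
        constructor
        · intro h; exact Or.inr h
        · rintro (⟨y, ⟨_, hyΛ⟩, rfl⟩ | h)
          · exact absurd (hb.mapsTo hyΛ) hx
          · exact h
    rw [this]
    refine (himg _ inter_subset_right (hAm.inter hΛ)).union (hbase.compl.inter ?_)
    exact MeasurableSet.const _
  have hJm := hT.measurable_J hβ₀ hβ₁ hA ω i
  let w : M → ENNReal := fun y => ENNReal.ofReal ((T.Λ ω i).indicator (T.J ω) y)⁻¹ * h y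
  have hw : Measurable w := hJm.inv.ennreal_ofReal.mul hh
  have hkΛ : ∀ x ∈ T.base ω, k x = inv x := fun x hx => piecewise_eq_of_mem _ _ _ hx
  refine ⟨w ∘ k, hw.comp hk, fun x hx => ?_, ?_⟩
  · have hy := hinv x hx
    have hyr : T.ret ω (inv x) = n := by rw [hT.ret_eq hy.1, hR]
    rw [Function.comp_apply, hkΛ x hx, bE, tsum_eq_single
      (⟨inv x, mem_base.2 ⟨i, hy.1⟩, hyr, hy.2⟩ : T.Ret ω n x)]
    · simp only [w]
      rw [indicator_of_mem hy.1, indicator_of_mem hy.1]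
    · intro y hne
      rw [indicator_of_notMem, mul_zero]
      intro hyΛ
      exact hne (Subtype.ext (hb.injOn hyΛ hy.1 (y.2.2.2.trans hy.2.symm)))
  · rw [hinter]
    have horb : Measurable (T.orbit ω n) := (hT.measurable_orbit n).comp measurable_prodMk_left
    -- The Jacobian identity as an identity of measures: the return map sends `J m_ω`, restricted to
    -- the atom, to the reference measure at the return time.
    have hmap : T.m (seqShift (n : ℤ) ω)
        = (((T.m ω).restrict (T.Λ ω i)).withDensity
          fun y => ENNReal.ofReal ((T.Λ ω i).indicator (T.J ω) y)).map (T.orbit ω n) := by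
      ext B hB
      rw [Measure.map_apply horb hB, withDensity_apply _ (horb hB),
        Measure.restrict_restrict (horb hB)]
      have h1 := hjac (T.orbit ω n ⁻¹' B ∩ T.Λ ω i) inter_subset_right ((horb hB).inter hΛ)
      have h2 : T.orbit ω n '' (T.orbit ω n ⁻¹' B ∩ T.Λ ω i) = B ∩ T.base ω := by
        rw [inter_comm, image_inter_preimage, hb.image_eq, inter_comm]
      rw [h2] at h1
      have h3 : T.m (seqShift (n : ℤ) ω) B = T.m (seqShift (n : ℤ) ω) (B ∩ T.base ω) := by
        refine (measure_inter_conull ?_).symm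
        rw [hT.base_eq ω (seqShift (n : ℤ) ω)]
        exact hT.m_base _
      rw [h3, h1]
      refine setLIntegral_congr_fun ((horb hB).inter hΛ) fun y hy => ?_
      simp only [indicator_of_mem hy.2]
    rw [hmap, lintegral_map (hw.comp hk) horb]
    refine (lintegral_withDensity_eq_lintegral_mul _
      hJm.ennreal_ofReal ((hw.comp hk).comp horb)).trans ?_
    refine setLIntegral_congr_fun hΛ fun y hy => ?_
    simp only [Pi.mul_apply, w, Function.comp_apply]
    rw [hkΛ _ (hb.mapsTo hy), hinv' y hy, indicator_of_mem hy, ← mul_assoc,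
      ← ENNReal.ofReal_mul (hT.J_pos ω y (mem_base.2 ⟨i, hy⟩)).le,
      mul_inv_cancel₀ (hT.J_pos ω y (mem_base.2 ⟨i, hy⟩)).ne', ENNReal.ofReal_one, one_mul]

theorem IsYoungTower.lintegral_bE (hT : T.IsYoungTower β) (hβ₀ : 0 < β) (hβ₁ : β < 1)
    {A₁ : ℝ} (hA : T.DistortionConst β A₁) (ω : ℤ → Ω₀) (n : ℕ) {h : M → ENNReal}
    (hh : Measurable h) : ∃ H : M → ENNReal, Measurable H ∧
      (∀ x ∈ T.base ω, T.bE ω n h x = H x) ∧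
      ∫⁻ x, H x ∂(T.m (seqShift (n : ℤ) ω))
        = ∫⁻ x in {x | x ∈ T.base ω ∧ T.ret ω x = n}, h x ∂(T.m ω) := by
  choose H hHm hHeq hHint using fun i => hT.lintegral_bE_atom hβ₀ hβ₁ hA ω n i hh
  refine ⟨fun x => ∑' i, H i x, Measurable.tsum hHm, fun x hx => ?_, ?_⟩
  · simp only [← hHeq _ x hx]
    simp only [bE]
    rw [ENNReal.tsum_comm]
    refine tsum_congr fun y => ?_
    rw [ENNReal.tsum_mul_left]
    congr 1
    obtain ⟨i, hi⟩ := mem_base.1 y.2.1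
    rw [tsum_eq_single i, indicator_of_mem hi]
    intro j hj
    exact indicator_of_notMem (fun hc => hj (hT.atom_unique hc hi)) _
  · rw [lintegral_tsum fun i => (hHm i).aemeasurable]
    simp only [hHint]
    have hret : MeasurableSet {x | T.ret ω x = n} :=
      (hT.measurable_ret.comp measurable_prodMk_left) (measurableSet_singleton n)
    have hset : {x | x ∈ T.base ω ∧ T.ret ω x = n}
        = ⋃ i, T.Λ ω i ∩ {x | T.ret ω x = n} := by
      rw [← iUnion_inter]; rfl
    rw [hset, lintegral_iUnion (fun i => (hT.measurableSet_Λ ω i).inter hret)]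
    exact fun i j hij => (hT.disjoint ω hij).mono inter_subset_left inter_subset_left

/-- The transfer operator of functions with values in `[0, ∞]`. -/
noncomputable def trE (T : RandomTower Ω₀ M) (ω : ℤ → Ω₀) (g : M × ℕ → ENNReal) (z : M × ℕ) :
    ENNReal :=
  ∑' y : T.fib ω z, ENNReal.ofReal (T.JF ω y)⁻¹ * g y

theorem trE_zero (ω : ℤ → Ω₀) (g : M × ℕ → ENNReal) (x : M) :
    T.trE ω g (x, 0)
      = ∑' ℓ : ℕ, T.bE (seqShift (-(ℓ : ℤ)) ω) (ℓ + 1) (fun y => g (y, ℓ)) x := by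
  rw [trE, ← (T.fibZeroEquiv ω x).tsum_eq]
  refine (ENNReal.tsum_sigma' _).trans ?_
  refine tsum_congr fun ℓ => tsum_congr fun y => ?_
  change ENNReal.ofReal (T.JF ω (y.1, ℓ))⁻¹ * g (y.1, ℓ) = _
  rw [JF_of_eq y.2.2.1]

theorem trE_succ {ω : ℤ → Ω₀} (g : M × ℕ → ENNReal) {x : M} {ℓ : ℕ}
    (hz : (x, ℓ + 1) ∈ T.tower (seqShift 1 ω)) : T.trE ω g (x, ℓ + 1) = g (x, ℓ) := by
  have : Unique (T.fib ω (x, ℓ + 1)) := by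
    rw [fib_succ hz]; exact Set.uniqueSingleton _
  have hd : ((default : T.fib ω (x, ℓ + 1)) : M × ℕ) = (x, ℓ) :=
    (Set.ext_iff.1 (fib_succ hz) _).1 (default : T.fib ω (x, ℓ + 1)).2
  rw [trE, tsum_eq_single default (fun b hb => absurd (Subsingleton.elim _ _) hb), hd,
    JF_of_lt (ret_of_mem_fib_succ hz), inv_one, ENNReal.ofReal_one, one_mul]

/-- The transfer operator preserves the integral. -/
theorem IsYoungTower.lintegral_trE (hT : T.IsYoungTower β) (hβ₀ : 0 < β) (hβ₁ : β < 1)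
    {A₁ : ℝ} (hA : T.DistortionConst β A₁) (ω : ℤ → Ω₀) {g : M × ℕ → ENNReal}
    (hg : Measurable g) : ∃ H : M × ℕ → ENNReal, Measurable H ∧
      (∀ z ∈ T.tower (seqShift 1 ω), T.trE ω g z = H z) ∧
      ∫⁻ z, H z ∂(T.towerMeasure (seqShift 1 ω)) = ∫⁻ z, g z ∂(T.towerMeasure ω) := by
  have hgℓ : ∀ ℓ : ℕ, Measurable fun x => g (x, ℓ) := fun ℓ => hg.comp measurable_prodMk_right
  choose H hHm hHeq hHint using fun ℓ : ℕ =>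
    hT.lintegral_bE hβ₀ hβ₁ hA (seqShift (-(ℓ : ℤ)) ω) (ℓ + 1) (hgℓ ℓ)
  let K : M × ℕ → ENNReal := fun z => Nat.casesOn z.2 (∑' ℓ, H ℓ z.1) fun ℓ => g (z.1, ℓ)
  have hK : Measurable K := by
    refine measurable_from_prod_countable_left fun k => ?_
    cases k with
    | zero => exact Measurable.tsum hHm
    | succ ℓ => exact hgℓ ℓ
  refine ⟨K, hK, ?_, ?_⟩
  · rintro ⟨x, k⟩ hz
    cases k with
    | zero =>
      rw [trE_zero]
      refine tsum_congr fun ℓ => hHeq ℓ x ?_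
      rw [hT.base_eq _ (seqShift 1 ω)]
      exact hT.mem_tower_zero.1 hz
    | succ ℓ => exact trE_succ g hz
  · rw [T.lintegral_towerMeasure _ hK, T.lintegral_towerMeasure _ hg,
      tsum_eq_zero_add' ENNReal.summable]
    have h0 : ∫⁻ x in {x | (x, 0) ∈ T.tower (seqShift 1 ω)}, K (x, 0)
        ∂(T.m (seqShift (-((0 : ℕ) : ℤ)) (seqShift 1 ω)))
        = ∑' ℓ : ℕ, ∫⁻ x in {x | x ∈ T.base (seqShift (-(ℓ : ℤ)) ω) ∧
          T.ret (seqShift (-(ℓ : ℤ)) ω) x = ℓ + 1}, g (x, ℓ)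
            ∂(T.m (seqShift (-(ℓ : ℤ)) ω)) := by
      have hs : {x | (x, 0) ∈ T.tower (seqShift 1 ω)} = T.base (seqShift 1 ω) := by
        ext x; exact hT.mem_tower_zero
      have hbs : (T.m (seqShift 1 ω)).restrict (T.base (seqShift 1 ω)) = T.m (seqShift 1 ω) :=
        Measure.restrict_eq_self_of_ae_mem (hT.m_base _)
      rw [hs]
      simp only [Nat.cast_zero, neg_zero, seqShift_zero]
      rw [hbs]
      change ∫⁻ x, ∑' ℓ, H ℓ x ∂_ = _
      rw [lintegral_tsum fun ℓ => (hHm ℓ).aemeasurable]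
      refine tsum_congr fun ℓ => ?_
      rw [← hHint ℓ, seqShift_seqShift,
        seqShift_congr (show ((ℓ + 1 : ℕ) : ℤ) + -(ℓ : ℤ) = 1 by push_cast; ring)]
    have h1 : ∀ ℓ : ℕ, ∫⁻ x in {x | (x, ℓ + 1) ∈ T.tower (seqShift 1 ω)}, K (x, ℓ + 1)
        ∂(T.m (seqShift (-((ℓ + 1 : ℕ) : ℤ)) (seqShift 1 ω)))
        = ∫⁻ x in {x | x ∈ T.base (seqShift (-(ℓ : ℤ)) ω) ∧
          ℓ + 1 < T.ret (seqShift (-(ℓ : ℤ)) ω) x}, g (x, ℓ)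
            ∂(T.m (seqShift (-(ℓ : ℤ)) ω)) := by
      intro ℓ
      have hs : {x | (x, ℓ + 1) ∈ T.tower (seqShift 1 ω)}
          = {x | x ∈ T.base (seqShift (-(ℓ : ℤ)) ω) ∧
            ℓ + 1 < T.ret (seqShift (-(ℓ : ℤ)) ω) x} := by
        ext x
        rw [mem_ofPred_eq, mem_tower, seqShift_seqShift, seqShift_neg_succ]
        rfl
      rw [hs, seqShift_seqShift, seqShift_neg_succ]
    rw [h0]
    simp only [h1]
    rw [← ENNReal.tsum_add]
    refine tsum_congr fun ℓ => ?_
    have hr : Measurable (T.ret (seqShift (-(ℓ : ℤ)) ω)) :=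
      hT.measurable_ret.comp measurable_prodMk_left
    -- Each level splits into the points that return and the points that climb. The former make up
    -- the integral over the base of the next tower, the latter the integrals over its higher
    -- levels.
    have hs : {x | (x, ℓ) ∈ T.tower ω} = {x | x ∈ T.base (seqShift (-(ℓ : ℤ)) ω) ∧
          T.ret (seqShift (-(ℓ : ℤ)) ω) x = ℓ + 1} ∪ {x | x ∈ T.base (seqShift (-(ℓ : ℤ)) ω) ∧
          ℓ + 1 < T.ret (seqShift (-(ℓ : ℤ)) ω) x} := by
      ext x
      rw [mem_ofPred_eq, mem_tower, mem_union, mem_ofPred_eq, mem_ofPred_eq, ← and_or_left,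
        le_iff_eq_or_lt, eq_comm]
    rw [hs, lintegral_union]
    · exact (hT.measurableSet_base _).inter (hr (measurableSet_Ioi (a := ℓ + 1)))
    · rw [Set.disjoint_left]
      rintro x ⟨_, h⟩ ⟨_, h'⟩
      omega

end

end RandomTower

/-! ### Integrals of real and complex functions, and consequences of the cone condition. -/

namespace RandomTower

section

variable {Ω₀ M : Type*} [MeasurableSpace Ω₀] [MeasurableSpace M] {T : RandomTower Ω₀ M} {β : ℝ}

/-- The standing hypotheses on the tower, with a choice of the constants. -/
structure Setup (T : RandomTower Ω₀ M) (β A₁ ε₀ c₂ D V C₁ C₂ : ℝ) : Prop where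
  young : T.IsYoungTower β
  β_pos : 0 < β
  β_lt_one : β < 1
  distortion : T.DistortionConst β A₁
  ε_pos : 0 < ε₀
  ε_lt : ε₀ < c₂
  D_nonneg : 0 ≤ D
  V_nonneg : 0 ≤ V
  C₁_nonneg : 0 ≤ C₁
  C₂_nonneg : 0 ≤ C₂

/-- The sequences `ω` along whose orbits all the estimates that hold almost everywhere are
satisfied. -/
structure Good (T : RandomTower Ω₀ M) (β ε₀ c₂ D V C₁ C₂ : ℝ) (φ : (ℤ → Ω₀) → M × ℕ → ℝ)
    (ω : ℤ → Ω₀) : Prop where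
  tail : T.TowerTail D c₂ ω
  mass : ∀ k : ℤ, ∫⁻ z, ENNReal.ofReal (wv ε₀ z) ∂(T.towerMeasure (seqShift k ω))
    ≤ ENNReal.ofReal V
  bdd : ∀ k : ℤ, ∀ z ∈ T.tower (seqShift k ω), |φ (seqShift k ω) z| ≤ C₁
  lip : ∀ k : ℤ, ∀ z ∈ T.tower (seqShift k ω), ∀ z' ∈ T.tower (seqShift k ω),
    |φ (seqShift k ω) z - φ (seqShift k ω) z'| ≤ C₂ * T.sepDist β (seqShift k ω) z z'

variable {A₁ ε₀ c₂ D V C₁ C₂ : ℝ} {φ : (ℤ → Ω₀) → M × ℕ → ℝ} {ω : ℤ → Ω₀}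

theorem Good.shift (hS : T.Setup β A₁ ε₀ c₂ D V C₁ C₂) (hω : T.Good β ε₀ c₂ D V C₁ C₂ φ ω)
    (k : ℤ) : T.Good β ε₀ c₂ D V C₁ C₂ φ (seqShift k ω) where
  tail := hω.tail.shift hS.young k
  mass j := by rw [seqShift_seqShift]; exact hω.mass _
  bdd j := by rw [seqShift_seqShift]; exact hω.bdd _
  lip j := by rw [seqShift_seqShift]; exact hω.lip _

theorem measurable_wv (ε₀ : ℝ) : Measurable (wv ε₀ : M × ℕ → ℝ) := by
  unfold wv
  refine Real.measurable_exp.comp (measurable_const.mul ?_)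
  exact (Measurable.of_discrete (f := fun n : ℕ => (n : ℝ))).comp measurable_snd

/-- Measurability of the restriction to the tower. -/
def MeasOn {E : Type*} [Zero E] [MeasurableSpace E] (T : RandomTower Ω₀ M) (ω : ℤ → Ω₀)
    (g : M × ℕ → E) : Prop := Measurable ((T.tower ω).indicator g)

theorem MeasOn.of_measurable {E : Type*} [Zero E] [MeasurableSpace E] (hT : T.IsYoungTower β)
    {g : M × ℕ → E} (hg : Measurable g) : T.MeasOn ω g :=
  hg.indicator (hT.measurableSet_tower ω)

theorem MeasOn.mul {E : Type*} [MulZeroClass E] [MeasurableSpace E] [MeasurableMul₂ E]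
    {g h : M × ℕ → E} (hg : T.MeasOn ω g) (hh : T.MeasOn ω h) :
    T.MeasOn ω fun z => g z * h z := by
  unfold MeasOn
  rw [indicator_mul]
  exact Measurable.mul hg hh

theorem indicator_ae_eq {E : Type*} [Zero E] (hT : T.IsYoungTower β) (g : M × ℕ → E) :
    (T.tower ω).indicator g =ᵐ[T.towerMeasure ω] g := by
  filter_upwards [hT.ae_mem_tower ω] with z hz
  exact indicator_of_mem hz g

theorem MeasOn.aestronglyMeasurable {E : Type*} [NormedAddCommGroup E] [MeasurableSpace E]
    [BorelSpace E] [SecondCountableTopology E] (hT : T.IsYoungTower β)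
    {g : M × ℕ → E} (hg : T.MeasOn ω g) :
    AEStronglyMeasurable g (T.towerMeasure ω) :=
  ⟨_, Measurable.stronglyMeasurable hg, (indicator_ae_eq hT g).symm⟩

theorem Good.integrable_wv (hω : T.Good β ε₀ c₂ D V C₁ C₂ φ ω) :
    Integrable (wv ε₀) (T.towerMeasure ω) := by
  refine ⟨(measurable_wv ε₀).aestronglyMeasurable, ?_⟩
  rw [hasFiniteIntegral_iff_ofReal (ae_of_all _ fun z => (wv_pos ε₀ z).le)]
  have := hω.mass 0
  rw [seqShift_zero] at this
  exact this.trans_lt ENNReal.ofReal_lt_top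

theorem Good.integral_wv_le (hV : 0 ≤ V) (hω : T.Good β ε₀ c₂ D V C₁ C₂ φ ω) :
    ∫ z, wv ε₀ z ∂(T.towerMeasure ω) ≤ V := by
  rw [integral_eq_lintegral_of_nonneg_ae (ae_of_all _ fun z => (wv_pos ε₀ z).le)
    (measurable_wv ε₀).aestronglyMeasurable]
  have := hω.mass 0
  rw [seqShift_zero] at this
  exact ENNReal.toReal_le_of_le_ofReal hV this

theorem Tame.integrable {E : Type*} [NormedAddCommGroup E] [MeasurableSpace E]
    [BorelSpace E] [SecondCountableTopology E] (hT : T.IsYoungTower β)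
    (hω : T.Good β ε₀ c₂ D V C₁ C₂ φ ω)
    {g : M × ℕ → E} {A : ℝ} (hg : T.Tame ε₀ ω A g) (hm : T.MeasOn ω g) :
    Integrable g (T.towerMeasure ω) := by
  refine (hω.integrable_wv.const_mul A).mono' (hm.aestronglyMeasurable hT) ?_
  filter_upwards [hT.ae_mem_tower ω] with z hz
  exact hg z hz

theorem integral_tr_of_nonneg (hS : T.Setup β A₁ ε₀ c₂ D V C₁ C₂)
    (hω : T.Good β ε₀ c₂ D V C₁ C₂ φ ω) {g : M × ℕ → ℝ} {A : ℝ} (hg : T.Tame ε₀ ω A g)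
    (hm : T.MeasOn ω g) (h0 : ∀ y ∈ T.tower ω, 0 ≤ g y) :
    Integrable (T.tr ω g) (T.towerMeasure (seqShift 1 ω)) ∧
      ∫ z, T.tr ω g z ∂(T.towerMeasure (seqShift 1 ω)) = ∫ z, g z ∂(T.towerMeasure ω) := by
  have hT := hS.young
  obtain ⟨H, hH, hHeq, hHint⟩ := hT.lintegral_trE hS.β_pos hS.β_lt_one hS.distortion ω
    hm.ennreal_ofReal
  have h1 : ∀ z ∈ T.tower (seqShift 1 ω), ENNReal.ofReal (T.tr ω g z) = H z := by
    intro z hz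
    rw [← hHeq z hz, tr, ENNReal.ofReal_tsum_of_nonneg
      (fun y : T.fib ω z => smul_nonneg (inv_nonneg.2 (hT.JF_pos y.2.1).le) (h0 y y.2.1))
      (hg.summable hT hS.β_pos hS.β_lt_one hS.distortion hS.ε_lt hω.tail hz)]
    refine tsum_congr fun y => ?_
    rw [smul_eq_mul, ENNReal.ofReal_mul (inv_nonneg.2 (hT.JF_pos y.2.1).le)]
    dsimp only
    rw [indicator_of_mem y.2.1]
  have h2 : ∀ z ∈ T.tower (seqShift 1 ω), 0 ≤ T.tr ω g z := fun z _ =>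
    tsum_nonneg fun y => smul_nonneg (inv_nonneg.2 (hT.JF_pos y.2.1).le) (h0 y y.2.1)
  have h3 : T.tr ω g =ᵐ[T.towerMeasure (seqShift 1 ω)] fun z => (H z).toReal := by
    filter_upwards [hT.ae_mem_tower (seqShift 1 ω)] with z hz
    rw [← h1 z hz, ENNReal.toReal_ofReal (h2 z hz)]
  have h4 : AEStronglyMeasurable (T.tr ω g) (T.towerMeasure (seqShift 1 ω)) :=
    ⟨_, hH.ennreal_toReal.stronglyMeasurable, h3⟩
  have h5 : 0 ≤ᵐ[T.towerMeasure (seqShift 1 ω)] T.tr ω g := by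
    filter_upwards [hT.ae_mem_tower (seqShift 1 ω)] with z hz using h2 z hz
  have h6 : 0 ≤ᵐ[T.towerMeasure ω] g := by
    filter_upwards [hT.ae_mem_tower ω] with z hz using h0 z hz
  have h7 : ∫⁻ z, ENNReal.ofReal (T.tr ω g z) ∂(T.towerMeasure (seqShift 1 ω))
      = ∫⁻ z, ENNReal.ofReal (g z) ∂(T.towerMeasure ω) := by
    have e1 : (fun z => ENNReal.ofReal (T.tr ω g z)) =ᵐ[T.towerMeasure (seqShift 1 ω)] H := by
      filter_upwards [hT.ae_mem_tower (seqShift 1 ω)] with z hz using h1 z hz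
    have e2 : (fun z => ENNReal.ofReal ((T.tower ω).indicator g z)) =ᵐ[T.towerMeasure ω]
        fun z => ENNReal.ofReal (g z) := by
      filter_upwards [hT.ae_mem_tower ω] with z hz
      rw [indicator_of_mem hz]
    rw [lintegral_congr_ae e1, hHint, lintegral_congr_ae e2]
  have hgi := hg.integrable hT hω hm
  refine ⟨⟨h4, ?_⟩, ?_⟩
  · rw [hasFiniteIntegral_iff_ofReal h5, h7, ← hasFiniteIntegral_iff_ofReal h6]
    exact hgi.2
  · rw [integral_eq_lintegral_of_nonneg_ae h5 h4, h7,
      integral_eq_lintegral_of_nonneg_ae h6 hgi.1]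

/-- Adding `|A| v` makes the function nonnegative; the two nonnegative cases are then subtracted. -/
theorem integral_tr_real (hS : T.Setup β A₁ ε₀ c₂ D V C₁ C₂)
    (hω : T.Good β ε₀ c₂ D V C₁ C₂ φ ω) {g : M × ℕ → ℝ} {A : ℝ} (hg : T.Tame ε₀ ω A g)
    (hm : T.MeasOn ω g) : Integrable (T.tr ω g) (T.towerMeasure (seqShift 1 ω)) ∧
      ∫ z, T.tr ω g z ∂(T.towerMeasure (seqShift 1 ω)) = ∫ z, g z ∂(T.towerMeasure ω) := by
  have hT := hS.young
  have hvt : T.Tame ε₀ ω |A| (fun z => A * wv ε₀ z) := fun z _ => by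
    rw [Real.norm_eq_abs, abs_mul, abs_of_pos (wv_pos ε₀ z)]
  have hvm : T.MeasOn ω fun z => A * wv ε₀ z :=
    MeasOn.of_measurable hT ((measurable_wv ε₀).const_mul A)
  have hv' : T.Tame ε₀ ω |A| (fun z => |A| * wv ε₀ z) := fun z _ => by
    rw [Real.norm_eq_abs, abs_mul, abs_of_pos (wv_pos ε₀ z), abs_abs]
  have hvm' : T.MeasOn ω fun z => |A| * wv ε₀ z :=
    MeasOn.of_measurable hT ((measurable_wv ε₀).const_mul _)
  have hst : T.Tame ε₀ ω (A + |A|) (fun z => g z + |A| * wv ε₀ z) := fun z hz => by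
    refine (norm_add_le _ _).trans ?_
    rw [add_mul]
    exact add_le_add (hg z hz) (hv' z hz)
  have hsm : T.MeasOn ω fun z => g z + |A| * wv ε₀ z := by
    change Measurable ((T.tower ω).indicator (g + fun z => |A| * wv ε₀ z))
    rw [indicator_add']
    exact Measurable.add hm hvm'
  have h1 := integral_tr_of_nonneg hS hω hst hsm fun y hy => by
    have h2 := hg y hy
    rw [Real.norm_eq_abs] at h2
    have h3 := (abs_le.1 h2).1
    have h4 := mul_le_mul_of_nonneg_right (le_abs_self A) (wv_pos ε₀ y).le
    linarith
  have h2 := integral_tr_of_nonneg hS hω hv' hvm' fun y _ =>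
    mul_nonneg (abs_nonneg A) (wv_pos ε₀ y).le
  have h3 : T.tr ω g =ᵐ[T.towerMeasure (seqShift 1 ω)] fun z =>
      T.tr ω (fun z => g z + |A| * wv ε₀ z) z - T.tr ω (fun z => |A| * wv ε₀ z) z := by
    filter_upwards [hT.ae_mem_tower (seqShift 1 ω)] with z hz
    have e1 := hst.summable hT hS.β_pos hS.β_lt_one hS.distortion hS.ε_lt hω.tail hz
    have e2 := hv'.summable hT hS.β_pos hS.β_lt_one hS.distortion hS.ε_lt hω.tail hz
    simp only [tr]
    rw [← e1.tsum_sub e2]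
    refine tsum_congr fun y => ?_
    simp only [smul_eq_mul]
    ring
  refine ⟨(h1.1.sub h2.1).congr h3.symm, ?_⟩
  rw [integral_congr_ae h3, integral_sub h1.1 h2.1, h1.2, h2.2,
    integral_add (hg.integrable hT hω hm) (hv'.integrable hT hω hvm')]
  ring

theorem integral_tr (hS : T.Setup β A₁ ε₀ c₂ D V C₁ C₂)
    (hω : T.Good β ε₀ c₂ D V C₁ C₂ φ ω) {g : M × ℕ → ℂ} {A : ℝ} (hg : T.Tame ε₀ ω A g)
    (hm : T.MeasOn ω g) :
      ∫ z, T.tr ω g z ∂(T.towerMeasure (seqShift 1 ω)) = ∫ z, g z ∂(T.towerMeasure ω) := by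
  have hT := hS.young
  have hre : T.Tame ε₀ ω A (fun z => (g z).re) := fun z hz =>
    (Complex.abs_re_le_norm _).trans (hg z hz)
  have him : T.Tame ε₀ ω A (fun z => (g z).im) := fun z hz =>
    (Complex.abs_im_le_norm _).trans (hg z hz)
  have hrm : T.MeasOn ω (fun z => (g z).re) := by
    have := Complex.measurable_re.comp hm
    change Measurable _
    convert this using 1
    funext z
    by_cases hz : z ∈ T.tower ω <;> simp [hz]
  have himm : T.MeasOn ω (fun z => (g z).im) := by
    have := Complex.measurable_im.comp hm
    change Measurable _
    convert this using 1
    funext z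
    by_cases hz : z ∈ T.tower ω <;> simp [hz]
  have h1 := integral_tr_real hS hω hre hrm
  have h2 := integral_tr_real hS hω him himm
  have h3 : T.tr ω g =ᵐ[T.towerMeasure (seqShift 1 ω)] fun z =>
      ((T.tr ω (fun z => (g z).re) z : ℝ) : ℂ)
        + ((T.tr ω (fun z => (g z).im) z : ℝ) : ℂ) * Complex.I := by
    filter_upwards [hT.ae_mem_tower (seqShift 1 ω)] with z hz
    have e := hg.summable hT hS.β_pos hS.β_lt_one hS.distortion hS.ε_lt hω.tail hz
    simp only [tr]
    apply Complex.ext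
    · rw [Complex.re_tsum e]
      simp
    · rw [Complex.im_tsum e]
      simp
  have hgi := hg.integrable hT hω hm
  rw [integral_congr_ae h3, integral_add h1.1.ofReal (h2.1.ofReal.mul_const _),
    integral_mul_const, integral_complex_ofReal, integral_complex_ofReal, h1.2, h2.2]
  have := integral_re_add_im hgi
  simpa using this

theorem tr_comp_mul (ψ g : M × ℕ → ℂ) (z : M × ℕ) :
    T.tr ω (fun y => ψ (T.F ω y) * g y) z = ψ z * T.tr ω g z := by
  rw [tr, tr, ← tsum_mul_left]
  refine tsum_congr fun y => ?_
  rw [y.2.2]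
  simp only [Complex.real_smul]
  ring

/-- The integral of a function in the cone bounds its values on the base. -/
theorem Cone.le_integral (hS : T.Setup β A₁ ε₀ c₂ D V C₁ C₂) {K : ℝ} (hK : 0 ≤ K)
    {h : M × ℕ → ℝ} (hh : T.Cone β K 0 ω h) (h0 : ∀ y ∈ T.tower ω, 0 ≤ h y)
    (hi : Integrable h (T.towerMeasure ω)) (hm : T.MeasOn ω h) {x : M} (hx : x ∈ T.base ω) :
    h (x, 0) ≤ Real.exp K * ∫ z, h z ∂(T.towerMeasure ω) := by
  have hT := hS.young
  have hx' : (x, 0) ∈ T.tower ω := hT.mem_tower_zero.2 hx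
  have h6 : 0 ≤ᵐ[T.towerMeasure ω] h := by
    filter_upwards [hT.ae_mem_tower ω] with z hz using h0 z hz
  have h1 : ∀ y, (y, 0) ∈ T.tower ω → h (x, 0) * Real.exp (-K) ≤ h (y, 0) := by
    intro y hy
    have := hh (x, 0) hx' (y, 0) hy (Or.inl ⟨rfl, rfl⟩) (sameCylinder_zero _ _ _)
    have h2 : Real.exp (K * T.sepDist β ω (x, 0) (y, 0)) ≤ Real.exp K :=
      Real.exp_le_exp.2 (mul_le_of_le_one_right hK
        ((sepDist_le hS.β_pos hS.β_lt_one _ _ _).trans hS.β_lt_one.le))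
    rw [Real.exp_neg, ← div_eq_mul_inv, div_le_iff₀ (Real.exp_pos _)]
    exact this.trans (mul_le_mul_of_nonneg_left h2 (h0 _ hy))
  have e2 : (fun z => ENNReal.ofReal (h z)) =ᵐ[T.towerMeasure ω]
      fun z => ENNReal.ofReal ((T.tower ω).indicator h z) := by
    filter_upwards [hT.ae_mem_tower ω] with z hz
    rw [indicator_of_mem hz]
  -- Two points of the base are always comparable at order `0`, so `e^{-K} h(x, 0)` is a lower bound
  -- of `h` on the base, which has mass one.
  have h2 : ENNReal.ofReal (h (x, 0) * Real.exp (-K))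
      ≤ ∫⁻ z, ENNReal.ofReal (h z) ∂(T.towerMeasure ω) := by
    rw [lintegral_congr_ae e2, T.lintegral_towerMeasure ω hm.ennreal_ofReal]
    refine le_trans ?_ (ENNReal.le_tsum 0)
    have hs : {x | (x, 0) ∈ T.tower ω} = T.base ω := by
      ext x; exact hT.mem_tower_zero
    rw [hs]
    simp only [Nat.cast_zero, neg_zero, seqShift_zero]
    calc ENNReal.ofReal (h (x, 0) * Real.exp (-K))
        = ∫⁻ _ in T.base ω, ENNReal.ofReal (h (x, 0) * Real.exp (-K)) ∂(T.m ω) := by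
          rw [setLIntegral_const, hT.m_base_eq_one, mul_one]
      _ ≤ _ := by
          refine setLIntegral_mono' (hT.measurableSet_base ω) fun y hy => ?_
          have hy' : (y, 0) ∈ T.tower ω := hT.mem_tower_zero.2 hy
          rw [indicator_of_mem hy']
          exact ENNReal.ofReal_le_ofReal (h1 y hy')
  rw [← ofReal_integral_eq_lintegral_ofReal hi h6] at h2
  have h3 := (ENNReal.ofReal_le_ofReal_iff (integral_nonneg_of_ae h6)).1 h2
  rw [Real.exp_neg, ← div_eq_mul_inv, div_le_iff₀ (Real.exp_pos _)] at h3
  rwa [mul_comm]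

theorem Cone.abs_sub_le {K : ℝ} (hK : 0 ≤ K) (hβ₀ : 0 < β) (hβ₁ : β < 1) {j : ℕ} {h : M × ℕ → ℝ}
    (hh : T.Cone β K j ω h) (h0 : ∀ y ∈ T.tower ω, 0 ≤ h y) {z z' : M × ℕ} (hz : z ∈ T.tower ω)
    (hz' : z' ∈ T.tower ω) (hc : T.Comparable ω z z') (hs : T.SameCylinder ω j z z') :
    |h z - h z'| ≤ K * Real.exp K * h z * T.sepDist β ω z z' := by
  have h1 := hh z hz z' hz' hc hs
  have h2 := hh z' hz' z hz hc.symm hs.symm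
  rw [sepDist_comm] at h2
  have hd := (sepDist_le (T := T) hβ₀ hβ₁ ω z z').trans hβ₁.le
  have hd0 := T.sepDist_nonneg hβ₀.le ω z z'
  set d := T.sepDist β ω z z'
  have hp := h0 z hz
  have hKd : 0 ≤ K * d := mul_nonneg hK hd0
  have e1 := Real.add_one_le_exp (-(K * d))
  have e2 : Real.exp (K * d) ≤ Real.exp K := Real.exp_le_exp.2 (mul_le_of_le_one_right hK hd)
  have e3 : Real.exp (K * d) - 1 ≤ K * d * Real.exp (K * d) := by
    rw [Real.exp_neg] at e1
    have := mul_le_mul_of_nonneg_right e1 (Real.exp_pos (K * d)).le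
    rw [inv_mul_cancel₀ (Real.exp_pos _).ne'] at this
    linarith
  have e4 : Real.exp (K * d) - 1 ≤ K * d * Real.exp K :=
    e3.trans (mul_le_mul_of_nonneg_left e2 hKd)
  have e5 : K * d ≤ K * d * Real.exp K :=
    le_mul_of_one_le_right hKd (Real.one_le_exp hK)
  rw [abs_le]
  constructor
  · nlinarith [mul_le_mul_of_nonneg_left e4 hp]
  · have e6 : h z * Real.exp (-(K * d)) ≤ h z' := by
      rw [Real.exp_neg, ← div_eq_mul_inv, div_le_iff₀ (Real.exp_pos _)]; exact h1
    nlinarith [mul_le_mul_of_nonneg_left e1 hp, mul_le_mul_of_nonneg_left e5 hp]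

/-- Points in different cylinders of order `j` are at distance at least `β^j`, so for them the bound
by `A v` already gives a Lipschitz estimate on the atom. -/
theorem Cone.measOn (hS : T.Setup β A₁ ε₀ c₂ D V C₁ C₂) {K : ℝ} (hK : 0 ≤ K) {j : ℕ}
    {h : M × ℕ → ℝ} (hh : T.Cone β K j ω h) (h0 : ∀ y ∈ T.tower ω, 0 ≤ h y) {A : ℝ}
    (hA : 0 ≤ A) (ht : T.Tame ε₀ ω A h) : T.MeasOn ω h := by
  have hβ₀ := hS.β_pos
  refine hS.young.measurable_of_lipschitz hS.β_pos hS.β_lt_one ω fun z hz => ?_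
  refine ⟨K * Real.exp K * h z + 2 * (A * wv ε₀ z) / β ^ j, ?_, fun z' hz' hsa => ?_⟩
  · have := h0 z hz
    have := wv_pos ε₀ z
    positivity
  · have hd0 := T.sepDist_nonneg hβ₀.le ω z z'
    have hw := wv_pos ε₀ z
    by_cases hs : T.SameCylinder ω j z z'
    · refine (hh.abs_sub_le hK hβ₀ hS.β_lt_one h0 hz hz' (Or.inr hsa) hs).trans ?_
      refine mul_le_mul_of_nonneg_right ?_ hd0
      have : 0 ≤ 2 * (A * wv ε₀ z) / β ^ j := by positivity
      linarith
    · have h1 := le_sepDist_of_not_sameCylinder hβ₀ hS.β_lt_one hs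
      have hzz : wv ε₀ z' = wv ε₀ z := by rw [wv, wv, hsa.level]
      have h2 := ht z' hz'
      rw [hzz] at h2
      have h3 : ‖h z - h z'‖ ≤ 2 * (A * wv ε₀ z) := by
        refine (norm_sub_le _ _).trans ?_
        have := ht z hz
        linarith
      refine h3.trans ?_
      have h4 : 2 * (A * wv ε₀ z) ≤ 2 * (A * wv ε₀ z) / β ^ j * T.sepDist β ω z z' := by
        rw [div_mul_eq_mul_div, le_div_iff₀ (by positivity)]
        exact mul_le_mul_of_nonneg_left h1 (by positivity)
      refine h4.trans (mul_le_mul_of_nonneg_right ?_ hd0)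
      have : 0 ≤ K * Real.exp K * h z := by have := h0 z hz; positivity
      linarith

end

end RandomTower

/-! ### Uniform bounds for the iterates, and the characteristic function as an integral of twisted
iterates. -/

namespace RandomTower

section

variable {Ω₀ M : Type*} [MeasurableSpace Ω₀] [MeasurableSpace M] {T : RandomTower Ω₀ M} {β : ℝ}
  {A₁ ε₀ c₂ D V C₁ C₂ : ℝ} {φ : (ℤ → Ω₀) → M × ℕ → ℝ} {ω : ℤ → Ω₀}

theorem seqShift_succ {Ω₀ : Type*} (n : ℕ) (ω : ℤ → Ω₀) :
    seqShift 1 (seqShift (n : ℤ) ω) = seqShift ((n + 1 : ℕ) : ℤ) ω := by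
  rw [seqShift_seqShift]
  exact seqShift_congr (by push_cast; ring) ω

/-- The iterates of the transfer operators. -/
noncomputable def trn (T : RandomTower Ω₀ M) (ω : ℤ → Ω₀) : ℕ → (M × ℕ → ℝ) → M × ℕ → ℝ
  | 0, g => g
  | n + 1, g => T.tr (seqShift (n : ℤ) ω) (trn T ω n g)

/-- The iterates of the twisted transfer operators. -/
noncomputable def Pn (T : RandomTower Ω₀ M) (φ : (ℤ → Ω₀) → M × ℕ → ℝ) (t : ℝ) (ω : ℤ → Ω₀) :
    ℕ → (M × ℕ → ℂ) → M × ℕ → ℂ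
  | 0, g => g
  | n + 1, g => T.tw φ t (seqShift (n : ℤ) ω) (Pn T φ t ω n g)

theorem Pn_add (t : ℝ) (n m : ℕ) (g : M × ℕ → ℂ) :
    T.Pn φ t ω (n + m) g = T.Pn φ t (seqShift (n : ℤ) ω) m (T.Pn φ t ω n g) := by
  induction m with
  | zero => rfl
  | succ m ih =>
    change T.tw φ t (seqShift ((n + m : ℕ) : ℤ) ω) (T.Pn φ t ω (n + m) g) = T.tw φ t _ _
    rw [ih, seqShift_seqShift]
    rw [seqShift_congr (show ((n + m : ℕ) : ℤ) = m + n by push_cast; ring)]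

theorem mem_tower_pred {x : M} {ℓ : ℕ} (hz : (x, ℓ + 1) ∈ T.tower (seqShift 1 ω)) :
    (x, ℓ) ∈ T.tower ω := by
  rw [mem_tower, seqShift_seqShift, seqShift_neg_succ] at hz
  exact mem_tower.2 ⟨hz.1, Nat.le_of_succ_le hz.2⟩

/-- Bounds on the base propagate to the upper levels with the weight. -/
theorem climb (hε : 0 ≤ ε₀) {g : ℕ → M × ℕ → ℝ} {a b : ℝ} (ha : 0 ≤ a)
    (h0 : ∀ z ∈ T.tower ω, g 0 z ≤ b * wv ε₀ z) (n : ℕ)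
    (hbase : ∀ m, 1 ≤ m → m ≤ n → ∀ x, (x, 0) ∈ T.tower (seqShift (m : ℤ) ω) → g m (x, 0) ≤ a)
    (hb : 0 ≤ b)
    (hup : ∀ m x ℓ, (x, ℓ + 1) ∈ T.tower (seqShift ((m + 1 : ℕ) : ℤ) ω) →
      g (m + 1) (x, ℓ + 1) ≤ g m (x, ℓ)) :
    ∀ z ∈ T.tower (seqShift (n : ℤ) ω), g n z ≤ (a + b * Real.exp (-ε₀ * n)) * wv ε₀ z := by
  -- A point of level `ℓ < n` at time `n` was in the base at time `n - ℓ`. A point of level `ℓ ≥ n`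
  -- has climbed since time `0` from level `ℓ - n`, and its bound `b e^{ε₀(ℓ-n)}` carries the factor
  -- `e^{-ε₀ n}`.
  induction n with
  | zero =>
    intro z hz
    rw [Nat.cast_zero, seqShift_zero] at hz
    refine (h0 z hz).trans ?_
    simp only [Nat.cast_zero, mul_zero, Real.exp_zero, mul_one]
    exact mul_le_mul_of_nonneg_right (by linarith) (wv_pos ε₀ z).le
  | succ n ih =>
    rintro ⟨x, k⟩ hz
    cases k with
    | zero =>
      rw [wv_zero, mul_one]
      have := hbase (n + 1) (by omega) le_rfl x hz
      have h2 : 0 ≤ b * Real.exp (-ε₀ * (n + 1 : ℕ)) := by positivity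
      linarith
    | succ ℓ =>
      have hz' := hz
      rw [← seqShift_succ] at hz'
      have h1 := ih (fun m hm hmn => hbase m hm (hmn.trans (Nat.le_succ n)))
        (x, ℓ) (mem_tower_pred hz')
      refine (hup n x ℓ hz).trans (h1.trans ?_)
      rw [wv_succ ε₀ x x ℓ, ← mul_assoc]
      refine mul_le_mul_of_nonneg_right ?_ (wv_pos ε₀ _).le
      rw [add_mul, mul_assoc, ← Real.exp_add]
      have e1 : -ε₀ * ((n + 1 : ℕ) : ℝ) + ε₀ = -ε₀ * n := by push_cast; ring
      rw [e1]
      have := mul_le_mul_of_nonneg_left (Real.one_le_exp hε) ha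
      linarith

/-- A crude bound whose constant deteriorates under iteration. It only serves to keep the iterates
summable and integrable; the uniform bound is `Setup.wn_le`. -/
theorem Tame.tr (hS : T.Setup β A₁ ε₀ c₂ D V C₁ C₂) (hD : T.TowerTail D c₂ ω)
    {g : M × ℕ → ℝ} {A : ℝ} (hA : 0 ≤ A) (hg : T.Tame ε₀ ω A g) :
    T.Tame ε₀ (seqShift 1 ω) (A * (levelSum ε₀ c₂ D + 1)) (T.tr ω g) := by
  have hT := hS.young
  have hL : 0 ≤ levelSum ε₀ c₂ D := tsum_nonneg fun ℓ => by
    have := hS.D_nonneg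
    positivity
  rintro ⟨x, k⟩ hz
  cases k with
  | zero =>
    have hx : x ∈ T.base ω := hT.base_eq (seqShift 1 ω) ω ▸ hT.mem_tower_zero.1 hz
    have hv : T.Tame ε₀ ω A (fun z => A * wv ε₀ z) := fun z _ => by
      rw [Real.norm_eq_abs, abs_mul, abs_of_pos (wv_pos ε₀ z), abs_of_nonneg hA]
    have h1 := norm_tr_le hT hS.β_pos hS.β_lt_one hS.distortion hS.ε_lt hD hz hg hv
      fun y hy => hg y hy.1
    have h2 := tr_wv_zero_le hT hS.β_pos hS.β_lt_one hS.distortion hS.ε_lt hD hx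
    have h3 : T.tr ω (fun z => A * wv ε₀ z) (x, 0) = A * T.tr ω (wv ε₀) (x, 0) := by
      rw [RandomTower.tr, RandomTower.tr, ← tsum_mul_left]
      refine tsum_congr fun y => ?_
      simp only [smul_eq_mul]; ring
    rw [wv_zero, mul_one]
    rw [h3] at h1
    have := mul_le_mul_of_nonneg_left h2 hA
    linarith
  | succ ℓ =>
    rw [tr_succ g hz, wv_succ ε₀ x x ℓ]
    refine (hg _ (mem_tower_pred hz)).trans ?_
    have h1 := Real.one_le_exp hS.ε_pos.le
    have h2 := wv_pos ε₀ (x, ℓ)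
    have h3 : 1 ≤ (levelSum ε₀ c₂ D + 1) * Real.exp ε₀ := by nlinarith
    calc A * wv ε₀ (x, ℓ) = A * wv ε₀ (x, ℓ) * 1 := (mul_one _).symm
      _ ≤ A * wv ε₀ (x, ℓ) * ((levelSum ε₀ c₂ D + 1) * Real.exp ε₀) :=
        mul_le_mul_of_nonneg_left h3 (by positivity)
      _ = _ := by ring

theorem Setup.K_nonneg (hS : T.Setup β A₁ ε₀ c₂ D V C₁ C₂) : 0 ≤ A₁ / (1 - β) :=
  div_nonneg hS.distortion.1.le (by linarith [hS.β_lt_one])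

/-- The invariants of the iteration, proved together because each step needs all of them. The order
of the cone falls by one per step and stops at `0`, where the condition compares all points of the
base. -/
theorem trn_spec (hS : T.Setup β A₁ ε₀ c₂ D V C₁ C₂) (hω : T.Good β ε₀ c₂ D V C₁ C₂ φ ω)
    {h : M × ℕ → ℝ} {A : ℝ} (hA : 0 ≤ A) (ht : T.Tame ε₀ ω A h)
    (h0 : ∀ y ∈ T.tower ω, 0 ≤ h y) {j : ℕ} (hc : T.Cone β (A₁ / (1 - β)) j ω h) (n : ℕ) :
    (∀ z ∈ T.tower (seqShift (n : ℤ) ω), 0 ≤ T.trn ω n h z) ∧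
      T.Cone β (A₁ / (1 - β)) (j - n) (seqShift (n : ℤ) ω) (T.trn ω n h) ∧
      (∃ A', 0 ≤ A' ∧ T.Tame ε₀ (seqShift (n : ℤ) ω) A' (T.trn ω n h)) ∧
      ∫ z, T.trn ω n h z ∂(T.towerMeasure (seqShift (n : ℤ) ω))
        = ∫ z, h z ∂(T.towerMeasure ω) := by
  have hT := hS.young
  induction n with
  | zero =>
    simp only [Nat.cast_zero, seqShift_zero, Nat.sub_zero]
    exact ⟨h0, hc, ⟨A, hA, ht⟩, rfl⟩
  | succ n ih =>
    obtain ⟨i0, i1, ⟨A', hA', i2⟩, i3⟩ := ih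
    have hg := hω.shift hS (n : ℤ)
    have hm := i1.measOn hS hS.K_nonneg i0 hA' i2
    have hi := integral_tr_of_nonneg hS hg i2 hm i0
    have h1 := (i1.mono (show j - n ≤ j - (n + 1) + 1 by omega)).tr hT hS.β_pos hS.β_lt_one
      hS.distortion hS.ε_lt hg.tail i2 i0
    have h2 := i2.tr hS hg.tail hA'
    rw [seqShift_succ] at h1 h2 hi
    refine ⟨fun z _ => tsum_nonneg fun y => smul_nonneg
      (inv_nonneg.2 (hT.JF_pos y.2.1).le) (i0 y y.2.1), h1, ⟨_, ?_, h2⟩, hi.2.trans i3⟩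
    have : 0 ≤ levelSum ε₀ c₂ D := tsum_nonneg fun ℓ => by
      have := hS.D_nonneg
      positivity
    positivity

/-- The uniform bound of the iterates on the weight. -/
noncomputable def unifConst (β A₁ V : ℝ) : ℝ := Real.exp (A₁ / (1 - β)) * V + 1

theorem Setup.one_le_unifConst (hS : T.Setup β A₁ ε₀ c₂ D V C₁ C₂) : 1 ≤ unifConst β A₁ V := by
  have := hS.V_nonneg
  have : 0 ≤ Real.exp (A₁ / (1 - β)) * V := by positivity
  unfold unifConst
  linarith

theorem cone_wv (K : ℝ) (j : ℕ) (hK : 0 ≤ K) (hβ₀ : 0 < β) : T.Cone β K j ω (wv ε₀) := by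
  intro z hz z' hz' hc hs
  have hl : z.2 = z'.2 := by
    rcases hc with h | h
    · rw [h.1, h.2]
    · exact h.1
  have : wv ε₀ z = wv ε₀ z' := by rw [wv, wv, hl]
  rw [this]
  exact le_mul_of_one_le_right (wv_pos ε₀ z').le
    (Real.one_le_exp (mul_nonneg hK (T.sepDist_nonneg hβ₀.le _ _ _)))

/-- After `j` steps the cone has order `0`; from then on the values on the base are controlled by
the integral, which does not change. -/
theorem trn_base_le (hS : T.Setup β A₁ ε₀ c₂ D V C₁ C₂) (hω : T.Good β ε₀ c₂ D V C₁ C₂ φ ω)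
    {h : M × ℕ → ℝ} {A : ℝ} (hA : 0 ≤ A) (ht : T.Tame ε₀ ω A h)
    (h0 : ∀ y ∈ T.tower ω, 0 ≤ h y) {j : ℕ} (hc : T.Cone β (A₁ / (1 - β)) j ω h) {n : ℕ}
    (hn : j ≤ n) {x : M} (hx : (x, 0) ∈ T.tower (seqShift (n : ℤ) ω)) :
    T.trn ω n h (x, 0) ≤ Real.exp (A₁ / (1 - β)) * ∫ z, h z ∂(T.towerMeasure ω) := by
  obtain ⟨i0, i1, ⟨A', hA', i2⟩, i3⟩ := trn_spec hS hω hA ht h0 hc n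
  rw [Nat.sub_eq_zero_of_le hn] at i1
  have hm := i1.measOn hS hS.K_nonneg i0 hA' i2
  rw [← i3]
  exact i1.le_integral hS hS.K_nonneg i0 (i2.integrable hS.young (hω.shift hS n) hm) hm
    (hS.young.mem_tower_zero.1 hx)

theorem trn_up {h : M × ℕ → ℝ} (m : ℕ) (x : M) (ℓ : ℕ)
    (hz : (x, ℓ + 1) ∈ T.tower (seqShift ((m + 1 : ℕ) : ℤ) ω)) :
    T.trn ω (m + 1) h (x, ℓ + 1) = T.trn ω m h (x, ℓ) := by
  rw [← seqShift_succ] at hz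
  exact tr_succ _ hz

/-- The weight lies in the cone of order `0`, because it is constant on levels, so its iterates are
at most `e^K V` on the base at every time; `climb` carries this to the upper levels. -/
theorem Setup.wn_le (hS : T.Setup β A₁ ε₀ c₂ D V C₁ C₂) (hω : T.Good β ε₀ c₂ D V C₁ C₂ φ ω)
    (n : ℕ) : ∀ z ∈ T.tower (seqShift (n : ℤ) ω),
      T.trn ω n (wv ε₀) z ≤ unifConst β A₁ V * wv ε₀ z := by
  intro z hz
  have h1 := climb (T := T) (ω := ω) (ε₀ := ε₀) (g := fun n => T.trn ω n (wv ε₀))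
    (a := Real.exp (A₁ / (1 - β)) * V) (b := 1) hS.ε_pos.le
    (mul_nonneg (Real.exp_pos _).le hS.V_nonneg) (fun z _ => by rw [one_mul]; rfl) n
    (fun m _ _ x hx => (trn_base_le hS hω zero_le_one (tame_wv ε₀ ω)
      (fun y _ => (wv_pos ε₀ y).le) (cone_wv _ 0 hS.K_nonneg hS.β_pos) (Nat.zero_le m) hx).trans
      (mul_le_mul_of_nonneg_left (hω.integral_wv_le hS.V_nonneg) (Real.exp_pos _).le))
    zero_le_one (fun m x ℓ hz => (trn_up m x ℓ hz).le) z hz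
  refine h1.trans (mul_le_mul_of_nonneg_right ?_ (wv_pos ε₀ z).le)
  unfold unifConst
  have : Real.exp (-ε₀ * n) ≤ 1 := Real.exp_le_one_iff.2 (by
    have := hS.ε_pos
    have : 0 ≤ ε₀ * n := by positivity
    linarith)
  linarith

theorem Setup.wn_tame (hS : T.Setup β A₁ ε₀ c₂ D V C₁ C₂)
    (hω : T.Good β ε₀ c₂ D V C₁ C₂ φ ω) (n : ℕ) :
    T.Tame ε₀ (seqShift (n : ℤ) ω) (unifConst β A₁ V) (T.trn ω n (wv ε₀)) := by
  intro z hz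
  have h0 := (trn_spec hS hω zero_le_one (tame_wv ε₀ ω)
    (fun y _ => (wv_pos ε₀ y).le) (cone_wv _ 0 hS.K_nonneg hS.β_pos) n).1 z hz
  rw [Real.norm_of_nonneg h0]
  exact hS.wn_le hω n z hz

/-- Iterates of a function bounded by `A v` are bounded by `A` times the iterates of `v`. -/
theorem trn_le (hS : T.Setup β A₁ ε₀ c₂ D V C₁ C₂) (hω : T.Good β ε₀ c₂ D V C₁ C₂ φ ω)
    {h : M × ℕ → ℝ} {A : ℝ} (hA : 0 ≤ A) (ht : T.Tame ε₀ ω A h) (n : ℕ) :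
    ∀ z ∈ T.tower (seqShift (n : ℤ) ω), ‖T.trn ω n h z‖ ≤ A * T.trn ω n (wv ε₀) z := by
  induction n with
  | zero =>
    intro z hz
    rw [Nat.cast_zero, seqShift_zero] at hz
    exact ht z hz
  | succ n ih =>
    intro z hz
    rw [← seqShift_succ] at hz
    have hw := hS.wn_tame hω n
    have hw' : T.Tame ε₀ (seqShift (n : ℤ) ω) (A * unifConst β A₁ V)
        (fun z => A * T.trn ω n (wv ε₀) z) := fun z hz => by
      rw [norm_mul, Real.norm_of_nonneg hA, mul_assoc]
      exact mul_le_mul_of_nonneg_left (hw z hz) hA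
    have hg : T.Tame ε₀ (seqShift (n : ℤ) ω) (A * unifConst β A₁ V) (T.trn ω n h) :=
      fun z hz => (ih z hz).trans ((le_abs_self _).trans (hw' z hz))
    have := norm_tr_le hS.young hS.β_pos hS.β_lt_one hS.distortion hS.ε_lt
      (hω.shift hS n).tail hz hg hw' fun y hy => ih y hy.1
    refine this.trans (le_of_eq ?_)
    change _ = A * T.tr _ _ z
    rw [tr, tr, ← tsum_mul_left]
    refine tsum_congr fun y => ?_
    simp only [smul_eq_mul]; ring

theorem norm_Pn_le (hS : T.Setup β A₁ ε₀ c₂ D V C₁ C₂) (hω : T.Good β ε₀ c₂ D V C₁ C₂ φ ω)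
    {g : M × ℕ → ℂ} {A : ℝ} (hA : 0 ≤ A) (hg : T.Tame ε₀ ω A g) (t : ℝ) (n : ℕ) :
    ∀ z ∈ T.tower (seqShift (n : ℤ) ω), ‖T.Pn φ t ω n g z‖ ≤ A * T.trn ω n (wv ε₀) z := by
  induction n with
  | zero =>
    intro z hz
    rw [Nat.cast_zero, seqShift_zero] at hz
    exact hg z hz
  | succ n ih =>
    intro z hz
    rw [← seqShift_succ] at hz
    have hw := hS.wn_tame hω n
    have hw' : T.Tame ε₀ (seqShift (n : ℤ) ω) (A * unifConst β A₁ V)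
        (fun z => A * T.trn ω n (wv ε₀) z) := fun z hz => by
      rw [norm_mul, Real.norm_of_nonneg hA, mul_assoc]
      exact mul_le_mul_of_nonneg_left (hw z hz) hA
    have hg : T.Tame ε₀ (seqShift (n : ℤ) ω) (A * unifConst β A₁ V) (T.Pn φ t ω n g) :=
      fun z hz => (ih z hz).trans ((le_abs_self _).trans (hw' z hz))
    have := norm_tw_le hS.young hS.β_pos hS.β_lt_one hS.distortion hS.ε_lt
      (hω.shift hS n).tail hz φ t hg hw' fun y hy => ih y hy.1
    refine this.trans (le_of_eq ?_)
    change _ = A * T.tr _ _ z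
    rw [tr, tr, ← tsum_mul_left]
    refine tsum_congr fun y => ?_
    simp only [smul_eq_mul]; ring

/-- The functions bounded by `A v` and Lipschitz with constant `B v` on each atom. -/
structure Bd (T : RandomTower Ω₀ M) (β ε₀ : ℝ) (ω : ℤ → Ω₀) (A B : ℝ) (g : M × ℕ → ℂ) :
    Prop where
  tame : T.Tame ε₀ ω A g
  lip : T.DomLip β ω (wv ε₀) B g

theorem Bd.mono (hβ : 0 < β) {A B A' B' : ℝ} {g : M × ℕ → ℂ} (h : T.Bd β ε₀ ω A B g)
    (hA : A ≤ A') (hB : B ≤ B') : T.Bd β ε₀ ω A' B' g where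
  tame := h.tame.mono hA
  lip z hz z' hz' hs := (h.lip z hz z' hz' hs).trans (by
    have := wv_pos ε₀ z
    have := T.sepDist_nonneg hβ.le ω z z'
    gcongr)

theorem Bd.measOn (hS : T.Setup β A₁ ε₀ c₂ D V C₁ C₂) {A B : ℝ} (hB : 0 ≤ B) {g : M × ℕ → ℂ}
    (h : T.Bd β ε₀ ω A B g) : T.MeasOn ω g :=
  hS.young.measurable_of_lipschitz hS.β_pos hS.β_lt_one ω fun z hz =>
    ⟨B * wv ε₀ z, mul_nonneg hB (wv_pos ε₀ z).le, fun z' hz' hs => h.lip z hz z' hz' hs⟩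

/-- The constant of the Lasota--Yorke inequality. -/
noncomputable def lyConst (β A₁ C₂ t : ℝ) : ℝ :=
  (|t| * C₂ + Real.exp (A₁ / (1 - β)) * A₁) / (1 - β)

theorem Setup.lyConst_nonneg (hS : T.Setup β A₁ ε₀ c₂ D V C₁ C₂) (t : ℝ) :
    0 ≤ lyConst β A₁ C₂ t := by
  have h1 := hS.C₂_nonneg
  have h2 := hS.distortion.1
  refine div_nonneg (by positivity) (by linarith [hS.β_lt_one])

/-- Measuring Lipschitz constants relative to the iterates of `v` turns the one-step inequality into
the recursion `B ↦ β B + A (1 - β) lyConst`, whose fixed point is `A lyConst`. No constant is lost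
by iterating. -/
theorem Setup.domLip_Pn (hS : T.Setup β A₁ ε₀ c₂ D V C₁ C₂)
    (hω : T.Good β ε₀ c₂ D V C₁ C₂ φ ω) {A B : ℝ} (hA : 0 ≤ A)
    {g : M × ℕ → ℂ} (hg : T.Bd β ε₀ ω A B g) (t : ℝ) (n : ℕ) :
    T.DomLip β (seqShift (n : ℤ) ω) (T.trn ω n (wv ε₀))
      (β ^ n * B + A * lyConst β A₁ C₂ t) (T.Pn φ t ω n g) := by
  have hly := hS.lyConst_nonneg t
  have hβ₀ := hS.β_pos
  induction n with
  | zero =>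
    intro z hz z' hz' hs
    simp only [Nat.cast_zero, seqShift_zero] at hz hz' hs ⊢
    refine (hg.lip z hz z' hz' hs).trans ?_
    have h1 := wv_pos ε₀ z
    have h2 := T.sepDist_nonneg hβ₀.le ω z z'
    change _ ≤ _ * wv ε₀ z * _
    rw [pow_zero, one_mul]
    refine mul_le_mul_of_nonneg_right (mul_le_mul_of_nonneg_right ?_ h1.le) h2
    have : 0 ≤ A * lyConst β A₁ C₂ t := by positivity
    linarith
  | succ n ih =>
    intro z hz z' hz' hs
    have hsp := trn_spec hS hω zero_le_one (tame_wv ε₀ ω)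
      (fun y _ => (wv_pos ε₀ y).le) (cone_wv _ 1 hS.K_nonneg hS.β_pos) n
    have hω' := hω.shift hS n
    have hl := hω'.lip 0
    rw [seqShift_zero] at hl
    have h1 := ih.tw hS.young hS.β_pos hS.β_lt_one hS.distortion hS.ε_lt
      hω'.tail hS.C₂_nonneg hl t (hS.wn_tame hω n) hsp.1
      (hsp.2.1.mono (by omega)) hA (norm_Pn_le hS hω hA hg.tame t n)
      (z := z) (z' := z') (by rwa [seqShift_succ]) (by rwa [seqShift_succ])
      (by rw [seqShift_succ]; exact Or.inr hs)
    rw [seqShift_succ] at h1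
    refine h1.trans (le_of_eq ?_)
    change _ * T.tr _ _ z * _ = _ * T.tr _ _ z * _
    congr 2
    have : 1 - β ≠ 0 := by linarith [hS.β_lt_one]
    unfold lyConst
    field_simp
    ring

theorem Setup.bd_Pn (hS : T.Setup β A₁ ε₀ c₂ D V C₁ C₂)
    (hω : T.Good β ε₀ c₂ D V C₁ C₂ φ ω) {A B : ℝ} (hA : 0 ≤ A) (hB : 0 ≤ B)
    {g : M × ℕ → ℂ} (hg : T.Bd β ε₀ ω A B g) (t : ℝ) (n : ℕ) :
    T.Bd β ε₀ (seqShift (n : ℤ) ω) (unifConst β A₁ V * A)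
      (unifConst β A₁ V * (β ^ n * B + A * lyConst β A₁ C₂ t)) (T.Pn φ t ω n g) where
  tame z hz := by
    refine (norm_Pn_le hS hω hA hg.tame t n z hz).trans ?_
    have := mul_le_mul_of_nonneg_left (hS.wn_le hω n z hz) hA
    linarith
  lip z hz z' hz' hs := by
    refine (hS.domLip_Pn hω hA hg t n z hz z' hz' hs).trans ?_
    refine mul_le_mul_of_nonneg_right ?_ (T.sepDist_nonneg hS.β_pos.le _ _ _)
    have h1 : 0 ≤ β ^ n * B + A * lyConst β A₁ C₂ t := by
      have := hS.lyConst_nonneg t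
      have := hS.β_pos
      positivity
    have := mul_le_mul_of_nonneg_left (hS.wn_le hω n z hz) h1
    linarith

theorem birkhoff_succ (φ : (ℤ → Ω₀) → M × ℕ → ℝ) (ω : ℤ → Ω₀) (n : ℕ) (z : M × ℕ) :
    T.birkhoff φ ω (n + 1) z = φ ω z + T.birkhoff φ (seqShift 1 ω) n (T.F ω z) := by
  unfold birkhoff
  rw [Finset.sum_range_succ', add_comm]
  congr 1
  · simp [Fiter]
  · refine Finset.sum_congr rfl fun j _ => ?_
    rw [Fiter_succ', seqShift_seqShift]
    norm_cast

theorem IsYoungTower.measurable_birkhoff (hT : T.IsYoungTower β)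
    (hφ : Measurable (Function.uncurry φ)) (n : ℕ) :
    Measurable fun p : (ℤ → Ω₀) × (M × ℕ) => T.birkhoff φ p.1 n p.2 := by
  refine Finset.measurable_sum _ fun j _ => ?_
  exact hφ.comp (((measurable_seqShift (j : ℤ)).comp measurable_fst).prodMk
    (hT.measurable_Fiter j))

/-- The characteristic function of the Birkhoff sums in terms of the twisted transfer operators. -/
theorem Setup.integral_exp_birkhoff (hS : T.Setup β A₁ ε₀ c₂ D V C₁ C₂)
    (hφ : Measurable (Function.uncurry φ)) (t : ℝ) (n : ℕ) :
    ∀ {ω : ℤ → Ω₀}, T.Good β ε₀ c₂ D V C₁ C₂ φ ω → ∀ {A B : ℝ}, 0 ≤ A → 0 ≤ B →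
    ∀ {g : M × ℕ → ℂ}, T.Bd β ε₀ ω A B g →
    ∫ z, Complex.exp (Complex.I * t * (T.birkhoff φ ω n z : ℂ)) * g z ∂(T.towerMeasure ω)
      = ∫ z, T.Pn φ t ω n g z ∂(T.towerMeasure (seqShift (n : ℤ) ω)) := by
  have hT := hS.young
  induction n with
  | zero =>
    intro ω hω A B hA hB g hg
    simp [birkhoff, Pn]
  | succ n ih =>
    intro ω hω A B hA hB g hg
    -- `e^{itS_{n+1}}` is the product of `e^{itS_n}`, taken at `σω` and composed with `F_ω`, and of
    -- the phase of one step. The first factor comes out of the transfer operator, and the second is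
    -- absorbed into the twisted operator.
    let ψ : M × ℕ → ℂ := fun z =>
      Complex.exp (Complex.I * t * (T.birkhoff φ (seqShift 1 ω) n z : ℂ))
    let G : M × ℕ → ℂ := fun z => Complex.exp (Complex.I * t * (φ ω z : ℂ)) * g z
    have hψ : Measurable ψ := by
      have : Measurable fun z => T.birkhoff φ (seqShift 1 ω) n z :=
        (hT.measurable_birkhoff hφ n).comp measurable_prodMk_left
      exact Complex.measurable_exp.comp
        (measurable_const.mul (Complex.measurable_ofReal.comp this))
    have hF : Measurable (T.F ω) := hT.measurable_F.comp measurable_prodMk_left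
    have hφω : Measurable fun z => Complex.exp (Complex.I * t * (φ ω z : ℂ)) :=
      Complex.measurable_exp.comp (measurable_const.mul (Complex.measurable_ofReal.comp
        (hφ.comp measurable_prodMk_left)))
    have hGm : T.MeasOn ω G := (MeasOn.of_measurable hT hφω).mul (hg.measOn hS hB)
    have hm : T.MeasOn ω fun z => ψ (T.F ω z) * G z :=
      (MeasOn.of_measurable hT (hψ.comp hF)).mul hGm
    have htame : T.Tame ε₀ ω A fun z => ψ (T.F ω z) * G z := fun z hz => by
      simp only [ψ, G]
      rw [norm_mul, norm_mul, norm_exp_twist, norm_exp_twist, one_mul, one_mul]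
      exact hg.tame z hz
    have h1 := integral_tr hS hω htame hm
    have h2 : ∀ z, Complex.exp (Complex.I * t * (T.birkhoff φ ω (n + 1) z : ℂ)) * g z
        = ψ (T.F ω z) * G z := fun z => by
      simp only [ψ, G]
      rw [birkhoff_succ, ← mul_assoc, ← Complex.exp_add]
      congr 2
      push_cast; ring
    simp only [h2]
    rw [← h1]
    simp only [tr_comp_mul]
    -- The image of `g` after one step is again regular, at `σω` and with other constants; this is
    -- why the induction lets `ω`, `A`, `B` and `g` vary.
    have h3 := hS.bd_Pn hω hA hB hg t 1
    have hu := hS.one_le_unifConst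
    have hω1 := hω.shift hS 1
    have hPn1 : T.Pn φ t ω 1 g = T.tr ω G := by
      change T.tw φ t (seqShift ((0 : ℕ) : ℤ) ω) g = _
      rw [Nat.cast_zero, seqShift_zero]
      rfl
    rw [hPn1, Nat.cast_one] at h3
    have hl := hS.lyConst_nonneg t
    have hβ := hS.β_pos
    rw [ih hω1 (by positivity) (by positivity) h3, add_comm n 1, Pn_add, hPn1, seqShift_seqShift]
    congr 3
    push_cast
    ring

end

end RandomTower

/-! ### Atoms, returns and cylinders of `Δ_a` persist for `ω` near `a`. -/

namespace RandomTower

section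

variable {Ω₀ M : Type*} [MeasurableSpace Ω₀] [MeasurableSpace M] {T : RandomTower Ω₀ M} {β : ℝ}
  {φ : (ℤ → Ω₀) → M × ℕ → ℝ} {ω a : ℤ → Ω₀}

theorem tendsto_seqShift [TopologicalSpace Ω₀] (ha : ∀ k, seqShift k a = a) (k : ℤ) :
    Tendsto (seqShift k) (𝓝 a) (𝓝 a) := by
  have : Continuous (seqShift k : (ℤ → Ω₀) → ℤ → Ω₀) :=
    continuous_pi fun j => continuous_apply (j + k)
  have h := this.tendsto a
  rwa [ha] at h

theorem baseOp_eq_bR (n : ℕ) (g : M → ℂ) (x : M) : T.baseOp ω n g x = T.bR ω n g x := by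
  unfold baseOp bR
  refine tsum_congr fun y => ?_
  rw [Complex.real_smul, div_eq_inv_mul, Complex.ofReal_inv]

theorem bR_ofReal (n : ℕ) (g : M → ℝ) (x : M) :
    T.bR ω n (fun y => (g y : ℂ)) x = ((T.bR ω n g x : ℝ) : ℂ) := by
  unfold bR
  rw [Complex.ofReal_tsum]
  refine tsum_congr fun y => ?_
  rw [Complex.real_smul, smul_eq_mul, Complex.ofReal_mul]

theorem summable_bR (hT : T.IsYoungTower β) (hβ₀ : 0 < β) (hβ₁ : β < 1) {A₁ : ℝ}
    (hA : T.DistortionConst β A₁) (ω : ℤ → Ω₀) (n : ℕ) (x : M) {g : M → ℝ} {B : ℝ}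
    (hg : ∀ y ∈ T.base ω, |g y| ≤ B) :
    Summable fun y : T.Ret ω n x => (T.J ω y)⁻¹ • g y := by
  refine Summable.of_norm_bounded ((hT.summable_inv_J hβ₀ hβ₁ hA ω n x).mul_left B) fun y => ?_
  have hJ := (inv_pos.2 (hT.J_pos ω y y.2.1)).le
  rw [norm_smul, Real.norm_of_nonneg hJ, mul_comm]
  exact mul_le_mul_of_nonneg_right (hg y y.2.1) hJ

theorem inv_J_le_bR (hT : T.IsYoungTower β) (hβ₀ : 0 < β) (hβ₁ : β < 1) {A₁ : ℝ}
    (hA : T.DistortionConst β A₁) {n : ℕ} {g : M → ℝ} {B : ℝ}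
    (hg : ∀ y ∈ T.base ω, |g y| ≤ B) (h0 : ∀ y ∈ T.base ω, 0 ≤ g y) {y : M} (hy : y ∈ T.base ω)
    (hn : T.ret ω y = n) : (T.J ω y)⁻¹ * g y ≤ T.bR ω n g (T.orbit ω n y) :=
  (summable_bR hT hβ₀ hβ₁ hA ω n _ hg).le_tsum ⟨y, hy, hn, rfl⟩ fun y' _ =>
    smul_nonneg (inv_pos.2 (hT.J_pos ω y' y'.2.1)).le (h0 y' y'.2.1)

/-- Only one term of the sum is left for a function that vanishes off an atom. -/
theorem bR_eq_of_atom (hT : T.IsYoungTower β) {n j : ℕ} {g : M → ℝ}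
    (hg : ∀ y ∈ T.base ω, g y ≠ 0 → y ∈ T.Λ ω j) {y : M} (hy : y ∈ T.Λ ω j)
    (hn : T.ret ω y = n) : T.bR ω n g (T.orbit ω n y) = (T.J ω y)⁻¹ * g y := by
  have hb : y ∈ T.base ω := mem_base.2 ⟨j, hy⟩
  unfold bR
  rw [tsum_eq_single ⟨y, hb, hn, rfl⟩]
  · rfl
  · rintro ⟨b, hb1, hb2, hb3⟩ hne
    by_cases h : g b = 0
    · simp [h]
    · refine absurd (Subtype.ext ?_) hne
      have hbj := hg b hb1 h
      have hR : T.R ω j = n := by rw [← hn, hT.ret_eq hy]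
      have hinj := (hT.bijOn ω j ⟨y, hy⟩).injOn
      rw [hR] at hinj
      exact hinj hbj hy hb3

theorem Fiter_add (ω : ℤ → Ω₀) (n k : ℕ) (z : M × ℕ) :
    T.Fiter ω (n + k) z = T.Fiter (seqShift (n : ℤ) ω) k (T.Fiter ω n z) := by
  induction k with
  | zero => rfl
  | succ k ih =>
    change T.F (seqShift ((n + k : ℕ) : ℤ) ω) (T.Fiter ω (n + k) z) = T.F _ _
    rw [ih, seqShift_seqShift, seqShift_congr (show ((n + k : ℕ) : ℤ) = k + n by push_cast; ring)]

theorem SameCylinder.Fiter {n k : ℕ} {z z' : M × ℕ} (h : T.SameCylinder ω (n + k) z z') :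
    T.SameCylinder (seqShift (n : ℤ) ω) k (T.Fiter ω n z) (T.Fiter ω n z') := by
  intro j hj
  have := h (n + j) (by omega)
  rw [Fiter_add, Fiter_add] at this
  rwa [seqShift_seqShift, seqShift_congr (show (j : ℤ) + n = ((n + j : ℕ) : ℤ) by push_cast; ring)]

theorem Fiter_of_lt {x : M} (m : ℕ) (h : m < T.ret ω x) : T.Fiter ω m (x, 0) = (x, m) := by
  induction m with
  | zero => rfl
  | succ m ih =>
    change T.F _ (T.Fiter ω m (x, 0)) = _
    rw [ih (by omega)]
    refine F_of_lt ?_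
    rw [seqShift_seqShift, seqShift_congr (show -(m : ℤ) + m = 0 by ring), seqShift_zero]
    exact h

theorem IsYoungTower.Fiter_ret (hT : T.IsYoungTower β) {x : M} (hx : x ∈ T.base ω) :
    T.Fiter ω (T.ret ω x) (x, 0) = (T.orbit ω (T.ret ω x) x, 0) := by
  obtain ⟨m, hm⟩ := Nat.exists_eq_succ_of_ne_zero (hT.ret_pos hx).ne'
  rw [hm]
  change T.F _ (T.Fiter ω m (x, 0)) = _
  rw [Fiter_of_lt m (by omega)]
  have e : seqShift (-(m : ℤ)) (seqShift (m : ℤ) ω) = ω := by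
    rw [seqShift_seqShift, seqShift_congr (show -(m : ℤ) + m = 0 by ring), seqShift_zero]
  rw [F_of_eq (by rw [e, hm]), e]

theorem sameAtom_base {x y : M} :
    T.SameAtom ω (x, 0) (y, 0) ↔ ∃ i, x ∈ T.Λ ω i ∧ y ∈ T.Λ ω i := by
  simp [SameAtom, seqShift_zero]

theorem SameCylinder.sameAtom {n : ℕ} (hn : 0 < n) {z z' : M × ℕ}
    (h : T.SameCylinder ω n z z') : T.SameAtom ω z z' := by
  have := h 0 hn
  rwa [Nat.cast_zero, seqShift_zero] at this

/-- Points in different cylinders of order `k` are at distance at least `β^k`, so functions constant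
on cylinders are admissible tests for the convergence of the operators. -/
theorem lipOnBase_of_cylinder (hβ₀ : 0 < β) (hβ₁ : β < 1) {g : M → ℂ}
    {B : ℝ} (hB : ∀ x ∈ T.base a, ‖g x‖ ≤ B) (k : ℕ)
    (hg : ∀ x ∈ T.base a, ∀ y ∈ T.base a, T.SameCylinder a k (x, 0) (y, 0) → g x = g y) :
    T.LipOnBase β a g := by
  refine ⟨B + 2 * B / β ^ k, fun x hx => ⟨?_, fun y hy => ?_⟩⟩
  · have hB0 : 0 ≤ B := (norm_nonneg _).trans (hB x hx)
    have : 0 ≤ 2 * B / β ^ k := by positivity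
    linarith [hB x hx]
  · have hB0 : 0 ≤ B := (norm_nonneg _).trans (hB x hx)
    by_cases h : T.SameCylinder a k (x, 0) (y, 0)
    · rw [hg x hx y hy h, sub_self, norm_zero]
      exact mul_nonneg (by positivity) (T.sepDist_nonneg hβ₀.le _ _ _)
    · have h1 := le_sepDist_of_not_sameCylinder (T := T) hβ₀ hβ₁ h
      have h2 : ‖g x - g y‖ ≤ 2 * B := (norm_sub_le _ _).trans (by linarith [hB x hx, hB y hy])
      refine h2.trans ?_
      calc 2 * B = 2 * B / β ^ k * β ^ k := by field_simp
        _ ≤ (B + 2 * B / β ^ k) * T.sepDist β a (x, 0) (y, 0) :=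
          mul_le_mul (by linarith) h1 (by positivity) (by positivity)

section near

variable [TopologicalSpace Ω₀] (ha : ∀ k, seqShift k a = a) (hT : T.IsYoungTower β)
  (hβ₀ : 0 < β) (hβ₁ : β < 1) {A₁ : ℝ} (hA : T.DistortionConst β A₁)
  (hc : T.ContinuousAtSeq β φ a)

include hc hβ₀ hβ₁

/-- The operators of the base converge uniformly on the real functions that are constant on the
cylinders of some order. -/
theorem eventually_bR (n : ℕ) {g : M → ℝ} {B : ℝ} (hB : ∀ x ∈ T.base a, |g x| ≤ B) (k : ℕ)
    (hg : ∀ x ∈ T.base a, ∀ y ∈ T.base a, T.SameCylinder a k (x, 0) (y, 0) → g x = g y)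
    {η : ℝ} (hη : 0 < η) :
    ∀ᶠ ω in 𝓝 a, ∀ x ∈ T.base a, |T.bR ω n g x - T.bR a n g x| < η := by
  have h1 : T.LipOnBase β a fun y => (g y : ℂ) :=
    lipOnBase_of_cylinder hβ₀ hβ₁ (B := B)
      (fun x hx => by rw [Complex.norm_real]; exact hB x hx) k
      fun x hx y hy h => by rw [hg x hx y hy h]
  have h2 := Metric.tendstoUniformlyOn_iff.1 (hc.operators n _ h1) η hη
  filter_upwards [h2] with ω hω x hx
  have := hω x hx
  rw [baseOp_eq_bR, baseOp_eq_bR, bR_ofReal, bR_ofReal, dist_comm, Complex.dist_eq,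
    ← Complex.ofReal_sub, Complex.norm_real] at this
  exact this

include hT hA

omit hc in
theorem indicator_atom_const (i : ℕ) : ∀ x ∈ T.base a, ∀ y ∈ T.base a,
    T.SameCylinder a 1 (x, 0) (y, 0) →
      (T.Λ a i).indicator (fun _ => (1 : ℝ)) x = (T.Λ a i).indicator (fun _ => (1 : ℝ)) y := by
  intro x _ y _ h
  obtain ⟨j, hj, hj'⟩ := sameAtom_base.1 (h.sameAtom one_pos)
  by_cases hij : i = j
  · subst hij
    rw [indicator_of_mem hj, indicator_of_mem hj']
  · rw [indicator_of_notMem fun h => hij (hT.atom_unique h hj),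
      indicator_of_notMem fun h => hij (hT.atom_unique h hj')]

/-- The operators are tested on the indicator of `Λ_{a,i}` at the return of `y`. At `a` the value is
at least `1/J_a(y) > 0`, so for `ω` near `a` some point of `Λ_{a,i}` still returns to the same place
at the same time. As `Λ_{a,i}` lies in one atom of `ω`, all its points share that return time. -/
theorem eventually_atom {i : ℕ} {y : M} (hy : y ∈ T.Λ a i) :
    ∀ᶠ ω in 𝓝 a, (∃ j, T.Λ a i ⊆ T.Λ ω j) ∧ (∀ y' ∈ T.Λ a i, T.ret ω y' = T.R a i) ∧
      ∃ y' ∈ T.Λ a i, T.orbit ω (T.R a i) y' = T.orbit a (T.R a i) y ∧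
        (T.J a y)⁻¹ / 2 ≤ (T.J ω y')⁻¹ := by
  have hyb : y ∈ T.base a := mem_base.2 ⟨i, hy⟩
  have hJ := inv_pos.2 (hT.J_pos a y hyb)
  have hxb : T.orbit a (T.R a i) y ∈ T.base a := by
    have := hT.orbit_mem_base hyb
    rw [hT.ret_eq hy] at this
    rwa [hT.base_eq _ a] at this
  set g : M → ℝ := (T.Λ a i).indicator fun _ => (1 : ℝ) with hg
  have hgB : ∀ y, |g y| ≤ 1 := fun y => by
    rw [hg]; unfold indicator; split_ifs <;> simp
  have h1 := eventually_bR hβ₀ hβ₁ hc (T.R a i) (g := g) (fun x _ => hgB x) 1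
    (indicator_atom_const hT hβ₀ hβ₁ hA i) (half_pos hJ)
  filter_upwards [hc.atoms i, h1] with ω ⟨j, hj⟩ h2
  have h3 := (abs_lt.1 (h2 _ hxb)).1
  have h4 : (T.J a y)⁻¹ ≤ T.bR a (T.R a i) g (T.orbit a (T.R a i) y) := by
    have := inv_J_le_bR hT hβ₀ hβ₁ hA (g := g) (fun y _ => hgB y)
      (fun y _ => indicator_nonneg (fun _ _ => zero_le_one) y) hyb (hT.ret_eq hy)
    rw [hg, indicator_of_mem hy, mul_one] at this
    exact this
  have h5 : (T.J a y)⁻¹ / 2 < T.bR ω (T.R a i) g (T.orbit a (T.R a i) y) := by linarith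
  have h6 : ∃ y' ∈ T.Λ a i, T.ret ω y' = T.R a i ∧
      T.orbit ω (T.R a i) y' = T.orbit a (T.R a i) y := by
    by_contra hne
    push Not at hne
    have : T.bR ω (T.R a i) g (T.orbit a (T.R a i) y) = 0 := by
      unfold bR
      refine (tsum_congr fun b => ?_).trans tsum_zero
      rw [hg, indicator_of_notMem (fun hb => hne b hb b.2.2.1 b.2.2.2), smul_zero]
    linarith
  obtain ⟨y', hy', hr, ho⟩ := h6
  refine ⟨⟨j, hj⟩, fun u hu => ?_, y', hy', ho, ?_⟩
  · rw [hT.ret_eq (hj hu), ← hT.ret_eq (hj hy'), hr]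
  · rw [← ho, bR_eq_of_atom hT (j := j) (fun u _ hu => hj ?_) (hj hy') hr, hg,
      indicator_of_mem hy', mul_one] at h5
    · exact h5.le
    · by_contra h
      exact hu (indicator_of_notMem h _)

include ha

/-- The test function is the indicator of `D`, the points of the atom whose return under `a` lies in
a given cylinder of order `k`. If a point of `D` returned under `ω` outside that cylinder, then at
its image the operator of `a` would vanish while that of `ω` would be at least `1/J_ω(y')`.
Distortion bounds the latter from below, which contradicts uniform closeness. -/
theorem eventually_return (k : ℕ) {i : ℕ} {y : M} (hy : y ∈ T.Λ a i) :
    ∀ᶠ ω in 𝓝 a, ∀ y' ∈ T.Λ a i,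
      T.SameCylinder a k (T.orbit a (T.R a i) y, 0) (T.orbit a (T.R a i) y', 0) →
      T.SameCylinder a k (T.orbit a (T.R a i) y, 0) (T.orbit ω (T.R a i) y', 0) := by
  set n := T.R a i with hn
  have hyb : y ∈ T.base a := mem_base.2 ⟨i, hy⟩
  have hJ := inv_pos.2 (hT.J_pos a y hyb)
  have hA1 : 0 < 1 + A₁ := by have := hA.1; positivity
  set D : Set M := {y' | y' ∈ T.Λ a i ∧
    T.SameCylinder a k (T.orbit a n y, 0) (T.orbit a n y', 0)} with hD
  set g : M → ℝ := D.indicator fun _ => (1 : ℝ) with hg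
  have hgB : ∀ y, |g y| ≤ 1 := fun y => by
    rw [hg]; unfold indicator; split_ifs <;> simp
  -- `D` is a union of cylinders: two points in a common cylinder of order `n + k` have returns at
  -- time `n` in a common cylinder of order `k`.
  have hDc : ∀ u v, T.SameCylinder a (n + k + 1) (u, 0) (v, 0) → u ∈ D → v ∈ D := by
    rintro u v h ⟨hu, hu'⟩
    obtain ⟨j, hj, hj'⟩ := sameAtom_base.1 (h.sameAtom (Nat.succ_pos _))
    obtain rfl := hT.atom_unique hu hj
    refine ⟨hj', hT.sameCylinder_trans hu' ?_⟩
    have h2 := (h.mono (Nat.le_succ _)).Fiter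
    rw [hn, ← hT.ret_eq hj, hT.Fiter_ret (mem_base.2 ⟨i, hj⟩), hT.ret_eq hj, ← hT.ret_eq hj',
      hT.Fiter_ret (mem_base.2 ⟨i, hj'⟩), hT.ret_eq hj', ha] at h2
    exact h2
  have h1 := eventually_bR hβ₀ hβ₁ hc n (g := g) (fun x _ => hgB x) (n + k + 1)
    (fun u _ v _ h => by
      by_cases hu : u ∈ D
      · rw [hg, indicator_of_mem hu, indicator_of_mem (hDc u v h hu)]
      · rw [hg, indicator_of_notMem hu, indicator_of_notMem fun hv => hu (hDc v u h.symm hv)])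
    -- Half of the lower bound for `1/J_ω(y')`: one factor `1/2` is lost in passing from `a` to `ω`
    -- at the point `w`, and `1 + A₁` in passing from `w` to `y'`.
    (show 0 < (T.J a y)⁻¹ / 2 / (1 + A₁) / 2 by positivity)
  filter_upwards [h1, eventually_atom hT hβ₀ hβ₁ hA hc hy] with ω hω ⟨⟨j, hj⟩, hr, w, hw, _, hJw⟩
  intro y' hy' hs
  by_contra hne
  have hy'b : y' ∈ T.base ω := mem_base.2 ⟨j, hj hy'⟩
  have hmem : T.orbit ω n y' ∈ T.base a := by
    have := hT.orbit_mem_base hy'b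
    rw [hr y' hy'] at this
    rwa [hT.base_eq _ a] at this
  have h2 := (abs_lt.1 (hω _ hmem)).2
  have h3 := inv_J_le_bR hT hβ₀ hβ₁ hA (g := g) (fun y _ => hgB y)
    (fun y _ => indicator_nonneg (fun _ _ => zero_le_one) y) hy'b (hr y' hy')
  rw [hg, indicator_of_mem (show y' ∈ D from ⟨hy', hs⟩), mul_one, ← hg] at h3
  have h4 : T.bR a n g (T.orbit ω n y') = 0 := by
    unfold bR
    refine (tsum_congr fun b => ?_).trans tsum_zero
    rw [hg, indicator_of_notMem, smul_zero]
    rintro ⟨-, hb⟩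
    rw [b.2.2.2] at hb
    exact hne hb
  have h5 := hA.div_le hβ₀ hβ₁ (hj hy') (hj hw)
  have hJ' := hT.J_pos ω y' hy'b
  have hJw' := hT.J_pos ω w (mem_base.2 ⟨j, hj hw⟩)
  have h6 : (T.J ω w)⁻¹ ≤ (1 + A₁) * (T.J ω y')⁻¹ := by
    rw [div_le_iff₀ hJw'] at h5
    rw [inv_le_comm₀ hJw' (by positivity), mul_inv, inv_inv, ← div_eq_inv_mul, div_le_iff₀ hA1]
    linarith
  have h7 : (T.J a y)⁻¹ / 2 / (1 + A₁) ≤ (T.J ω y')⁻¹ := by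
    rw [div_le_iff₀ hA1]; linarith
  have h8 : 0 < (T.J a y)⁻¹ / 2 / (1 + A₁) := by positivity
  rw [h4] at h2
  linarith

theorem eventually_sameAtom {z : M × ℕ} (hz : z ∈ T.tower a) :
    ∀ᶠ ω in 𝓝 a, z ∈ T.tower ω ∧ ∀ z', T.SameAtom a z z' → T.SameAtom ω z z' := by
  obtain ⟨x, ℓ⟩ := z
  have hz' := mem_tower.1 hz
  rw [ha] at hz'
  obtain ⟨i, hi⟩ := mem_base.1 hz'.1
  have h1 := (tendsto_seqShift ha (-(ℓ : ℤ))).eventually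
    (eventually_atom hT hβ₀ hβ₁ hA hc hi)
  filter_upwards [h1] with ω ⟨⟨j, hj⟩, hr, _⟩
  refine ⟨mem_tower.2 ⟨mem_base.2 ⟨j, hj hi⟩, ?_⟩, ?_⟩
  · rw [hr x hi, ← hT.ret_eq hi]; exact hz'.2
  · rintro ⟨x', ℓ'⟩ ⟨h, i', hi1, hi2⟩
    obtain rfl : ℓ = ℓ' := h
    simp only [ha] at hi1 hi2
    obtain rfl := hT.atom_unique hi hi1
    exact ⟨rfl, j, hj hi1, hj hi2⟩

/-- The cylinder of `Δ_a` around a point is contained in the corresponding cylinder of `Δ_ω`, for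
`ω` near `a`. -/
theorem eventually_sameCylinder (k : ℕ) : ∀ {z : M × ℕ}, z ∈ T.tower a →
    ∀ᶠ ω in 𝓝 a, ∀ z', T.SameCylinder a k z z' → T.SameCylinder ω k z z' := by
  induction k with
  | zero => exact fun _ => Eventually.of_forall fun ω z' _ => sameCylinder_zero ω _ z'
  | succ k ih =>
    intro z hz
    have hFz : T.F a z ∈ T.tower a := by
      have := hT.mapsTo_F hz
      rwa [ha] at this
    have h1 := (tendsto_seqShift ha 1).eventually (ih hFz)
    obtain ⟨x, ℓ⟩ := z
    have hz' := mem_tower.1 hz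
    rw [ha] at hz'
    obtain ⟨i, hi⟩ := mem_base.1 hz'.1
    have h2 := (tendsto_seqShift ha (-(ℓ : ℤ))).eventually
      (eventually_atom hT hβ₀ hβ₁ hA hc hi)
    have h3 := (tendsto_seqShift ha (-(ℓ : ℤ))).eventually
      (eventually_return ha hT hβ₀ hβ₁ hA hc k hi)
    filter_upwards [eventually_sameAtom ha hT hβ₀ hβ₁ hA hc hz, h1, h2, h3]
      with ω hω1 hω2 ⟨_, hr, _⟩ hω3 z' hs
    rw [sameCylinder_succ, ha] at hs
    refine sameCylinder_succ.2 ⟨hω1.2 z' hs.1, ?_⟩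
    obtain ⟨x', ℓ'⟩ := z'
    obtain ⟨⟨h, i', hi1, hi2⟩, hs2⟩ := hs
    obtain rfl : ℓ = ℓ' := h
    simp only [ha] at hi1 hi2
    obtain rfl := hT.atom_unique hi hi1
    have hra := hT.ret_eq hi1
    have hra' := hT.ret_eq hi2
    rcases hz'.2.lt_or_eq with hlt | heq
    · have e1 : T.F a (x, ℓ) = (x, ℓ + 1) := F_of_lt (by rw [ha]; exact hlt)
      have e2 : T.F a (x', ℓ) = (x', ℓ + 1) := F_of_lt (by rw [ha, hra', ← hra]; exact hlt)
      have e3 : T.F ω (x, ℓ) = (x, ℓ + 1) := F_of_lt (by rw [hr x hi1, ← hra]; exact hlt)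
      have e4 : T.F ω (x', ℓ) = (x', ℓ + 1) := F_of_lt (by rw [hr x' hi2, ← hra]; exact hlt)
      rw [e1, e2] at hs2
      rw [e1] at hω2
      rw [e3, e4]
      exact hω2 _ hs2
    · have hRℓ : T.R a i = ℓ + 1 := by rw [← hra, ← heq]
      have e1 : T.F a (x, ℓ) = (T.orbit a (ℓ + 1) x, 0) := by
        rw [F_of_eq (by rw [ha, ← heq]), ha]
      have e2 : T.F a (x', ℓ) = (T.orbit a (ℓ + 1) x', 0) := by
        rw [F_of_eq (by rw [ha, hra', hRℓ]), ha]
      have e3 : T.F ω (x, ℓ) = (T.orbit (seqShift (-(ℓ : ℤ)) ω) (ℓ + 1) x, 0) :=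
        F_of_eq (by rw [hr x hi1, hRℓ])
      have e4 : T.F ω (x', ℓ) = (T.orbit (seqShift (-(ℓ : ℤ)) ω) (ℓ + 1) x', 0) :=
        F_of_eq (by rw [hr x' hi2, hRℓ])
      rw [hRℓ] at hω3
      rw [e1, e2] at hs2
      rw [e1] at hω2 hFz
      rw [e3, e4]
      -- Under `ω` both points return into the cylinder of `Δ_a` around `F_a z`. The induction
      -- hypothesis at `F_a z` places both returns in one cylinder of the tower at `σω`.
      have h5 := hω3 x hi1 (hT.sameCylinder_refl hFz k)
      have h6 := hω3 x' hi2 hs2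
      exact hT.sameCylinder_trans (hω2 _ h5).symm (hω2 _ h6)

/-- No closeness in `M` is involved: the two images merely share a long cylinder, and this is enough
for functions that are Lipschitz in the separation distance. -/
theorem eventually_F_close (k : ℕ) {y : M × ℕ} (hy : y ∈ T.tower a) :
    ∀ᶠ ω in 𝓝 a, T.SameCylinder (seqShift 1 ω) k (T.F a y) (T.F ω y) := by
  have hFy : T.F a y ∈ T.tower a := by
    have := hT.mapsTo_F hy
    rwa [ha] at this
  have h1 := (tendsto_seqShift ha 1).eventually
    (eventually_sameCylinder ha hT hβ₀ hβ₁ hA hc k hFy)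
  obtain ⟨x, ℓ⟩ := y
  have hz' := mem_tower.1 hy
  rw [ha] at hz'
  obtain ⟨i, hi⟩ := mem_base.1 hz'.1
  have h2 := (tendsto_seqShift ha (-(ℓ : ℤ))).eventually
    (eventually_atom hT hβ₀ hβ₁ hA hc hi)
  have h3 := (tendsto_seqShift ha (-(ℓ : ℤ))).eventually
    (eventually_return ha hT hβ₀ hβ₁ hA hc k hi)
  filter_upwards [h1, h2, h3] with ω hω1 ⟨_, hr, _⟩ hω3
  refine hω1 _ ?_
  have hra := hT.ret_eq hi
  rcases hz'.2.lt_or_eq with hlt | heq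
  · have e1 : T.F a (x, ℓ) = (x, ℓ + 1) := F_of_lt (by rw [ha]; exact hlt)
    have e3 : T.F ω (x, ℓ) = (x, ℓ + 1) := F_of_lt (by rw [hr x hi, ← hra]; exact hlt)
    rw [e1] at hFy ⊢
    rw [e3]
    exact hT.sameCylinder_refl hFy k
  · have hRℓ : T.R a i = ℓ + 1 := by rw [← hra, ← heq]
    have e1 : T.F a (x, ℓ) = (T.orbit a (ℓ + 1) x, 0) := by
      rw [F_of_eq (by rw [ha, ← heq]), ha]
    have e3 : T.F ω (x, ℓ) = (T.orbit (seqShift (-(ℓ : ℤ)) ω) (ℓ + 1) x, 0) :=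
      F_of_eq (by rw [hr x hi, hRℓ])
    rw [e1] at hFy ⊢
    rw [e3]
    rw [hRℓ] at hω3
    exact hω3 x hi (hT.sameCylinder_refl hFy k)

omit ha in
/-- The return times outside finitely many atoms of `a` contribute little, uniformly near `a`. -/
theorem eventually_bR_tail (n : ℕ) {η : ℝ} (hη : 0 < η) :
    ∃ I : Finset ℕ, ∀ᶠ ω in 𝓝 a, ∀ x ∈ T.base a,
      T.bR ω n ((⋃ i ∈ I, T.Λ a i)ᶜ.indicator fun _ => (1 : ℝ)) x ≤ η := by
  have hA1 : 0 < 1 + A₁ := by have := hA.1; positivity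
  have htail := tendsto_tsum_compl_atTop_zero fun i => (T.m a (T.Λ a i)).toReal
  -- `I` leaves out atoms of total mass so small that the sum at `a` is at most `η/2`; uniform
  -- convergence accounts for the other half.
  obtain ⟨I, hI⟩ := (htail.eventually (gt_mem_nhds
    (show 0 < η / 2 / (1 + A₁) by positivity))).exists
  refine ⟨I, ?_⟩
  set g : M → ℝ := (⋃ i ∈ I, T.Λ a i)ᶜ.indicator fun _ => (1 : ℝ) with hg
  have hgB : ∀ y, |g y| ≤ 1 := fun y => by
    rw [hg]; unfold indicator; split_ifs <;> simp
  have hconst : ∀ u v, T.SameCylinder a 1 (u, 0) (v, 0) →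
      u ∈ (⋃ i ∈ I, T.Λ a i) → v ∈ ⋃ i ∈ I, T.Λ a i := by
    intro u v h hu
    obtain ⟨j, hj, hj'⟩ := sameAtom_base.1 (h.sameAtom one_pos)
    obtain ⟨i, hiI, hi⟩ := mem_iUnion₂.1 hu
    obtain rfl := hT.atom_unique hi hj
    exact mem_iUnion₂.2 ⟨i, hiI, hj'⟩
  have h1 := eventually_bR hβ₀ hβ₁ hc n (g := g) (fun x _ => hgB x) 1
    (fun u _ v _ h => by
      by_cases hu : u ∈ ⋃ i ∈ I, T.Λ a i
      · rw [hg, indicator_of_notMem (notMem_compl_iff.2 hu),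
          indicator_of_notMem (notMem_compl_iff.2 (hconst u v h hu))]
      · rw [hg, indicator_of_mem (mem_compl hu),
          indicator_of_mem (mem_compl fun hv => hu (hconst v u h.symm hv))])
    (half_pos hη)
  filter_upwards [h1] with ω hω x hx
  have h2 := (abs_lt.1 (hω x hx)).2
  have h3 : T.bR a n g x ≤ (1 + A₁) * ∑' i : ((↑I : Set ℕ)ᶜ : Set ℕ), (T.m a (T.Λ a i)).toReal := by
    refine hT.bR_le_of_index hβ₀ hβ₁ hA a n x _ g ?_ fun y => (le_abs_self _).trans (hgB y)
    intro y i hi hy _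
    rw [hg, indicator_of_notMem]
    rw [notMem_compl_iff] at hi ⊢
    exact mem_iUnion₂.2 ⟨i, hi, hy⟩
  have h4 : (1 + A₁) * ∑' i : ((↑I : Set ℕ)ᶜ : Set ℕ), (T.m a (T.Λ a i)).toReal ≤ η / 2 := by
    have h5 : ∑' i : ((↑I : Set ℕ)ᶜ : Set ℕ), (T.m a (T.Λ a i)).toReal ≤ η / 2 / (1 + A₁) := hI.le
    have := mul_le_mul_of_nonneg_left h5 hA1.le
    rwa [mul_div_cancel₀ _ hA1.ne'] at this
  linarith

end near

end

end RandomTower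

/-! ### Smallness, upper bounds and limits pass through the transfer operators near `a`. -/

namespace RandomTower

section

variable {Ω₀ M : Type*} [MeasurableSpace Ω₀] [MeasurableSpace M] {T : RandomTower Ω₀ M} {β : ℝ}
  {φ : (ℤ → Ω₀) → M × ℕ → ℝ} {ω a : ℤ → Ω₀} {A₁ ε₀ c₂ D V C₁ C₂ : ℝ}

theorem bR_mono (hT : T.IsYoungTower β) (hβ₀ : 0 < β) (hβ₁ : β < 1)
    (hA : T.DistortionConst β A₁) (ω : ℤ → Ω₀) (n : ℕ) (x : M) {g h : M → ℝ} {B B' : ℝ}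
    (hg : ∀ y ∈ T.base ω, |g y| ≤ B) (hh : ∀ y ∈ T.base ω, |h y| ≤ B')
    (hle : ∀ y ∈ T.base ω, T.ret ω y = n → T.orbit ω n y = x → g y ≤ h y) :
    T.bR ω n g x ≤ T.bR ω n h x :=
  Summable.tsum_le_tsum (fun y => mul_le_mul_of_nonneg_left (hle y y.2.1 y.2.2.1 y.2.2.2)
    (inv_pos.2 (hT.J_pos ω y y.2.1)).le) (summable_bR hT hβ₀ hβ₁ hA ω n x hg)
    (summable_bR hT hβ₀ hβ₁ hA ω n x hh)

theorem bR_linear (hT : T.IsYoungTower β) (hβ₀ : 0 < β) (hβ₁ : β < 1)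
    (hA : T.DistortionConst β A₁) (ω : ℤ → Ω₀) (n : ℕ) (x : M) {g h : M → ℝ} {B B' : ℝ}
    (hg : ∀ y ∈ T.base ω, |g y| ≤ B) (hh : ∀ y ∈ T.base ω, |h y| ≤ B') (c d : ℝ) :
    T.bR ω n (fun y => c * g y + d * h y) x = c * T.bR ω n g x + d * T.bR ω n h x := by
  unfold bR
  rw [← tsum_mul_left, ← tsum_mul_left, ← Summable.tsum_add
    ((summable_bR hT hβ₀ hβ₁ hA ω n x hg).mul_left c)
    ((summable_bR hT hβ₀ hβ₁ hA ω n x hh).mul_left d)]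
  refine tsum_congr fun y => ?_
  simp only [smul_eq_mul]; ring

theorem norm_bR_le {E : Type*} [NormedAddCommGroup E] [NormedSpace ℝ E]
    (hT : T.IsYoungTower β) (hβ₀ : 0 < β) (hβ₁ : β < 1)
    (hA : T.DistortionConst β A₁) (hD : T.TowerTail D c₂ ω) {x : M} (hx : x ∈ T.base ω) (ℓ : ℕ)
    {g : M → E} {B : ℝ} (hB : 0 ≤ B)
    (hg : ∀ y ∈ T.base (seqShift (-(ℓ : ℤ)) ω), T.ret (seqShift (-(ℓ : ℤ)) ω) y = ℓ + 1 →
      ‖g y‖ ≤ B) :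
    ‖T.bR (seqShift (-(ℓ : ℤ)) ω) (ℓ + 1) g x‖ ≤ B * (D * Real.exp (-c₂ * (ℓ + 1 : ℕ))) := by
  set ω' := seqShift (-(ℓ : ℤ)) ω with hω'
  have h1 := hD (-(ℓ : ℤ)) (ℓ + 1) (Nat.succ_pos _) x hx
  refine le_trans ?_ (mul_le_mul_of_nonneg_left h1 hB)
  have hs := (hT.summable_inv_J hβ₀ hβ₁ hA ω' (ℓ + 1) x).mul_left B
  have hle : ∀ y : T.Ret ω' (ℓ + 1) x, ‖(T.J ω' y)⁻¹ • g y‖ ≤ B * (T.J ω' y)⁻¹ := fun y => by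
    have hJ := (inv_pos.2 (hT.J_pos ω' y y.2.1)).le
    rw [norm_smul, Real.norm_of_nonneg hJ, mul_comm]
    exact mul_le_mul_of_nonneg_right (hg y y.2.1 y.2.2.1) hJ
  refine (tsum_of_norm_bounded hs.hasSum hle).trans (le_of_eq ?_)
  rw [tsum_mul_left, bR]
  congr 1
  exact tsum_congr fun y => (mul_one _).symm

section near

variable [TopologicalSpace Ω₀] (ha : ∀ k, seqShift k a = a)
  (hS : T.Setup β A₁ ε₀ c₂ D V C₁ C₂) (hc : T.ContinuousAtSeq β φ a)
  {ι : Type*} {l : Filter ι} {Ω : ι → ℤ → Ω₀} (hΩ : Tendsto Ω l (𝓝 a))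
  (hD : ∀ᶠ i in l, T.TowerTail D c₂ (Ω i))

include ha hS hc hΩ hD

/-- All but finitely many atoms of `a` contribute little, by `eventually_bR_tail`. Each remaining
atom with return time `ℓ + 1` contains a preimage of `x`, where the smallness hypothesis applies.
The others return at another time, also under `ω` near `a`, and contribute nothing. -/
theorem eventually_bR_small {u : ι → M → ℝ} {B : ℝ} (hB : 0 ≤ B) (ℓ : ℕ)
    (hu : ∀ᶠ i in l, ∀ y ∈ T.base (seqShift (-(ℓ : ℤ)) (Ω i)),
      T.ret (seqShift (-(ℓ : ℤ)) (Ω i)) y = ℓ + 1 → 0 ≤ u i y ∧ u i y ≤ B)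
    {x : M} (hx : x ∈ T.base a) {X : ι → Set M}
    (h : ∀ y, (y, ℓ) ∈ T.fib a (x, 0) → ∀ η > 0, ∀ᶠ i in l, ∀ y', T.SameAtom a (y, ℓ) (y', ℓ) →
      ∀ x' ∈ X i, (y', ℓ) ∈ T.fib (Ω i) (x', 0) → u i y' ≤ η) {η : ℝ} (hη : 0 < η) :
    ∀ᶠ i in l, ∀ x' ∈ X i, x' ∈ T.base a →
      T.bR (seqShift (-(ℓ : ℤ)) (Ω i)) (ℓ + 1) (u i) x' ≤ η := by
  have hT := hS.young
  have hD0 := hS.D_nonneg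
  have hΩℓ : Tendsto (fun i => seqShift (-(ℓ : ℤ)) (Ω i)) l (𝓝 a) :=
    (tendsto_seqShift ha _).comp hΩ
  obtain ⟨I, hI⟩ := eventually_bR_tail hT hS.β_pos hS.β_lt_one hS.distortion hc (ℓ + 1)
    (show 0 < η / 2 / (B + 1) by positivity)
  have h1 : ∀ j ∈ I, ∀ᶠ i in l, ∀ y' ∈ T.Λ a j, ∀ x' ∈ X i, (y', ℓ) ∈ T.fib (Ω i) (x', 0) →
      u i y' ≤ η / 2 / (D + 1) := by
    intro j _
    rcases (T.Λ a j).eq_empty_or_nonempty with he | ⟨y₀, hy₀⟩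
    · exact Eventually.of_forall fun i y' hy' => by rw [he] at hy'; exact absurd hy' (notMem_empty _)
    · by_cases hR : T.R a j = ℓ + 1
      · have hb := (hT.bijOn a j ⟨y₀, hy₀⟩).surjOn
        rw [hR, ha] at hb
        obtain ⟨y, hy, hyx⟩ := hb hx
        have hf : (y, ℓ) ∈ T.fib a (x, 0) := mem_fib_zero.2
          ⟨by rw [ha]; exact mem_base.2 ⟨j, hy⟩, by rw [ha, hT.ret_eq hy, hR], by rw [ha, hyx]⟩
        filter_upwards [h y hf (η / 2 / (D + 1)) (by positivity)] with i hi y' hy' x' hx' hf'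
        exact hi y' ⟨rfl, j, by simp only [ha]; exact ⟨hy, hy'⟩⟩ x' hx' hf'
      · filter_upwards [hΩℓ.eventually (eventually_atom hT hS.β_pos hS.β_lt_one hS.distortion
          hc hy₀)] with i hi y' hy' x' hx' hf'
        exact absurd ((hi.2.1 y' hy').symm.trans (mem_fib_zero.1 hf').2.1) hR
  filter_upwards [hΩℓ.eventually hI, (eventually_all_finset I).2 h1, hu, hD]
    with i hi1 hi2 hi3 hi4 x' hx' hx'b
  set ω' := seqShift (-(ℓ : ℤ)) (Ω i) with hω'
  set g : M → ℝ := (⋃ j ∈ I, T.Λ a j)ᶜ.indicator fun _ => (1 : ℝ) with hg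
  have hgB : ∀ y, |g y| ≤ 1 := fun y => by
    rw [hg]; unfold indicator; split_ifs <;> simp
  have hg0 : ∀ y, 0 ≤ g y := fun y => indicator_nonneg (fun _ _ => zero_le_one) y
  -- The bounds on `u` hold only at the points with the return time in question. Truncation does not
  -- change the sum and makes the bound global.
  set u' : M → ℝ := fun y => max 0 (min (u i y) B) with hu'
  have hu'B : ∀ y, |u' y| ≤ B := fun y => by
    rw [hu', abs_of_nonneg (le_max_left _ _)]
    exact max_le hB (min_le_right _ _)
  have e1 : T.bR ω' (ℓ + 1) (u i) x' = T.bR ω' (ℓ + 1) u' x' := tsum_congr fun y => by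
    have := hi3 y y.2.1 y.2.2.1
    simp only [hu', min_eq_left this.2, max_eq_right this.1]
  have e2 : T.bR ω' (ℓ + 1) u' x'
      ≤ T.bR ω' (ℓ + 1) (fun y => η / 2 / (D + 1) * 1 + B * g y) x' := by
    refine bR_mono hT hS.β_pos hS.β_lt_one hS.distortion ω' (ℓ + 1) x' (fun y _ => hu'B y)
      (B' := η / 2 / (D + 1) + B) (fun y _ => ?_) fun y hy hr ho => ?_
    · rw [abs_of_nonneg (by have := hg0 y; positivity)]
      have := mul_le_mul_of_nonneg_left ((le_abs_self _).trans (hgB y)) hB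
      linarith
    · have hin := hi3 y hy hr
      rw [hu']
      simp only [min_eq_left hin.2, max_eq_right hin.1]
      by_cases hy' : y ∈ ⋃ j ∈ I, T.Λ a j
      · obtain ⟨j, hj, hyj⟩ := mem_iUnion₂.1 hy'
        have := hi2 j hj y hyj x' hx' (mem_fib_zero.2 ⟨hy, hr, ho⟩)
        have h0 := mul_nonneg hB (hg0 y)
        linarith
      · rw [hg, indicator_of_mem (mem_compl hy'), mul_one, mul_one]
        have : 0 ≤ η / 2 / (D + 1) := by positivity
        linarith
  have e3 := bR_linear hT hS.β_pos hS.β_lt_one hS.distortion ω' (ℓ + 1) x'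
    (g := fun _ => (1 : ℝ)) (h := g) (B := 1) (B' := 1) (fun y _ => by simp) (fun y _ => hgB y)
    (η / 2 / (D + 1)) B
  have e4 := hi1 x' hx'b
  have e5 := hi4 (-(ℓ : ℤ)) (ℓ + 1) (Nat.succ_pos _) x' (hT.base_eq a (Ω i) ▸ hx'b)
  have e6 : D * Real.exp (-c₂ * ((ℓ + 1 : ℕ) : ℝ)) ≤ D + 1 := by
    have hc₂ : 0 < c₂ := hS.ε_pos.trans hS.ε_lt
    have : Real.exp (-c₂ * ((ℓ + 1 : ℕ) : ℝ)) ≤ 1 := Real.exp_le_one_iff.2 (by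
      have : 0 ≤ c₂ * ((ℓ + 1 : ℕ) : ℝ) := by positivity
      linarith)
    nlinarith
  rw [e1]
  refine e2.trans (e3.le.trans ?_)
  have e7 : η / 2 / (D + 1) * T.bR ω' (ℓ + 1) (fun _ => (1 : ℝ)) x' ≤ η / 2 := by
    calc _ ≤ η / 2 / (D + 1) * (D + 1) := mul_le_mul_of_nonneg_left (e5.trans e6) (by positivity)
      _ = η / 2 := div_mul_cancel₀ _ (by positivity)
  have e8 : B * T.bR ω' (ℓ + 1) g x' ≤ η / 2 := by
    calc _ ≤ B * (η / 2 / (B + 1)) := mul_le_mul_of_nonneg_left e4 hB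
      _ ≤ (B + 1) * (η / 2 / (B + 1)) := mul_le_mul_of_nonneg_right (by linarith) (by positivity)
      _ = η / 2 := mul_div_cancel₀ _ (by positivity)
  linarith

/-- A family of functions that is small near the preimages under `F_a` of a point of the base has
small image under the transfer operators near that point. -/
theorem eventually_tr_small {u : ι → M × ℕ → ℝ} {A : ℝ} (hA : 0 ≤ A)
    (hu0 : ∀ᶠ i in l, ∀ y ∈ T.tower (Ω i), 0 ≤ u i y)
    (hut : ∀ᶠ i in l, T.Tame ε₀ (Ω i) A (u i))
    {x : M} (hx : x ∈ T.base a) {X : ι → Set M} (hX : ∀ i, X i ⊆ T.base a)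
    (h : ∀ y ∈ T.fib a (x, 0), ∀ η > 0, ∀ᶠ i in l, ∀ y', T.SameAtom a y y' →
      ∀ x' ∈ X i, y' ∈ T.fib (Ω i) (x', 0) → u i y' ≤ η) {η : ℝ} (hη : 0 < η) :
    ∀ᶠ i in l, ∀ x' ∈ X i, T.tr (Ω i) (u i) (x', 0) ≤ η := by
  have hT := hS.young
  have hsum := (summable_exp_levels hS.ε_lt D).mul_left A
  -- The levels from `L` on contribute at most `η/2` for every `ω` with the tail bound; the finitely
  -- many lower levels are treated one at a time.
  obtain ⟨L, hL⟩ := ((tendsto_sum_nat_add fun ℓ : ℕ =>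
    A * (Real.exp (ε₀ * ℓ) * (D * Real.exp (-c₂ * (ℓ + 1 : ℕ))))).eventually
    (gt_mem_nhds (half_pos hη))).exists
  have h1 : ∀ ℓ ∈ Finset.range L, ∀ᶠ i in l, ∀ x' ∈ X i, x' ∈ T.base a →
      T.bR (seqShift (-(ℓ : ℤ)) (Ω i)) (ℓ + 1) (fun y => u i (y, ℓ)) x' ≤ η / 2 / (L + 1) := by
    intro ℓ _
    refine eventually_bR_small ha hS hc hΩ hD (u := fun i y => u i (y, ℓ))
      (B := A * Real.exp (ε₀ * ℓ)) (by positivity) ℓ ?_ hx ?_ (by positivity)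
    · filter_upwards [hu0, hut] with i h0 h1 y hy hr
      have hm : (y, ℓ) ∈ T.tower (Ω i) := mem_tower.2 ⟨hy, hr.ge⟩
      exact ⟨h0 _ hm, (le_abs_self _).trans (h1 _ hm)⟩
    · intro y hy η' hη'
      filter_upwards [h _ hy η' hη'] with i hi y' hs x' hx' hf
      exact hi _ hs x' hx' hf
  filter_upwards [(eventually_all_finset (Finset.range L)).2 h1, hu0, hut, hD]
    with i hi h0 ht hDi x' hx'
  have hx'b : x' ∈ T.base (Ω i) := hT.base_eq a (Ω i) ▸ hX i hx'
  have hb : ∀ ℓ : ℕ, |T.bR (seqShift (-(ℓ : ℤ)) (Ω i)) (ℓ + 1) (fun y => u i (y, ℓ)) x'|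
      ≤ A * (Real.exp (ε₀ * ℓ) * (D * Real.exp (-c₂ * (ℓ + 1 : ℕ)))) := fun ℓ => by
    have := norm_bR_le hT hS.β_pos hS.β_lt_one hS.distortion hDi hx'b ℓ
      (g := fun y => u i (y, ℓ)) (B := A * Real.exp (ε₀ * ℓ)) (by positivity)
      fun y hy hr => ht (y, ℓ) (mem_tower.2 ⟨hy, hr.ge⟩)
    rwa [mul_assoc] at this
  have hs : Summable fun ℓ : ℕ => T.bR (seqShift (-(ℓ : ℤ)) (Ω i)) (ℓ + 1)
      (fun y => u i (y, ℓ)) x' := Summable.of_norm_bounded hsum hb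
  rw [ht.tr_zero hT hS.β_pos hS.β_lt_one hS.distortion hS.ε_lt hDi hx'b,
    ← hs.sum_add_tsum_nat_add L]
  have e1 : ∑ ℓ ∈ Finset.range L, T.bR (seqShift (-(ℓ : ℤ)) (Ω i)) (ℓ + 1)
      (fun y => u i (y, ℓ)) x' ≤ η / 2 := by
    calc _ ≤ ∑ _ℓ ∈ Finset.range L, η / 2 / (L + 1) :=
          Finset.sum_le_sum fun ℓ hℓ => hi ℓ hℓ x' hx' (hX i hx')
      _ = L * (η / 2 / (L + 1)) := by simp
      _ ≤ (L + 1) * (η / 2 / (L + 1)) := by gcongr; linarith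
      _ = η / 2 := mul_div_cancel₀ _ (by positivity)
  have e2 := Summable.tsum_le_tsum (fun ℓ => (le_abs_self _).trans (hb (ℓ + L)))
    ((summable_nat_add_iff L).2 hs) ((summable_nat_add_iff L).2 hsum)
  linarith

/-- Upper bounds of a family of functions on the cylinders of order `k + 1` yield upper bounds of
their images on the cylinders of order `k`. -/
theorem eventually_norm_tw_le (hΩ1 : Tendsto (fun i => seqShift 1 (Ω i)) l (𝓝 a)) (t : ℝ) (k : ℕ)
    {H : ι → M × ℕ → ℂ} {h : ι → M × ℕ → ℝ} {A A' : ℝ} (hA : 0 ≤ A)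
    (hH : ∀ᶠ i in l, T.Tame ε₀ (Ω i) A (H i))
    (hh : ∀ᶠ i in l, T.Tame ε₀ (Ω i) A' (h i)) (h0 : ∀ᶠ i in l, ∀ y ∈ T.tower (Ω i), 0 ≤ h i y)
    (hup : ∀ z ∈ T.tower a, ∀ η > 0, ∀ᶠ i in l, ∀ z' ∈ T.tower (Ω i),
      T.Comparable (Ω i) z z' → T.SameCylinder (Ω i) (k + 1) z z' → ‖H i z'‖ ≤ h i z' + η) :
    ∀ z ∈ T.tower a, ∀ η > 0, ∀ᶠ i in l, ∀ z' ∈ T.tower (seqShift 1 (Ω i)),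
      T.Comparable (seqShift 1 (Ω i)) z z' → T.SameCylinder (seqShift 1 (Ω i)) k z z' →
        ‖T.tw φ t (Ω i) (H i) z'‖ ≤ T.tr (Ω i) (h i) z' + η := by
  have hT := hS.young
  rintro ⟨x, m⟩ hz η hη
  cases m with
  | succ ℓ =>
    have hz1 : (x, ℓ) ∈ T.tower a := mem_tower_pred (by rw [ha]; exact hz)
    filter_upwards [hup _ hz1 η hη, hΩ1.eventually (eventually_sameAtom ha hT hS.β_pos
      hS.β_lt_one hS.distortion hc hz)] with i hi hi1 z' hz' hcomp hcyl
    obtain ⟨x', m'⟩ := z'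
    have hs : T.SameAtom (seqShift 1 (Ω i)) (x, ℓ + 1) (x', m') := by
      rcases hcomp with h | h
      · exact absurd h.1 (Nat.succ_ne_zero _)
      · exact h
    obtain rfl : ℓ + 1 = m' := hs.1
    have e0 : ‖T.tw φ t (Ω i) (H i) (x', ℓ + 1)‖ = ‖H i (x', ℓ)‖ := by
      rw [tw, tr_succ _ hz', norm_mul, norm_exp_twist, one_mul]
    rw [e0, tr_succ _ hz']
    have hs1 : T.SameAtom (Ω i) (x, ℓ) (x', ℓ) := by
      obtain ⟨-, j, hj⟩ := hs
      simp only [seqShift_seqShift, seqShift_neg_succ] at hj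
      exact ⟨rfl, j, hj⟩
    refine hi _ (mem_tower_pred hz') (Or.inr hs1) (sameCylinder_succ.2 ⟨hs1, ?_⟩)
    rw [F_of_lt (ret_of_mem_fib_succ hi1.1), F_of_lt (ret_of_mem_fib_succ hz')]
    exact hcyl
  | zero =>
    have hx : x ∈ T.base a := hT.mem_tower_zero.1 hz
    -- `u` is the excess of `‖H‖` over `h`. It becomes small near each preimage of `z`, so its image
    -- is small, and `‖H‖ ≤ h + u` gives the bound.
    set u : ι → M × ℕ → ℝ := fun i y => max (‖H i y‖ - h i y) 0 with hu
    have hut : ∀ᶠ i in l, T.Tame ε₀ (Ω i) A (u i) := by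
      filter_upwards [hH, h0] with i h1 h2 z hz
      rw [hu, Real.norm_of_nonneg (le_max_right _ _)]
      exact max_le (by linarith [h1 z hz, h2 z hz]) (mul_nonneg hA (wv_pos _ _).le)
    have h1 := eventually_tr_small ha hS hc hΩ hD hA
      (Eventually.of_forall fun i y _ => le_max_right (‖H i y‖ - h i y) 0) hut hx
      (X := fun i => {x' | x' ∈ T.base a ∧ T.SameCylinder (seqShift 1 (Ω i)) k (x, 0) (x', 0)})
      (fun i x' hx' => hx'.1) (fun y hy η' hη' => ?_) hη
    · filter_upwards [h1, hH, hh, hut, hD] with i hi hHi hhi hui hDi z' hz' hcomp hcyl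
      obtain ⟨x', m'⟩ := z'
      obtain rfl : 0 = m' := by
        rcases hcomp with h | h
        · exact h.2.symm
        · exact h.1
      have e1 := hi x' ⟨hT.base_eq _ a ▸ hT.mem_tower_zero.1 hz', hcyl⟩
      have e2 := norm_tw_le hT hS.β_pos hS.β_lt_one hS.distortion hS.ε_lt hDi hz' φ t hHi
        (A' := A' + A) (h := fun y => h i y + u i y) (fun y hy => ?_) fun y hy => ?_
      · have e3 : T.tr (Ω i) (fun y => h i y + u i y) (x', 0)
            = T.tr (Ω i) (h i) (x', 0) + T.tr (Ω i) (u i) (x', 0) := by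
          rw [tr, tr, tr, ← Summable.tsum_add
            (hhi.summable hT hS.β_pos hS.β_lt_one hS.distortion hS.ε_lt hDi hz')
            (hui.summable hT hS.β_pos hS.β_lt_one hS.distortion hS.ε_lt hDi hz')]
          exact tsum_congr fun y => smul_add _ _ _
        linarith
      · rw [add_mul]
        exact (norm_add_le _ _).trans (add_le_add (hhi y hy) (hui y hy))
      · have := le_max_left (‖H i y‖ - h i y) 0
        change _ ≤ h i y + max (‖H i y‖ - h i y) 0
        linarith
    · have hy1 : T.F a y = (x, 0) := hy.2
      have hF := hΩ.eventually (eventually_F_close ha hT hS.β_pos hS.β_lt_one hS.distortion hc k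
        hy.1)
      rw [hy1] at hF
      filter_upwards [hup y hy.1 η' hη', hF, hΩ.eventually (eventually_sameAtom ha hT hS.β_pos
        hS.β_lt_one hS.distortion hc hy.1)] with i hi hFi hsi y' hs x' hx' hf
      have hs' := hsi.2 y' hs
      have := hi y' hf.1 (Or.inr hs') (sameCylinder_succ.2 ⟨hs', by
        rw [hf.2]
        exact hT.sameCylinder_trans hFi.symm hx'.2⟩)
      exact max_le (by linarith) hη'.le

/-- Pointwise convergence of uniformly Lipschitz functions is preserved by the transfer
operators. -/
theorem tendsto_tr (hDa : T.TowerTail D c₂ a)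
    (hΩ1 : Tendsto (fun i => seqShift 1 (Ω i)) l (𝓝 a)) {G : ι → M × ℕ → ℂ} {g : M × ℕ → ℂ}
    {A B : ℝ} (hA : 0 ≤ A) (hB : 0 ≤ B) (hG : ∀ᶠ i in l, T.Bd β ε₀ (Ω i) A B (G i))
    (hg : T.Tame ε₀ a A g) (hp : ∀ y ∈ T.tower a, Tendsto (fun i => G i y) l (𝓝 (g y)))
    {z : M × ℕ} (hz : z ∈ T.tower a) :
    Tendsto (fun i => T.tr (Ω i) (G i) z) l (𝓝 (T.tr a g z)) := by
  have hT := hS.young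
  have hβ₀ := hS.β_pos
  have hβ₁ := hS.β_lt_one
  obtain ⟨x, m⟩ := z
  cases m with
  | succ ℓ =>
    have hz' : (x, ℓ + 1) ∈ T.tower (seqShift 1 a) := by rwa [ha]
    rw [tr_succ _ hz']
    refine (hp _ (mem_tower_pred hz')).congr' ?_
    filter_upwards [hΩ1.eventually (eventually_sameAtom ha hT hβ₀ hβ₁ hS.distortion hc hz)]
      with i hi
    rw [tr_succ _ hi.1]
  | zero =>
    have hx : x ∈ T.base a := hT.mem_tower_zero.1 hz
    have hz1 : (x, 0) ∈ T.tower (seqShift 1 a) := by rwa [ha]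
    classical
    -- `e` freezes `g` on each atom of `Δ_a` at its value at the preimage of `(x, 0)` in that atom,
    -- and vanishes on atoms without such a preimage. At `(x, 0)` the operator of `a` does not
    -- distinguish `e` from `g`. As `e` is constant on atoms, the convergence of the operators
    -- applies to it, and the difference `G - e` is small near the preimages.
    set e : M × ℕ → ℂ := fun y' =>
      if h : ∃ y ∈ T.fib a (x, 0), T.SameAtom a y y' then g h.choose else 0 with he
    have he1 : ∀ y ∈ T.fib a (x, 0), ∀ y', T.SameAtom a y y' → e y' = g y := by
      intro y hy y' hs
      have hex : ∃ y ∈ T.fib a (x, 0), T.SameAtom a y y' := ⟨y, hy, hs⟩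
      have := hex.choose_spec
      rw [he]
      simp only [dif_pos hex]
      rw [hT.fib_unique hz1 this.1 hy (hT.sameAtom_trans this.2 hs.symm)]
    have heA : ∀ y', ‖e y'‖ ≤ A * wv ε₀ y' := by
      intro y'
      by_cases hex : ∃ y ∈ T.fib a (x, 0), T.SameAtom a y y'
      · obtain ⟨y, hy, hs⟩ := hex
        rw [he1 y hy y' hs]
        have := hg y hy.1
        rwa [wv, hs.1] at this
      · rw [he]
        simp only [dif_neg hex, norm_zero]
        exact mul_nonneg hA (wv_pos _ _).le
    have hec : ∀ y y', T.SameAtom a y y' → e y = e y' := by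
      intro y y' hs
      by_cases hex : ∃ w ∈ T.fib a (x, 0), T.SameAtom a w y
      · obtain ⟨w, hw, hws⟩ := hex
        rw [he1 w hw y hws, he1 w hw y' (hT.sameAtom_trans hws hs)]
      · have hex' : ¬ ∃ w ∈ T.fib a (x, 0), T.SameAtom a w y' :=
          fun ⟨w, hw, hws⟩ => hex ⟨w, hw, hT.sameAtom_trans hws hs.symm⟩
        rw [he]
        simp only [dif_neg hex, dif_neg hex']
    have hea : T.tr a g (x, 0) = T.tr a e (x, 0) :=
      tr_congr fun y hy => (he1 y hy y (sameAtom_refl hy.1)).symm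
    rw [hea]
    have hlim : Tendsto (fun i => T.tr (Ω i) e (x, 0)) l (𝓝 (T.tr a e (x, 0))) := by
      have hconv : ∀ ω : ℤ → Ω₀, T.TowerTail D c₂ ω → T.tr ω e (x, 0)
          = ∑' ℓ : ℕ, T.bR (seqShift (-(ℓ : ℤ)) ω) (ℓ + 1) (fun y => e (y, ℓ)) x := fun ω hω =>
        Tame.tr_zero hT hβ₀ hβ₁ hS.distortion hS.ε_lt hω (hT.base_eq a ω ▸ hx)
          (A := A) fun y _ => heA y
      rw [hconv a hDa]
      refine Tendsto.congr' (f₁ := fun i => ∑' ℓ : ℕ, T.bR (seqShift (-(ℓ : ℤ)) (Ω i)) (ℓ + 1)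
        (fun y => e (y, ℓ)) x) ?_ ?_
      · filter_upwards [hD] with i hi
        rw [hconv _ hi]
      · refine tendsto_tsum_of_dominated_convergence
          ((summable_exp_levels hS.ε_lt D).mul_left A) (fun ℓ => ?_) ?_
        · have hL : T.LipOnBase β a fun y => e (y, ℓ) := by
            refine lipOnBase_of_cylinder hβ₀ hβ₁ (B := A * Real.exp (ε₀ * ℓ))
              (fun y _ => heA (y, ℓ)) 1 fun y _ y' _ h => ?_
            obtain ⟨j, hj⟩ := sameAtom_base.1 (h.sameAtom one_pos)
            exact hec _ _ ⟨rfl, j, by simp only [ha]; exact hj⟩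
          have h1 := (hc.operators (ℓ + 1) _ hL).tendsto_at hx
          have h2 := h1.comp ((tendsto_seqShift ha (-(ℓ : ℤ))).comp hΩ)
          rw [ha]
          simp only [← baseOp_eq_bR]
          exact h2
        · filter_upwards [hD] with i hi ℓ
          have := norm_bR_le hT hβ₀ hβ₁ hS.distortion hi (hT.base_eq a (Ω i) ▸ hx) ℓ
            (g := fun y => e (y, ℓ)) (B := A * Real.exp (ε₀ * ℓ)) (by positivity)
            fun y _ _ => heA (y, ℓ)
          rwa [mul_assoc] at this
    have hdiff : Tendsto (fun i => T.tr (Ω i) (G i) (x, 0) - T.tr (Ω i) e (x, 0)) l (𝓝 0) := by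
      rw [tendsto_zero_iff_norm_tendsto_zero, Metric.tendsto_nhds]
      intro η hη
      have h1 := eventually_tr_small ha hS hc hΩ hD (u := fun i y => ‖G i y - e y‖)
        (A := A + A) (by positivity) (Eventually.of_forall fun i y _ => norm_nonneg _)
        (by
          filter_upwards [hG] with i hi z hz
          rw [norm_norm, add_mul]
          exact (norm_sub_le _ _).trans (add_le_add (hi.tame z hz) (heA z)))
        hx (X := fun _ => {x}) (fun _ x' hx' => by rw [mem_singleton_iff.1 hx']; exact hx)
        (fun y hy η' hη' => ?_) (half_pos hη)
      · filter_upwards [h1, hG, hD] with i hi hGi hDi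
        have hxi : (x, 0) ∈ T.tower (seqShift 1 (Ω i)) :=
          hT.mem_tower_zero.2 (hT.base_eq a (seqShift 1 (Ω i)) ▸ hx)
        have e1 : T.tr (Ω i) (G i) (x, 0) - T.tr (Ω i) e (x, 0)
            = T.tr (Ω i) (fun y => G i y - e y) (x, 0) := by
          rw [tr, tr, tr, ← Summable.tsum_sub
            (hGi.tame.summable hT hβ₀ hβ₁ hS.distortion hS.ε_lt hDi hxi)
            (Tame.summable hT hβ₀ hβ₁ hS.distortion hS.ε_lt hDi hxi (A := A) fun y _ => heA y)]
          exact tsum_congr fun y => (smul_sub _ _ _).symm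
        have hte : T.Tame ε₀ (Ω i) (A + A) fun y => G i y - e y := fun z hz => by
          rw [add_mul]
          exact (norm_sub_le _ _).trans (add_le_add (hGi.tame z hz) (heA z))
        have e2 := norm_tr_le hT hβ₀ hβ₁ hS.distortion hS.ε_lt hDi hxi hte
          (A' := A + A) (h := fun y => ‖G i y - e y‖)
          (fun z hz => by rw [norm_norm]; exact hte z hz) fun y _ => le_rfl
        rw [e1, dist_zero_right, norm_norm]
        exact lt_of_le_of_lt (e2.trans (hi x rfl)) (half_lt_self hη)
      · have hw := wv_pos ε₀ y
        have hlimk : Tendsto (fun k : ℕ => B * wv ε₀ y * β ^ k) atTop (𝓝 0) := by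
          have := (tendsto_pow_atTop_nhds_zero_of_lt_one hβ₀.le hβ₁).const_mul (B * wv ε₀ y)
          rwa [mul_zero] at this
        -- Cylinders of order `k + 1` are so small that the functions `G` vary by less than `η'/2`
        -- on the one around `y`.
        obtain ⟨k, hk⟩ := (hlimk.eventually (gt_mem_nhds (half_pos hη'))).exists
        have hF := hΩ.eventually (eventually_F_close ha hT hβ₀ hβ₁ hS.distortion hc k hy.1)
        rw [hy.2] at hF
        filter_upwards [hF, hΩ.eventually (eventually_sameAtom ha hT hβ₀ hβ₁ hS.distortion hc
          hy.1), hG, Metric.tendsto_nhds.1 (hp y hy.1) _ (half_pos hη')]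
          with i hFi hsi hGi hpi y' hs x' hx' hf
        obtain rfl : x' = x := hx'
        have hs' := hsi.2 y' hs
        have hcyl : T.SameCylinder (Ω i) (k + 1) y y' :=
          sameCylinder_succ.2 ⟨hs', by rw [hf.2]; exact hFi.symm⟩
        rw [he1 y hy y' hs]
        have e1 := hGi.lip y hsi.1 y' hf.1 hs'
        have e2 := sepDist_le_of_sameCylinder hβ₀ hβ₁ hcyl
        have e3 : T.sepDist β (Ω i) y y' ≤ β ^ k := e2.trans
          (pow_le_pow_of_le_one hβ₀.le hβ₁.le (by omega))
        have e4 := mul_le_mul_of_nonneg_left e3 (mul_nonneg hB hw.le)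
        rw [dist_eq_norm] at hpi
        have e5 : ‖G i y' - g y‖ ≤ ‖G i y - G i y'‖ + ‖G i y - g y‖ := by
          rw [norm_sub_rev (G i y)]
          exact norm_sub_le_norm_sub_add_norm_sub _ _ _
        linarith
    simpa using hdiff.add hlim

end near

end

end RandomTower

/-! ### The Banach space `ℋ_a` and the spectral condition. -/

namespace RandomTower

section

variable {Ω₀ M : Type*} [MeasurableSpace Ω₀] [MeasurableSpace M] {T : RandomTower Ω₀ M}
  {φ : (ℤ → Ω₀) → M × ℕ → ℝ} {ω a : ℤ → Ω₀} {β : NNReal}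

theorem LipSpace.norm_toFun_le (g : T.LipSpace β ω) (z : T.tower ω) : ‖g.toFun z‖ ≤ ‖g‖ :=
  (le_ciSup g.2.1 z).trans (le_add_of_nonneg_right
    (Real.iSup_nonneg fun p => T.quot_nonneg β.2 ω g.toFun p))

theorem LipSpace.quot_le (g : T.LipSpace β ω) (p : T.LevelPair ω) :
    T.quot β ω g.toFun p ≤ ‖g‖ :=
  (le_ciSup g.2.2 p).trans (le_add_of_nonneg_left (Real.iSup_nonneg fun _ => norm_nonneg _))

/-- The element of `ℋ_ω` defined by a function with given bounds. -/
def LipSpace.mk (g : T.tower ω → ℂ) (A B : ℝ) (hA : ∀ z, ‖g z‖ ≤ A)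
    (hB : ∀ p, T.quot β ω g p ≤ B) : T.LipSpace β ω :=
  ⟨g, ⟨A, by rintro _ ⟨z, rfl⟩; exact hA z⟩, ⟨B, by rintro _ ⟨p, rfl⟩; exact hB p⟩⟩

theorem LipSpace.norm_mk_le {g : T.tower ω → ℂ} {A B : ℝ} (hA : ∀ z, ‖g z‖ ≤ A)
    (hB : ∀ p, T.quot β ω g p ≤ B) (hA0 : 0 ≤ A) (hB0 : 0 ≤ B) :
    ‖LipSpace.mk g A B hA hB‖ ≤ A + B :=
  add_le_add (Real.iSup_le hA hA0) (Real.iSup_le hB hB0)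

/-- Completeness is needed for the spectral radius formula. Bounds on values and difference
quotients survive pointwise limits. -/
instance : CompleteSpace (T.LipSpace β ω) := by
  refine Metric.complete_of_cauchySeq_tendsto fun u hu => ?_
  have hpt : ∀ z, CauchySeq fun n => (u n).toFun z := by
    intro z
    rw [Metric.cauchySeq_iff'] at hu ⊢
    intro ε hε
    obtain ⟨N, hN⟩ := hu ε hε
    refine ⟨N, fun n hn => lt_of_le_of_lt ?_ (hN n hn)⟩
    rw [dist_eq_norm, dist_eq_norm]
    exact (u n - u N).norm_toFun_le z
  choose g hg using fun z => cauchySeq_tendsto_of_complete (hpt z)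
  have key : ∀ ε > 0, ∃ N, ∀ n ≥ N, (∀ z, ‖(u n).toFun z - g z‖ ≤ ε) ∧
      ∀ p, T.quot β ω ((u n).toFun - g) p ≤ ε := by
    intro ε hε
    obtain ⟨N, hN⟩ := Metric.cauchySeq_iff.1 hu ε hε
    refine ⟨N, fun n hn => ⟨fun z => ?_, fun p => ?_⟩⟩
    · refine le_of_tendsto ((tendsto_const_nhds.sub (hg z)).norm) ?_
      filter_upwards [eventually_ge_atTop N] with m hm
      have := hN n hn m hm
      rw [dist_eq_norm] at this
      exact ((u n - u m).norm_toFun_le z).trans this.le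
    · have hlim : Tendsto (fun m => T.quot β ω ((u n).toFun - (u m).toFun) p) atTop
          (𝓝 (T.quot β ω ((u n).toFun - g) p)) := by
        unfold quot
        refine Tendsto.div_const ?_ _
        exact ((tendsto_const_nhds.sub (hg _)).sub (tendsto_const_nhds.sub (hg _))).norm
      refine le_of_tendsto hlim ?_
      filter_upwards [eventually_ge_atTop N] with m hm
      have := hN n hn m hm
      rw [dist_eq_norm] at this
      exact ((u n - u m).quot_le p).trans this.le
  obtain ⟨N, hN⟩ := key 1 one_pos
  let w : T.LipSpace β ω := LipSpace.mk ((u N).toFun - g) 1 1 (hN N le_rfl).1 (hN N le_rfl).2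
  refine ⟨u N - w, Metric.tendsto_atTop.2 fun ε hε => ?_⟩
  obtain ⟨N', hN'⟩ := key (ε / 4) (by positivity)
  refine ⟨N', fun n hn => ?_⟩
  have e : u n - (u N - w) = LipSpace.mk ((u n).toFun - g) (ε / 4) (ε / 4) (hN' n hn).1
      (hN' n hn).2 := by
    refine Subtype.ext ?_
    change (u n).toFun - ((u N).toFun - ((u N).toFun - g)) = (u n).toFun - g
    abel
  rw [dist_eq_norm, e]
  exact lt_of_le_of_lt (LipSpace.norm_mk_le (g := (u n).toFun - g) (hN' n hn).1 (hN' n hn).2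
    (by positivity) (by positivity)) (by linarith)

theorem transferP_eq_tw (t : ℝ) (g : M × ℕ → ℂ) (z : M × ℕ) :
    T.transferP φ ω (Complex.I * t) (fun y => g y) z = T.tw φ t ω g z := by
  let e : {y : T.tower ω // T.F ω y = z} ≃ T.fib ω z :=
    { toFun := fun y => ⟨y.1, y.1.2, y.2⟩
      invFun := fun y => ⟨⟨y.1, y.2.1⟩, y.2.2⟩
      left_inv := fun _ => rfl
      right_inv := fun _ => rfl }
  unfold transferP tw tr
  rw [← e.tsum_eq]
  refine tsum_congr fun y => ?_
  rw [Complex.real_smul, Complex.ofReal_inv, mul_assoc]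
  rfl

/-- The iterates of a twisted operator of spectral radius less than one. -/
theorem TwistedContracts.exists_Pn_le (ha : ∀ k, seqShift k a = a) (hβ₀ : 0 < β) (hβ₁ : β < 1)
    {ε₀ t : ℝ} (h : T.TwistedContracts β ε₀ φ a t) {δ : ℝ} (hδ : 0 < δ) :
    ∃ N, ∀ m ≥ N, ∀ g : M × ℕ → ℂ, T.Bd β ε₀ a 1 1 g → T.Tame ε₀ a δ (T.Pn φ t a m g) := by
  obtain ⟨L, hL, hr⟩ := h
  have hb₀ : (0 : ℝ) < β := hβ₀
  have hb₁ : (β : ℝ) < 1 := hβ₁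
  -- By Gelfand's formula a spectral radius below `1` makes the norms of the powers decay
  -- geometrically.
  have hlim : Tendsto (fun n => ‖L ^ n‖) atTop (𝓝 0) := by
    obtain ⟨r, hr1, hr2⟩ := exists_between hr
    have h1 := spectrum.pow_nnnorm_pow_one_div_tendsto_nhds_spectralRadius L
    lift r to NNReal using (hr2.trans ENNReal.one_lt_top).ne
    have hr2' : r < 1 := by exact_mod_cast hr2
    refine squeeze_zero' (Eventually.of_forall fun n => norm_nonneg _) ?_
      (tendsto_pow_atTop_nhds_zero_of_lt_one r.2 (by exact_mod_cast hr2'))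
    filter_upwards [h1.eventually (gt_mem_nhds hr1), eventually_gt_atTop 0] with n hn hn0
    have hn0' : (0 : ℝ) < n := by exact_mod_cast hn0
    have h2 : ((‖L ^ n‖₊ : ENNReal)) ≤ (r : ENNReal) ^ (n : ℝ) := by
      have := ENNReal.rpow_le_rpow hn.le hn0'.le
      rwa [← ENNReal.rpow_mul, one_div, inv_mul_cancel₀ hn0'.ne', ENNReal.rpow_one] at this
    rw [ENNReal.rpow_natCast] at h2
    exact_mod_cast h2
  have hlim2 := hlim.mul_const (1 + (1 + 2 / (β : ℝ)))
  rw [zero_mul] at hlim2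
  obtain ⟨N, hN⟩ := (hlim2.eventually (gt_mem_nhds hδ)).exists_forall_of_atTop
  refine ⟨N, fun m hm g hg z hz => ?_⟩
  have hgA : ∀ z : T.tower a, ‖g z / (wv ε₀ z.1 : ℂ)‖ ≤ 1 := fun z => by
    rw [norm_div, Complex.norm_real, Real.norm_of_nonneg (wv_pos _ _).le,
      div_le_one (wv_pos _ _)]
    simpa using hg.tame z z.2
  -- The norm of `ℋ_a` compares any two points of a level, while `Bd` compares points of one atom.
  -- Points in different atoms are at distance at least `β`, and boundedness gives the quotient
  -- `2/β`.
  have hgB : ∀ p, T.quot β a (fun z : T.tower a => g z / (wv ε₀ z.1 : ℂ)) p ≤ 1 + 2 / (β : ℝ) := by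
    rintro ⟨⟨z, z'⟩, hl, hne⟩
    have hd := T.sepDist_nonneg hb₀.le a z z'
    refine div_le_of_le_mul₀ hd (by positivity) ?_
    dsimp only at hl ⊢
    by_cases hs : T.SameAtom a z z'
    · have e : wv ε₀ z.1 = wv ε₀ z'.1 := by rw [wv, wv, hl]
      rw [← e, ← sub_div, norm_div, Complex.norm_real, Real.norm_of_nonneg (wv_pos _ _).le,
        div_le_iff₀ (wv_pos _ _)]
      have := hg.lip z z.2 z' z'.2 hs
      have h2 : 0 ≤ 2 / (β : ℝ) * T.sepDist β a z z' * wv ε₀ z.1 := by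
        have := wv_pos ε₀ z.1
        positivity
      linarith
    · have h1 : ¬ T.SameCylinder a 1 z z' := fun h => hs (h.sameAtom one_pos)
      have h2 := le_sepDist_of_not_sameCylinder (T := T) hb₀ hb₁ h1
      have h3 := (norm_sub_le (g z / (wv ε₀ z.1 : ℂ)) (g z' / (wv ε₀ z'.1 : ℂ))).trans
        (add_le_add (hgA z) (hgA z'))
      have h4 := mul_le_mul_of_nonneg_left h2 (show 0 ≤ 2 / (β : ℝ) by positivity)
      rw [pow_one, div_mul_cancel₀ _ hb₀.ne'] at h4
      linarith
  set h : T.LipSpace β a := LipSpace.mk _ 1 _ hgA hgB with hh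
  -- The weighted operator is the twisted operator conjugated by `v`, so the iterates of `g` are `v`
  -- times those of `g/v`.
  have hiter : ∀ m : ℕ, ∀ z : T.tower a,
      T.Pn φ t a m g z = ((L ^ m) h).toFun z * (wv ε₀ z.1 : ℂ) := by
    intro m
    induction m with
    | zero =>
      intro z
      have : (wv ε₀ z.1 : ℂ) ≠ 0 := Complex.ofReal_ne_zero.2 (wv_pos _ _).ne'
      change g z = g z / (wv ε₀ z.1 : ℂ) * (wv ε₀ z.1 : ℂ)
      rw [div_mul_cancel₀ _ this]
    | succ m ih =>
      intro z
      have hv : (wv ε₀ z.1 : ℂ) ≠ 0 := Complex.ofReal_ne_zero.2 (wv_pos _ _).ne'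
      rw [pow_succ', mul_apply_eq_comp, hL]
      change T.tw φ t (seqShift (m : ℤ) a) (T.Pn φ t a m g) z = _
      rw [ha, transferL, ← transferP_eq_tw]
      change _ = T.transferP φ a (Complex.I * t)
        (fun y => ((L ^ m) h).toFun y * (wv ε₀ y.1 : ℂ)) z / (wv ε₀ z.1 : ℂ) * _
      rw [div_mul_cancel₀ _ hv]
      congr 1
      funext y
      exact ih y
  rw [hiter m ⟨z, hz⟩, norm_mul, Complex.norm_real, Real.norm_of_nonneg (wv_pos _ _).le]
  refine mul_le_mul_of_nonneg_right ?_ (wv_pos _ _).le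
  refine (LipSpace.norm_toFun_le _ _).trans (((L ^ m).le_opNorm h).trans ?_)
  refine le_trans ?_ (hN m hm).le
  exact mul_le_mul_of_nonneg_left
    (LipSpace.norm_mk_le hgA hgB zero_le_one (by positivity)) (norm_nonneg _)

end

end RandomTower

/-! ### The compactness argument at the sequence `a`. -/

namespace RandomTower

section

variable {Ω₀ M : Type*} [MeasurableSpace Ω₀] [MeasurableSpace M] {T : RandomTower Ω₀ M} {β : ℝ}
  {φ : (ℤ → Ω₀) → M × ℕ → ℝ} {ω a : ℤ → Ω₀} {A₁ ε₀ c₂ D V C₁ C₂ : ℝ}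

theorem SameAtom.wv_eq {z z' : M × ℕ} (h : T.SameAtom ω z z') : wv ε₀ z = wv ε₀ z' := by
  rw [wv, wv, h.1]

theorem Good.lip_zero (hω : T.Good β ε₀ c₂ D V C₁ C₂ φ ω) : ∀ z ∈ T.tower ω, ∀ z' ∈ T.tower ω,
    |φ ω z - φ ω z'| ≤ C₂ * T.sepDist β ω z z' := by
  have := hω.lip 0
  rwa [seqShift_zero] at this

theorem Bd.twist (hS : T.Setup β A₁ ε₀ c₂ D V C₁ C₂) (hω : T.Good β ε₀ c₂ D V C₁ C₂ φ ω)
    {A B : ℝ} {g : M × ℕ → ℂ} (hg : T.Bd β ε₀ ω A B g) (t : ℝ) :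
    T.Bd β ε₀ ω A (B + |t| * C₂ * A) fun y => Complex.exp (Complex.I * t * (φ ω y : ℂ)) * g y where
  tame z hz := by
    rw [norm_mul, norm_exp_twist, one_mul]
    exact hg.tame z hz
  lip z hz z' hz' hs := by
    have hC := hS.C₂_nonneg
    have hw := wv_pos ε₀ z
    have hd := T.sepDist_nonneg hS.β_pos.le ω z z'
    have e : Complex.exp (Complex.I * t * (φ ω z : ℂ)) * g z
        - Complex.exp (Complex.I * t * (φ ω z' : ℂ)) * g z'
        = (Complex.exp (Complex.I * t * (φ ω z : ℂ))
          - Complex.exp (Complex.I * t * (φ ω z' : ℂ))) * g z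
          + Complex.exp (Complex.I * t * (φ ω z' : ℂ)) * (g z - g z') := by ring
    rw [e]
    refine (norm_add_le _ _).trans ?_
    rw [norm_mul, norm_mul, norm_exp_twist, one_mul]
    have h1 := norm_exp_twist_sub_le t (φ ω z) (φ ω z')
    have h2 := mul_le_mul_of_nonneg_left (hω.lip_zero z hz z' hz') (abs_nonneg t)
    have h3 := hg.lip z hz z' hz' hs
    have h4 := mul_le_mul (h1.trans h2) (hg.tame z hz) (norm_nonneg _) (by positivity)
    calc _ ≤ |t| * (C₂ * T.sepDist β ω z z') * (A * wv ε₀ z)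
          + B * wv ε₀ z * T.sepDist β ω z z' := add_le_add h4 h3
      _ = _ := by ring

theorem tr_const_mul (c : ℝ) (h : M × ℕ → ℝ) :
    T.tr ω (fun y => c * h y) = fun z => c * T.tr ω h z := by
  funext z
  rw [tr, tr, ← tsum_mul_left]
  exact tsum_congr fun y => by simp only [smul_eq_mul]; ring

theorem trn_nonneg (hS : T.Setup β A₁ ε₀ c₂ D V C₁ C₂) (hω : T.Good β ε₀ c₂ D V C₁ C₂ φ ω)
    (n : ℕ) : ∀ z ∈ T.tower (seqShift (n : ℤ) ω), 0 ≤ T.trn ω n (wv ε₀) z :=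
  (trn_spec hS hω zero_le_one (tame_wv ε₀ ω) (fun y _ => (wv_pos ε₀ y).le)
    (cone_wv _ 0 hS.K_nonneg hS.β_pos) n).1

section near

variable [TopologicalSpace Ω₀] (ha : ∀ k, seqShift k a = a)
  (hS : T.Setup β A₁ ε₀ c₂ D V C₁ C₂) (hc : T.ContinuousAtSeq β φ a)
  {ι : Type*} {l : Filter ι} {Ω : ι → ℤ → Ω₀} (hΩ : Tendsto Ω l (𝓝 a))
  (hG : ∀ᶠ i in l, T.Good β ε₀ c₂ D V C₁ C₂ φ (Ω i))

include ha hS hc hΩ hG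

/-- The sequence `a` may lie in the exceptional null set. The bound holds along nearby good
sequences and passes to the limit by the convergence of the operators on the constant `1`. -/
theorem towerTail_of_tendsto [l.NeBot] : T.TowerTail D c₂ a := by
  intro k n hn x hx
  rw [ha]
  refine le_of_forall_pos_le_add fun η hη => ?_
  have h1 := eventually_bR hS.β_pos hS.β_lt_one hc n (g := fun _ => (1 : ℝ)) (B := 1)
    (fun _ _ => by simp) 0 (fun _ _ _ _ _ => rfl) hη
  obtain ⟨i, hi1, hi2⟩ := ((hΩ.eventually h1).and hG).exists
  have h2 := (abs_lt.1 (hi1 x hx)).1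
  have h3 := hi2.tail 0 n hn x (hS.young.base_eq a (Ω i) ▸ hx)
  rw [seqShift_zero] at h3
  linarith

theorem tame_of_tendsto [l.NeBot] {G : ι → M × ℕ → ℂ} {g : M × ℕ → ℂ} {A : ℝ}
    (hA : ∀ᶠ i in l, T.Tame ε₀ (Ω i) A (G i))
    (hp : ∀ y ∈ T.tower a, Tendsto (fun i => G i y) l (𝓝 (g y))) : T.Tame ε₀ a A g := by
  intro z hz
  refine le_of_tendsto (hp z hz).norm ?_
  filter_upwards [hA, hΩ.eventually (eventually_sameAtom ha hS.young hS.β_pos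
    hS.β_lt_one hS.distortion hc hz)] with i hi hi'
  exact hi z hi'.1

/-- The distances `d_ω` need not converge to `d_a`. Since cylinders of `Δ_a` persist, points in a
common cylinder of order `n` of `Δ_a` eventually satisfy `d_ω ≤ β^{n+1}`, and this suffices. -/
theorem bd_of_tendsto [l.NeBot] {G : ι → M × ℕ → ℂ} {g : M × ℕ → ℂ} {A B : ℝ} (hB : 0 ≤ B)
    (hA : ∀ᶠ i in l, T.Bd β ε₀ (Ω i) A B (G i))
    (hp : ∀ y ∈ T.tower a, Tendsto (fun i => G i y) l (𝓝 (g y))) : T.Bd β ε₀ a A B g where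
  tame := tame_of_tendsto ha hS hc hΩ hG (hA.mono fun _ h => h.tame) hp
  lip z hz z' hz' hs := by
    have hT := hS.young
    have hβ₀ := hS.β_pos
    have hβ₁ := hS.β_lt_one
    have hw := wv_pos ε₀ z
    have key : ∀ n, T.SameCylinder a n z z' → ‖g z - g z'‖ ≤ B * wv ε₀ z * β ^ (n + 1) := by
      intro n hn
      refine le_of_tendsto ((hp z hz).sub (hp z' hz')).norm ?_
      filter_upwards [hA, hΩ.eventually (eventually_sameAtom ha hT hβ₀ hβ₁ hS.distortion hc hz),
        hΩ.eventually (eventually_sameAtom ha hT hβ₀ hβ₁ hS.distortion hc hz'),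
        hΩ.eventually (eventually_sameCylinder ha hT hβ₀ hβ₁ hS.distortion hc n hz)]
        with i h1 h2 h3 h4
      refine (h1.lip z h2.1 z' h3.1 (h2.2 z' hs)).trans ?_
      exact mul_le_mul_of_nonneg_left (sepDist_le_of_sameCylinder hβ₀ hβ₁ (h4 z' hn))
        (by positivity)
    rcases sameCylinder_cases T a z z' with h | ⟨n, h1, h2⟩
    · rw [sepDist_eq_of_forall h]
      have hlim : Tendsto (fun n : ℕ => B * wv ε₀ z * β ^ (n + 1)) atTop
          (𝓝 (B * wv ε₀ z * 0)) :=
        ((tendsto_pow_atTop_nhds_zero_of_lt_one hβ₀.le hβ₁).comp (tendsto_add_atTop_nat 1)).const_mul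
          _
      exact ge_of_tendsto' hlim fun n => key n (h n)
    · rw [sepDist_eq h1 h2]
      exact key n h1

/-- Induction with `tendsto_tr`: the uniform Lasota–Yorke bounds keep the iterates equi-Lipschitz,
and the phases converge by the continuity of the observable. -/
theorem tendsto_Pn [l.NeBot] (t : ℝ) {G : ι → M × ℕ → ℂ} {g : M × ℕ → ℂ}
    (hGb : ∀ᶠ i in l, T.Bd β ε₀ (Ω i) 1 1 (G i))
    (hp : ∀ y ∈ T.tower a, Tendsto (fun i => G i y) l (𝓝 (g y))) (m : ℕ) :
    ∀ z ∈ T.tower a, Tendsto (fun i => T.Pn φ t (Ω i) m (G i) z) l (𝓝 (T.Pn φ t a m g z)) := by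
  have hT := hS.young
  have hu := hS.one_le_unifConst
  have hl := hS.lyConst_nonneg t
  have hC₂ := hS.C₂_nonneg
  have hβ₀ := hS.β_pos
  induction m with
  | zero => exact hp
  | succ m ih =>
    intro z hz
    have hΩm : Tendsto (fun i => seqShift (m : ℤ) (Ω i)) l (𝓝 a) :=
      (tendsto_seqShift ha _).comp hΩ
    have hGm : ∀ᶠ i in l, T.Good β ε₀ c₂ D V C₁ C₂ φ (seqShift (m : ℤ) (Ω i)) :=
      hG.mono fun i hi => hi.shift hS m
    have hb : ∀ᶠ i in l, T.Bd β ε₀ (seqShift (m : ℤ) (Ω i))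
        (unifConst β A₁ V * 1) (unifConst β A₁ V * (β ^ m * 1 + 1 * lyConst β A₁ C₂ t)
          + |t| * C₂ * (unifConst β A₁ V * 1))
        fun y => Complex.exp (Complex.I * t * (φ (seqShift (m : ℤ) (Ω i)) y : ℂ))
          * T.Pn φ t (Ω i) m (G i) y := by
      filter_upwards [hGb, hG] with i h1 h2
      exact (hS.bd_Pn h2 zero_le_one zero_le_one h1 t m).twist hS (h2.shift hS m) t
    have hpe : ∀ y ∈ T.tower a, Tendsto
        (fun i => Complex.exp (Complex.I * t * (φ (seqShift (m : ℤ) (Ω i)) y : ℂ))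
          * T.Pn φ t (Ω i) m (G i) y) l
        (𝓝 (Complex.exp (Complex.I * t * (φ a y : ℂ)) * T.Pn φ t a m g y)) := by
      intro y hy
      refine Tendsto.mul ?_ (ih y hy)
      have hφ : Tendsto (fun i => φ (seqShift (m : ℤ) (Ω i)) y) l (𝓝 (φ a y)) := by
        rw [Metric.tendsto_nhds]
        intro ε hε
        filter_upwards [hΩm.eventually (hc.observable ε hε), hΩm.eventually
          (eventually_sameAtom ha hT hβ₀ hS.β_lt_one hS.distortion hc hy)] with i h1 h2
        exact h1 y ⟨h2.1, hy⟩
      exact (Complex.continuous_exp.tendsto _).comp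
        (((Complex.continuous_ofReal.tendsto _).comp hφ).const_mul _)
    have h1 := tendsto_tr ha hS hc hΩm (hGm.mono fun i hi => hi.tail)
      (towerTail_of_tendsto ha hS hc hΩ hG) ((tendsto_seqShift ha 1).comp hΩm) (by positivity)
      (by positivity) hb
      (tame_of_tendsto ha hS hc hΩm hGm (hb.mono fun _ h => h.tame) hpe) hpe hz
    change Tendsto _ l (𝓝 (T.tw φ t (seqShift (m : ℤ) a) (T.Pn φ t a m g) z))
    rw [ha]
    exact h1

/-- Upper bounds near the points of `Δ_a` for cylinders of order `k` become uniform upper bounds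
on the base after `k` steps. -/
theorem eventually_norm_Pn_base_le (t : ℝ) (k : ℕ) {H : ι → M × ℕ → ℂ} {A e : ℝ} (hA : 0 ≤ A)
    (he : 0 ≤ e) (hH : ∀ᶠ i in l, T.Tame ε₀ (Ω i) A (H i))
    (hup : ∀ z ∈ T.tower a, ∀ η > 0, ∀ᶠ i in l, ∀ z' ∈ T.tower (Ω i),
      T.Comparable (Ω i) z z' → T.SameCylinder (Ω i) k z z' → ‖H i z'‖ ≤ e * wv ε₀ z' + η)
    {η : ℝ} (hη : 0 < η) :
    ∀ᶠ i in l, ∀ x, (x, 0) ∈ T.tower (seqShift (k : ℤ) (Ω i)) →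
      ‖T.Pn φ t (Ω i) k (H i) (x, 0)‖ ≤ e * unifConst β A₁ V + η := by
  have hT := hS.young
  have hu := hS.one_le_unifConst
  have key : ∀ j ≤ k, ∀ z ∈ T.tower a, ∀ η > 0, ∀ᶠ i in l,
      ∀ z' ∈ T.tower (seqShift (j : ℤ) (Ω i)), T.Comparable (seqShift (j : ℤ) (Ω i)) z z' →
      T.SameCylinder (seqShift (j : ℤ) (Ω i)) (k - j) z z' →
      ‖T.Pn φ t (Ω i) j (H i) z'‖ ≤ e * T.trn (Ω i) j (wv ε₀) z' + η := by
    intro j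
    induction j with
    | zero =>
      intro _ z hz η hη
      filter_upwards [hup z hz η hη] with i hi
      simp only [Nat.cast_zero, seqShift_zero, Nat.sub_zero]
      exact hi
    | succ j ih =>
      intro hj
      have hΩj : Tendsto (fun i => seqShift (j : ℤ) (Ω i)) l (𝓝 a) :=
        (tendsto_seqShift ha _).comp hΩ
      have h1 := eventually_norm_tw_le ha hS hc hΩj
        (hG.mono fun i hi => (hi.shift hS j).tail) ((tendsto_seqShift ha 1).comp hΩj) t
        (k - (j + 1)) (H := fun i => T.Pn φ t (Ω i) j (H i))
        (h := fun i y => e * T.trn (Ω i) j (wv ε₀) y) (A := A * unifConst β A₁ V)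
        (A' := e * unifConst β A₁ V) (by positivity) ?_ ?_ ?_ ?_
      · intro z hz η hη
        filter_upwards [h1 z hz η hη] with i hi z' hz' hcomp hcyl
        rw [← seqShift_succ] at hz' hcomp hcyl
        have := hi z' hz' hcomp hcyl
        rw [tr_const_mul] at this
        exact this
      · filter_upwards [hH, hG] with i h1 h2 z hz
        refine (norm_Pn_le hS h2 hA h1 t j z hz).trans ?_
        rw [mul_assoc]
        exact mul_le_mul_of_nonneg_left (hS.wn_le h2 j z hz) hA
      · filter_upwards [hG] with i h2 z hz
        rw [norm_mul, Real.norm_of_nonneg he, mul_assoc]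
        exact mul_le_mul_of_nonneg_left (hS.wn_tame h2 j z hz) he
      · filter_upwards [hG] with i h2 z hz
        exact mul_nonneg he (trn_nonneg hS h2 j z hz)
      · rw [show k - (j + 1) + 1 = k - j by omega]
        exact ih (by omega)
  -- After `k` steps the cylinder has order `0` and is no restriction. A single point `x₀` then
  -- stands for the whole base, and the neighbourhood of `a` no longer depends on the point.
  obtain ⟨x₀, hx₀⟩ := hT.base_nonempty a
  filter_upwards [key k le_rfl (x₀, 0) (hT.mem_tower_zero.2 hx₀) η hη, hG] with i hi hGi x hx
  have h1 := hi (x, 0) hx (Or.inl ⟨rfl, rfl⟩) (by rw [Nat.sub_self]; exact sameCylinder_zero _ _ _)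
  have h2 := mul_le_mul_of_nonneg_left (hS.wn_le hGi k (x, 0) hx) he
  rw [wv_zero, mul_one] at h2
  linarith

end near

theorem DomLip.norm_le_of_cylinder (hβ₀ : 0 < β) (hβ₁ : β < 1) {A B : ℝ} {g : M × ℕ → ℂ}
    (hB : 0 ≤ B) (hg : T.Bd β ε₀ ω A B g) {z z' : M × ℕ} (hz : z ∈ T.tower ω)
    (hz' : z' ∈ T.tower ω) {k : ℕ} (h : T.SameCylinder ω (k + 1) z z') :
    ‖g z'‖ ≤ ‖g z‖ + B * β ^ k * wv ε₀ z := by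
  have hs := h.sameAtom (Nat.succ_pos k)
  have h1 := hg.lip z hz z' hz' hs
  have h2 : T.sepDist β ω z z' ≤ β ^ k := (sepDist_le_of_sameCylinder hβ₀ hβ₁ h).trans
    (pow_le_pow_of_le_one hβ₀.le hβ₁.le (by omega))
  have h3 := mul_le_mul_of_nonneg_left h2 (mul_nonneg hB (wv_pos ε₀ z).le)
  have h4 := norm_le_norm_add_norm_sub (g z) (g z')
  rw [mul_right_comm] at h3
  linarith

end

section

variable {Ω₀ M : Type*} [MeasurableSpace Ω₀] [MeasurableSpace M] {T : RandomTower Ω₀ M}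
  {φ : (ℤ → Ω₀) → M × ℕ → ℝ} {a : ℤ → Ω₀} {A₁ ε₀ c₂ D V C₁ C₂ : ℝ} {β : NNReal}

/-- Near the fixed sequence `a`, the twisted operators are small after some number of steps. -/
theorem eventually_tame_Pn [TopologicalSpace Ω₀] (ha : ∀ k, seqShift k a = a)
    (hS : T.Setup β A₁ ε₀ c₂ D V C₁ C₂) (hc : T.ContinuousAtSeq β φ a) {t : ℝ}
    (ht : T.TwistedContracts β ε₀ φ a t) {δ : ℝ} (hδ : 0 < δ) :
    ∃ N : ℕ, ∀ᶠ ω in 𝓝 a, T.Good β ε₀ c₂ D V C₁ C₂ φ ω → ∀ G, T.Bd β ε₀ ω 1 1 G →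
      T.Tame ε₀ (seqShift (N : ℤ) ω) δ (T.Pn φ t ω N G) := by
  have hT := hS.young
  have hu := hS.one_le_unifConst
  have hl := hS.lyConst_nonneg t
  have hβ₀ := hS.β_pos
  have hβ₁ := hS.β_lt_one
  set C := unifConst (β : ℝ) A₁ V with hC
  set B := C * (1 + lyConst β A₁ C₂ t) with hB
  have hB0 : 0 ≤ B := by positivity
  -- On the base the final bound will be `e C + δ/4 = δ/2`. Half of `e` comes from the spectral
  -- condition, half from the oscillation `B β^k` on cylinders of order `k + 1`.
  set e := δ / 4 / C with he
  have he0 : 0 < e := by positivity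
  obtain ⟨n₁, hn₁⟩ := ht.exists_Pn_le ha (by exact_mod_cast hβ₀) (by exact_mod_cast hβ₁)
    (half_pos he0)
  obtain ⟨k, hk⟩ : ∃ k : ℕ, B * (β : ℝ) ^ k < e / 2 := by
    have := (tendsto_pow_atTop_nhds_zero_of_lt_one hβ₀.le hβ₁).const_mul B
    rw [mul_zero] at this
    exact (this.eventually (gt_mem_nhds (half_pos he0))).exists
  obtain ⟨K, hK⟩ : ∃ K : ℕ, C * Real.exp (-ε₀ * K) < δ / 2 := by
    have h1 : Tendsto (fun K : ℕ => C * Real.exp (-ε₀) ^ K) atTop (𝓝 (C * 0)) :=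
      (tendsto_pow_atTop_nhds_zero_of_lt_one (Real.exp_pos _).le
        (Real.exp_lt_one_iff.2 (by linarith [hS.ε_pos]))).const_mul C
    rw [mul_zero] at h1
    obtain ⟨K, hK⟩ := (h1.eventually (gt_mem_nhds (half_pos hδ))).exists
    refine ⟨K, ?_⟩
    rwa [← Real.exp_nat_mul, mul_comm (K : ℝ)] at hK
  -- `n₁` steps for the spectral condition, `k + 1` to make the bound uniform on the base, and `K`
  -- to damp the high levels through the weight.
  refine ⟨n₁ + (k + 1) + K, ?_⟩
  by_contra hne
  rw [not_eventually] at hne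
  set s : Set (ℤ → Ω₀) := {ω | ¬ (T.Good β ε₀ c₂ D V C₁ C₂ φ ω → ∀ G, T.Bd β ε₀ ω 1 1 G →
      T.Tame ε₀ (seqShift ((n₁ + (k + 1) + K : ℕ) : ℤ) ω) δ
        (T.Pn φ t ω (n₁ + (k + 1) + K) G))} with hs
  have hex : ∀ ω, ∃ G, ω ∈ s → T.Good β ε₀ c₂ D V C₁ C₂ φ ω ∧ T.Bd β ε₀ ω 1 1 G ∧
      ¬ T.Tame ε₀ (seqShift ((n₁ + (k + 1) + K : ℕ) : ℤ) ω) δ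
        (T.Pn φ t ω (n₁ + (k + 1) + K) G) := by
    intro ω
    by_cases hω : ω ∈ s
    · have := hω
      rw [hs, mem_ofPred_eq] at this
      push Not at this
      obtain ⟨h1, G, h2, h3⟩ := this
      exact ⟨G, fun _ => ⟨h1, h2, h3⟩⟩
    · exact ⟨0, fun h => absurd h hω⟩
  choose G hGs using hex
  have hNe : (𝓝 a ⊓ 𝓟 s).NeBot := by
    rw [← frequently_mem_iff_neBot]
    exact hne
  -- Along an ultrafilter the bounded values of `G` converge at all points of `Δ_a` simultaneously,
  -- whatever their cardinality.
  set U := Ultrafilter.of (𝓝 a ⊓ 𝓟 s) with hU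
  have hUle : (U : Filter (ℤ → Ω₀)) ≤ 𝓝 a ⊓ 𝓟 s := Ultrafilter.of_le _
  have hUs : ∀ᶠ ω in (U : Filter (ℤ → Ω₀)), ω ∈ s := hUle.trans inf_le_right (mem_principal_self s)
  have hΩ : Tendsto (fun ω => ω) (U : Filter (ℤ → Ω₀)) (𝓝 a) := hUle.trans inf_le_left
  have hGood : ∀ᶠ ω in (U : Filter (ℤ → Ω₀)), T.Good β ε₀ c₂ D V C₁ C₂ φ ω :=
    hUs.mono fun ω h => (hGs ω h).1
  have hBd : ∀ᶠ ω in (U : Filter (ℤ → Ω₀)), T.Bd β ε₀ ω 1 1 (G ω) :=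
    hUs.mono fun ω h => (hGs ω h).2.1
  have hlimex : ∀ y, ∃ c, y ∈ T.tower a → Tendsto (fun ω => G ω y) U (𝓝 c) := by
    intro y
    by_cases hy : y ∈ T.tower a
    · have h1 : ∀ᶠ ω in (U : Filter (ℤ → Ω₀)),
          G ω y ∈ Metric.closedBall (0 : ℂ) (1 * wv ε₀ y) := by
        filter_upwards [hBd, hΩ.eventually (eventually_sameAtom ha hT hβ₀ hβ₁ hS.distortion hc hy)]
          with ω h1 h2
        rw [mem_closedBall_zero_iff]
        exact h1.tame y h2.1
      obtain ⟨c, -, hcl⟩ := (isCompact_closedBall (0 : ℂ) (1 * wv ε₀ y)).ultrafilter_le_nhds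
        (U.map fun ω => G ω y) (le_principal_iff.2 h1)
      exact ⟨c, fun _ => hcl⟩
    · exact ⟨0, fun h => absurd h hy⟩
  choose g hg using hlimex
  have hgBd : T.Bd β ε₀ a 1 1 g := bd_of_tendsto ha hS hc hΩ hGood zero_le_one hBd hg
  -- The bound on the base is needed at `K` consecutive times, since `climb` uses it at each of
  -- them; every `m ≥ n₁` works because `n₁` does.
  have hbase : ∀ m ≥ n₁, ∀ᶠ ω in (U : Filter (ℤ → Ω₀)),
      ∀ x, (x, 0) ∈ T.tower (seqShift ((m + (k + 1) : ℕ) : ℤ) ω) →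
        ‖T.Pn φ t ω (m + (k + 1)) (G ω) (x, 0)‖ ≤ δ / 2 := by
    intro m hm
    have hΩm : Tendsto (fun ω => seqShift (m : ℤ) ω) (U : Filter (ℤ → Ω₀)) (𝓝 a) :=
      (tendsto_seqShift ha _).comp hΩ
    have hGm : ∀ᶠ ω in (U : Filter (ℤ → Ω₀)),
        T.Good β ε₀ c₂ D V C₁ C₂ φ (seqShift (m : ℤ) ω) := hGood.mono fun ω h => h.shift hS m
    have hBm : ∀ᶠ ω in (U : Filter (ℤ → Ω₀)),
        T.Bd β ε₀ (seqShift (m : ℤ) ω) C B (T.Pn φ t ω m (G ω)) := by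
      filter_upwards [hGood, hBd] with ω h1 h2
      refine (hS.bd_Pn h1 zero_le_one zero_le_one h2 t m).mono hβ₀ (mul_one _).le ?_
      refine mul_le_mul_of_nonneg_left ?_ (by positivity)
      have : (β : ℝ) ^ m ≤ 1 := pow_le_one₀ hβ₀.le hβ₁.le
      linarith
    have h1 := eventually_norm_Pn_base_le ha hS hc hΩm hGm t (k + 1)
      (H := fun ω => T.Pn φ t ω m (G ω)) (A := C) (e := e) (by positivity) he0.le
      (hBm.mono fun _ h => h.tame) ?_ (show 0 < δ / 4 by positivity)
    · filter_upwards [h1] with ω h x hx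
      have e1 : ((m + (k + 1) : ℕ) : ℤ) = ((k + 1 : ℕ) : ℤ) + m := by push_cast; ring
      rw [seqShift_congr e1, ← seqShift_seqShift] at hx
      rw [Pn_add]
      refine (h x hx).trans (le_of_eq ?_)
      rw [← hC, he, div_mul_cancel₀ _ (by positivity)]
      ring
    · intro z hz η hη
      have hlim := (tendsto_Pn ha hS hc hΩ hGood t hBd hg m z hz).norm
      have hgz := hn₁ m hm g hgBd z hz
      filter_upwards [hBm, hlim.eventually (gt_mem_nhds (show ‖T.Pn φ t a m g z‖
          < ‖T.Pn φ t a m g z‖ + η by linarith)), hΩm.eventually (eventually_sameAtom ha hT hβ₀ hβ₁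
          hS.distortion hc hz)] with ω h1 h2 h3 z' hz' _ hcyl
      have h4 := DomLip.norm_le_of_cylinder hβ₀ hβ₁ hB0 h1 h3.1 hz' hcyl
      have h5 := mul_le_mul_of_nonneg_right hk.le (wv_pos ε₀ z).le
      rw [← (hcyl.sameAtom (Nat.succ_pos k)).wv_eq]
      linarith
  have hfin : ∀ᶠ ω in (U : Filter (ℤ → Ω₀)), ∀ j ∈ Finset.range (K + 1),
      ∀ x, (x, 0) ∈ T.tower (seqShift ((n₁ + j + (k + 1) : ℕ) : ℤ) ω) →
        ‖T.Pn φ t ω (n₁ + j + (k + 1)) (G ω) (x, 0)‖ ≤ δ / 2 :=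
    (eventually_all_finset _).2 fun j _ => hbase (n₁ + j) (Nat.le_add_right _ _)
  obtain ⟨ω, h1, h2, h3⟩ := (hfin.and (hUs.and hBd)).exists
  refine (hGs ω h2).2.2 ?_
  have hω := (hGs ω h2).1
  set N := n₁ + (k + 1) with hN
  have h4 := climb (T := T) (ω := seqShift (N : ℤ) ω) (ε₀ := ε₀)
    (g := fun m z => ‖T.Pn φ t (seqShift (N : ℤ) ω) m (T.Pn φ t ω N (G ω)) z‖)
    (a := δ / 2) (b := C) hS.ε_pos.le (by positivity)
    (fun z hz => ((hS.bd_Pn hω zero_le_one zero_le_one h3 t N).tame z hz).trans (by rw [mul_one]))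
    K (fun m _ hmK x hx => ?_) (by positivity) fun m x ℓ hz => ?_
  · intro z hz
    have e1 : ((N + K : ℕ) : ℤ) = (K : ℤ) + N := by push_cast; ring
    rw [seqShift_congr e1, ← seqShift_seqShift] at hz
    rw [Pn_add]
    refine (h4 z hz).trans (mul_le_mul_of_nonneg_right ?_ (wv_pos _ _).le)
    linarith
  · have h5 := h1 m (Finset.mem_range.2 (by omega)) x
    have e1 : ((n₁ + m + (k + 1) : ℕ) : ℤ) = (m : ℤ) + N := by rw [hN]; push_cast; ring
    have e2 : n₁ + m + (k + 1) = N + m := by omega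
    rw [e2] at h5
    rw [← Pn_add]
    refine h5 ?_
    rw [← e2, seqShift_congr e1, ← seqShift_seqShift]
    exact hx
  · rw [← seqShift_succ] at hz
    change ‖T.tw φ t _ _ _‖ ≤ _
    rw [tw, tr_succ _ hz, norm_mul, norm_exp_twist, one_mul]

end

end RandomTower

/-! ### Contraction after finitely many steps, for parameters near `t`. -/

namespace RandomTower

section

variable {Ω₀ M : Type*} [MeasurableSpace Ω₀] [MeasurableSpace M] {T : RandomTower Ω₀ M} {β : ℝ}
  {φ : (ℤ → Ω₀) → M × ℕ → ℝ} {ω a : ℤ → Ω₀} {A₁ ε₀ c₂ D V C₁ C₂ : ℝ}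

theorem norm_exp_sub_exp_le (s t x : ℝ) :
    ‖Complex.exp (Complex.I * s * (x : ℂ)) - Complex.exp (Complex.I * t * (x : ℂ))‖
      ≤ |s - t| * |x| := by
  have := norm_exp_twist_sub_le x s t
  rw [mul_comm |s - t|]
  rwa [show Complex.I * s * (x : ℂ) = Complex.I * x * s by ring,
    show Complex.I * t * (x : ℂ) = Complex.I * x * t by ring]

theorem Good.bdd_zero (hω : T.Good β ε₀ c₂ D V C₁ C₂ φ ω) : ∀ z ∈ T.tower ω, |φ ω z| ≤ C₁ := by
  have := hω.bdd 0
  rwa [seqShift_zero] at this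

/-- Changing the parameter alters the phase of each step by at most `|s - t| C₁`; these errors add
up over `n` steps. -/
theorem norm_Pn_sub_le (hS : T.Setup β A₁ ε₀ c₂ D V C₁ C₂)
    (hω : T.Good β ε₀ c₂ D V C₁ C₂ φ ω) {A : ℝ} (hA : 0 ≤ A) {G : M × ℕ → ℂ}
    (hG : T.Tame ε₀ ω A G) (s t : ℝ) (n : ℕ) :
    ∀ z ∈ T.tower (seqShift (n : ℤ) ω), ‖T.Pn φ s ω n G z - T.Pn φ t ω n G z‖
      ≤ n * |s - t| * C₁ * A * T.trn ω n (wv ε₀) z := by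
  have hT := hS.young
  have hC₁ := hS.C₁_nonneg
  induction n with
  | zero => intro z _; simp [Pn]
  | succ n ih =>
    intro z hz
    rw [← seqShift_succ] at hz
    have hn := hω.shift hS n
    have ht : ∀ t : ℝ, T.Tame ε₀ (seqShift (n : ℤ) ω) (A * unifConst β A₁ V)
        fun y => Complex.exp (Complex.I * t * (φ (seqShift (n : ℤ) ω) y : ℂ))
          * T.Pn φ t ω n G y := by
      intro t z hz
      rw [norm_mul, norm_exp_twist, one_mul, mul_assoc]
      exact (norm_Pn_le hS hω hA hG t n z hz).trans
        (mul_le_mul_of_nonneg_left (hS.wn_le hω n z hz) hA)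
    have hsum := fun t => (ht t).summable hT hS.β_pos hS.β_lt_one hS.distortion hS.ε_lt hn.tail hz
    have e1 : T.Pn φ s ω (n + 1) G z - T.Pn φ t ω (n + 1) G z
        = T.tr (seqShift (n : ℤ) ω) (fun y =>
          Complex.exp (Complex.I * s * (φ (seqShift (n : ℤ) ω) y : ℂ)) * T.Pn φ s ω n G y
          - Complex.exp (Complex.I * t * (φ (seqShift (n : ℤ) ω) y : ℂ)) * T.Pn φ t ω n G y) z := by
      change T.tw φ s (seqShift (n : ℤ) ω) (T.Pn φ s ω n G) z
        - T.tw φ t (seqShift (n : ℤ) ω) (T.Pn φ t ω n G) z = _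
      rw [tw, tw]
      rw [tr, tr, tr, ← Summable.tsum_sub (hsum s) (hsum t)]
      exact tsum_congr fun y => (smul_sub _ _ _).symm
    set c : ℝ := ((n + 1 : ℕ) : ℝ) * |s - t| * C₁ * A with hc
    have hc0 : 0 ≤ c := by positivity
    have e2 := norm_tr_le hT hS.β_pos hS.β_lt_one hS.distortion hS.ε_lt hn.tail hz
      (g := fun y =>
          Complex.exp (Complex.I * s * (φ (seqShift (n : ℤ) ω) y : ℂ)) * T.Pn φ s ω n G y
          - Complex.exp (Complex.I * t * (φ (seqShift (n : ℤ) ω) y : ℂ)) * T.Pn φ t ω n G y)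
      (h := fun y => c * T.trn ω n (wv ε₀) y) (A := A * unifConst β A₁ V + A * unifConst β A₁ V)
      (A' := c * unifConst β A₁ V) (fun z hz => ?_) (fun z hz => ?_) fun y hy => ?_
    · rw [e1]
      refine e2.trans (le_of_eq ?_)
      rw [tr_const_mul]
      rfl
    · rw [add_mul]
      exact (norm_sub_le _ _).trans (add_le_add (ht s z hz) (ht t z hz))
    · rw [norm_mul, Real.norm_of_nonneg hc0, mul_assoc c]
      exact mul_le_mul_of_nonneg_left (hS.wn_tame hω n z hz) hc0
    · set x := φ (seqShift (n : ℤ) ω) y with hx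
      have hy1 := hy.1
      have e3 : Complex.exp (Complex.I * s * (x : ℂ)) * T.Pn φ s ω n G y
          - Complex.exp (Complex.I * t * (x : ℂ)) * T.Pn φ t ω n G y
          = (Complex.exp (Complex.I * s * (x : ℂ)) - Complex.exp (Complex.I * t * (x : ℂ)))
            * T.Pn φ s ω n G y
          + Complex.exp (Complex.I * t * (x : ℂ)) * (T.Pn φ s ω n G y - T.Pn φ t ω n G y) := by
        ring
      rw [e3]
      refine (norm_add_le _ _).trans ?_
      rw [norm_mul, norm_mul, norm_exp_twist, one_mul]
      have h1 := (norm_exp_sub_exp_le s t x).trans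
        (mul_le_mul_of_nonneg_left (hn.bdd_zero y hy1) (abs_nonneg _))
      have h2 := mul_le_mul h1 (norm_Pn_le hS hω hA hG s n y hy1) (norm_nonneg _) (by positivity)
      refine (add_le_add h2 (ih y hy1)).trans (le_of_eq ?_)
      rw [hc]
      push_cast
      ring

theorem Pn_const_mul (c : ℂ) (t : ℝ) (n : ℕ) (G : M × ℕ → ℂ) :
    T.Pn φ t ω n (fun z => c * G z) = fun z => c * T.Pn φ t ω n G z := by
  induction n with
  | zero => rfl
  | succ n ih =>
    funext z
    change T.tw φ t _ (T.Pn φ t ω n fun z => c * G z) z = c * T.tw φ t _ _ z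
    rw [ih, tw, tw, tr, tr, ← tsum_mul_left]
    refine tsum_congr fun y => ?_
    simp only [Complex.real_smul]
    ring

theorem Bd.const_mul {A B : ℝ} {G : M × ℕ → ℂ} (hG : T.Bd β ε₀ ω A B G) (c : ℂ) :
    T.Bd β ε₀ ω (‖c‖ * A) (‖c‖ * B) fun z => c * G z where
  tame z hz := by
    rw [norm_mul, mul_assoc]
    exact mul_le_mul_of_nonneg_left (hG.tame z hz) (norm_nonneg _)
  lip z hz z' hz' hs := by
    rw [← mul_sub, norm_mul, mul_assoc, mul_assoc, ← mul_assoc B]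
    exact mul_le_mul_of_nonneg_left (hG.lip z hz z' hz' hs) (norm_nonneg _)

/-- The twisted operators of parameters near `t` contract after `N` steps, by the factor `κ`. -/
def ContractsAt (T : RandomTower Ω₀ M) (φ : (ℤ → Ω₀) → M × ℕ → ℝ) (β ε₀ t ρ κ : ℝ) (N : ℕ)
    (ω : ℤ → Ω₀) : Prop :=
  ∀ s, |s - t| < ρ → ∀ G, T.Bd β ε₀ ω 1 1 G →
    T.Bd β ε₀ (seqShift (N : ℤ) ω) κ κ (T.Pn φ s ω N G)

theorem ContractsAt.bd {t ρ κ s A : ℝ} {N : ℕ} (h : T.ContractsAt φ β ε₀ t ρ κ N ω)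
    (hs : |s - t| < ρ) (hA : 0 < A) {G : M × ℕ → ℂ} (hG : T.Bd β ε₀ ω A A G) :
    T.Bd β ε₀ (seqShift (N : ℤ) ω) (κ * A) (κ * A) (T.Pn φ s ω N G) := by
  have hA' : (A : ℂ) ≠ 0 := Complex.ofReal_ne_zero.2 hA.ne'
  have h1 := hG.const_mul ((A : ℂ)⁻¹)
  have hn : ‖(A : ℂ)⁻¹‖ = A⁻¹ := by rw [norm_inv, Complex.norm_real, Real.norm_of_nonneg hA.le]
  rw [hn, inv_mul_cancel₀ hA.ne'] at h1
  have h2 := (h s hs _ h1).const_mul (A : ℂ)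
  rw [Complex.norm_real, Real.norm_of_nonneg hA.le, mul_comm A] at h2
  have h3 := Pn_const_mul (T := T) (φ := φ) (ω := ω) (A : ℂ) s N fun z => (A : ℂ)⁻¹ * G z
  simp only [mul_inv_cancel_left₀ hA'] at h3
  rw [h3]
  exact h2

theorem lyConst_le (hS : T.Setup β A₁ ε₀ c₂ D V C₁ C₂) {s t : ℝ} (h : |s - t| < 1) :
    lyConst β A₁ C₂ s ≤ lyConst β A₁ C₂ (|t| + 1) := by
  have h1 := hS.C₂_nonneg
  have h2 : |s| ≤ |(|t| + 1)| := by
    rw [abs_of_nonneg (show 0 ≤ |t| + 1 by positivity)]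
    have := abs_sub_abs_le_abs_sub s t
    linarith
  have h3 := hS.β_lt_one
  unfold lyConst
  gcongr

/-- The bound of all iterates of the twisted operators with parameters near `t`. -/
noncomputable def iterConst (β A₁ V C₂ t : ℝ) : ℝ :=
  unifConst β A₁ V * (1 + lyConst β A₁ C₂ (|t| + 1))

theorem Setup.one_le_iterConst (hS : T.Setup β A₁ ε₀ c₂ D V C₁ C₂) (t : ℝ) :
    1 ≤ iterConst β A₁ V C₂ t := by
  have h1 := hS.one_le_unifConst
  have h2 := hS.lyConst_nonneg (|t| + 1)
  unfold iterConst
  nlinarith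

theorem Setup.bd_Pn_iterConst (hS : T.Setup β A₁ ε₀ c₂ D V C₁ C₂)
    (hω : T.Good β ε₀ c₂ D V C₁ C₂ φ ω) {s t A : ℝ} (h : |s - t| < 1) (hA : 0 ≤ A)
    {G : M × ℕ → ℂ} (hG : T.Bd β ε₀ ω A A G) (n : ℕ) :
    T.Bd β ε₀ (seqShift (n : ℤ) ω) (iterConst β A₁ V C₂ t * A) (iterConst β A₁ V C₂ t * A)
      (T.Pn φ s ω n G) := by
  have h1 := hS.one_le_unifConst
  have h2 := hS.lyConst_nonneg (|t| + 1)
  have h3 := lyConst_le hS h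
  have h4 : β ^ n ≤ 1 := pow_le_one₀ hS.β_pos.le hS.β_lt_one.le
  refine (hS.bd_Pn hω hA hA hG s n).mono hS.β_pos ?_ ?_
  · refine mul_le_mul_of_nonneg_right ?_ hA
    unfold iterConst
    nlinarith
  · unfold iterConst
    rw [mul_assoc]
    refine mul_le_mul_of_nonneg_left ?_ (by positivity)
    have h5 := mul_le_mul_of_nonneg_right h4 hA
    have h6 := mul_le_mul_of_nonneg_left h3 hA
    linarith

end

section

variable {Ω₀ M : Type*} [MeasurableSpace Ω₀] [MeasurableSpace M] {T : RandomTower Ω₀ M}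
  {φ : (ℤ → Ω₀) → M × ℕ → ℝ} {a : ℤ → Ω₀} {A₁ ε₀ c₂ D V C₁ C₂ : ℝ} {β : NNReal}

/-- After `N` steps the sup bound at `t` is at most `δ`, hence at most `2δ` for `s` close to `t`.
The Lipschitz part is then only bounded, but `m` more steps multiply it by `β^m`, up to a multiple
of the sup bound, which is already small. -/
theorem exists_contractsAt [TopologicalSpace Ω₀] (ha : ∀ k, seqShift k a = a)
    (hS : T.Setup β A₁ ε₀ c₂ D V C₁ C₂) (hc : T.ContinuousAtSeq β φ a) {t : ℝ}
    (ht : T.TwistedContracts β ε₀ φ a t) {κ : ℝ} (hκ : 0 < κ) :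
    ∃ N : ℕ, ∃ ρ > 0, ρ ≤ 1 ∧ ∀ᶠ ω in 𝓝 a, T.Good β ε₀ c₂ D V C₁ C₂ φ ω →
      T.ContractsAt φ β ε₀ t ρ κ N ω := by
  have hu := hS.one_le_unifConst
  have hl := hS.lyConst_nonneg (|t| + 1)
  have hC₁ := hS.C₁_nonneg
  have hβ₀ := hS.β_pos
  have hβ₁ := hS.β_lt_one
  set C := unifConst (β : ℝ) A₁ V with hC
  set Λ := lyConst (β : ℝ) A₁ C₂ (|t| + 1) with hΛ
  -- Chosen so that `C δ (1 + Λ) = κ/4`: the sup bound `2 C δ` and the term `2 C δ Λ` of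
  -- Lasota–Yorke are then at most `κ/2`.
  set δ := κ / 4 / C / (1 + Λ) with hδ
  have hδ0 : 0 < δ := by positivity
  obtain ⟨N, hN⟩ := eventually_tame_Pn ha hS hc ht hδ0
  obtain ⟨m, hm⟩ : ∃ m : ℕ, C * (C * (1 + Λ)) * (β : ℝ) ^ m < κ / 2 := by
    have := (tendsto_pow_atTop_nhds_zero_of_lt_one hβ₀.le hβ₁).const_mul (C * (C * (1 + Λ)))
    rw [mul_zero] at this
    exact (this.eventually (gt_mem_nhds (half_pos hκ))).exists
  -- The second radius makes the change of parameter cost at most `δ` in `N` steps; the radius `1`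
  -- keeps the Lasota–Yorke constants bounded.
  refine ⟨N + m, min 1 (δ / (N * C₁ * C + 1)), by positivity, min_le_left _ _, ?_⟩
  filter_upwards [hN] with ω hω hgood s hs G hG
  have hs1 : |s - t| < 1 := hs.trans_le (min_le_left _ _)
  have hs2 : |s - t| * (N * C₁ * C + 1) < δ := by
    rw [← lt_div_iff₀ (by positivity)]
    exact hs.trans_le (min_le_right _ _)
  have h1 : T.Tame ε₀ (seqShift (N : ℤ) ω) (2 * δ) (T.Pn φ s ω N G) := by
    intro z hz
    have e1 := hω hgood G hG z hz
    have e2 := norm_Pn_sub_le hS hgood zero_le_one hG.tame s t N z hz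
    have e3 := hS.wn_le hgood N z hz
    have hw := wv_pos ε₀ z
    have e4 : (N : ℝ) * |s - t| * C₁ * 1 * T.trn ω N (wv ε₀) z ≤ δ * wv ε₀ z := by
      calc _ ≤ (N : ℝ) * |s - t| * C₁ * 1 * (C * wv ε₀ z) :=
            mul_le_mul_of_nonneg_left e3 (by positivity)
        _ = (|s - t| * (N * C₁ * C)) * wv ε₀ z := by ring
        _ ≤ δ * wv ε₀ z := by
            refine mul_le_mul_of_nonneg_right ?_ hw.le
            have := abs_nonneg (s - t)
            linarith
    have e5 : ‖T.Pn φ s ω N G z‖ ≤ ‖T.Pn φ s ω N G z - T.Pn φ t ω N G z‖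
        + ‖T.Pn φ t ω N G z‖ := by
      simpa using norm_add_le (T.Pn φ s ω N G z - T.Pn φ t ω N G z) (T.Pn φ t ω N G z)
    linarith
  have h2 : T.Bd β ε₀ (seqShift (N : ℤ) ω) (2 * δ) (C * (1 + Λ)) (T.Pn φ s ω N G) := by
    refine ⟨h1, ?_⟩
    have := hS.bd_Pn_iterConst hgood hs1 zero_le_one hG N
    rw [mul_one] at this
    exact this.lip
  have h3 := hS.bd_Pn (hgood.shift hS N) (by positivity) (by positivity) h2 s m
  rw [Pn_add, seqShift_congr (show ((N + m : ℕ) : ℤ) = m + N by push_cast; ring),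
    ← seqShift_seqShift]
  have h4 : C * δ * (1 + Λ) = κ / 4 := by rw [hδ]; field_simp
  have h5 : C * δ ≤ κ / 4 := by
    rw [← h4]
    exact le_mul_of_one_le_right (by positivity) (by linarith)
  refine h3.mono hβ₀ ?_ ?_
  · rw [← hC]; linarith
  · rw [← hC]
    have h6 := mul_le_mul_of_nonneg_left (lyConst_le hS hs1) (show 0 ≤ C * (2 * δ) by positivity)
    have h7 : C * δ * Λ ≤ κ / 4 := by rw [← h4]; nlinarith [mul_pos (show 0 < C by positivity) hδ0]
    have e : C * ((β : ℝ) ^ m * (C * (1 + Λ)) + 2 * δ * lyConst (β : ℝ) A₁ C₂ s)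
        = C * (C * (1 + Λ)) * (β : ℝ) ^ m + C * (2 * δ) * lyConst (β : ℝ) A₁ C₂ s := by ring
    rw [e]
    have h8 : C * (2 * δ) * Λ = 2 * (C * δ * Λ) := by ring
    linarith

end

end RandomTower

/-! ### Independent blocks of coordinates. -/

section

variable {Ω₀ : Type*} [MeasurableSpace Ω₀] (P₀ : Measure Ω₀) [IsProbabilityMeasure P₀]

theorem measurePreserving_seqShift (k : ℤ) :
    MeasurePreserving (seqShift k) (Measure.infinitePi fun _ : ℤ => P₀)
      (Measure.infinitePi fun _ : ℤ => P₀) where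
  measurable := measurable_pi_lambda _ fun j => measurable_pi_apply (j + k)
  map_eq := Measure.map_infinitePi_infinitePi_of_inj (P := fun _ : ℤ => P₀)
    (f := fun j : ℤ => j + k) (add_left_injective k)

theorem ae_forall_seqShift {p : (ℤ → Ω₀) → Prop}
    (h : ∀ᵐ ω ∂(Measure.infinitePi fun _ : ℤ => P₀), p ω) :
    ∀ᵐ ω ∂(Measure.infinitePi fun _ : ℤ => P₀), ∀ k : ℤ, p (seqShift k ω) :=
  ae_all_iff.2 fun k => (measurePreserving_seqShift P₀ k).quasiMeasurePreserving.ae h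

/-- The event that the coordinates of the `j`-th block of length `w`, at distance `L` from one
another, lie in `U`. -/
def blockEvent (U : Set Ω₀) (L w j : ℕ) : Set (ℤ → Ω₀) :=
  {ω | ∀ i ∈ Finset.range w, ω ((j * L + i : ℕ) : ℤ) ∈ U}

variable {U : Set Ω₀} {L w : ℕ}

theorem measurableSet_blockEvent_iSup (hU : MeasurableSet U) (j : ℕ) (S : Set ℤ)
    (hS : ∀ i < w, ((j * L + i : ℕ) : ℤ) ∈ S) :
    MeasurableSet[⨆ i ∈ S, MeasurableSpace.comap (fun ω : ℤ → Ω₀ => ω i) inferInstance]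
      (blockEvent U L w j) := by
  have : blockEvent U L w j
      = ⋂ i ∈ Finset.range w, (fun ω : ℤ → Ω₀ => ω ((j * L + i : ℕ) : ℤ)) ⁻¹' U := by
    ext ω; simp [blockEvent]
  rw [this]
  refine Finset.measurableSet_biInter _ fun i hi => ?_
  have h1 : MeasurableSpace.comap (fun ω : ℤ → Ω₀ => ω ((j * L + i : ℕ) : ℤ)) inferInstance
      ≤ ⨆ i ∈ S, MeasurableSpace.comap (fun ω : ℤ → Ω₀ => ω i) inferInstance :=
    le_iSup₂_of_le _ (hS i (Finset.mem_range.1 hi)) le_rfl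
  exact h1 _ ⟨U, hU, rfl⟩

theorem comap_eval_le (S : Set ℤ) :
    (⨆ i ∈ S, MeasurableSpace.comap (fun ω : ℤ → Ω₀ => ω i) inferInstance)
      ≤ (inferInstance : MeasurableSpace (ℤ → Ω₀)) :=
  iSup₂_le fun i _ => (measurable_pi_apply i).comap_le

open Classical in
/-- The factor `1/2` for each block event that occurs. -/
noncomputable def blockFactor (U : Set Ω₀) (L w j : ℕ) (ω : ℤ → Ω₀) : ENNReal :=
  if ω ∈ blockEvent U L w j then 2⁻¹ else 1

/-- As `w ≤ L`, different blocks read disjoint sets of coordinates, so the factors are independent.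
Each has mean `p/2 + (1 - p)` with `p = P₀(U)^w`. -/
theorem lintegral_prod_blockFactor (hU : MeasurableSet U) (hw : w ≤ L) (k : ℕ) :
    ∫⁻ ω, ∏ j ∈ Finset.range k, blockFactor U L w j ω ∂(Measure.infinitePi fun _ : ℤ => P₀)
      = (2⁻¹ * P₀ U ^ w + (1 - P₀ U ^ w)) ^ k := by
  set P := Measure.infinitePi fun _ : ℤ => P₀ with hP
  have hmE : ∀ j, MeasurableSet (blockEvent U L w j) := fun j =>
    comap_eval_le univ _ (measurableSet_blockEvent_iSup hU j univ fun _ _ => mem_univ _)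
  have hone : ∀ j, ∫⁻ ω, blockFactor U L w j ω ∂P = 2⁻¹ * P₀ U ^ w + (1 - P₀ U ^ w) := by
    intro j
    have hE : P (blockEvent U L w j) = P₀ U ^ w := by
      have h1 : blockEvent U L w j = Set.pi ((Finset.range w).map
          ⟨fun i : ℕ => ((j * L + i : ℕ) : ℤ), fun a b h => by
            dsimp only at h
            omega⟩ : Finset ℤ) fun _ => U := by
        ext ω
        simp [blockEvent, Set.mem_pi]
      rw [h1, hP, Measure.infinitePi_pi _ (fun _ _ => hU), Finset.prod_const, Finset.card_map,
        Finset.card_range]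
    have h2 : ∀ ω, blockFactor U L w j ω = (blockEvent U L w j).indicator (fun _ => 2⁻¹) ω
        + (blockEvent U L w j)ᶜ.indicator (fun _ => 1) ω := by
      intro ω
      unfold blockFactor
      by_cases h : ω ∈ blockEvent U L w j
      · rw [if_pos h, indicator_of_mem h, indicator_of_notMem (notMem_compl_iff.2 h), add_zero]
      · rw [if_neg h, indicator_of_notMem h, indicator_of_mem (mem_compl h), zero_add]
    simp only [h2]
    rw [lintegral_add_left (measurable_const.indicator (hmE j)), lintegral_indicator_const (hmE j),
      lintegral_indicator_const (hmE j).compl, hE, measure_compl (hmE j) (measure_ne_top _ _), hE,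
      measure_univ, one_mul]
  have hind : iIndep (fun i : ℤ => MeasurableSpace.comap (fun ω : ℤ → Ω₀ => ω i) inferInstance) P :=
    iIndepFun_infinitePi (P := fun _ : ℤ => P₀) (X := fun _ ω => ω) fun _ => measurable_id
  have hmF : ∀ (j : ℕ) (S : Set ℤ), (∀ i < w, ((j * L + i : ℕ) : ℤ) ∈ S) →
      Measurable[⨆ i ∈ S, MeasurableSpace.comap (fun ω : ℤ → Ω₀ => ω i) inferInstance]
        (blockFactor U L w j) := fun j S hS => by
    unfold blockFactor
    exact Measurable.ite (measurableSet_blockEvent_iSup hU j S hS) measurable_const measurable_const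
  induction k with
  | zero => simp
  | succ k ih =>
    simp only [Finset.prod_range_succ]
    rw [pow_succ, ← ih, ← hone k]
    -- The first `k` factors read coordinates below `k L`, the next one only coordinates from `k L`
    -- on.
    have hdisj : Disjoint {i : ℤ | i < ((k * L : ℕ) : ℤ)} {i : ℤ | ((k * L : ℕ) : ℤ) ≤ i} :=
      Set.disjoint_left.2 fun i (h1 : i < _) (h2 : _ ≤ i) => absurd h1 (not_lt.2 h2)
    have hi2 := indep_iSup_of_disjoint (fun i => (measurable_pi_apply i).comap_le) hind hdisj
    refine lintegral_mul_eq_lintegral_mul_lintegral_of_independent_measurableSpace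
      (comap_eval_le _) (comap_eval_le _) hi2 ?_ ?_
    · refine Finset.measurable_fun_prod _ fun j hj => hmF j _ fun i hi => ?_
      have h1 : j + 1 ≤ k := Finset.mem_range.1 hj
      have h2 : (j + 1) * L ≤ k * L := Nat.mul_le_mul_right L h1
      have h3 : j * L + i < k * L := by rw [Nat.add_mul, one_mul] at h2; omega
      exact Int.ofNat_lt.2 h3
    · refine hmF k _ fun i _ => ?_
      have : k * L ≤ k * L + i := Nat.le_add_right _ _
      exact Int.ofNat_le.2 this

open Classical in
/-- The product of the block factors decays exponentially fast, almost surely. -/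
theorem exists_rate_blockFactor (hU : MeasurableSet U) (hU0 : 0 < P₀ U) (hw : w ≤ L) :
    ∃ ρ : ℝ, 0 < ρ ∧ ρ < 1 ∧ ∀ᵐ ω ∂(Measure.infinitePi fun _ : ℤ => P₀), ∃ C : ℝ, ∀ k : ℕ,
      ∏ j ∈ Finset.range k, (if ω ∈ blockEvent U L w j then (2⁻¹ : ℝ) else 1) ≤ C * ρ ^ k := by
  set P := Measure.infinitePi fun _ : ℤ => P₀ with hP
  have hmF : ∀ j, Measurable (blockFactor U L w j) := fun j => by
    unfold blockFactor
    exact Measurable.ite (comap_eval_le univ _ (measurableSet_blockEvent_iSup hU j univ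
      fun _ _ => mem_univ _)) measurable_const measurable_const
  set r : ENNReal := 2⁻¹ * P₀ U ^ w + (1 - P₀ U ^ w) with hr
  have hp0 : P₀ U ^ w ≠ 0 := pow_ne_zero _ hU0.ne'
  have hp1 : P₀ U ^ w ≤ 1 := pow_le_one₀ zero_le prob_le_one
  have hr1 : r < 1 := by
    have h1 : 2⁻¹ * P₀ U ^ w < P₀ U ^ w := by
      have := ENNReal.half_lt_self hp0 (ne_top_of_le_ne_top ENNReal.one_ne_top hp1)
      rwa [ENNReal.div_eq_inv_mul] at this
    calc r < P₀ U ^ w + (1 - P₀ U ^ w) :=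
          ENNReal.add_lt_add_right (ne_top_of_le_ne_top ENNReal.one_ne_top tsub_le_self) h1
      _ = 1 := add_tsub_cancel_of_le hp1
  obtain ⟨ρ, hρ1, hρ2⟩ := exists_between hr1
  have hρ0 : 0 < ρ := lt_of_le_of_lt zero_le hρ1
  have hρt : ρ ≠ ⊤ := (hρ2.trans ENNReal.one_lt_top).ne
  refine ⟨ρ.toReal, ENNReal.toReal_pos hρ0.ne' hρt, ?_, ?_⟩
  · rw [← ENNReal.toReal_one]
    exact (ENNReal.toReal_lt_toReal hρt ENNReal.one_ne_top).2 hρ2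
  set Y : ℕ → (ℤ → Ω₀) → ENNReal := fun k ω => ∏ j ∈ Finset.range k, blockFactor U L w j ω with hY
  have hYm : ∀ k, Measurable (Y k) := fun k => Finset.measurable_fun_prod _ fun j _ => hmF j
  -- With `r < ρ < 1` the series of `ρ^{-k}` times the products has mean `∑ (r/ρ)^k < ∞`. It
  -- converges almost surely, and its sum bounds every term.
  have hsum : ∫⁻ ω, ∑' k, (ρ ^ k)⁻¹ * Y k ω ∂P ≠ ⊤ := by
    rw [lintegral_tsum fun k => ((hYm k).const_mul _).aemeasurable]
    have h1 : ∀ k, ∫⁻ ω, (ρ ^ k)⁻¹ * Y k ω ∂P = (r / ρ) ^ k := fun k => by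
      rw [lintegral_const_mul _ (hYm k), hY, lintegral_prod_blockFactor P₀ hU hw k, ← hr,
        ENNReal.div_eq_inv_mul, mul_pow, ENNReal.inv_pow]
    simp only [h1]
    rw [ENNReal.tsum_geometric]
    refine ENNReal.inv_ne_top.2 (tsub_pos_of_lt ?_).ne'
    rw [ENNReal.div_lt_iff (Or.inl hρ0.ne') (Or.inl hρt), one_mul]
    exact hρ1
  filter_upwards [ae_lt_top (Measurable.tsum fun k => (hYm k).const_mul _) hsum] with ω hω
  set S := ∑' k, (ρ ^ k)⁻¹ * Y k ω with hS
  refine ⟨S.toReal, fun k => ?_⟩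
  have h1 : Y k ω ≤ S * ρ ^ k := by
    have h2 := ENNReal.le_tsum (f := fun k => (ρ ^ k)⁻¹ * Y k ω) k
    have h3 := mul_le_mul_left (α := ENNReal) h2 (ρ ^ k)
    rwa [mul_right_comm, ENNReal.inv_mul_cancel (pow_ne_zero _ hρ0.ne')
      (ENNReal.pow_ne_top hρt), one_mul] at h3
  have h4 : (Y k ω).toReal ≤ S.toReal * ρ.toReal ^ k := by
    have := ENNReal.toReal_mono (ENNReal.mul_ne_top hω.ne (ENNReal.pow_ne_top hρt)) h1
    rwa [ENNReal.toReal_mul, ENNReal.toReal_pow] at this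
  refine le_trans (le_of_eq ?_) h4
  rw [hY, ENNReal.toReal_prod]
  refine Finset.prod_congr rfl fun j _ => ?_
  unfold blockFactor
  split_ifs <;> simp

end

/-! ### Exponential decay of the twisted operators along almost every orbit. -/

namespace RandomTower

section

variable {Ω₀ M : Type*} [MeasurableSpace Ω₀] [MeasurableSpace M] {T : RandomTower Ω₀ M}
  {φ : (ℤ → Ω₀) → M × ℕ → ℝ} {ω : ℤ → Ω₀} {A₁ ε₀ c₂ D V C₁ C₂ : ℝ}

/-- The iterates of the twisted operator at `s` decay exponentially fast along the orbit of `ω`. -/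
def DecaysAt (T : RandomTower Ω₀ M) (φ : (ℤ → Ω₀) → M × ℕ → ℝ) (β ε₀ : ℝ) (ω : ℤ → Ω₀)
    (C c s : ℝ) : Prop :=
  ∀ A > 0, ∀ G, T.Bd β ε₀ ω A A G → ∀ n : ℕ,
    T.Tame ε₀ (seqShift (n : ℤ) ω) (C * A * Real.exp (-c * n)) (T.Pn φ s ω n G)

theorem DecaysAt.mono {β C C' c c' s : ℝ} (h : T.DecaysAt φ β ε₀ ω C c s) (hC : C ≤ C')
    (hC' : 0 ≤ C') (hc : c' ≤ c) : T.DecaysAt φ β ε₀ ω C' c' s := by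
  intro A hA G hG n
  refine (h A hA G hG n).mono ?_
  gcongr

open Classical in
/-- Every block on which the operators contract gains a factor `1/2`. -/
theorem bd_Pn_blocks {β : ℝ} (hS : T.Setup β A₁ ε₀ c₂ D V C₁ C₂)
    (hω : T.Good β ε₀ c₂ D V C₁ C₂ φ ω) {t ρ s A : ℝ} {N w q L : ℕ} {U : Set Ω₀} (hL : q + N ≤ L)
    (hρ : ρ ≤ 1) (hs : |s - t| < ρ) (hA : 0 < A)
    (hU : ∀ k : ℕ, ω ∈ blockEvent U L w k →
      T.ContractsAt φ β ε₀ t ρ (2 * iterConst β A₁ V C₂ t)⁻¹ N (seqShift ((k * L + q : ℕ) : ℤ) ω))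
    {G : M × ℕ → ℂ} (hG : T.Bd β ε₀ ω A A G) (k : ℕ) :
    ∀ n ≥ k * L, T.Bd β ε₀ (seqShift (n : ℤ) ω)
      (iterConst β A₁ V C₂ t * A *
        ∏ j ∈ Finset.range k, (if ω ∈ blockEvent U L w j then (2⁻¹ : ℝ) else 1))
      (iterConst β A₁ V C₂ t * A *
        ∏ j ∈ Finset.range k, (if ω ∈ blockEvent U L w j then (2⁻¹ : ℝ) else 1))
      (T.Pn φ s ω n G) := by
  have hC := hS.one_le_iterConst t
  set C := iterConst β A₁ V C₂ t with hCd
  induction k with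
  | zero =>
    intro n _
    rw [Finset.range_zero, Finset.prod_empty, mul_one]
    exact hS.bd_Pn_iterConst hω (hs.trans_le hρ) hA.le hG n
  | succ k ih =>
    intro n hn
    rw [Nat.add_mul, one_mul] at hn
    rw [Finset.prod_range_succ, ← mul_assoc]
    set b := C * A * ∏ j ∈ Finset.range k, (if ω ∈ blockEvent U L w j then (2⁻¹ : ℝ) else 1) with hb
    have hb0 : 0 < b := by
      refine mul_pos (by positivity) (Finset.prod_pos fun j _ => ?_)
      split_ifs <;> norm_num
    by_cases hE : ω ∈ blockEvent U L w k
    · rw [if_pos hE]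
      -- From the centre `k L + q` of the block, `N` steps contract by `(2C)⁻¹`. All later steps
      -- together cost at most one factor `C`, so the net gain is `1/2`.
      have h1 := (hU k hE).bd hs hb0 (ih (k * L + q) (Nat.le_add_right _ _))
      obtain ⟨m, rfl⟩ := Nat.exists_eq_add_of_le (show k * L + q + N ≤ n by omega)
      have h2 := hS.bd_Pn_iterConst ((hω.shift hS ((k * L + q : ℕ) : ℤ)).shift hS (N : ℤ))
        (hs.trans_le hρ) (t := t) (A := (2 * C)⁻¹ * b) (by positivity) h1 m
      have e : seqShift (m : ℤ) (seqShift (N : ℤ) (seqShift ((k * L + q : ℕ) : ℤ) ω))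
          = seqShift ((k * L + q + N + m : ℕ) : ℤ) ω := by
        rw [seqShift_seqShift, seqShift_seqShift]
        exact seqShift_congr (by push_cast; ring) ω
      have e2 : T.Pn φ s ω (k * L + q + N + m) G
          = T.Pn φ s (seqShift (N : ℤ) (seqShift ((k * L + q : ℕ) : ℤ) ω)) m
            (T.Pn φ s (seqShift ((k * L + q : ℕ) : ℤ) ω) N (T.Pn φ s ω (k * L + q) G)) := by
        rw [Nat.add_assoc, Pn_add, Pn_add]
      have e3 : C * ((2 * C)⁻¹ * b) = b * 2⁻¹ := by field_simp
      rw [e, ← hCd, e3, ← e2] at h2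
      exact h2
    · rw [if_neg hE, mul_one]
      exact ih n (by omega)

end

section

variable {Ω₀ M : Type*} [TopologicalSpace Ω₀] [MeasurableSpace Ω₀] [OpensMeasurableSpace Ω₀]
  [MeasurableSpace M] {T : RandomTower Ω₀ M}
  {φ : (ℤ → Ω₀) → M × ℕ → ℝ} {A₁ ε₀ c₂ D V C₁ C₂ : ℝ} {β : NNReal}
  (P₀ : Measure Ω₀) [IsProbabilityMeasure P₀]

/-- Neighbourhoods in the product topology restrict finitely many coordinates; a symmetric window
around `0` contains them. -/
theorem exists_window {a₀ : Ω₀} {W : Set (ℤ → Ω₀)} (hW : W ∈ 𝓝 (fun _ : ℤ => a₀)) :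
    ∃ U : Set Ω₀, IsOpen U ∧ a₀ ∈ U ∧ ∃ q : ℕ, ∀ ω : ℤ → Ω₀,
      (∀ i < 2 * q + 1, ω ((i : ℤ) - q) ∈ U) → ω ∈ W := by
  rw [nhds_pi, Filter.mem_pi] at hW
  obtain ⟨I, hI, u, hu, hsub⟩ := hW
  have h1 : (⋂ i ∈ I, u i) ∈ 𝓝 a₀ := (biInter_mem hI).2 fun i _ => hu i
  obtain ⟨U, hUs, hUo, haU⟩ := mem_nhds_iff.1 h1
  obtain ⟨q, hq⟩ : ∃ q : ℕ, ∀ i ∈ I, i.natAbs ≤ q := by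
    obtain ⟨q, hq⟩ := (hI.image Int.natAbs).bddAbove
    exact ⟨q, fun i hi => hq ⟨i, hi, rfl⟩⟩
  refine ⟨U, hUo, haU, q, fun ω hω => hsub fun i hi => ?_⟩
  have h2 := hq i hi
  have h3 := hω (i + q).toNat (by omega)
  rw [show (((i + q).toNat : ℤ)) - q = i by omega] at h3
  exact mem_iInter₂.1 (hUs h3) i hi

theorem ae_decaysAt_near (hS : T.Setup β A₁ ε₀ c₂ D V C₁ C₂) {a₀ : Ω₀}
    (ha₀ : ∀ U ∈ 𝓝 a₀, 0 < P₀ U) (hc : T.ContinuousAtSeq β φ fun _ => a₀)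
    (hgood : ∀ᵐ ω ∂(Measure.infinitePi fun _ : ℤ => P₀), T.Good β ε₀ c₂ D V C₁ C₂ φ ω)
    {t : ℝ} (ht : T.TwistedContracts β ε₀ φ (fun _ => a₀) t) :
    ∃ ρ > 0, ∃ c > 0, ∀ᵐ ω ∂(Measure.infinitePi fun _ : ℤ => P₀), ∃ C, ∀ s, |s - t| < ρ →
      T.DecaysAt φ β ε₀ ω C c s := by
  have hC := hS.one_le_iterConst t
  obtain ⟨N, ρ, hρ0, hρ1, hW⟩ := exists_contractsAt (fun k => seqShift_const k a₀) hS hc ht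
    (show 0 < (2 * iterConst (β : ℝ) A₁ V C₂ t)⁻¹ by positivity)
  obtain ⟨U, hUo, haU, q, hq⟩ := exists_window hW
  set w := 2 * q + 1 with hw
  -- The window occupies `w` coordinates; the spacing also leaves room for the `N` steps of
  -- contraction, counted from its centre, before the next block starts.
  set L := w + N with hL
  obtain ⟨r, hr0, hr1, hrate⟩ := exists_rate_blockFactor P₀ (L := L) (w := w)
    hUo.measurableSet (ha₀ U (hUo.mem_nhds haU)) (by omega)
  have hL0 : (0 : ℝ) < L := by exact_mod_cast (show 0 < L by omega)
  have hlog : Real.log r < 0 := Real.log_neg hr0 hr1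
  refine ⟨ρ, hρ0, -Real.log r / L, div_pos (by linarith) hL0, ?_⟩
  filter_upwards [hgood, hrate] with ω hω ⟨K, hK⟩
  refine ⟨iterConst (β : ℝ) A₁ V C₂ t * K * r⁻¹, fun s hs A hA G hG n => ?_⟩
  have h1 := bd_Pn_blocks hS hω (L := L) (w := w) (q := q) (N := N) (U := U) (by omega) hρ1 hs hA
    (fun k hk => hq _ (fun i hi => ?_) (hω.shift hS _)) hG (n / L) n (Nat.div_mul_le_self n L)
  · refine h1.tame.mono ?_
    refine (mul_le_mul_of_nonneg_left (hK (n / L)) (by positivity)).trans ?_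
    have hK0 : 0 ≤ K := by
      have := hK 0
      simp only [Finset.range_zero, Finset.prod_empty, pow_zero, mul_one] at this
      linarith
    -- Only complete blocks count; rounding `n / L` down costs at most one factor `r⁻¹`.
    have h2 : r ^ (n / L) ≤ r⁻¹ * Real.exp (-(-Real.log r / L) * n) := by
      rw [← div_eq_inv_mul, le_div_iff₀ hr0, ← pow_succ, ← Real.exp_log hr0, ← Real.exp_nat_mul,
        Real.exp_log hr0, Real.exp_le_exp]
      have h3 : (n : ℝ) ≤ ((n / L + 1 : ℕ) : ℝ) * L := by
        have := (Nat.lt_div_mul_add (a := n) (b := L) (by omega)).le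
        have h4 : n ≤ (n / L + 1) * L := by rw [Nat.add_mul, one_mul]; exact this
        exact_mod_cast h4
      have h5 : -(-Real.log r / L) * n = Real.log r * (n / L) := by ring
      rw [h5, mul_comm]
      refine mul_le_mul_of_nonpos_left ?_ hlog.le
      rw [div_le_iff₀ hL0]
      exact h3
    calc _ ≤ iterConst (β : ℝ) A₁ V C₂ t * A * (K * (r⁻¹ * Real.exp (-(-Real.log r / L) * n))) := by
          gcongr
      _ = _ := by ring
  · have h2 := hk i (Finset.mem_range.2 hi)
    change ω _ ∈ U
    convert h2 using 2
    push_cast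
    ring

/-- Uniform exponential decay of the twisted operators on compact sets of parameters. -/
theorem ae_decaysAt (hS : T.Setup β A₁ ε₀ c₂ D V C₁ C₂) {a₀ : Ω₀}
    (ha₀ : ∀ U ∈ 𝓝 a₀, 0 < P₀ U) (hc : T.ContinuousAtSeq β φ fun _ => a₀)
    (hgood : ∀ᵐ ω ∂(Measure.infinitePi fun _ : ℤ => P₀), T.Good β ε₀ c₂ D V C₁ C₂ φ ω)
    {I : Set ℝ} (hI : ∀ t ∈ I, T.TwistedContracts β ε₀ φ (fun _ => a₀) t) :
    ∀ᵐ ω ∂(Measure.infinitePi fun _ : ℤ => P₀), ∀ J : Set ℝ, IsCompact J → J ⊆ I →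
      ∃ C c, 0 < c ∧ ∀ s ∈ J, T.DecaysAt φ β ε₀ ω C c s := by
  have h1 : ∀ t, ∃ ρ > 0, t ∈ I → ∃ c > 0, ∀ᵐ ω ∂(Measure.infinitePi fun _ : ℤ => P₀), ∃ C,
      ∀ s, |s - t| < ρ → T.DecaysAt φ β ε₀ ω C c s := by
    intro t
    by_cases ht : t ∈ I
    · obtain ⟨ρ, hρ, h⟩ := ae_decaysAt_near P₀ hS ha₀ hc hgood (hI t ht)
      exact ⟨ρ, hρ, fun _ => h⟩
    · exact ⟨1, one_pos, fun h => absurd h ht⟩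
  choose ρ hρ h2 using h1
  -- The exceptional set depends on `t`. Countably many of the neighbourhoods cover `I` by the
  -- Lindelöf property, so one null set is removed before `J` is chosen.
  obtain ⟨S, hSI, hScount, hScov⟩ := TopologicalSpace.countable_cover_nhdsWithin
    (f := fun t => Metric.ball t (ρ t)) (s := I)
    fun t _ => mem_nhdsWithin_of_mem_nhds (Metric.ball_mem_nhds t (hρ t))
  have h3 : ∀ᵐ ω ∂(Measure.infinitePi fun _ : ℤ => P₀), ∀ t ∈ S, ∃ c > 0, ∃ C,
      ∀ s, |s - t| < ρ t → T.DecaysAt φ β ε₀ ω C c s := by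
    refine (ae_ball_iff hScount).2 fun t ht => ?_
    obtain ⟨c, hc, h⟩ := h2 t (hSI ht)
    exact h.mono fun ω hω => ⟨c, hc, hω⟩
  filter_upwards [h3] with ω hω J hJ hJI
  choose! c hc' C hC using hω
  obtain ⟨b, hbS, hbfin, hbcov⟩ := hJ.elim_finite_subcover_image (b := S)
    (c := fun t => Metric.ball t (ρ t)) (fun _ _ => Metric.isOpen_ball) (hJI.trans hScov)
  obtain ⟨c₀, hc₀, hc₀'⟩ : ∃ c₀ > 0, ∀ t ∈ b, c₀ ≤ c t := by
    have h4 : ∀ᶠ x in 𝓝[>] (0 : ℝ), ∀ t ∈ b, x ≤ c t :=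
      (eventually_all_finite hbfin).2 fun t ht =>
        mem_nhdsWithin_of_mem_nhds (Iic_mem_nhds (hc' t (hbS ht)))
    obtain ⟨x, hx1, hx2⟩ := (h4.and self_mem_nhdsWithin).exists
    exact ⟨x, hx2, hx1⟩
  obtain ⟨K, hK, hK'⟩ : ∃ K, 0 ≤ K ∧ ∀ t ∈ b, C t ≤ K := by
    have h4 : ∀ᶠ x in (atTop : Filter ℝ), ∀ t ∈ b, C t ≤ x :=
      (eventually_all_finite hbfin).2 fun t _ => eventually_ge_atTop (C t)
    obtain ⟨x, hx1, hx2⟩ := (h4.and (eventually_ge_atTop 0)).exists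
    exact ⟨x, hx2, hx1⟩
  refine ⟨K, c₀, hc₀, fun s hs => ?_⟩
  obtain ⟨t, ht, hst⟩ := mem_iUnion₂.1 (hbcov hs)
  exact (hC t (hbS ht) s hst).mono (hK' t ht) hK (hc₀' t ht)

end

end RandomTower

/-! ### Transport of densities that depend on finitely many atoms of the orbit. -/

namespace RandomTower

section

variable {Ω₀ M : Type*} [MeasurableSpace Ω₀] [MeasurableSpace M] {T : RandomTower Ω₀ M} {β : ℝ}
  {A₁ ε₀ c₂ D V C₁ C₂ : ℝ} {φ : (ℤ → Ω₀) → M × ℕ → ℝ} {ω : ℤ → Ω₀}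

theorem trn_add (n m : ℕ) (g : M × ℕ → ℝ) :
    T.trn ω (n + m) g = T.trn (seqShift (n : ℤ) ω) m (T.trn ω n g) := by
  induction m with
  | zero => rfl
  | succ m ih =>
    change T.tr (seqShift ((n + m : ℕ) : ℤ) ω) (T.trn ω (n + m) g) = T.tr _ _
    rw [ih, seqShift_seqShift]
    rw [seqShift_congr (show ((n + m : ℕ) : ℤ) = m + n by push_cast; ring)]

theorem Setup.trn_cone_zero_le (hS : T.Setup β A₁ ε₀ c₂ D V C₁ C₂)
    (hω : T.Good β ε₀ c₂ D V C₁ C₂ φ ω) {h : M × ℕ → ℝ} {A : ℝ} (hA : 0 ≤ A)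
    (ht : T.Tame ε₀ ω A h) (h0 : ∀ y ∈ T.tower ω, 0 ≤ h y)
    (hc : T.Cone β (A₁ / (1 - β)) 0 ω h) (n : ℕ) :
    ∀ z ∈ T.tower (seqShift (n : ℤ) ω), T.trn ω n h z
      ≤ (Real.exp (A₁ / (1 - β)) * ∫ z, h z ∂(T.towerMeasure ω) + A * Real.exp (-ε₀ * n))
        * wv ε₀ z := by
  have h6 : 0 ≤ᵐ[T.towerMeasure ω] h := by
    filter_upwards [hS.young.ae_mem_tower ω] with z hz using h0 z hz
  refine climb (g := fun n => T.trn ω n h) hS.ε_pos.le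
    (mul_nonneg (Real.exp_pos _).le (integral_nonneg_of_ae h6))
    (fun z hz => (le_abs_self _).trans (ht z hz)) n
    (fun m _ _ x hx => trn_base_le hS hω hA ht h0 hc (Nat.zero_le m) hx) hA
    fun m x ℓ hz => (trn_up m x ℓ hz).le

/-- Iterates of nonnegative functions that are constant on cylinders of order `k` eventually satisfy
bounds that depend on the integral only. -/
theorem Setup.bd_trn (hS : T.Setup β A₁ ε₀ c₂ D V C₁ C₂)
    (hω : T.Good β ε₀ c₂ D V C₁ C₂ φ ω) {h : M × ℕ → ℝ} {A : ℝ} (hA : 0 ≤ A)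
    (ht : T.Tame ε₀ ω A h) (h0 : ∀ y ∈ T.tower ω, 0 ≤ h y) {k : ℕ}
    (hc : T.Cone β (A₁ / (1 - β)) k ω h) {b : ℝ} (hb : ∫ z, h z ∂(T.towerMeasure ω) ≤ b) {p : ℕ}
    (hp : A * unifConst β A₁ V * Real.exp (-ε₀ * p) ≤ 1) :
    T.Bd β ε₀ (seqShift ((k + p : ℕ) : ℤ) ω)
      ((1 + A₁ / (1 - β)) * Real.exp (A₁ / (1 - β)) * (Real.exp (A₁ / (1 - β)) * b + 1))
      ((1 + A₁ / (1 - β)) * Real.exp (A₁ / (1 - β)) * (Real.exp (A₁ / (1 - β)) * b + 1))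
      fun z => (T.trn ω (k + p) h z : ℂ) := by
  have hK := hS.K_nonneg
  set K := A₁ / (1 - β)
  have hE : 1 ≤ Real.exp K := Real.one_le_exp hK
  have hu := hS.one_le_unifConst
  -- `k` steps bring the order of the cone to `0`, so that the base is controlled by the integral;
  -- `p` more steps make the contribution of the initial bound `A` on the upper levels at most `1`.
  obtain ⟨i0, i1, _, i3⟩ := trn_spec hS hω hA ht h0 hc k
  rw [Nat.sub_self] at i1
  have hω' := hω.shift hS (k : ℤ)
  have i2 : T.Tame ε₀ (seqShift (k : ℤ) ω) (A * unifConst β A₁ V) (T.trn ω k h) := fun z hz => by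
    refine (trn_le hS hω hA ht k z hz).trans ?_
    rw [mul_assoc]
    exact mul_le_mul_of_nonneg_left (hS.wn_le hω k z hz) hA
  have hA' : 0 ≤ A * unifConst β A₁ V := by positivity
  have j1 := hS.trn_cone_zero_le hω' hA' i2 i0 i1 p
  obtain ⟨l0, l1, _, _⟩ := trn_spec hS hω' hA' i2 i0 i1 p
  rw [Nat.zero_sub] at l1
  have hsh : seqShift (p : ℤ) (seqShift (k : ℤ) ω) = seqShift ((k + p : ℕ) : ℤ) ω := by
    rw [seqShift_seqShift]
    exact seqShift_congr (by push_cast; ring) ω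
  rw [hsh, ← trn_add] at l1
  rw [hsh, ← trn_add] at l0 j1
  have h6 : 0 ≤ᵐ[T.towerMeasure ω] h := by
    filter_upwards [hS.young.ae_mem_tower ω] with z hz using h0 z hz
  have hb0 : 0 ≤ b := (integral_nonneg_of_ae h6).trans hb
  have j2 : ∀ z ∈ T.tower (seqShift ((k + p : ℕ) : ℤ) ω), T.trn ω (k + p) h z
      ≤ (Real.exp K * b + 1) * wv ε₀ z := fun z hz => by
    refine (j1 z hz).trans (mul_le_mul_of_nonneg_right ?_ (wv_pos ε₀ z).le)
    rw [i3]
    exact add_le_add (mul_le_mul_of_nonneg_left hb (Real.exp_pos _).le) hp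
  have hC : 0 ≤ Real.exp K * b + 1 := by positivity
  constructor
  · intro z hz
    rw [Complex.norm_real, Real.norm_of_nonneg (l0 z hz)]
    refine (j2 z hz).trans (mul_le_mul_of_nonneg_right ?_ (wv_pos ε₀ z).le)
    refine le_mul_of_one_le_left hC ?_
    nlinarith
  · intro z hz z' hz' hs
    rw [← Complex.ofReal_sub, Complex.norm_real, Real.norm_eq_abs]
    refine (l1.abs_sub_le hK hS.β_pos hS.β_lt_one l0 hz hz' (Or.inr hs)
      (sameCylinder_zero _ _ _)).trans ?_
    refine mul_le_mul_of_nonneg_right ?_ (T.sepDist_nonneg hS.β_pos.le _ _ _)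
    have hw := wv_pos ε₀ z
    calc K * Real.exp K * T.trn ω (k + p) h z
        ≤ K * Real.exp K * ((Real.exp K * b + 1) * wv ε₀ z) :=
          mul_le_mul_of_nonneg_left (j2 z hz) (by positivity)
      _ ≤ (1 + K) * Real.exp K * ((Real.exp K * b + 1) * wv ε₀ z) := by
          gcongr
          linarith
      _ = _ := by ring

theorem tr_ofReal (g : M × ℕ → ℝ) (z : M × ℕ) :
    T.tr ω (fun y => (g y : ℂ)) z = ((T.tr ω g z : ℝ) : ℂ) := by
  rw [tr, tr, Complex.ofReal_tsum]
  refine tsum_congr fun y => ?_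
  simp only [Complex.real_smul, smul_eq_mul, Complex.ofReal_mul]

/-- Duality of the iterates of the tower maps and of the transfer operators. -/
theorem Setup.integral_comp_Fiter (hS : T.Setup β A₁ ε₀ c₂ D V C₁ C₂)
    (hω : T.Good β ε₀ c₂ D V C₁ C₂ φ ω) {h : M × ℕ → ℝ} {A : ℝ} (hA : 0 ≤ A)
    (ht : T.Tame ε₀ ω A h) (h0 : ∀ y ∈ T.tower ω, 0 ≤ h y) {k : ℕ}
    (hc : T.Cone β (A₁ / (1 - β)) k ω h) (n : ℕ) :
    ∀ ψ : M × ℕ → ℂ, Measurable ψ → (∀ z, ‖ψ z‖ ≤ 1) →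
    ∫ z, ψ (T.Fiter ω n z) * (h z : ℂ) ∂(T.towerMeasure ω)
      = ∫ z, ψ z * (T.trn ω n h z : ℂ) ∂(T.towerMeasure (seqShift (n : ℤ) ω)) := by
  have hT := hS.young
  induction n with
  | zero =>
    intro ψ hψ hb
    rw [Nat.cast_zero, seqShift_zero]
    rfl
  | succ n ih =>
    intro ψ hψ hb
    obtain ⟨i0, i1, ⟨A', hA', i2⟩, _⟩ := trn_spec hS hω hA ht h0 hc n
    have hm := i1.measOn hS hS.K_nonneg i0 hA' i2
    have hF : Measurable (T.F (seqShift (n : ℤ) ω)) := hT.measurable_F.comp measurable_prodMk_left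
    have hm' : T.MeasOn (seqShift (n : ℤ) ω) fun z => (T.trn ω n h z : ℂ) := by
      have := Complex.measurable_ofReal.comp hm
      change Measurable _
      convert this using 1
      funext z
      by_cases hz : z ∈ T.tower (seqShift (n : ℤ) ω) <;> simp [hz]
    have h1 := ih (fun z => ψ (T.F (seqShift (n : ℤ) ω) z)) (hψ.comp hF) fun z => hb _
    change ∫ z, ψ (T.F (seqShift (n : ℤ) ω) (T.Fiter ω n z)) * (h z : ℂ) ∂(T.towerMeasure ω) = _
    rw [h1, ← integral_tr hS (hω.shift hS (n : ℤ)) (A := A')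
      (g := fun z => ψ (T.F (seqShift (n : ℤ) ω) z) * (T.trn ω n h z : ℂ)) (fun z hz => ?_)
      ((MeasOn.of_measurable hT (hψ.comp hF)).mul hm'), seqShift_succ]
    · refine integral_congr_ae (ae_of_all _ fun z => ?_)
      dsimp only
      rw [tr_comp_mul, tr_ofReal]
      rfl
    · rw [norm_mul, Complex.norm_real]
      exact (mul_le_of_le_one_left (norm_nonneg _) (hb _)).trans (i2 z hz)

end

end RandomTower

/-! ### Approximation of absolutely continuous measures on cylinders by a countable family of
densities. -/

section

variable {X : Type*} [MeasurableSpace X] {C : ℕ → Type*} [∀ n, Countable (C n)]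
  [∀ n, MeasurableSpace (C n)] [∀ n, MeasurableSingletonClass (C n)]

/-- The total variation of `μ - ν` on the cylinders of each order is at most `ε`. -/
def CodeClose (code : ∀ n, X → C n) (μ ν : Measure X) (ε : ℝ) : Prop :=
  ∀ j, ∑' c, ENNReal.ofReal |μ.real (code j ⁻¹' {c}) - ν.real (code j ⁻¹' {c})| ≤ ENNReal.ofReal ε

/-- The functions of the `k`-th code with finitely many nonnegative rational values. -/
noncomputable def codeFun (code : ∀ n, X → C n) (q : Σ k, (C k →₀ ℕ) × ℕ) (z : X) : ℝ :=
  (q.2.1 (code q.1 z) : ℝ) / q.2.2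

theorem codeFun_nonneg (code : ∀ n, X → C n) (q : Σ k, (C k →₀ ℕ) × ℕ) (z : X) :
    0 ≤ codeFun code q z := by
  unfold codeFun; positivity

variable {code : ∀ n, X → C n}

theorem measurable_codeFun (hm : ∀ n, Measurable (code n)) (q : Σ k, (C k →₀ ℕ) × ℕ) : Measurable (codeFun code q) :=
  (Measurable.of_discrete (f := fun c => (q.2.1 c : ℝ) / q.2.2)).comp (hm q.1)

theorem CodeClose.norm_integral_sub_le (hm : ∀ n, Measurable (code n)) {μ ν : Measure X} [IsFiniteMeasure μ] [IsFiniteMeasure ν]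
    {ε : ℝ} (hε : 0 ≤ ε) (h : CodeClose code μ ν ε) (j : ℕ) (r : C j → ℂ) (hr : ∀ c, ‖r c‖ ≤ 1) :
    ‖∫ z, r (code j z) ∂μ - ∫ z, r (code j z) ∂ν‖ ≤ ε := by
  have hrm : Measurable r := Measurable.of_discrete
  have key : ∀ μ' : Measure X, IsFiniteMeasure μ' →
      HasSum (fun c => μ'.real (code j ⁻¹' {c}) • r c) (∫ z, r (code j z) ∂μ') := by
    intro μ' hμ'
    have hi : Integrable r (μ'.map (code j)) :=
      Integrable.of_bound hrm.aestronglyMeasurable 1 (ae_of_all _ hr)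
    have h1 := hasSum_integral_of_summable_integral_norm (μ := μ')
      (F := fun c z => (code j ⁻¹' {c}).indicator (fun _ => r c) z) (fun c => ?_) ?_
    · have e1 : (fun c => μ'.real (code j ⁻¹' {c}) • r c)
          = fun c => ∫ z, (code j ⁻¹' {c}).indicator (fun _ => r c) z ∂μ' := by
        funext c
        rw [integral_indicator_const _ (hm j (measurableSet_singleton c))]
      have e2 : ∫ z, r (code j z) ∂μ'
          = ∫ z, ∑' c, (code j ⁻¹' {c}).indicator (fun _ => r c) z ∂μ' := by
        refine integral_congr_ae (ae_of_all _ fun z => ?_)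
        dsimp only
        rw [tsum_eq_single (code j z)]
        · rw [indicator_of_mem (by exact rfl)]
        · intro c hc
          exact indicator_of_notMem (fun h => hc h.symm) _
      rw [e1, e2]
      exact h1
    · exact (integrable_const _).indicator (hm j (measurableSet_singleton c))
    · have h2 : ∀ c, ∫ z, ‖(code j ⁻¹' {c}).indicator (fun _ => r c) z‖ ∂μ'
          = μ'.real (code j ⁻¹' {c}) * ‖r c‖ := fun c => by
        simp only [norm_indicator_eq_indicator_norm]
        rw [integral_indicator_const _ (hm j (measurableSet_singleton c)), smul_eq_mul]
      simp only [h2]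
      have h3 : Summable fun c => μ'.real (code j ⁻¹' {c}) := by
        refine ENNReal.summable_toReal ?_
        refine ((tsum_meas_le_meas_iUnion_of_disjoint μ'
          (fun c => hm j (measurableSet_singleton c)) ?_).trans_lt (measure_lt_top μ' _)).ne
        intro c c' hc
        exact (disjoint_singleton.2 hc).preimage _
      exact h3.of_nonneg_of_le (fun c => by positivity) fun c =>
        mul_le_of_le_one_right measureReal_nonneg (hr c)
  have h1 := (key μ inferInstance).sub (key ν inferInstance)
  have h2 : Summable fun c => |μ.real (code j ⁻¹' {c}) - ν.real (code j ⁻¹' {c})| := by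
    have := ENNReal.summable_toReal ((h j).trans_lt ENNReal.ofReal_lt_top).ne
    refine this.congr fun c => ?_
    rw [ENNReal.toReal_ofReal (abs_nonneg _)]
  have h3 : ∑' c, |μ.real (code j ⁻¹' {c}) - ν.real (code j ⁻¹' {c})| ≤ ε := by
    have := h j
    rw [← ENNReal.ofReal_tsum_of_nonneg (fun _ => abs_nonneg _) h2] at this
    exact (ENNReal.ofReal_le_ofReal_iff hε).1 this
  have h4 : ∀ c, ‖μ.real (code j ⁻¹' {c}) • r c - ν.real (code j ⁻¹' {c}) • r c‖
      ≤ |μ.real (code j ⁻¹' {c}) - ν.real (code j ⁻¹' {c})| := fun c => by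
    rw [← sub_smul, norm_smul, Real.norm_eq_abs]
    exact mul_le_of_le_one_right (abs_nonneg _) (hr c)
  rw [← h1.tsum_eq]
  exact (tsum_of_norm_bounded h2.hasSum h4).trans h3

/-- Masses of cylinders see the density only through its conditional expectation on the σ-algebra of
all codes. By Lévy's upward theorem this is an `L¹` limit of functions of the `k`-th code, and such
functions are approximated by finitely supported rational ones. -/
theorem exists_codeClose (hm : ∀ n, Measurable (code n))
    (hmono : ∀ k l, k ≤ l → ∃ g : C l → C k, code k = g ∘ code l)
    {m μ : Measure X} [IsFiniteMeasure m] [IsFiniteMeasure μ] (hac : μ ≪ m) {ε : ℝ} (hε : 0 < ε) :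
    ∃ q : Σ k, (C k →₀ ℕ) × ℕ,
      CodeClose code μ (m.withDensity fun z => ENNReal.ofReal (codeFun code q z)) ε := by
  classical
  let ℱ : Filtration ℕ (inferInstance : MeasurableSpace X) :=
    { seq := fun k => MeasurableSpace.comap (code k) inferInstance
      mono' := fun k l hkl => by
        obtain ⟨g, hg⟩ := hmono k l hkl
        change MeasurableSpace.comap (code k) _ ≤ MeasurableSpace.comap (code l) _
        rw [hg, ← MeasurableSpace.comap_comp]
        exact MeasurableSpace.comap_mono (Measurable.of_discrete (f := g)).comap_le
      le' := fun k => (hm k).comap_le }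
  have hle : (⨆ n, ℱ n) ≤ (inferInstance : MeasurableSpace X) := iSup_le ℱ.le
  set ρ : X → ℝ := fun z => (μ.rnDeriv m z).toReal with hρ
  have hρi : Integrable ρ m := Measure.integrable_toReal_rnDeriv
  set g : X → ℝ := m[ρ | ⨆ n, ℱ n] with hg
  have hgi : Integrable g m := integrable_condExp
  have hg0 : 0 ≤ᵐ[m] g := condExp_nonneg (ae_of_all _ fun z => ENNReal.toReal_nonneg)
  obtain ⟨k, hk⟩ := ((ENNReal.tendsto_nhds_zero.1 (tendsto_eLpNorm_condExp (μ := m) (ℱ := ℱ) ρ)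
    (ENNReal.ofReal (ε / 2)) (by simpa using hε))).exists
  obtain ⟨r, hrm, hr⟩ := (stronglyMeasurable_condExp (m := ℱ k) (μ := m)
    (f := ρ)).exists_eq_measurable_comp (f := code k)
  have hri : Integrable (fun z => r (code k z)) m := by
    have : Integrable (m[ρ | ℱ k]) m := integrable_condExp
    rwa [hr] at this
  have hgri : Integrable (fun z => g z - r (code k z)) m := hgi.sub hri
  have hgr : ∫ z, ‖g z - r (code k z)‖ ∂m ≤ ε / 2 := by
    rw [integral_norm_eq_lintegral_enorm hgri.1]
    refine ENNReal.toReal_le_of_le_ofReal (by positivity) (le_trans (le_of_eq ?_) hk)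
    rw [eLpNorm_one_eq_lintegral_enorm, hr]
    refine lintegral_congr fun z => ?_
    simp only [Pi.sub_apply, Function.comp]
    exact enorm_sub_rev _ _
  let _ : Encodable (C k) := Encodable.ofCountable _
  let s : ℕ → Finset (C k) := fun N => (Finset.range N).preimage Encodable.encode
    Encodable.encode_injective.injOn
  -- On the codes enumerated before `N`, `r` is rounded down to a nonnegative multiple of `1/N`; on
  -- the others it is replaced by `0`.
  let q : ℕ → Σ k, (C k →₀ ℕ) × ℕ := fun N =>
    ⟨k, Finsupp.onFinset (s N) (fun c => if c ∈ s N then ⌊r c * N⌋₊ else 0) fun c hc => by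
      by_contra h
      exact hc (if_neg h), N⟩
  have hq : ∀ N z, codeFun code (q N) z
      = ((if code k z ∈ s N then ⌊r (code k z) * N⌋₊ else 0 : ℕ) : ℝ) / N := fun N z => rfl
  have hqle : ∀ N z, codeFun code (q N) z ≤ max (r (code k z)) 0 := by
    intro N z
    rw [hq]
    rcases N.eq_zero_or_pos with h0 | h0
    · simp [h0]
    · split_ifs
      · rcases le_or_gt 0 (r (code k z)) with h | h
        · rw [div_le_iff₀ (by positivity)]
          refine (Nat.floor_le (by positivity)).trans ?_
          gcongr
          exact le_max_left _ _
        · rw [Nat.floor_of_nonpos (mul_nonpos_of_nonpos_of_nonneg h.le (Nat.cast_nonneg _))]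
          simp
      · simp
  have hlim : Tendsto (fun N => ∫ z, ‖max (r (code k z)) 0 - codeFun code (q N) z‖ ∂m) atTop
      (𝓝 (∫ _, (0 : ℝ) ∂m)) := by
    refine tendsto_integral_of_dominated_convergence (fun z => |r (code k z)|) (fun N => ?_)
      hri.abs (fun N => ae_of_all _ fun z => ?_) (ae_of_all _ fun z => ?_)
    · exact (((hri.1.sup aestronglyMeasurable_const)).sub
        (measurable_codeFun hm (q N)).aestronglyMeasurable).norm
    · rw [norm_norm, Real.norm_eq_abs, abs_of_nonneg (sub_nonneg.2 (hqle N z))]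
      have := codeFun_nonneg code (q N) z
      have h2 : max (r (code k z)) 0 ≤ |r (code k z)| := max_le (le_abs_self _) (abs_nonneg _)
      linarith
    · have h1 : Tendsto (fun N : ℕ => codeFun code (q N) z) atTop (𝓝 (max (r (code k z)) 0)) := by
        have h2 : ∀ᶠ N : ℕ in atTop, (⌊r (code k z) * N⌋₊ : ℝ) / N = codeFun code (q N) z := by
          filter_upwards [eventually_gt_atTop (Encodable.encode (code k z))] with N hN
          rw [hq, if_pos]
          simpa [s] using hN
        refine Tendsto.congr' h2 ?_
        rcases le_or_gt 0 (r (code k z)) with h | h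
        · rw [max_eq_left h]
          exact (tendsto_nat_floor_mul_div_atTop h).comp tendsto_natCast_atTop_atTop
        · rw [max_eq_right h.le]
          refine tendsto_const_nhds.congr fun N => ?_
          rw [Nat.floor_of_nonpos (mul_nonpos_of_nonpos_of_nonneg h.le (Nat.cast_nonneg _))]
          simp
      simpa using ((tendsto_const_nhds (x := max (r (code k z)) 0)).sub h1).norm
  rw [integral_zero] at hlim
  obtain ⟨N, hN⟩ := (hlim.eventually (ge_mem_nhds (show (0 : ℝ) < ε / 2 by positivity))).exists
  refine ⟨q N, fun j => ?_⟩
  set h : X → ℝ := codeFun code (q N) with hh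
  have hhm : Measurable h := measurable_codeFun hm (q N)
  have hmaxi : Integrable (fun z => max (r (code k z)) 0) m := hri.sup (integrable_const 0)
  have hhi : Integrable h m := by
    refine hmaxi.mono' hhm.aestronglyMeasurable (ae_of_all _ fun z => ?_)
    rw [Real.norm_of_nonneg (codeFun_nonneg code (q N) z)]
    exact hqle N z
  have hghi : Integrable (fun z => |g z - h z|) m := (hgi.sub hhi).abs
  have hmhi : Integrable (fun z => ‖max (r (code k z)) 0 - h z‖) m := (hmaxi.sub hhi).norm
  -- Replacing `r` by its positive part does not increase the distance to `g`, as `g ≥ 0` almost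
  -- everywhere.
  have hgh : ∫ z, |g z - h z| ∂m ≤ ε := by
    have h1 : ∫ z, |g z - h z| ∂m
        ≤ ∫ z, (‖g z - r (code k z)‖ + ‖max (r (code k z)) 0 - h z‖) ∂m := by
      refine integral_mono_ae hghi (hgri.norm.add hmhi) ?_
      filter_upwards [hg0] with z hz
      have h2 : |g z - h z| ≤ |g z - max (r (code k z)) 0| + |max (r (code k z)) 0 - h z| :=
        abs_sub_le _ _ _
      refine h2.trans (add_le_add ?_ le_rfl)
      rcases le_or_gt 0 (r (code k z)) with h3 | h3
      · rw [max_eq_left h3]; rfl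
      · have hz' : 0 ≤ g z := hz
        rw [max_eq_right h3.le, Real.norm_eq_abs, sub_zero, abs_of_nonneg hz',
          abs_of_nonneg (by linarith)]
        linarith
    rw [integral_add hgri.norm hmhi] at h1
    linarith
  have hset : ∀ c, MeasurableSet (code j ⁻¹' {c}) := fun c => hm j (measurableSet_singleton c)
  have hcell : ∀ c, ENNReal.ofReal |μ.real (code j ⁻¹' {c})
      - (m.withDensity fun z => ENNReal.ofReal (h z)).real (code j ⁻¹' {c})|
      ≤ ∫⁻ z in code j ⁻¹' {c}, ENNReal.ofReal |g z - h z| ∂m := by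
    intro c
    have h1 : ∫ z in code j ⁻¹' {c}, g z ∂m = μ.real (code j ⁻¹' {c}) := by
      rw [hg, setIntegral_condExp hle hρi, Measure.setIntegral_toReal_rnDeriv hac]
      have : MeasurableSet[ℱ j] (code j ⁻¹' {c}) := ⟨{c}, measurableSet_singleton c, rfl⟩
      exact le_iSup (fun n => (ℱ n : MeasurableSpace X)) j _ this
    have h2 : (m.withDensity fun z => ENNReal.ofReal (h z)).real (code j ⁻¹' {c})
        = ∫ z in code j ⁻¹' {c}, h z ∂m := by
      rw [measureReal_def, withDensity_apply _ (hset c), integral_eq_lintegral_of_nonneg_ae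
        (ae_of_all _ fun z => codeFun_nonneg code (q N) z) hhm.aestronglyMeasurable]
    rw [← h1, h2, ← integral_sub hgi.integrableOn hhi.integrableOn]
    rw [← ofReal_integral_eq_lintegral_ofReal hghi.integrableOn
      (ae_of_all _ fun z => abs_nonneg _)]
    exact ENNReal.ofReal_le_ofReal (abs_integral_le_integral_abs)
  refine (ENNReal.tsum_le_tsum hcell).trans ?_
  rw [← lintegral_iUnion hset fun c c' hc => (disjoint_singleton.2 hc).preimage _]
  refine (setLIntegral_le_lintegral _ _).trans ?_
  rw [← ofReal_integral_eq_lintegral_ofReal hghi (ae_of_all _ fun z => abs_nonneg _)]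
  exact ENNReal.ofReal_le_ofReal hgh

end

/-! ### Measurability in `ω` of the closeness on cylinders, and the functions it controls. -/

namespace RandomTower

section

variable {Ω₀ M : Type*} [MeasurableSpace Ω₀] [MeasurableSpace M] {T : RandomTower Ω₀ M} {β : ℝ}
  {A₁ ε₀ c₂ D V C₁ C₂ : ℝ} {φ : (ℤ → Ω₀) → M × ℕ → ℝ} {ω : ℤ → Ω₀}

theorem IsYoungTower.measurable_lintegral_towerMeasure (hT : T.IsYoungTower β)
    {g : (ℤ → Ω₀) × (M × ℕ) → ENNReal} (hg : Measurable g) :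
    Measurable fun ω => ∫⁻ z, g (ω, z) ∂(T.towerMeasure ω) := by
  have : IsMarkovKernel T.m := ⟨hT.m_prob⟩
  have h1 : (fun ω => ∫⁻ z, g (ω, z) ∂(T.towerMeasure ω)) = fun ω => ∑' ℓ : ℕ,
      ∫⁻ x, {p : (ℤ → Ω₀) × M | (p.2, ℓ) ∈ T.tower p.1}.indicator (fun p => g (p.1, p.2, ℓ)) (ω, x)
        ∂(T.m.comap (seqShift (-(ℓ : ℤ))) (measurable_seqShift _) ω) := by
    funext ω
    rw [T.lintegral_towerMeasure ω (g := fun z => g (ω, z)) (hg.comp measurable_prodMk_left)]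
    refine tsum_congr fun ℓ => ?_
    rw [Kernel.comap_apply, ← lintegral_indicator (hT.measurableSet_level_fixed ω ℓ)]
    rfl
  rw [h1]
  refine Measurable.tsum fun ℓ => Measurable.lintegral_kernel_prod_right' ?_
  exact (hg.comp (by fun_prop)).indicator (hT.measurableSet_level ℓ)

theorem Good.isFiniteMeasure (hS : T.Setup β A₁ ε₀ c₂ D V C₁ C₂)
    (hω : T.Good β ε₀ c₂ D V C₁ C₂ φ ω) : IsFiniteMeasure (T.towerMeasure ω) := by
  refine ⟨?_⟩
  have h1 := hω.mass 0
  rw [seqShift_zero] at h1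
  rw [← lintegral_one]
  refine lt_of_le_of_lt (lintegral_mono fun z => ?_) (h1.trans_lt ENNReal.ofReal_lt_top)
  rw [← ENNReal.ofReal_one]
  exact ENNReal.ofReal_le_ofReal (one_le_wv hS.ε_pos.le z)

/-- The density on the tower given by a function of the codes. -/
noncomputable def codeMeasure (T : RandomTower Ω₀ M) (q : Σ k, ((Fin k → ℕ × ℕ) →₀ ℕ) × ℕ)
    (ω : ℤ → Ω₀) : Measure (M × ℕ) :=
  (T.towerMeasure ω).withDensity fun z =>
    ENNReal.ofReal (codeFun (fun n => T.code n ω) q z)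

theorem IsYoungTower.measurable_code_fixed (hT : T.IsYoungTower β) (ω : ℤ → Ω₀) (n : ℕ) :
    Measurable (T.code n ω) := (hT.measurable_code n).comp measurable_prodMk_left

/-- Recurrence requires a measurable event. Closeness on cylinders is such an event because it
involves countably many codes, each of which depends measurably on `ω`. -/
theorem IsYoungTower.measurableSet_codeClose (hT : T.IsYoungTower β)
    (μ : Kernel (ℤ → Ω₀) (M × ℕ)) [IsFiniteKernel μ] (q : Σ k, ((Fin k → ℕ × ℕ) →₀ ℕ) × ℕ) (ε : ℝ) :
    MeasurableSet {ω | CodeClose (fun n => T.code n ω) (μ ω) (T.codeMeasure q ω) ε} := by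
  have h1 : {ω | CodeClose (fun n => T.code n ω) (μ ω) (T.codeMeasure q ω) ε}
      = ⋂ j, {ω | ∑' c, ENNReal.ofReal |(μ ω).real (T.code j ω ⁻¹' {c})
        - (T.codeMeasure q ω).real (T.code j ω ⁻¹' {c})| ≤ ENNReal.ofReal ε} := by
    ext ω
    simp only [CodeClose, mem_ofPred_eq, mem_iInter]
  rw [h1]
  refine MeasurableSet.iInter fun j => measurableSet_le ?_ measurable_const
  refine Measurable.tsum fun c => ENNReal.measurable_ofReal.comp ?_
  have hset : MeasurableSet {p : (ℤ → Ω₀) × (M × ℕ) | T.code j p.1 p.2 = c} :=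
    hT.measurable_code j (measurableSet_singleton c)
  have h2 : Measurable fun ω => μ ω (T.code j ω ⁻¹' {c}) :=
    Kernel.measurable_kernel_prodMk_left hset
  have h3 : Measurable fun ω => T.codeMeasure q ω (T.code j ω ⁻¹' {c}) := by
    have e : (fun ω => T.codeMeasure q ω (T.code j ω ⁻¹' {c})) = fun ω =>
        ∫⁻ z, {p : (ℤ → Ω₀) × (M × ℕ) | T.code j p.1 p.2 = c}.indicator
          (fun p => ENNReal.ofReal (codeFun (fun n => T.code n p.1) q p.2)) (ω, z)
          ∂(T.towerMeasure ω) := by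
      funext ω
      have hs := hT.measurable_code_fixed ω j (measurableSet_singleton c)
      rw [codeMeasure, withDensity_apply _ hs, ← lintegral_indicator hs]
      rfl
    rw [e]
    refine hT.measurable_lintegral_towerMeasure (Measurable.indicator ?_ hset)
    refine ENNReal.measurable_ofReal.comp ?_
    exact (Measurable.of_discrete (f := fun c => (q.2.1 c : ℝ) / q.2.2)).comp
      (hT.measurable_code q.1)
  exact continuous_abs.measurable.comp (h2.ennreal_toReal.sub h3.ennreal_toReal)

theorem code_castLE (ω : ℤ → Ω₀) {k l : ℕ} (h : k ≤ l) :
    T.code k ω = (fun c i => c (Fin.castLE h i)) ∘ T.code l ω := rfl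

/-- Closeness on cylinders controls the integrals of functions that are continuous with respect to
the cylinders. -/
theorem IsYoungTower.norm_integral_sub_le (hT : T.IsYoungTower β) (hβ₀ : 0 < β) (hβ₁ : β < 1)
    {μ ν : Measure (M × ℕ)} [IsFiniteMeasure μ] [IsFiniteMeasure ν]
    (hμ : μ ≪ T.towerMeasure ω) (hν : ν ≪ T.towerMeasure ω) {ε : ℝ} (hε : 0 ≤ ε)
    (h : CodeClose (fun n => T.code n ω) μ ν ε) {u : M × ℕ → ℂ} (hu : ∀ z, ‖u z‖ ≤ 1)
    (hlip : ∀ z ∈ T.tower ω, ∃ B, ∀ j, ∀ z' ∈ T.tower ω, T.SameCylinder ω (j + 1) z z' →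
      ‖u z - u z'‖ ≤ B * β ^ j) :
    ‖∫ z, u z ∂μ - ∫ z, u z ∂ν‖ ≤ ε := by
  obtain ⟨r, hr, hlim⟩ := hT.exists_code_tendsto hβ₀ hβ₁ ω hlip
  have hr1 : ∀ n c, ‖r n c‖ ≤ 1 := fun n c => by
    rcases hr n c with h | ⟨z, _, h⟩
    · rw [h, norm_zero]; exact zero_le_one
    · rw [h]; exact hu z
  have key : ∀ κ : Measure (M × ℕ), IsFiniteMeasure κ → κ ≪ T.towerMeasure ω →
      Tendsto (fun n => ∫ z, r n (T.code n ω z) ∂κ) atTop (𝓝 (∫ z, u z ∂κ)) := by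
    intro κ hκ hac
    refine tendsto_integral_of_dominated_convergence (fun _ => 1) (fun n => ?_)
      (integrable_const _) (fun n => ae_of_all _ fun z => hr1 n _) ?_
    · exact ((Measurable.of_discrete (f := r n)).comp
        (hT.measurable_code_fixed ω n)).aestronglyMeasurable
    · filter_upwards [hac.ae_le (hT.ae_mem_tower ω)] with z hz using hlim z hz
  exact le_of_tendsto ((key μ inferInstance hμ).sub (key ν inferInstance hν)).norm
    (Eventually.of_forall fun n => h.norm_integral_sub_le (hT.measurable_code_fixed ω) hε n (r n)
      (hr1 n))

theorem sepDist_Fiter_le (hβ₀ : 0 < β) (hβ₁ : β < 1) {j : ℕ} {z z' : M × ℕ}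
    (h : T.SameCylinder ω (j + 1) z z') (k : ℕ) :
    T.sepDist β (seqShift (k : ℤ) ω) (T.Fiter ω k z) (T.Fiter ω k z') ≤ β ^ j / β ^ k := by
  rw [le_div_iff₀ (by positivity)]
  rcases le_or_gt k (j + 1) with hk | hk
  · obtain ⟨i, hi⟩ := Nat.exists_eq_add_of_le hk
    rw [hi] at h
    have h1 := sepDist_le_of_sameCylinder hβ₀ hβ₁ h.Fiter
    calc _ ≤ β ^ (i + 1) * β ^ k := by gcongr
      _ = β ^ (i + 1 + k) := (pow_add _ _ _).symm
      _ ≤ β ^ j := pow_le_pow_of_le_one hβ₀.le hβ₁.le (by omega)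
  · have h1 := (sepDist_le (T := T) hβ₀ hβ₁ (seqShift (k : ℤ) ω) (T.Fiter ω k z)
      (T.Fiter ω k z')).trans hβ₁.le
    calc _ ≤ 1 * β ^ k := by gcongr
      _ = β ^ k := one_mul _
      _ ≤ β ^ j := pow_le_pow_of_le_one hβ₀.le hβ₁.le (by omega)

/-- `B` grows with `n` and `l`. This is harmless: only the continuity with respect to cylinders is
used, in `IsYoungTower.norm_integral_sub_le`, and not its modulus. -/
theorem Good.exp_birkhoff_lip (hS : T.Setup β A₁ ε₀ c₂ D V C₁ C₂)
    (hω : T.Good β ε₀ c₂ D V C₁ C₂ φ ω) (s : ℝ) (n l : ℕ) : ∃ B, ∀ z ∈ T.tower ω, ∀ j,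
      ∀ z' ∈ T.tower ω, T.SameCylinder ω (j + 1) z z' →
      ‖Complex.exp (Complex.I * s * (T.birkhoff φ (seqShift (n : ℤ) ω) l (T.Fiter ω n z) : ℂ))
        - Complex.exp (Complex.I * s *
          (T.birkhoff φ (seqShift (n : ℤ) ω) l (T.Fiter ω n z') : ℂ))‖ ≤ B * β ^ j := by
  have hT := hS.young
  have hβ := hS.β_pos
  refine ⟨|s| * ∑ i ∈ Finset.range l, C₂ / β ^ (n + i), fun z hz j z' hz' h => ?_⟩
  refine (norm_exp_twist_sub_le _ _ _).trans ?_
  rw [mul_assoc]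
  refine mul_le_mul_of_nonneg_left ?_ (abs_nonneg s)
  unfold birkhoff
  rw [← Finset.sum_sub_distrib, Finset.sum_mul]
  refine (Finset.abs_sum_le_sum_abs _ _).trans (Finset.sum_le_sum fun i _ => ?_)
  rw [seqShift_seqShift, seqShift_congr (show (i : ℤ) + n = ((n + i : ℕ) : ℤ) by push_cast; ring),
    ← Fiter_add, ← Fiter_add]
  refine (hω.lip _ _ (hT.mapsTo_Fiter hz _) _ (hT.mapsTo_Fiter hz' _)).trans ?_
  have := mul_le_mul_of_nonneg_left (sepDist_Fiter_le hβ hS.β_lt_one h (n + i)) hS.C₂_nonneg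
  refine this.trans (le_of_eq ?_)
  ring

theorem IsYoungTower.map_Fiter (hT : T.IsYoungTower β) {μ : Kernel (ℤ → Ω₀) (M × ℕ)}
    (h : ∀ k : ℤ, (μ (seqShift k ω)).map (T.F (seqShift k ω)) = μ (seqShift (k + 1) ω)) (n : ℕ) :
    (μ ω).map (T.Fiter ω n) = μ (seqShift (n : ℤ) ω) := by
  induction n with
  | zero =>
    rw [Nat.cast_zero, seqShift_zero]
    exact Measure.map_id
  | succ n ih =>
    have h1 : T.Fiter ω (n + 1) = T.F (seqShift (n : ℤ) ω) ∘ T.Fiter ω n := rfl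
    have h2 : Measurable (T.F (seqShift (n : ℤ) ω)) := hT.measurable_F.comp measurable_prodMk_left
    have h3 : Measurable (T.Fiter ω n) := (hT.measurable_Fiter n).comp measurable_prodMk_left
    rw [h1, ← Measure.map_map h2 h3, ih, h n]
    exact congrArg μ (seqShift_congr (by push_cast; ring) ω)

end

end RandomTower

/-! ### Characteristic functions of regular densities and of equivariant measures. -/

namespace RandomTower

section

variable {Ω₀ M : Type*} [MeasurableSpace Ω₀] [MeasurableSpace M] {T : RandomTower Ω₀ M} {β : ℝ}
  {A₁ ε₀ c₂ D V C₁ C₂ : ℝ} {φ : (ℤ → Ω₀) → M × ℕ → ℝ} {ω : ℤ → Ω₀}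

/-- The characteristic functions with respect to a density that decays under the twisted
operators. -/
theorem DecaysAt.norm_integral_le (hS : T.Setup β A₁ ε₀ c₂ D V C₁ C₂)
    (hφ : Measurable (Function.uncurry φ)) (hω : T.Good β ε₀ c₂ D V C₁ C₂ φ ω) {C c s : ℝ}
    (hC : 0 ≤ C) (h : T.DecaysAt φ β ε₀ ω C c s) {A : ℝ} (hA : 0 < A) {G : M × ℕ → ℂ}
    (hG : T.Bd β ε₀ ω A A G) (n : ℕ) :
    ‖∫ z, Complex.exp (Complex.I * s * (T.birkhoff φ ω n z : ℂ)) * G z ∂(T.towerMeasure ω)‖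
      ≤ C * A * V * Real.exp (-c * n) := by
  have hω' := hω.shift hS (n : ℤ)
  rw [hS.integral_exp_birkhoff hφ s n hω hA.le hA.le hG]
  refine (norm_integral_le_of_norm_le (g := fun z => C * A * Real.exp (-c * n) * wv ε₀ z)
    (hω'.integrable_wv.const_mul _) ?_).trans ?_
  · filter_upwards [hS.young.ae_mem_tower (seqShift (n : ℤ) ω)] with z hz
    exact h A hA G hG n z hz
  · rw [integral_const_mul]
    have := mul_le_mul_of_nonneg_left (hω'.integral_wv_le hS.V_nonneg)
      (show 0 ≤ C * A * Real.exp (-c * n) by positivity)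
    linarith

/-- The bound of the densities that are reached from the remote past. -/
noncomputable def pastConst (β A₁ : ℝ) : ℝ :=
  (1 + A₁ / (1 - β)) * Real.exp (A₁ / (1 - β)) * (Real.exp (A₁ / (1 - β)) * 2 + 1)

theorem Setup.pastConst_pos (hS : T.Setup β A₁ ε₀ c₂ D V C₁ C₂) : 0 < pastConst β A₁ := by
  have := hS.K_nonneg
  unfold pastConst
  positivity

/-- Characteristic functions with respect to a measure whose images in the remote past are
frequently approximated by a fixed function of the codes. -/
theorem Setup.norm_integral_exp_le (hS : T.Setup β A₁ ε₀ c₂ D V C₁ C₂)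
    (hφ : Measurable (Function.uncurry φ)) (hω : T.Good β ε₀ c₂ D V C₁ C₂ φ ω)
    {μ : Kernel (ℤ → Ω₀) (M × ℕ)} (hprob : ∀ k : ℤ, IsProbabilityMeasure (μ (seqShift k ω)))
    (hac : ∀ k : ℤ, μ (seqShift k ω) ≪ T.towerMeasure (seqShift k ω))
    (heq : ∀ k : ℤ, (μ (seqShift k ω)).map (T.F (seqShift k ω)) = μ (seqShift (k + 1) ω))
    (happ : ∀ ε > 0, ∃ q, ∃ᶠ n : ℕ in atTop, CodeClose (fun j => T.code j (seqShift (-(n : ℤ)) ω))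
      (μ (seqShift (-(n : ℤ)) ω)) (T.codeMeasure q (seqShift (-(n : ℤ)) ω)) ε)
    {C c s : ℝ} (hC : 0 ≤ C) (h : T.DecaysAt φ β ε₀ ω C c s) (l : ℕ) :
    ‖∫ z, Complex.exp (Complex.I * s * (T.birkhoff φ ω l z : ℂ)) ∂(μ ω)‖
      ≤ C * pastConst β A₁ * V * Real.exp (-c * l) := by
  have hT := hS.young
  refine le_of_forall_pos_le_add fun ε hε => ?_
  -- The minimum with `1` keeps the mass of the approximating density below `2`, which is the `2` in
  -- `pastConst`.
  obtain ⟨q, hq⟩ := happ (min ε 1) (lt_min hε one_pos)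
  obtain ⟨K, hK, hqK⟩ : ∃ K, 0 ≤ K ∧ ∀ ω' : ℤ → Ω₀, ∀ z,
      codeFun (fun j => T.code j ω') q z ≤ K := by
    obtain ⟨N, hN⟩ := q.2.1.finite_range.bddAbove
    refine ⟨(N : ℝ) / q.2.2, by positivity, fun ω' z => ?_⟩
    unfold codeFun
    gcongr
    exact hN ⟨_, rfl⟩
  have hlim : Tendsto (fun p : ℕ => K * unifConst β A₁ V * Real.exp (-ε₀ * p)) atTop (𝓝 0) := by
    have h1 : Tendsto (fun p : ℕ => Real.exp (-(ε₀ * p))) atTop (𝓝 0) :=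
      Real.tendsto_exp_neg_atTop_nhds_zero.comp
        (tendsto_natCast_atTop_atTop.const_mul_atTop hS.ε_pos)
    simpa [neg_mul] using h1.const_mul (K * unifConst β A₁ V)
  -- Large `n` leave `q.1` steps to make the density regular and enough further steps `p` to forget
  -- its bound `K`.
  have hlim' : ∀ᶠ n : ℕ in atTop, ∃ p, n = q.1 + p ∧
      K * unifConst β A₁ V * Real.exp (-ε₀ * p) ≤ 1 := by
    obtain ⟨p₀, hp₀⟩ := eventually_atTop.1 (hlim.eventually (ge_mem_nhds one_pos))
    filter_upwards [eventually_ge_atTop (q.1 + p₀)] with n hn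
    exact ⟨n - q.1, by omega, hp₀ _ (by omega)⟩
  obtain ⟨n, hclose, p, hnp, hp⟩ := (hq.and_eventually hlim').exists
  set ω' := seqShift (-(n : ℤ)) ω with hω'
  have hback : seqShift (n : ℤ) ω' = ω := by
    rw [hω', seqShift_seqShift, add_neg_cancel, seqShift_zero]
  have hg : T.Good β ε₀ c₂ D V C₁ C₂ φ ω' := hω.shift hS _
  have := hg.isFiniteMeasure hS
  have : IsProbabilityMeasure (μ ω') := hprob _
  set hf : M × ℕ → ℝ := codeFun (fun j => T.code j ω') q with hhf
  have hf0 : ∀ z, 0 ≤ hf z := codeFun_nonneg _ q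
  have hfm : Measurable hf := measurable_codeFun (hT.measurable_code_fixed ω') q
  have hfi : Integrable hf (T.towerMeasure ω') :=
    Integrable.of_bound hfm.aestronglyMeasurable K (ae_of_all _ fun z => by
      rw [Real.norm_of_nonneg (hf0 z)]; exact hqK ω' z)
  have : IsFiniteMeasure (T.codeMeasure q ω') :=
    isFiniteMeasure_withDensity_ofReal hfi.2
  have hac' : T.codeMeasure q ω' ≪ T.towerMeasure ω' := withDensity_absolutelyContinuous _ _
  have hcodeInt : ∀ u : M × ℕ → ℂ, ∫ z, u z ∂(T.codeMeasure q ω')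
      = ∫ z, u z * (hf z : ℂ) ∂(T.towerMeasure ω') := fun u => by
    rw [codeMeasure, integral_withDensity_eq_integral_toReal_smul
      hfm.ennreal_ofReal (ae_of_all _ fun z => ENNReal.ofReal_lt_top)]
    refine integral_congr_ae (ae_of_all _ fun z => ?_)
    dsimp only
    rw [ENNReal.toReal_ofReal (hf0 z), Complex.real_smul, mul_comm]
  -- At order `0` there is a single code, so closeness compares the total masses.
  have hmass : ∫ z, hf z ∂(T.towerMeasure ω') ≤ 2 := by
    have h1 := hclose.norm_integral_sub_le (hT.measurable_code_fixed ω')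
      (le_min hε.le zero_le_one) 0 (fun _ => 1) (fun _ => by simp)
    rw [hcodeInt] at h1
    simp only [one_mul, integral_const, probReal_univ, one_smul] at h1
    rw [integral_complex_ofReal, ← Complex.ofReal_one, ← Complex.ofReal_sub,
      Complex.norm_real, Real.norm_eq_abs] at h1
    have h2 := (abs_le.1 (h1.trans (min_le_right _ _))).1
    linarith
  have htame : T.Tame ε₀ ω' K hf := fun z _ => by
    rw [Real.norm_of_nonneg (hf0 z)]
    exact (hqK ω' z).trans (le_mul_of_one_le_right hK (one_le_wv hS.ε_pos.le z))
  have hcone : T.Cone β (A₁ / (1 - β)) q.1 ω' hf := fun z hz z' hz' _ hs => by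
    have h1 : hf z = hf z' := by
      have := (hT.sameCylinder_iff hz hz' q.1).1 hs
      simp only [hhf, codeFun, this]
    rw [h1]
    exact le_mul_of_one_le_right (hf0 z')
      (Real.one_le_exp (mul_nonneg hS.K_nonneg (T.sepDist_nonneg hS.β_pos.le _ _ _)))
  -- The bound at time `0` no longer involves `q` or `K`; therefore the final constant does not
  -- depend on `ε`.
  have hbd := hS.bd_trn hg hK htame (fun y _ => hf0 y) hcone hmass hp
  rw [← hnp, hback] at hbd
  have hmψ : Measurable fun z => Complex.exp (Complex.I * s * (T.birkhoff φ ω l z : ℂ)) := by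
    have : Measurable fun z => T.birkhoff φ ω l z :=
      (hT.measurable_birkhoff hφ l).comp measurable_prodMk_left
    exact Complex.measurable_exp.comp
      (measurable_const.mul (Complex.measurable_ofReal.comp this))
  have hmF : Measurable (T.Fiter ω' n) := (hT.measurable_Fiter n).comp measurable_prodMk_left
  have h1 : ∫ z, Complex.exp (Complex.I * s * (T.birkhoff φ ω l z : ℂ)) ∂(μ ω)
      = ∫ z, Complex.exp (Complex.I * s * (T.birkhoff φ ω l (T.Fiter ω' n z) : ℂ)) ∂(μ ω') := by
    have h2 := hT.map_Fiter (μ := μ) (ω := ω') (fun k => by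
      rw [hω', seqShift_seqShift, heq, seqShift_seqShift]
      exact congrArg μ (seqShift_congr (by ring) ω)) n
    rw [hback] at h2
    rw [← h2, integral_map hmF.aemeasurable hmψ.aestronglyMeasurable]
  have h2 := hT.norm_integral_sub_le hS.β_pos hS.β_lt_one (hac _) hac'
    (le_min hε.le zero_le_one) hclose
    (u := fun z => Complex.exp (Complex.I * s * (T.birkhoff φ ω l (T.Fiter ω' n z) : ℂ)))
    (fun z => (norm_exp_twist _ _).le) (by
      obtain ⟨B, hB⟩ := hg.exp_birkhoff_lip hS s n l
      rw [hback] at hB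
      exact fun z hz => ⟨B, hB z hz⟩)
  have h3 := hS.integral_comp_Fiter hg hK htame (fun y _ => hf0 y) hcone n _ hmψ
    (fun z => (norm_exp_twist _ _).le)
  rw [hback] at h3
  have h4 := h.norm_integral_le hS hφ hω hC hS.pastConst_pos hbd l
  rw [← h3, ← hcodeInt] at h4
  rw [h1]
  have h5 := norm_le_norm_add_norm_sub'
    (∫ z, Complex.exp (Complex.I * s * (T.birkhoff φ ω l (T.Fiter ω' n z) : ℂ)) ∂(μ ω'))
    (∫ z, Complex.exp (Complex.I * s * (T.birkhoff φ ω l (T.Fiter ω' n z) : ℂ))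
      ∂(T.codeMeasure q ω'))
  have h6 := h2.trans (min_le_left _ _)
  linarith

end

end RandomTower

/-! ### Recurrence in the past, the constants, and the conclusion. -/

namespace RandomTower

section

variable {Ω₀ M : Type*} [MeasurableSpace Ω₀] [MeasurableSpace M] {T : RandomTower Ω₀ M} {β : ℝ}
  {A₁ ε₀ c₂ D V C₁ C₂ : ℝ} {φ : (ℤ → Ω₀) → M × ℕ → ℝ} {ω : ℤ → Ω₀}
  (P₀ : Measure Ω₀) [IsProbabilityMeasure P₀]

/-- Almost surely, the measures of an absolutely continuous family are infinitely often in the past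
close to a fixed function of the codes. -/
theorem Setup.ae_frequently_codeClose (hS : T.Setup β A₁ ε₀ c₂ D V C₁ C₂)
    (hgood : ∀ᵐ ω ∂(Measure.infinitePi fun _ : ℤ => P₀), T.Good β ε₀ c₂ D V C₁ C₂ φ ω)
    {μ : Kernel (ℤ → Ω₀) (M × ℕ)}
    (hprob : ∀ᵐ ω ∂(Measure.infinitePi fun _ : ℤ => P₀), IsProbabilityMeasure (μ ω))
    (hac : ∀ᵐ ω ∂(Measure.infinitePi fun _ : ℤ => P₀), μ ω ≪ T.towerMeasure ω) :
    ∀ᵐ ω ∂(Measure.infinitePi fun _ : ℤ => P₀), ∀ ε > 0, ∃ q, ∃ᶠ n : ℕ in atTop,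
      CodeClose (fun j => T.code j (seqShift (-(n : ℤ)) ω)) (μ (seqShift (-(n : ℤ)) ω))
        (T.codeMeasure q (seqShift (-(n : ℤ)) ω)) ε := by
  classical
  have hT := hS.young
  set P := Measure.infinitePi fun _ : ℤ => P₀ with hP
  have hSm : MeasurableSet {ω | μ ω univ = 1} :=
    (Kernel.measurable_coe μ MeasurableSet.univ) (measurableSet_singleton 1)
  -- Setting the kernel to zero where its mass differs from one makes it finite everywhere without
  -- changing it at almost every `ω`.
  let μ' : Kernel (ℤ → Ω₀) (M × ℕ) := Kernel.piecewise hSm μ 0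
  have hμ' : ∀ ω, IsProbabilityMeasure (μ ω) → μ' ω = μ ω := fun ω h => by
    rw [Kernel.piecewise_apply, if_pos]
    exact h.measure_univ
  have : IsFiniteKernel μ' := ⟨1, ENNReal.one_lt_top, fun ω => by
    rw [Kernel.piecewise_apply]
    split_ifs with h
    · exact le_of_eq h
    · simp⟩
  have hmp := measurePreserving_seqShift P₀ (-1)
  -- Poincaré recurrence for the backward shift, applied to every `q` and every precision `1/(i+1)`.
  -- The family is countable, so one null set suffices.
  have hrec : ∀ᵐ ω ∂P, ∀ q, ∀ i : ℕ,
      ω ∈ {ω | CodeClose (fun n => T.code n ω) (μ' ω) (T.codeMeasure q ω) (1 / (i + 1))} →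
      ∃ᶠ n in atTop, (seqShift (-1))^[n] ω ∈
        {ω | CodeClose (fun n => T.code n ω) (μ' ω) (T.codeMeasure q ω) (1 / (i + 1))} :=
    ae_all_iff.2 fun q => ae_all_iff.2 fun i =>
      hmp.conservative.ae_mem_imp_frequently_image_mem
        (hT.measurableSet_codeClose μ' q (1 / (i + 1))).nullMeasurableSet
  have hiter : ∀ (n : ℕ) (ω : ℤ → Ω₀), (seqShift (-1))^[n] ω = seqShift (-(n : ℤ)) ω := by
    intro n ω
    induction n with
    | zero => simp
    | succ n ih =>
      rw [Function.iterate_succ_apply', ih, seqShift_seqShift]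
      exact seqShift_congr (by push_cast; ring) ω
  filter_upwards [hrec, hgood, hac, ae_forall_seqShift P₀ hprob] with ω hω hg hacω hp ε hε
  obtain ⟨i, hi⟩ := exists_nat_one_div_lt hε
  have hp0 := hp 0
  rw [seqShift_zero] at hp0
  have := hg.isFiniteMeasure hS
  obtain ⟨q, hq⟩ := exists_codeClose (hT.measurable_code_fixed ω)
    (fun k l hkl => ⟨_, code_castLE ω hkl⟩) hacω (show (0 : ℝ) < 1 / (i + 1) by positivity)
  refine ⟨q, (hω q i (by rw [hμ' ω hp0]; exact hq)).mono fun n hn => ?_⟩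
  rw [hiter, hμ' _ (hp _)] at hn
  exact fun j => (hn j).trans (ENNReal.ofReal_le_ofReal hi.le)

/-- `D` combines the tail constant with the distortion factor `1 + A₁`. `V` bounds `∫ v dm_ω`: level
`ℓ` contributes at most `e^{ε₀ ℓ} c₁ e^{-c₂(ℓ+1)}`. Constants that might be negative are replaced by
their maximum with `0`. -/
theorem exists_setup (hT : T.IsYoungTower β) (hβ₀ : 0 < β) (hβ₁ : β < 1) {c₁ : ℝ} (hε₀ : 0 < ε₀)
    (hε₀c₂ : ε₀ < c₂) (htails : T.ExpTails (Measure.infinitePi fun _ : ℤ => P₀) c₁ c₂)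
    (hφ : T.IsObservable (Measure.infinitePi fun _ : ℤ => P₀) β φ) :
    ∃ A₁ D V C₁ C₂, T.Setup β A₁ ε₀ c₂ D V C₁ C₂ ∧
      ∀ᵐ ω ∂(Measure.infinitePi fun _ : ℤ => P₀), T.Good β ε₀ c₂ D V C₁ C₂ φ ω := by
  obtain ⟨A₁, hA₁⟩ := hT.distortion
  obtain ⟨C₁, hC₁⟩ := hφ.bounded
  obtain ⟨C₂, hC₂⟩ := hφ.lipschitz
  have hc0 : 0 ≤ max c₁ 0 := le_max_right _ _
  have hA0 := hA₁.1
  refine ⟨A₁, (1 + A₁) * max c₁ 0, levelSum ε₀ c₂ (max c₁ 0), max C₁ 0, max C₂ 0,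
    ⟨hT, hβ₀, hβ₁, hA₁, hε₀, hε₀c₂, by positivity,
      tsum_nonneg fun ℓ => by positivity, le_max_right _ _, le_max_right _ _⟩, ?_⟩
  filter_upwards [ae_forall_seqShift P₀ htails, ae_forall_seqShift P₀ hC₁,
    ae_forall_seqShift P₀ hC₂] with ω h1 h2 h3
  have h1' : ∀ k : ℤ, ∀ n : ℕ, 1 ≤ n → T.m (seqShift k ω) {x | x ∈ T.base (seqShift k ω) ∧
      n ≤ T.ret (seqShift k ω) x} ≤ ENNReal.ofReal (max c₁ 0 * Real.exp (-c₂ * n)) :=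
    fun k n hn => (h1 k n hn).trans (ENNReal.ofReal_le_ofReal
      (mul_le_mul_of_nonneg_right (le_max_left _ _) (Real.exp_pos _).le))
  refine ⟨hT.towerTail hβ₀ hβ₁ hA₁ hc0 h1', fun k => ?_,
    fun k z hz => (h2 k z hz).trans (le_max_left _ _), fun k z hz z' hz' =>
      (h3 k z hz z' hz').trans (mul_le_mul_of_nonneg_right (le_max_left _ _)
        (T.sepDist_nonneg hβ₀.le _ _ _))⟩
  rw [T.lintegral_towerMeasure _ (measurable_wv ε₀).ennreal_ofReal, levelSum,
    ENNReal.ofReal_tsum_of_nonneg (fun ℓ => by positivity) (summable_exp_levels hε₀c₂ _)]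
  refine ENNReal.tsum_le_tsum fun ℓ => ?_
  have h4 : ∀ x : M, ENNReal.ofReal (wv ε₀ (x, ℓ)) = ENNReal.ofReal (Real.exp (ε₀ * ℓ)) :=
    fun x => rfl
  simp only [h4]
  rw [setLIntegral_const, ENNReal.ofReal_mul (Real.exp_pos _).le, seqShift_seqShift]
  have h5 : {x | (x, ℓ) ∈ T.tower (seqShift k ω)} = {x | x ∈ T.base (seqShift (-(ℓ : ℤ) + k) ω) ∧
      ℓ + 1 ≤ T.ret (seqShift (-(ℓ : ℤ) + k) ω) x} := by
    ext x
    rw [mem_ofPred_eq, mem_tower, seqShift_seqShift]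
    rfl
  rw [h5]
  gcongr
  exact h1' _ (ℓ + 1) (by omega)

/-- Half of the rate absorbs the factor `√n`, since `√n ≤ n ≤ (2/c) e^{cn/2}`. -/
theorem charDecays_of_le {κ : Measure (M × ℕ)} {J : Set ℝ} {K c : ℝ} (hK : 0 ≤ K) (hc : 0 < c)
    (h : ∀ s ∈ J, ∀ n : ℕ,
      ‖∫ z, Complex.exp (Complex.I * s * (T.birkhoff φ ω n z : ℂ)) ∂κ‖ ≤ K * Real.exp (-c * n)) :
    T.CharDecays φ ω κ J := by
  refine ⟨2 / c * K, c / 2, by positivity, fun n => ?_⟩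
  have h1 : (⨆ t : J, ‖∫ z, Complex.exp (Complex.I * (t : ℝ) * (T.birkhoff φ ω n z : ℂ)) ∂κ‖)
      ≤ K * Real.exp (-c * n) := Real.iSup_le (fun t => h t t.2 n) (by positivity)
  have h2 : √(n : ℝ) ≤ n := by
    rcases n.eq_zero_or_pos with h | h
    · simp [h]
    · have : (1 : ℝ) ≤ n := by exact_mod_cast h
      exact Real.sqrt_le_iff.2 ⟨by positivity, by nlinarith⟩
  have h3 : (n : ℝ) ≤ 2 / c * Real.exp (c / 2 * n) := by
    rw [div_mul_eq_mul_div, le_div_iff₀ hc]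
    have := Real.add_one_le_exp (c / 2 * n)
    linarith
  calc _ ≤ (2 / c * Real.exp (c / 2 * n)) * (K * Real.exp (-c * n)) :=
        mul_le_mul (h2.trans h3) h1 (Real.iSup_nonneg fun _ => norm_nonneg _) (by positivity)
    _ = 2 / c * K * (Real.exp (c / 2 * n) * Real.exp (-c * n)) := by ring
    _ = _ := by rw [← Real.exp_add]; ring_nf

theorem bd_wv (hβ : 0 < β) : T.Bd β ε₀ ω 1 1 fun z => (wv ε₀ z : ℂ) where
  tame z hz := by rw [Complex.norm_real]; exact tame_wv ε₀ ω z hz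
  lip z hz z' hz' h := by
    have := T.sepDist_nonneg hβ.le ω z z'
    have := wv_pos ε₀ z
    dsimp only
    rw [← h.wv_eq, sub_self, norm_zero]
    positivity

theorem bd_one (hβ : 0 < β) (hε : 0 ≤ ε₀) : T.Bd β ε₀ ω 1 1 fun _ => (1 : ℂ) where
  tame z hz := by rw [norm_one, one_mul]; exact one_le_wv hε z
  lip z hz z' hz' h := by
    have := T.sepDist_nonneg hβ.le ω z z'
    have := wv_pos ε₀ z
    rw [sub_self, norm_zero]
    positivity

end

section

variable {Ω₀ M : Type*} [TopologicalSpace Ω₀] [MeasurableSpace Ω₀] [OpensMeasurableSpace Ω₀]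
  [MeasurableSpace M] (P₀ : Measure Ω₀) [IsProbabilityMeasure P₀] {T : RandomTower Ω₀ M}

/-- The densities `1` and `v` are regular, so the decay of the operators applies to them directly;
the family `μ` requires the approximation from the past. -/
theorem ae_charDecays {β : NNReal} (hβ₀ : 0 < β) (hβ₁ : β < 1) (hT : T.IsYoungTower β)
    {c₁ c₂ ε₀ : ℝ} (hε₀ : 0 < ε₀) (hε₀c₂ : ε₀ < c₂)
    (htails : T.ExpTails (Measure.infinitePi fun _ : ℤ => P₀) c₁ c₂)
    {φ : (ℤ → Ω₀) → M × ℕ → ℝ}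
    (hφ : T.IsObservable (Measure.infinitePi fun _ : ℤ => P₀) β φ)
    {μ : Kernel (ℤ → Ω₀) (M × ℕ)}
    (hμ : T.IsEquivariant (Measure.infinitePi fun _ : ℤ => P₀) μ)
    {a₀ : Ω₀} (ha₀ : ∀ U ∈ 𝓝 a₀, 0 < P₀ U) (hcont : T.ContinuousAtSeq β φ fun _ => a₀)
    {I : Set ℝ} (hI : ∀ t ∈ I, T.TwistedContracts β ε₀ φ (fun _ => a₀) t) :
    ∀ᵐ ω ∂(Measure.infinitePi fun _ : ℤ => P₀), ∀ J : Set ℝ, IsCompact J → J ⊆ I →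
      T.CharDecays φ ω (μ ω) J ∧ T.CharDecays φ ω (T.normMeasure ω) J ∧
        T.CharDecays φ ω (T.weightedMeasure ε₀ ω) J := by
  obtain ⟨A₁, D, V, C₁, C₂, hS, hgood⟩ := exists_setup P₀ hT (NNReal.coe_pos.2 hβ₀)
    (by exact_mod_cast hβ₁) hε₀ hε₀c₂ htails hφ
  filter_upwards [ae_decaysAt P₀ hS ha₀ hcont hgood hI, hgood,
    hS.ae_frequently_codeClose P₀ hgood hμ.prob hμ.absolutelyContinuous,
    ae_forall_seqShift P₀ hμ.prob, ae_forall_seqShift P₀ hμ.absolutelyContinuous,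
    ae_forall_seqShift P₀ hμ.equivariant] with ω hdec hω happ hp hac heq J hJ hJI
  obtain ⟨C, c, hc, hCJ⟩ := hdec J hJ hJI
  have hC0 : 0 ≤ max C 0 := le_max_right _ _
  have hdec' : ∀ s ∈ J, T.DecaysAt φ β ε₀ ω (max C 0) c s := fun s hs =>
    (hCJ s hs).mono (le_max_left _ _) hC0 le_rfl
  have hV := hS.V_nonneg
  have hpc := hS.pastConst_pos
  refine ⟨charDecays_of_le (K := max C 0 * pastConst β A₁ * V) (by positivity) hc
      fun s hs n => ?_, charDecays_of_le
      (K := (T.towerMeasure ω univ)⁻¹.toReal * (max C 0 * 1 * V)) (by positivity) hc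
      fun s hs n => ?_,
    charDecays_of_le (K := max C 0 * 1 * V) (by positivity) hc fun s hs n => ?_⟩
  · refine hS.norm_integral_exp_le hφ.measurable hω hp hac (fun k => ?_) happ hC0
      (hdec' s hs) n
    rw [heq k, seqShift_seqShift, add_comm]
  · rw [normMeasure, integral_smul_measure, norm_smul, Real.norm_of_nonneg ENNReal.toReal_nonneg,
      mul_assoc]
    refine mul_le_mul_of_nonneg_left ?_ ENNReal.toReal_nonneg
    have := (hdec' s hs).norm_integral_le hS hφ.measurable hω hC0 one_pos
      (bd_one hS.β_pos hε₀.le) n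
    simpa only [mul_one] using this
  · have h1 := (hdec' s hs).norm_integral_le hS hφ.measurable hω hC0 one_pos (bd_wv hS.β_pos) n
    change ‖∫ z, _ ∂((T.towerMeasure ω).withDensity fun z => ENNReal.ofReal (wv ε₀ z))‖ ≤ _
    rw [integral_withDensity_eq_integral_toReal_smul
      (measurable_wv ε₀).ennreal_ofReal (ae_of_all _ fun z => ENNReal.ofReal_lt_top)]
    refine le_trans (le_of_eq (congrArg _ (integral_congr_ae (ae_of_all _ fun z => ?_)))) h1
    dsimp only
    rw [ENNReal.toReal_ofReal (wv_pos ε₀ z).le, Complex.real_smul, mul_comm]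

end

end RandomTower

theorem mainTheorem9 {Ω₀ M : Type*} [TopologicalSpace Ω₀] [MeasurableSpace Ω₀]
    [OpensMeasurableSpace Ω₀] [MeasurableSpace M]
    (P₀ : Measure Ω₀) [IsProbabilityMeasure P₀] (T : RandomTower Ω₀ M)
    (β : NNReal) (hβ₀ : 0 < β) (hβ₁ : β < 1) (hT : T.IsYoungTower β)
    (c₁ c₂ ε₀ : ℝ) (hε₀ : 0 < ε₀) (hε₀c₂ : ε₀ < c₂)
    (htails : T.ExpTails (Measure.infinitePi fun _ : ℤ => P₀) c₁ c₂)
    (φ : (ℤ → Ω₀) → M × ℕ → ℝ)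
    (hφ : T.IsObservable (Measure.infinitePi fun _ : ℤ => P₀) β φ)
    (μ : Kernel (ℤ → Ω₀) (M × ℕ))
    (hμ : T.IsEquivariant (Measure.infinitePi fun _ : ℤ => P₀) μ)
    (a₀ : Ω₀) (ha₀ : ∀ U ∈ 𝓝 a₀, 0 < P₀ U)
    (hcont : T.ContinuousAtSeq β φ (fun _ => a₀)) :
    ((∀ t : ℝ, t ≠ 0 → T.TwistedContracts β ε₀ φ (fun _ => a₀) t) →
      ∀ᵐ ω ∂(Measure.infinitePi fun _ : ℤ => P₀), ∀ J : Set ℝ, IsCompact J → J ⊆ {0}ᶜ →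
        T.CharDecays φ ω (μ ω) J ∧ T.CharDecays φ ω (T.normMeasure ω) J ∧
          T.CharDecays φ ω (T.weightedMeasure ε₀ ω) J) ∧
    (∀ h : ℝ, 0 < h →
      (∀ t ∈ Icc (-(Real.pi / h)) (Real.pi / h), t ≠ 0 →
        T.TwistedContracts β ε₀ φ (fun _ => a₀) t) →
      ∀ᵐ ω ∂(Measure.infinitePi fun _ : ℤ => P₀), ∀ J : Set ℝ, IsCompact J →
        J ⊆ Icc (-(Real.pi / h)) (Real.pi / h) \ {0} →
        T.CharDecays φ ω (μ ω) J ∧ T.CharDecays φ ω (T.normMeasure ω) J ∧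
          T.CharDecays φ ω (T.weightedMeasure ε₀ ω) J) := by
  -- The aperiodic and the lattice case differ only in the set `I` of parameters.
  have key := fun (I : Set ℝ) (hI : ∀ t ∈ I, T.TwistedContracts β ε₀ φ (fun _ => a₀) t) =>
    RandomTower.ae_charDecays P₀ hβ₀ hβ₁ hT hε₀ hε₀c₂ htails hφ hμ ha₀ hcont hI
  exact ⟨fun h => key _ fun t ht => h t ht, fun h _ hI => key _ fun t ht => hI t ht.1 ht.2⟩
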